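/- Theorem 1. Let $f_0$ be a probability density on $\mathbb{R}$ with $c(\theta)=\log\int e^{\theta x}f_0(x)\,dx$ finite in a neighbourhood of $0$ and $c'(0)=0$ (mean zero), and let $\Theta$ be the interior of $\{\theta:\int e^{\theta x}f_0(x)\,dx<\infty\}$. Let $(X_i)_{i\in\mathbb{Z}}$ be independent with density $f_0$ (law $P_0^*$, steady state), let $Z_{t;w}=w^{-1/2}\sum_{i=t-w+1}^{t}X_i$, and let $\tau_{MA}=\inf\{t>0: Z_{t;w}>b\}$ be the alarm time of the moving-average chart with window $w$ and boundary $b$. Let $S_n=\sum_{i=1}^n(X_i-X_i')$, where $X_i,X_i'$, $i\ge1$, are independent with density $f_0$, and $\tau_+=\inf\{n>0:S_n>0\}$. Then $\tau_+<\infty$ almost surely and $E\,S_{\tau_+}^2<\infty$, so that the mean overshoot $\rho_+=E S_{\tau_+}^2/(2\,E S_{\tau_+})$ is well defined. Put $$A(w,b,L)=\frac{L\,b\,e^{-\theta b+wc(\theta/\sqrt w)}}{\sqrt{2\pi}\,w\,c''(\theta/\sqrt w)^{1/2}}\;e^{-\frac{\theta}{\sqrt w}\rho_+},$$ where $\theta$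 solves $b=\sqrt w\,c'(\theta/\sqrt w)$ with $\theta/\sqrt w\in\Theta$. The approximation $P_0^*(\tau_{MA}\le L)\approx A(w,b,L)$ holds in the following sense. There is a function $r$, depending only on $f_0$, such that for every $h>0$ in $c'(\Theta)$, whenever $w,b,L\to\infty$ with $b/\sqrt w\to h$ and $L=O(w)$, $$\frac{P_0^*(\tau_{MA}\le L)}{A(w,b,L)}\longrightarrow r(h),$$ and $r(h)=1+O(h^2)$ as $h\downarrow0$. -/

import Mathlib

open MeasureTheory ProbabilityTheory Filter Asymptotics
open scoped Topology

noncomputable section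

/-- The log-normalizer `c(θ) = log ∫ exp(θ x) dμ(x)` of the exponential family
`dF_θ = exp(θ x - c(θ)) dμ` generated by the baseline law `μ`. -/
def logNormalizer (μ : Measure ℝ) : ℝ → ℝ := cgf id μ

/-- The interior of the natural parameter set `{θ | ∫ exp(θ x) dμ(x) < ∞}`. -/
def naturalInterior (μ : Measure ℝ) : Set ℝ := interior (integrableExpSet id μ)

/-- The moving average of width `w` of a data stream `x`, at time `t`. -/
def movingAverage (x : ℤ → ℝ) (w : ℕ) (t : ℤ) : ℝ :=
  (1 / (w : ℝ)) * ∑ i ∈ Finset.Icc (t - w + 1) t, x i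

/-- The chart statistic `Z_{t;w} = √w * (moving average)`. -/
def chartStat (x : ℤ → ℝ) (w : ℕ) (t : ℤ) : ℝ :=
  √(w : ℝ) * movingAverage x w t

/-- The alarm time `inf {t > 0 | Z_{t;w} > b}` of the moving-average chart (`⊤` if there is no
alarm). -/
def alarmTime (w : ℕ) (b : ℝ) (x : ℤ → ℝ) : ℕ∞ :=
  sInf {s : ℕ∞ | ∃ t : ℕ, s = (t : ℕ∞) ∧ 0 < t ∧ b < chartStat x w (t : ℤ)}

/-- The law of the stationary baseline data stream: independent observations with law `μ`, indexed
by all integers, so that the moving average is in its steady state when monitoring starts. -/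
def steadyState (μ : Measure ℝ) [IsProbabilityMeasure μ] : Measure (ℤ → ℝ) :=
  Measure.infinitePi (fun _ : ℤ => μ)

/-- The false detection probability: an alarm is raised at one of the times `1, …, L` although all
observations follow the baseline law. -/
def falseDetectionProb (μ : Measure ℝ) [IsProbabilityMeasure μ] (w : ℕ) (b : ℝ) (L : ℕ) : ℝ :=
  (steadyState μ).real {x | alarmTime w b x ≤ (L : ℕ∞)}

/-- The law of two independent sequences `X_1, X_2, …` and `X_1', X_2', …` of independent
observations with law `μ` (the pair with index `i : ℕ` is `(X_{i+1}, X_{i+1}')`). -/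
def pairLaw (μ : Measure ℝ) [IsProbabilityMeasure μ] : Measure (ℕ → ℝ × ℝ) :=
  Measure.infinitePi (fun _ : ℕ => μ.prod μ)

/-- The random walk `S_n = ∑_{i=1}^n (X_i - X_i')`. -/
def diffWalk (y : ℕ → ℝ × ℝ) (n : ℕ) : ℝ :=
  ∑ i ∈ Finset.range n, ((y i).1 - (y i).2)

/-- The ladder epoch `τ₊ = inf {n > 0 | S_n > 0}` (`0` on the event that the walk never becomes
positive). -/
def ladderEpoch (y : ℕ → ℝ × ℝ) : ℕ := sInf {n : ℕ | 0 < n ∧ 0 < diffWalk y n}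

/-- The ladder height `S_{τ₊}`. -/
def ladderHeight (y : ℕ → ℝ × ℝ) : ℝ := diffWalk y (ladderEpoch y)

/-- The mean overshoot `ρ₊ = E S_{τ₊}² / (2 E S_{τ₊})`. -/
def meanOvershoot (μ : Measure ℝ) [IsProbabilityMeasure μ] : ℝ :=
  (∫ y, ladderHeight y ^ 2 ∂(pairLaw μ)) / (2 * ∫ y, ladderHeight y ∂(pairLaw μ))

/-- The approximation
`L b exp(-θ b + w c(θ/√w)) / (√(2π) w c''(θ/√w)^{1/2}) * exp(-(θ/√w) ρ₊)`. -/
def fdpApprox (μ : Measure ℝ) [IsProbabilityMeasure μ] (w : ℕ) (b θ : ℝ) (L : ℕ) : ℝ :=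
  (L : ℝ) * b * Real.exp (-θ * b + (w : ℝ) * logNormalizer μ (θ / √(w : ℝ))) /
      (√(2 * Real.pi) * (w : ℝ) * √(deriv (deriv (logNormalizer μ)) (θ / √(w : ℝ)))) *
    Real.exp (-(θ / √(w : ℝ)) * meanOvershoot μ)

end

/-! Write T_t for the sum of the w observations in the window at time t, M = e^c for the moment
generating function, a = √w·b = w·c'(θ/√w) for the boundary on the scale of sums, and ϑ for the tilt
with c'(ϑ) = h, so that θ/√w → ϑ.

Local maxima. An alarm by time L means that some T_t with 1 ≤ t ≤ L exceeds a. Since the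
observations have a density, the maximum of T over 1, …, L is almost surely attained once, so the
alarm probability is the sum over t of P(T_t > a, T_t maximal) (`measureReal_exceedEvent`). Away
from the ends, maximality may be replaced by maximality within a fixed distance m. A higher value
farther away forces a joint exceedance, and `exists_pair_le` bounds these by a geometric series in
`pairDecay` < 1, plus a product term that is negligible because L·P(T > a) → 0. Moving the window
one step in either direction replaces an observation inside it by a fresh one. Conditionally on a
high T_t the observations in the window look tilted by ϑ, so the increments on the two sides are
independent walks with steps X' - X, where X is tilted and X' is not. Each walk stays nonpositive
for m steps with a probability that tends to q = `survivalProb μ ϑ` as m → ∞. Together with the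
sharp tail asymptotics P(T > a) ~ M^w e^{-(θ/√w)a} / (ϑ √(2π w c''(ϑ))) (`tendsto_sumLaw_Ioi`), this
gives `tendsto_exceedEvent`, and division by the approximation yields the limit r(h) = q² / (ϑ c'(ϑ)
e^{-ϑρ₊}), which is `tiltRatio`.

Small tilts. It remains to expand log q to second order in ϑ = 2η. The identity e^{2ηx} = e^{η(x+y)}
e^{-η(y-x)} turns the drifting step law into e^{-η·} times a symmetric defective law of mass
M(η)²/M(2η). For a symmetric law the Wiener–Hopf factorization reads 1 - ν̂ = |1 - K̂|², with K the
law of the first ladder height. Since log(1 - K̂) extends to a half-plane, Poisson's formula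
recovers 1 - ∫ e^{-λx} dK from log(1 - ν̂) integrated against the Cauchy kernel
(`two_mul_log_one_sub_laplace_exitTotal`). With λ = η this is an exact formula for 2 log q. The same
formula for the untilted walk, with λ → 0, gives the first two moments of the ladder height, hence
its integrability and ρ₊ = 1 - `ladderConst`/2. The first-order term in the expansion of log q
involves this same constant, so the factor e^{-ϑρ₊} cancels it exactly. The pair expectations in
`PairBounds` show that all that is left is O(η²) (`exists_tiltRatio_bounds`), and h is of exact
order ϑ near 0. -/

noncomputable section

set_option linter.unusedSectionVars false

/-! ### Random walks killed on leaving a set, and changes of measure for them. -/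

section KilledWalk

open scoped ENNReal

variable {G : Type*} [AddCommGroup G] [MeasurableSpace G] [MeasurableAdd₂ G]

/-- The law of a random walk with step law `ν` started at `0` and killed when it leaves `s`,
after `n` steps. -/
def killedWalk (ν : Measure G) (s : Set G) : ℕ → Measure G
  | 0 => Measure.dirac 0
  | n + 1 => (killedWalk ν s n ∗ ν).restrict s

/-- The law of the walk at step `n + 1`, on the event that it leaves `s` at this step. -/
def exitLaw (ν : Measure G) (s : Set G) (n : ℕ) : Measure G :=
  (killedWalk ν s n ∗ ν).restrict sᶜ

lemma conv_apply_univ (μ ν : Measure G) [SFinite μ] [SFinite ν] :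
    (μ ∗ ν) Set.univ = μ Set.univ * ν Set.univ := by
  rw [Measure.conv, Measure.map_apply (by fun_prop) MeasurableSet.univ, Set.preimage_univ,
    ← Set.univ_prod_univ, Measure.prod_prod]

instance isFiniteMeasure_killedWalk (ν : Measure G) [IsFiniteMeasure ν] (s : Set G) (n : ℕ) :
    IsFiniteMeasure (killedWalk ν s n) := by
  induction n with
  | zero => simp only [killedWalk]; infer_instance
  | succ n ih => simp only [killedWalk]; infer_instance

instance isFiniteMeasure_exitLaw (ν : Measure G) [IsFiniteMeasure ν] (s : Set G) (n : ℕ) :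
    IsFiniteMeasure (exitLaw ν s n) := by
  unfold exitLaw; infer_instance

lemma killedWalk_add_exitLaw (ν : Measure G) {s : Set G} (hs : MeasurableSet s) (n : ℕ) :
    killedWalk ν s (n + 1) + exitLaw ν s n = killedWalk ν s n ∗ ν := by
  simp only [killedWalk, exitLaw]
  exact Measure.restrict_add_restrict_compl hs

lemma killedWalk_univ_le (ν : Measure G) [IsFiniteMeasure ν] (s : Set G) (n : ℕ) :
    killedWalk ν s n Set.univ ≤ ν Set.univ ^ n := by
  induction n with
  | zero => simp [killedWalk]
  | succ n ih =>
    simp only [killedWalk]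
    calc _ ≤ (killedWalk ν s n ∗ ν) Set.univ := Measure.restrict_apply_le _ _
      _ = _ := conv_apply_univ _ _
      _ ≤ _ := by rw [pow_succ]; gcongr

lemma sum_conv (μ : ℕ → Measure G) [∀ n, SFinite (μ n)] (ν : Measure G) [SFinite ν] :
    Measure.sum (fun n => μ n ∗ ν) = Measure.sum μ ∗ ν := by
  simp only [Measure.conv]
  rw [Measure.prod_sum_left, Measure.map_sum (by fun_prop)]

/-- A density that is multiplicative factorizes along a sum of independent variables; this is
exponential tilting. -/
lemma withDensity_conv {χ : G → ℝ≥0∞} (hχ : Measurable χ) (hadd : ∀ x y, χ (x + y) = χ x * χ y)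
    (μ ν : Measure G) [SFinite μ] [SFinite ν] :
    (μ ∗ ν).withDensity χ = μ.withDensity χ ∗ ν.withDensity χ := by
  ext A hA
  rw [withDensity_apply _ hA, ← lintegral_indicator hA,
    Measure.lintegral_conv (hχ.indicator hA), ← lintegral_indicator_one hA,
    Measure.lintegral_conv (measurable_one.indicator hA),
    lintegral_withDensity_eq_lintegral_mul₀ hχ.aemeasurable (by
      refine Measurable.aemeasurable ?_
      refine Measurable.lintegral_prod_right'
        (f := fun p : G × G => A.indicator (1 : G → ℝ≥0∞) (p.1 + p.2)) ?_
      exact (measurable_one.indicator hA).comp measurable_add)]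
  refine lintegral_congr fun x => ?_
  have hm : Measurable fun y => A.indicator (1 : G → ℝ≥0∞) (x + y) :=
    (measurable_one.indicator hA).comp (measurable_const_add x)
  rw [Pi.mul_apply, lintegral_withDensity_eq_lintegral_mul₀ hχ.aemeasurable hm.aemeasurable,
    ← lintegral_const_mul _ (hχ.mul hm)]
  refine lintegral_congr fun y => ?_
  by_cases h : x + y ∈ A <;> simp [h, hadd]

/-- Tilting commutes with convolution and with restriction, hence with every step of the killed
walk. It serves both to tilt observations and to symmetrize the drifting step law. -/
lemma killedWalk_withDensity {χ : G → ℝ≥0∞} (hχ : Measurable χ)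
    (hadd : ∀ x y, χ (x + y) = χ x * χ y) (h0 : χ 0 = 1) (ν : Measure G) [IsFiniteMeasure ν]
    {s : Set G} (hs : MeasurableSet s) (n : ℕ) :
    (killedWalk ν s n).withDensity χ = killedWalk (ν.withDensity χ) s n := by
  induction n with
  | zero =>
    simp only [killedWalk]
    ext A hA
    rw [withDensity_apply _ hA, ← lintegral_indicator hA, lintegral_dirac' _ (hχ.indicator hA),
      Measure.dirac_apply' _ hA]
    by_cases h : (0 : G) ∈ A <;> simp [h, h0]
  | succ n ih =>
    simp only [killedWalk]
    rw [← ih, ← withDensity_conv hχ hadd, restrict_withDensity hs]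

lemma exitLaw_withDensity {χ : G → ℝ≥0∞} (hχ : Measurable χ)
    (hadd : ∀ x y, χ (x + y) = χ x * χ y) (h0 : χ 0 = 1) (ν : Measure G) [IsFiniteMeasure ν]
    {s : Set G} (hs : MeasurableSet s) (n : ℕ) :
    (exitLaw ν s n).withDensity χ = exitLaw (ν.withDensity χ) s n := by
  simp only [exitLaw]
  rw [← killedWalk_withDensity hχ hadd h0 ν hs, ← withDensity_conv hχ hadd,
    restrict_withDensity hs.compl]

/-- When survival depends only on the image under a homomorphism, the image is itself a killed walk.
It is used to forget the removed observations and keep the increments. -/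
lemma killedWalk_map {H : Type*} [AddCommGroup H] [MeasurableSpace H] [MeasurableAdd₂ H]
    (f : G →+ H) (hf : Measurable f) (ν : Measure G) [IsFiniteMeasure ν]
    {s : Set H} (hs : MeasurableSet s) (n : ℕ) :
    (killedWalk ν (f ⁻¹' s) n).map f = killedWalk (ν.map f) s n := by
  induction n with
  | zero => simp only [killedWalk]; rw [Measure.map_dirac' hf, map_zero]
  | succ n ih =>
    simp only [killedWalk]
    rw [← Measure.restrict_map hf hs, Measure.map_conv_addMonoidHom f hf, ih]

instance measurableAdd₂_prod {H : Type*} [AddCommGroup H] [MeasurableSpace H] [MeasurableAdd₂ H] :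
    MeasurableAdd₂ (G × H) where
  measurable_add := by
    refine Measurable.prodMk ?_ ?_
    · exact (measurable_fst.comp measurable_fst).add (measurable_fst.comp measurable_snd)
    · exact (measurable_snd.comp measurable_fst).add (measurable_snd.comp measurable_snd)

lemma prod_conv_prod {H : Type*} [AddCommGroup H] [MeasurableSpace H] [MeasurableAdd₂ H]
    (μ₁ ν₁ : Measure G) (μ₂ ν₂ : Measure H) [IsFiniteMeasure μ₁] [IsFiniteMeasure ν₁]
    [IsFiniteMeasure μ₂] [IsFiniteMeasure ν₂] :
    μ₁.prod μ₂ ∗ ν₁.prod ν₂ = (μ₁ ∗ ν₁).prod (μ₂ ∗ ν₂) := by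
  symm
  refine Measure.prod_eq fun A B hA hB => ?_
  rw [← lintegral_indicator_one (hA.prod hB), ← lintegral_indicator_one hA,
    ← lintegral_indicator_one hB,
    Measure.lintegral_conv (measurable_one.indicator (hA.prod hB)),
    Measure.lintegral_conv (measurable_one.indicator hA),
    Measure.lintegral_conv (measurable_one.indicator hB)]
  have h : ∀ (x : G × H) (y : G × H), (A ×ˢ B).indicator (1 : G × H → ℝ≥0∞) (x + y)
      = A.indicator 1 (x.1 + y.1) * B.indicator 1 (x.2 + y.2) := by
    intro x y
    rw [show x + y = (x.1 + y.1, x.2 + y.2) from rfl]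
    by_cases h1 : x.1 + y.1 ∈ A <;> by_cases h2 : x.2 + y.2 ∈ B <;> simp [h1, h2]
  simp_rw [h]
  have h2 : ∀ x : G × H, ∫⁻ y, A.indicator (1 : G → ℝ≥0∞) (x.1 + y.1) *
      B.indicator 1 (x.2 + y.2) ∂ν₁.prod ν₂
      = (∫⁻ y, A.indicator 1 (x.1 + y) ∂ν₁) * ∫⁻ y, B.indicator 1 (x.2 + y) ∂ν₂ := by
    intro x
    exact lintegral_prod_mul
      ((measurable_one.indicator hA).comp (measurable_const_add x.1)).aemeasurable
      ((measurable_one.indicator hB).comp (measurable_const_add x.2)).aemeasurable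
  simp_rw [h2]
  have hmA : Measurable fun x => ∫⁻ y, A.indicator (1 : G → ℝ≥0∞) (x + y) ∂ν₁ :=
    Measurable.lintegral_prod_right' (f := fun p : G × G => A.indicator (1 : G → ℝ≥0∞) (p.1 + p.2))
      ((measurable_one.indicator hA).comp measurable_add)
  have hmB : Measurable fun x => ∫⁻ y, B.indicator (1 : H → ℝ≥0∞) (x + y) ∂ν₂ :=
    Measurable.lintegral_prod_right' (f := fun p : H × H => B.indicator (1 : H → ℝ≥0∞) (p.1 + p.2))
      ((measurable_one.indicator hB).comp measurable_add)
  exact lintegral_prod_mul hmA.aemeasurable hmB.aemeasurable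

/-- Independent coordinates with a rectangular survival set do not interact. This separates the two
sides of a local maximum. -/
lemma killedWalk_prod {H : Type*} [AddCommGroup H] [MeasurableSpace H] [MeasurableAdd₂ H]
    (ν₁ : Measure G) (ν₂ : Measure H) [IsFiniteMeasure ν₁] [IsFiniteMeasure ν₂]
    (s : Set G) (t : Set H) (n : ℕ) :
    killedWalk (ν₁.prod ν₂) (s ×ˢ t) n = (killedWalk ν₁ s n).prod (killedWalk ν₂ t n) := by
  induction n with
  | zero =>
    simp only [killedWalk]
    rw [Measure.dirac_prod_dirac]; rfl
  | succ n ih =>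
    simp only [killedWalk]
    rw [ih, prod_conv_prod, Measure.prod_restrict]

/-- Survival up to step n and the position at step n are functions of the first n increments, hence
independent of the next one. -/
lemma map_restrict_path_step {Ω : Type*} [MeasurableSpace Ω] {P : Measure Ω}
    [IsProbabilityMeasure P] {ξ : ℕ → Ω → G} (hξ : ∀ i, Measurable (ξ i)) {ν : Measure G}
    [IsProbabilityMeasure ν] {n : ℕ} (hν : P.map (ξ n) = ν)
    (hind : IndepFun (fun ω (i : Fin n) => ξ i ω) (ξ n) P)
    {s : Set G} (hs : MeasurableSet s) :
    (P.restrict {ω | ∀ k < n, ∑ i ∈ Finset.range (k + 1), ξ i ω ∈ s}).map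
      (fun ω => ∑ i ∈ Finset.range (n + 1), ξ i ω) =
    (P.restrict {ω | ∀ k < n, ∑ i ∈ Finset.range (k + 1), ξ i ω ∈ s}).map
      (fun ω => ∑ i ∈ Finset.range n, ξ i ω) ∗ ν := by
  have hS : ∀ n, Measurable fun ω => ∑ i ∈ Finset.range n, ξ i ω := fun n =>
    Finset.measurable_sum _ fun i _ => hξ i
  set E := {ω | ∀ k < n, ∑ i ∈ Finset.range (k + 1), ξ i ω ∈ s}
  set S := fun ω => ∑ i ∈ Finset.range n, ξ i ω
  have hjoint : (P.restrict E).map (fun ω => (S ω, ξ n ω)) = ((P.restrict E).map S).prod ν := by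
    symm
    refine Measure.prod_eq fun A B hA hB => ?_
    rw [Measure.map_apply ((hS n).prodMk (hξ n)) (hA.prod hB), Measure.map_apply (hS n) hA,
      Measure.restrict_apply (((hS n).prodMk (hξ n)) (hA.prod hB)),
      Measure.restrict_apply (hS n hA), ← hν, Measure.map_apply (hξ n) hB]
    have hS' : ∀ k ≤ n, Measurable fun x : Fin n → G =>
        ∑ i ∈ Finset.range k, if h : i < n then x ⟨i, h⟩ else 0 := by
      intro k _
      refine Finset.measurable_sum _ fun i _ => ?_
      split_ifs <;> fun_prop
    -- The past event is written as a condition on a tuple of n increments; padding with 0 keeps the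
    -- sums over `Finset.range`.
    have hC : MeasurableSet {x : Fin n → G | (∀ k < n, (∑ i ∈ Finset.range (k + 1),
        if h : i < n then x ⟨i, h⟩ else 0) ∈ s) ∧ (∑ i ∈ Finset.range n,
        if h : i < n then x ⟨i, h⟩ else 0) ∈ A} := by
      have h1 := MeasurableSet.iInter fun k => MeasurableSet.iInter fun hk : k < n =>
        hS' (k + 1) (by omega) hs
      convert h1.inter (hS' n le_rfl hA) using 1
      ext x
      simp
    have key := hind.measure_inter_preimage_eq_mul _ _ hC hB
    have e1 : (fun ω (i : Fin n) => ξ i ω) ⁻¹' {x : Fin n → G | (∀ k < n,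
        (∑ i ∈ Finset.range (k + 1), if h : i < n then x ⟨i, h⟩ else 0) ∈ s) ∧
        (∑ i ∈ Finset.range n, if h : i < n then x ⟨i, h⟩ else 0) ∈ A} = S ⁻¹' A ∩ E := by
      have hsum : ∀ ω, ∀ k ≤ n, (∑ i ∈ Finset.range k, if h : i < n then ξ i ω else 0)
          = ∑ i ∈ Finset.range k, ξ i ω := by
        intro ω k hk
        refine Finset.sum_congr rfl fun i hi => ?_
        rw [dif_pos (by have := Finset.mem_range.1 hi; omega)]
      ext ω
      simp only [Set.mem_preimage, Set.mem_ofPred_eq, Set.mem_inter_iff, E, S]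
      rw [hsum ω n le_rfl, and_comm]
      refine and_congr_right fun _ => forall₂_congr fun k hk => ?_
      rw [hsum ω (k + 1) (by omega)]
    rw [e1] at key
    rw [← key]
    congr 1
    ext ω
    simp only [Set.mem_inter_iff, Set.mem_preimage, Set.mem_prod]
    tauto
  rw [Measure.conv, ← hjoint, Measure.map_map measurable_add ((hS n).prodMk (hξ n))]
  congr 1
  ext ω
  simp [Finset.sum_range_succ]

/-- The killed walk is the law of the partial sums of independent steps on the event that the path
stays in `s`. -/
lemma map_restrict_path_eq_killedWalk {Ω : Type*} [MeasurableSpace Ω] {P : Measure Ω}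
    [IsProbabilityMeasure P] {ξ : ℕ → Ω → G} (hξ : ∀ i, Measurable (ξ i)) {ν : Measure G}
    [IsProbabilityMeasure ν] (m : ℕ) (hν : ∀ i < m, P.map (ξ i) = ν)
    (hind : ∀ n < m, IndepFun (fun ω (i : Fin n) => ξ i ω) (ξ n) P)
    {s : Set G} (hs : MeasurableSet s) (n : ℕ) (hn : n ≤ m) :
    (P.restrict {ω | ∀ k < n, ∑ i ∈ Finset.range (k + 1), ξ i ω ∈ s}).map
      (fun ω => ∑ i ∈ Finset.range n, ξ i ω) = killedWalk ν s n := by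
  have hS : ∀ n, Measurable fun ω => ∑ i ∈ Finset.range n, ξ i ω := fun n =>
    Finset.measurable_sum _ fun i _ => hξ i
  induction n with
  | zero => simp [killedWalk, Measure.map_const]
  | succ n ih =>
    simp only [killedWalk]
    rw [← ih (by omega), ← map_restrict_path_step hξ (hν n (by omega)) (hind n (by omega)) hs,
      Measure.restrict_map (hS _) hs, Measure.restrict_restrict (hS _ hs)]
    congr 2
    ext ω
    simp only [Set.mem_ofPred_eq, Set.mem_inter_iff, Set.mem_preimage]
    constructor
    · intro h
      exact ⟨h n (by omega), fun k hk => h k (by omega)⟩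
    · rintro ⟨h1, h2⟩ k hk
      rcases Nat.lt_succ_iff_lt_or_eq.1 hk with h | rfl
      · exact h2 k h
      · exact h1

/-- The exit law is the law of the partial sum on the event of leaving `s` at this step. -/
lemma map_restrict_exit_eq_exitLaw {Ω : Type*} [MeasurableSpace Ω] {P : Measure Ω}
    [IsProbabilityMeasure P] {ξ : ℕ → Ω → G} (hξ : ∀ i, Measurable (ξ i)) {ν : Measure G}
    [IsProbabilityMeasure ν] (hν : ∀ i, P.map (ξ i) = ν)
    (hind : ∀ n, IndepFun (fun ω (i : Fin n) => ξ i ω) (ξ n) P)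
    {s : Set G} (hs : MeasurableSet s) (n : ℕ) :
    (P.restrict {ω | (∀ k < n, ∑ i ∈ Finset.range (k + 1), ξ i ω ∈ s) ∧
      ∑ i ∈ Finset.range (n + 1), ξ i ω ∉ s}).map
      (fun ω => ∑ i ∈ Finset.range (n + 1), ξ i ω) = exitLaw ν s n := by
  have hS : ∀ n, Measurable fun ω => ∑ i ∈ Finset.range n, ξ i ω := fun n =>
    Finset.measurable_sum _ fun i _ => hξ i
  rw [exitLaw, ← map_restrict_path_eq_killedWalk hξ n (fun i _ => hν i) (fun i _ => hind i) hs n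
    le_rfl, ← map_restrict_path_step hξ (hν n) (hind n) hs, Measure.restrict_map (hS _) hs.compl,
    Measure.restrict_restrict (hS _ hs.compl)]
  congr 2
  ext ω
  simp only [Set.mem_ofPred_eq, Set.mem_inter_iff, Set.mem_preimage, Set.mem_compl_iff]
  tauto

end KilledWalk

/-! ### Wiener–Hopf factorization for symmetric defective laws without atoms. -/

section WienerHopf

open scoped ENNReal ComplexConjugate

/-- The occupation measure of the walk killed on leaving `s`. -/
def occupation (ν : Measure ℝ) (s : Set ℝ) : Measure ℝ := Measure.sum (killedWalk ν s)

/-- The law of the first position outside `s`. -/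
def exitTotal (ν : Measure ℝ) (s : Set ℝ) : Measure ℝ := Measure.sum (exitLaw ν s)

lemma isFiniteMeasure_occupation {ν : Measure ℝ} [IsFiniteMeasure ν] (hν : ν Set.univ < 1)
    (s : Set ℝ) : IsFiniteMeasure (occupation ν s) := by
  refine ⟨?_⟩
  rw [occupation, Measure.sum_apply _ MeasurableSet.univ]
  calc _ ≤ ∑' n, ν Set.univ ^ n := ENNReal.tsum_le_tsum fun n => killedWalk_univ_le ν s n
    _ = (1 - ν Set.univ)⁻¹ := ENNReal.tsum_geometric _
    _ < ⊤ := by simpa using hν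

/-- Sum over n the identity that each step either stays in `s` or exits; the sum of the shifted
survivors lacks only the starting mass at 0. -/
lemma occupation_conv (ν : Measure ℝ) [IsFiniteMeasure ν] {s : Set ℝ} (hs : MeasurableSet s) :
    Measure.dirac 0 + occupation ν s ∗ ν = occupation ν s + exitTotal ν s := by
  rw [occupation, ← sum_conv]
  ext A hA
  simp only [Measure.add_apply, exitTotal, Measure.sum_apply _ hA]
  simp_rw [← killedWalk_add_exitLaw ν hs, Measure.add_apply]
  rw [ENNReal.tsum_add, ← add_assoc]
  congr 1
  rw [tsum_eq_zero_add' (f := fun n => killedWalk ν s n A) ENNReal.summable]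
  rfl

/-- In total masses the renewal identity reads l = 1 - N(1 - z), and N ≥ 1 because the starting
point is counted. -/
lemma exitTotal_univ_le {ν : Measure ℝ} [IsFiniteMeasure ν] (hν : ν Set.univ < 1)
    {s : Set ℝ} (hs : MeasurableSet s) : exitTotal ν s Set.univ ≤ ν Set.univ := by
  have := isFiniteMeasure_occupation hν s
  have h := congrArg (fun m => m Set.univ) (occupation_conv ν hs)
  simp only [Measure.add_apply, conv_apply_univ, measure_univ] at h
  have h1 : 1 ≤ occupation ν s Set.univ := by
    rw [occupation, Measure.sum_apply _ MeasurableSet.univ]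
    refine le_trans ?_ (ENNReal.le_tsum 0)
    simp [killedWalk]
  have hN : occupation ν s Set.univ ≠ ⊤ := measure_ne_top _ _
  have hz : ν Set.univ ≠ ⊤ := measure_ne_top _ _
  have hL : exitTotal ν s Set.univ ≠ ⊤ := by
    intro hc
    rw [hc] at h
    exact (ENNReal.add_ne_top.2 ⟨ENNReal.one_ne_top, ENNReal.mul_ne_top hN hz⟩) (by simpa using h)
  lift occupation ν s Set.univ to NNReal using hN with N
  lift ν Set.univ to NNReal using hz with z
  lift exitTotal ν s Set.univ to NNReal using hL with l
  norm_cast at *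
  have h' : (1 : ℝ) + N * z = N + l := by exact_mod_cast h
  have h1' : (1 : ℝ) ≤ N := by exact_mod_cast h1
  have h2' : (z : ℝ) < 1 := by exact_mod_cast hν
  have : (l : ℝ) ≤ z := by nlinarith
  exact_mod_cast this

lemma isFiniteMeasure_exitTotal {ν : Measure ℝ} [IsFiniteMeasure ν] (hν : ν Set.univ < 1)
    {s : Set ℝ} (hs : MeasurableSet s) : IsFiniteMeasure (exitTotal ν s) :=
  ⟨(exitTotal_univ_le hν hs).trans_lt (measure_lt_top _ _)⟩

lemma noAtoms_conv {μ ν : Measure ℝ} [SFinite μ] [SFinite ν] [NullSingletonClass ν] :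
    NullSingletonClass (μ ∗ ν) := by
  refine ⟨fun x => ?_⟩
  rw [← lintegral_indicator_one (measurableSet_singleton x),
    Measure.lintegral_conv (measurable_one.indicator (measurableSet_singleton x))]
  have : ∀ a : ℝ, ∫⁻ y, ({x} : Set ℝ).indicator (1 : ℝ → ℝ≥0∞) (a + y) ∂ν = 0 := by
    intro a
    have : ∀ y, ({x} : Set ℝ).indicator (1 : ℝ → ℝ≥0∞) (a + y)
        = ({x - a} : Set ℝ).indicator 1 y := by
      intro y
      by_cases h : a + y = x
      · rw [Set.indicator_of_mem (by simpa using h), Set.indicator_of_mem (by simp; linarith)]; rfl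
      · rw [Set.indicator_of_notMem (by simpa using h),
          Set.indicator_of_notMem (by simp; intro h'; apply h; linarith)]
    simp_rw [this]
    rw [lintegral_indicator_one (measurableSet_singleton _)]
    simp
  rw [lintegral_congr this, lintegral_zero]

/-- Without atoms only time 0 charges the origin, so strict and weak ladder heights need not be
distinguished. -/
lemma occupation_singleton_zero (ν : Measure ℝ) [IsFiniteMeasure ν] [NullSingletonClass ν] (s : Set ℝ) :
    occupation ν s {0} = 1 := by
  rw [occupation, Measure.sum_apply _ (measurableSet_singleton _), tsum_eq_single 0]
  · simp [killedWalk]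
  · intro n hn
    obtain ⟨k, rfl⟩ := Nat.exists_eq_succ_of_ne_zero hn
    simp only [killedWalk]
    have := noAtoms_conv (μ := killedWalk ν s k) (ν := ν)
    exact measure_singleton _

lemma killedWalk_compl (ν : Measure ℝ) {s : Set ℝ} (hs : MeasurableSet s) (h0 : (0 : ℝ) ∈ s)
    (n : ℕ) : killedWalk ν s n sᶜ = 0 := by
  cases n with
  | zero => simp [killedWalk, hs.compl, h0]
  | succ n =>
    simp only [killedWalk]
    rw [Measure.restrict_apply hs.compl]
    simp

/-- The Wiener–Hopf factor of a symmetric walk: the reflected occupation measure of the negative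
half-line is the renewal measure of the ladder heights. -/
lemma occupation_map_neg_eq {ν : Measure ℝ} [IsFiniteMeasure ν] [NullSingletonClass ν]
    (hν : ν Set.univ < 1) (hsymm : ν.map (fun x => -x) = ν) :
    (occupation ν (Set.Iic 0)).map (fun x => -x) = Measure.dirac 0 +
      exitTotal ν (Set.Iic 0) ∗ (occupation ν (Set.Iic 0)).map (fun x => -x) := by
  have hs : MeasurableSet (Set.Iic (0 : ℝ)) := measurableSet_Iic
  have := isFiniteMeasure_occupation hν (Set.Iic 0)
  have := isFiniteMeasure_exitTotal hν hs
  set N := occupation ν (Set.Iic 0) with hN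
  set K := exitTotal ν (Set.Iic 0) with hK
  set N' := N.map (fun x => -x) with hN'
  set K' := K.map (fun x => -x) with hK'
  have e1 : Measure.dirac 0 + N ∗ ν = N + K := occupation_conv ν hs
  have hconv : ∀ (α β : Measure ℝ) [SFinite α] [SFinite β],
      (α ∗ β).map (fun x => -x) = α.map (fun x => -x) ∗ β.map (fun x => -x) := by
    intro α β _ _
    exact Measure.map_conv_addMonoidHom (negAddMonoidHom (α := ℝ)) measurable_neg
  have e2 : Measure.dirac 0 + N' ∗ ν = N' + K' := by
    have h := congrArg (fun m => m.map (fun x : ℝ => -x)) e1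
    simp only [Measure.map_add _ _ measurable_neg, hconv, hsymm] at h
    rw [Measure.map_dirac' measurable_neg, neg_zero] at h
    exact h
  -- The same triple convolution is expanded by the renewal identity for N and by its reflection for
  -- N'.
  have hcomm : N' ∗ (N ∗ ν) = N ∗ (N' ∗ ν) := by
    rw [← Measure.conv_assoc, ← Measure.conv_assoc, Measure.conv_comm N' N]
  -- Cancelling the common finite terms leaves N' + K' ∗ N = N + K ∗ N'. The measures N', K ∗ N'
  -- live on the right half-line and N, K' ∗ N on the left, so the identity can be split by sign.
  have e3 : ∀ A : Set ℝ, N' A + (K' ∗ N) A = N A + (K ∗ N') A := by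
    intro A
    have h1 : N' + N' ∗ (N ∗ ν) = N' ∗ N + N' ∗ K := by
      rw [← Measure.conv_add, ← e1, Measure.conv_add, Measure.conv_dirac_zero]
    have h2 : N + N ∗ (N' ∗ ν) = N ∗ N' + N ∗ K' := by
      rw [← Measure.conv_add, ← e2, Measure.conv_add, Measure.conv_dirac_zero]
    rw [hcomm, Measure.conv_comm N' K] at h1
    rw [Measure.conv_comm N K', Measure.conv_comm N N'] at h2
    have h1 := congrArg (fun m => m A) h1
    have h2 := congrArg (fun m => m A) h2
    simp only [Measure.add_apply] at h1 h2
    have f1 : (N ∗ (N' ∗ ν)) A ≠ ⊤ := measure_ne_top _ _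
    have f2 : (N' ∗ N) A ≠ ⊤ := measure_ne_top _ _
    have f3 : N' A ≠ ⊤ := measure_ne_top _ _
    have f4 : N A ≠ ⊤ := measure_ne_top _ _
    have f5 : (K ∗ N') A ≠ ⊤ := measure_ne_top _ _
    have f6 : (K' ∗ N) A ≠ ⊤ := measure_ne_top _ _
    rw [← ENNReal.toReal_eq_toReal_iff' (by simp [*]) (by simp [*])] at h1 h2 ⊢
    rw [ENNReal.toReal_add (by assumption) (by assumption),
      ENNReal.toReal_add (by assumption) (by assumption)] at h1 h2 ⊢
    linarith
  have hNpos : N (Set.Ioi 0) = 0 := by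
    rw [hN, occupation, Measure.sum_apply _ measurableSet_Ioi, ENNReal.tsum_eq_zero]
    intro n
    rw [← Set.compl_Iic]
    exact killedWalk_compl ν hs (by simp) n
  have hKneg : K (Set.Iic 0) = 0 := by
    rw [hK, exitTotal, Measure.sum_apply _ hs, ENNReal.tsum_eq_zero]
    intro n
    rw [exitLaw, Measure.restrict_apply hs, Set.inter_compl_self, measure_empty]
  have hN'neg : N' (Set.Iio 0) = 0 := by
    rw [hN', Measure.map_apply measurable_neg measurableSet_Iio]
    simpa using hNpos
  have hconvzero : ∀ (α β : Measure ℝ) [SFinite α] [SFinite β] (A B C : Set ℝ),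
      MeasurableSet A → MeasurableSet B → MeasurableSet C →
      α Aᶜ = 0 → β Bᶜ = 0 → (∀ x ∈ A, ∀ y ∈ B, x + y ∉ C) → (α ∗ β) C = 0 := by
    intro α β _ _ A B C hA hB hC h1 h2 h3
    rw [Measure.conv, Measure.map_apply measurable_add hC]
    refine measure_mono_null (t := (Aᶜ ×ˢ Set.univ) ∪ (Set.univ ×ˢ Bᶜ)) ?_ ?_
    · rintro ⟨x, y⟩ hxy
      by_contra hcon
      simp only [Set.mem_union, Set.mem_prod, Set.mem_compl_iff, Set.mem_univ, and_true,
        true_and, not_or, not_not] at hcon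
      exact h3 x hcon.1 y hcon.2 hxy
    · rw [measure_union_null_iff, Measure.prod_prod, Measure.prod_prod, h1, h2]
      simp
  have hKN' : (K ∗ N') (Set.Iic 0) = 0 := by
    refine hconvzero _ _ (Set.Ioi 0) (Set.Ici 0) _ measurableSet_Ioi measurableSet_Ici hs
      (by simpa using hKneg) (by simpa using hN'neg) fun x hx y hy => ?_
    simp only [Set.mem_Ioi, Set.mem_Ici, Set.mem_Iic, not_le] at *
    linarith
  have hK'N : (K' ∗ N) (Set.Ici 0) = 0 := by
    refine hconvzero _ _ (Set.Iio 0) (Set.Iic 0) _ measurableSet_Iio hs measurableSet_Ici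
      ?_ (by simpa using hNpos) fun x hx y hy => ?_
    · rw [hK', Set.compl_Iio, Measure.map_apply measurable_neg measurableSet_Ici]
      simpa using hKneg
    · simp only [Set.mem_Iio, Set.mem_Ici, Set.mem_Iic, not_le] at *
      linarith
  have hN0 : N' {0} = 1 := by
    rw [hN', Measure.map_apply measurable_neg (measurableSet_singleton _)]
    have : (fun x : ℝ => -x) ⁻¹' {0} = {0} := by ext; simp
    rw [this]
    exact occupation_singleton_zero ν _
  ext A hA
  have split : ∀ m : Measure ℝ, m A = m (A ∩ Set.Iio 0) + (m (A ∩ {0}) + m (A ∩ Set.Ioi 0)) := by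
    intro m
    rw [← measure_inter_add_sdiff A (measurableSet_Iio (a := (0 : ℝ)))]
    congr 1
    rw [← measure_inter_add_sdiff (A \ Set.Iio 0) (measurableSet_singleton (0 : ℝ))]
    congr 2
    · ext x
      simp only [Set.mem_inter_iff, Set.mem_sdiff, Set.mem_Iio, not_lt, Set.mem_singleton_iff,
        and_assoc]
      exact and_congr_right fun _ => ⟨fun h => h.2, fun h => ⟨h.ge, h⟩⟩
    · ext x
      simp only [Set.mem_sdiff, Set.mem_Iio, not_lt, Set.mem_singleton_iff, Set.mem_inter_iff,
        Set.mem_Ioi, and_assoc]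
      refine and_congr_right fun _ => ?_
      rw [lt_iff_le_and_ne, ne_comm]
  have z1 : N' (A ∩ Set.Iio 0) = 0 := measure_mono_null Set.inter_subset_right hN'neg
  have z2 : (K ∗ N') (A ∩ Set.Iio 0) = 0 :=
    measure_mono_null (Set.inter_subset_right.trans Set.Iio_subset_Iic_self) hKN'
  have z3 : (K ∗ N') (A ∩ {0}) = 0 :=
    measure_mono_null (Set.inter_subset_right.trans (by simp)) hKN'
  -- On the open right half-line both left-supported measures vanish; at 0 the mass of N' is exactly
  -- the Dirac mass.
  have z4 : N' (A ∩ Set.Ioi 0) = (K ∗ N') (A ∩ Set.Ioi 0) := by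
    have h := e3 (A ∩ Set.Ioi 0)
    rwa [measure_mono_null (μ := K' ∗ N)
      (Set.inter_subset_right.trans Set.Ioi_subset_Ici_self) hK'N,
      measure_mono_null Set.inter_subset_right hNpos, add_zero, zero_add] at h
  have z5 : N' (A ∩ {0}) = Measure.dirac 0 A := by
    rw [Measure.dirac_apply' _ hA]
    by_cases h : (0 : ℝ) ∈ A
    · rw [Set.inter_eq_right.2 (by simpa using h), hN0]; simp [h]
    · rw [Set.inter_singleton_eq_empty.2 h]; simp [h]
  rw [Measure.add_apply, split N', split (K ∗ N'), z1, z2, z3, z4, z5]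
  simp

lemma charFun_add_measure (μ ν : Measure ℝ) [IsFiniteMeasure μ] [IsFiniteMeasure ν] (t : ℝ) :
    charFun (μ + ν) t = charFun μ t + charFun ν t := by
  simp only [charFun_apply_real]
  refine integral_add_measure ?_ ?_ <;>
  · refine (integrable_const (1 : ℝ)).mono (by fun_prop) (ae_of_all _ fun x => ?_)
    rw [← Complex.ofReal_mul, Complex.norm_exp_ofReal_mul_I]
    simp

lemma charFun_map_neg (μ : Measure ℝ) (t : ℝ) :
    charFun (μ.map (fun x => -x)) t = conj (charFun μ t) := by
  have h := charFun_map_mul (μ := μ) (-1) t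
  simp only [neg_mul, one_mul] at h
  rw [h, charFun_neg]

/-- Wiener–Hopf factorization of a symmetric killed walk. -/
lemma one_sub_charFun_eq_mul_conj {ν : Measure ℝ} [IsFiniteMeasure ν] [NullSingletonClass ν]
    (hν : ν Set.univ < 1) (hsymm : ν.map (fun x => -x) = ν) (u : ℝ) :
    1 - charFun ν u = (1 - charFun (exitTotal ν (Set.Iic 0)) u) *
      conj (1 - charFun (exitTotal ν (Set.Iic 0)) u) := by
  have hs : MeasurableSet (Set.Iic (0 : ℝ)) := measurableSet_Iic
  have := isFiniteMeasure_occupation hν (Set.Iic 0)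
  have := isFiniteMeasure_exitTotal hν hs
  have h1 := congrArg (fun m => charFun m u) (occupation_conv ν hs)
  have h2 := congrArg (fun m => charFun m u) (occupation_map_neg_eq hν hsymm)
  simp only [charFun_add_measure, charFun_conv, charFun_map_neg, charFun_dirac] at h1 h2
  simp only [inner_zero_left, Complex.ofReal_zero, zero_mul, Complex.exp_zero] at h1 h2
  set a := charFun (occupation ν (Set.Iic 0)) u
  set k := charFun (exitTotal ν (Set.Iic 0)) u
  set f := charFun ν u
  -- The transform of the reflected occupation measure is conj a, so conjugation brings the
  -- factorization back to a.
  have h3 : a = 1 + conj k * a := by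
    have := congrArg conj h2
    simpa using this
  have h4 : a * conj (1 - k) = 1 := by
    rw [map_sub, map_one]; linear_combination h3
  have h5 : a * (1 - f) = 1 - k := by linear_combination -h1
  calc 1 - f = (1 - f) * (a * conj (1 - k)) := by rw [h4, mul_one]
    _ = a * (1 - f) * conj (1 - k) := by ring
    _ = _ := by rw [h5]

end WienerHopf

/-! ### Fourier integrals, the Poisson kernel and the logarithm of 1 - ρ̂. -/

section Fourier

open scoped ENNReal ComplexConjugate FourierTransform

/-- Fourier inversion in the convention e^{iux} with prefactor 1/(2π), by the substitution u = 2πv.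
-/
lemma eq_integral_of_fourier {f F : ℝ → ℂ} (hc : Continuous f) (hf : Integrable f)
    (hF : ∀ u : ℝ, ∫ x : ℝ, Complex.exp (-(u * x) * Complex.I) * f x = F u)
    (hFi : Integrable F) (x : ℝ) :
    f x = (2 * Real.pi : ℂ)⁻¹ * ∫ u : ℝ, Complex.exp (u * x * Complex.I) * F u := by
  have h2pi : (2 * Real.pi) ≠ 0 := by positivity
  have h1 : 𝓕 f = fun w => F (2 * Real.pi * w) := by
    ext w
    rw [Real.fourier_real_eq_integral_exp_smul, ← hF]
    refine integral_congr_ae (ae_of_all _ fun v => ?_)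
    simp only [smul_eq_mul]
    congr 2
    push_cast
    ring
  have hFi' : Integrable (𝓕 f) := by
    rw [h1]
    exact hFi.comp_mul_left' h2pi
  have h := congrFun (hc.fourierInv_fourier_eq hf hFi') x
  rw [Real.fourierInv_eq', h1] at h
  rw [← h]
  have h3 := Measure.integral_comp_mul_left
    (fun u : ℝ => Complex.exp (u * x * Complex.I) * F u) (2 * Real.pi)
  rw [abs_of_pos (by positivity)] at h3
  have h4 : (∫ v : ℝ, Complex.exp (↑(2 * Real.pi * inner ℝ v x) * Complex.I) •
      F (2 * Real.pi * v)) = ∫ v : ℝ, Complex.exp (↑(2 * Real.pi * v) * x * Complex.I) *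
      F (2 * Real.pi * v) := by
    refine integral_congr_ae (ae_of_all _ fun v => ?_)
    simp only [smul_eq_mul]
    congr 2
    simp only [RCLike.inner_apply, conj_trivial]
    push_cast
    ring
  rw [h4, h3, Complex.real_smul]
  push_cast
  rfl

/-- The Cauchy density with scale `lam`, i.e. the Poisson kernel of the half-plane. -/
def cauchyKernel (lam u : ℝ) : ℝ := Real.pi⁻¹ * (lam / (lam ^ 2 + u ^ 2))

lemma cauchyKernel_eq {lam : ℝ} (hl : 0 < lam) (u : ℝ) :
    cauchyKernel lam u = Real.pi⁻¹ * lam⁻¹ * (1 + (lam⁻¹ * u) ^ 2)⁻¹ := by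
  rw [cauchyKernel]
  have h1 : (lam ^ 2 + u ^ 2) ≠ 0 := by positivity
  have h2 : (1 + (lam⁻¹ * u) ^ 2) ≠ 0 := by positivity
  field_simp

lemma cauchyKernel_nonneg {lam : ℝ} (hl : 0 < lam) (u : ℝ) : 0 ≤ cauchyKernel lam u := by
  rw [cauchyKernel]; positivity

lemma continuous_cauchyKernel {lam : ℝ} (hl : 0 < lam) : Continuous (cauchyKernel lam) := by
  unfold cauchyKernel
  refine continuous_const.mul (continuous_const.div (by fun_prop) fun u => ?_)
  positivity

lemma integrable_cauchyKernel {lam : ℝ} (hl : 0 < lam) : Integrable (cauchyKernel lam) := by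
  have : cauchyKernel lam = fun u => Real.pi⁻¹ * lam⁻¹ * (1 + (lam⁻¹ * u) ^ 2)⁻¹ :=
    funext (cauchyKernel_eq hl)
  rw [this]
  exact (integrable_inv_one_add_sq.comp_mul_left' (inv_ne_zero hl.ne')).const_mul _

lemma integral_cauchyKernel {lam : ℝ} (hl : 0 < lam) : ∫ u, cauchyKernel lam u = 1 := by
  simp_rw [cauchyKernel_eq hl]
  rw [integral_const_mul, Measure.integral_comp_mul_left (fun u : ℝ => (1 + u ^ 2)⁻¹) lam⁻¹,
    integral_univ_inv_one_add_sq, inv_inv, abs_of_pos hl, smul_eq_mul]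
  field_simp

lemma integrable_exp_neg_mul_abs {lam : ℝ} (hl : 0 < lam) :
    Integrable fun x : ℝ => Real.exp (-lam * |x|) := by
  rw [← integrableOn_univ, ← Set.Iic_union_Ioi (a := (0 : ℝ))]
  refine IntegrableOn.union ?_ ?_
  · refine (integrableOn_exp_mul_Iic hl 0).congr_fun (fun x hx => ?_) measurableSet_Iic
    simp only [abs_of_nonpos (Set.mem_Iic.1 hx)]
    ring_nf
  · refine (integrableOn_exp_mul_Ioi (neg_lt_zero.2 hl) 0).congr_fun (fun x hx => ?_)
      measurableSet_Ioi
    simp only [abs_of_pos (Set.mem_Ioi.1 hx)]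

/-- The transform of e^{-λ|x|} is elementary on each half-line and equals 2π times the Cauchy
density; inversion does the rest. -/
lemma integral_cauchyKernel_mul_exp {lam : ℝ} (hl : 0 < lam) (x : ℝ) :
    ∫ u : ℝ, (cauchyKernel lam u : ℂ) * Complex.exp (u * x * Complex.I)
      = Real.exp (-lam * |x|) := by
  have hfc : Continuous fun x : ℝ => ((Real.exp (-lam * |x|) : ℝ) : ℂ) := by fun_prop
  have h := eq_integral_of_fourier (f := fun x => ((Real.exp (-lam * |x|) : ℝ) : ℂ))
    (F := fun u => ((2 * Real.pi * cauchyKernel lam u : ℝ) : ℂ)) hfc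
    (integrable_exp_neg_mul_abs hl).ofReal ?_
    ((integrable_cauchyKernel hl).const_mul (2 * Real.pi)).ofReal x
  · rw [h, ← integral_const_mul]
    refine integral_congr_ae (ae_of_all _ fun u => ?_)
    have : (Real.pi : ℂ) ≠ 0 := by exact_mod_cast Real.pi_ne_zero
    simp only
    push_cast
    field_simp
  · intro u
    have hint : Integrable fun x : ℝ =>
        Complex.exp (-(u * x) * Complex.I) * ((Real.exp (-lam * |x|) : ℝ) : ℂ) := by
      refine (integrable_exp_neg_mul_abs hl).mono (by fun_prop) (ae_of_all _ fun x => ?_)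
      rw [norm_mul, ← Complex.ofReal_mul, ← Complex.ofReal_neg, Complex.norm_exp_ofReal_mul_I,
        one_mul, Complex.norm_real]
    rw [← setIntegral_univ, ← Set.Iic_union_Ioi (a := (0 : ℝ)),
      setIntegral_union (Set.Iic_disjoint_Ioi le_rfl) measurableSet_Ioi hint.integrableOn
        hint.integrableOn]
    have e1 : ∫ x in Set.Iic (0 : ℝ), Complex.exp (-(u * x) * Complex.I) *
        ((Real.exp (-lam * |x|) : ℝ) : ℂ)
        = ∫ x in Set.Iic (0 : ℝ), Complex.exp (((lam : ℂ) - u * Complex.I) * x) := by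
      refine setIntegral_congr_fun measurableSet_Iic fun x hx => ?_
      simp only [abs_of_nonpos (Set.mem_Iic.1 hx)]
      push_cast
      rw [← Complex.exp_add]
      congr 1
      ring
    have e2 : ∫ x in Set.Ioi (0 : ℝ), Complex.exp (-(u * x) * Complex.I) *
        ((Real.exp (-lam * |x|) : ℝ) : ℂ)
        = ∫ x in Set.Ioi (0 : ℝ), Complex.exp ((-(lam : ℂ) - u * Complex.I) * x) := by
      refine setIntegral_congr_fun measurableSet_Ioi fun x hx => ?_
      simp only [abs_of_pos (Set.mem_Ioi.1 hx)]
      push_cast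
      rw [← Complex.exp_add]
      congr 1
      ring
    rw [e1, e2, integral_exp_mul_complex_Iic (by simpa using hl),
      integral_exp_mul_complex_Ioi (by simpa using hl)]
    have hsq : ((lam : ℂ) ^ 2 + (u : ℂ) ^ 2) ≠ 0 := by
      norm_cast; positivity
    have hprod : ((lam : ℂ) - u * Complex.I) * (-(lam : ℂ) - u * Complex.I)
        = -((lam : ℂ) ^ 2 + (u : ℂ) ^ 2) := by
      ring_nf; rw [Complex.I_sq]; ring
    have n1 : ((lam : ℂ) - u * Complex.I) ≠ 0 := by
      intro h0; rw [h0, zero_mul] at hprod; exact hsq (neg_eq_zero.1 hprod.symm)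
    have n2 : (-(lam : ℂ) - u * Complex.I) ≠ 0 := by
      intro h0; rw [h0, mul_zero] at hprod; exact hsq (neg_eq_zero.1 hprod.symm)
    have hpi : (Real.pi : ℂ) ≠ 0 := by exact_mod_cast Real.pi_ne_zero
    rw [cauchyKernel]
    push_cast
    simp only [mul_zero, Complex.exp_zero]
    rw [div_add_div _ _ n1 n2, hprod]
    field_simp
    ring

/-- The kernel `x⁺ e^{-ϑ x}` as a Fourier integral. -/
lemma posPart_mul_exp_eq_integral {θ : ℝ} (hθ : 0 < θ) (x : ℝ) :
    ((max x 0 * Real.exp (-θ * x) : ℝ) : ℂ) = (2 * Real.pi : ℂ)⁻¹ *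
      ∫ u : ℝ, Complex.exp (u * x * Complex.I) * (((θ : ℂ) + u * Complex.I) ^ 2)⁻¹ := by
  have hnorm : ∀ u : ℝ, ‖(((θ : ℂ) + u * Complex.I) ^ 2)⁻¹‖ = (θ ^ 2 + u ^ 2)⁻¹ := by
    intro u
    rw [norm_inv, norm_pow, ← Complex.normSq_eq_norm_sq, Complex.normSq_add_mul_I]
  have hne : ∀ u : ℝ, ((θ : ℂ) + u * Complex.I) ≠ 0 := by
    intro u h
    have := congrArg Complex.re h
    simp at this
    exact hθ.ne' this
  have hF : Integrable fun u : ℝ => (((θ : ℂ) + u * Complex.I) ^ 2)⁻¹ := by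
    refine Integrable.mono ((integrable_cauchyKernel hθ).const_mul (Real.pi / θ))
      (Continuous.aestronglyMeasurable ?_) (ae_of_all _ fun u => ?_)
    · exact Continuous.inv₀ (by fun_prop) fun u => pow_ne_zero _ (hne u)
    · rw [hnorm, cauchyKernel, Real.norm_of_nonneg (by positivity)]
      refine le_of_eq ?_
      field_simp
  have hgamma : IntegrableOn (fun x : ℝ => x * Real.exp (-θ * x)) (Set.Ioi 0) := by
    have := integrableOn_rpow_mul_exp_neg_mul_rpow (s := 1) (p := 1) (b := θ) (by norm_num)
      (by norm_num) hθ
    simpa using this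
  have hf : Integrable fun x : ℝ => max x 0 * Real.exp (-θ * x) := by
    rw [← integrableOn_univ, ← Set.Iic_union_Ioi (a := (0 : ℝ))]
    refine IntegrableOn.union ?_ ?_
    · refine integrableOn_zero.congr_fun (fun x hx => ?_) measurableSet_Iic
      simp [max_eq_right (Set.mem_Iic.1 hx)]
    · refine hgamma.congr_fun (fun x hx => ?_) measurableSet_Ioi
      simp only [max_eq_left (Set.mem_Ioi.1 hx).le]
  refine eq_integral_of_fourier (f := fun x => ((max x 0 * Real.exp (-θ * x) : ℝ) : ℂ))
    (F := fun u => (((θ : ℂ) + u * Complex.I) ^ 2)⁻¹) (by fun_prop) hf.ofReal (fun u => ?_) hF x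
  set s : ℂ := (θ : ℂ) + u * Complex.I with hs
  have hint : Integrable fun x : ℝ =>
      Complex.exp (-(u * x) * Complex.I) * ((max x 0 * Real.exp (-θ * x) : ℝ) : ℂ) := by
    refine hf.mono (by fun_prop) (ae_of_all _ fun x => ?_)
    rw [norm_mul, ← Complex.ofReal_mul, ← Complex.ofReal_neg, Complex.norm_exp_ofReal_mul_I,
      one_mul, Complex.norm_real]
  rw [← setIntegral_univ, ← Set.Iic_union_Ioi (a := (0 : ℝ)),
    setIntegral_union (Set.Iic_disjoint_Ioi le_rfl) measurableSet_Ioi hint.integrableOn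
      hint.integrableOn]
  have e1 : ∫ x in Set.Iic (0 : ℝ), Complex.exp (-(u * x) * Complex.I) *
      ((max x 0 * Real.exp (-θ * x) : ℝ) : ℂ) = 0 := by
    refine setIntegral_eq_zero_of_forall_eq_zero fun x hx => ?_
    simp [max_eq_right (Set.mem_Iic.1 hx)]
  have e2 : ∫ x in Set.Ioi (0 : ℝ), Complex.exp (-(u * x) * Complex.I) *
      ((max x 0 * Real.exp (-θ * x) : ℝ) : ℂ)
      = ∫ x in Set.Ioi (0 : ℝ), (x : ℂ) * Complex.exp (-s * x) := by
    refine setIntegral_congr_fun measurableSet_Ioi fun x hx => ?_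
    simp only [max_eq_left (Set.mem_Ioi.1 hx).le]
    push_cast
    rw [mul_left_comm, ← Complex.exp_add]
    congr 2
    rw [hs]; ring
  rw [e1, e2, zero_add]
  -- An explicit antiderivative of x e^{-sx}; its value at 0 is -1/s² and it vanishes at infinity.
  have hderiv : ∀ x ∈ Set.Ici (0 : ℝ), HasDerivAt
      (fun x : ℝ => -((x : ℂ) / s + (s ^ 2)⁻¹) * Complex.exp (-s * x))
      ((x : ℂ) * Complex.exp (-s * x)) x := by
    intro x _
    have h1 : HasDerivAt (fun x : ℝ => (x : ℂ)) 1 x := Complex.ofRealCLM.hasDerivAt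
    have h2 : HasDerivAt (fun x : ℝ => -((x : ℂ) / s + (s ^ 2)⁻¹) * Complex.exp (-s * x))
        (-(1 / s) * Complex.exp (-s * x) + -((x : ℂ) / s + (s ^ 2)⁻¹) *
          (Complex.exp (-s * x) * (-s * 1))) x :=
      ((h1.div_const s).add_const (s ^ 2)⁻¹).neg.mul (h1.const_mul (-s)).cexp
    refine h2.congr_deriv ?_
    have := hne u
    rw [← hs] at this
    field_simp
    ring
  have hexp : ∀ x : ℝ, ‖Complex.exp (-s * x)‖ = Real.exp (-θ * x) := by
    intro x
    rw [Complex.norm_exp]; simp [hs]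
  have hlim : Tendsto (fun x : ℝ => -((x : ℂ) / s + (s ^ 2)⁻¹) * Complex.exp (-s * x)) atTop
      (𝓝 0) := by
    have t1 : Tendsto (fun x : ℝ => x * Real.exp (-θ * x)) atTop (𝓝 0) := by
      have := Real.tendsto_pow_mul_exp_neg_atTop_nhds_zero 1
      have h2 := (this.comp (tendsto_id.const_mul_atTop hθ)).const_mul (θ⁻¹)
      simp only [mul_zero] at h2
      refine h2.congr fun x => ?_
      simp only [Function.comp, id, pow_one]
      field_simp
    have t2 : Tendsto (fun x : ℝ => Real.exp (-θ * x)) atTop (𝓝 0) := by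
      refine Real.tendsto_exp_atBot.comp ?_
      exact tendsto_id.const_mul_atTop_of_neg (neg_lt_zero.2 hθ)
    rw [tendsto_zero_iff_norm_tendsto_zero]
    have t3 := (t1.const_mul ‖s‖⁻¹).add (t2.const_mul ‖(s ^ 2)⁻¹‖)
    simp only [mul_zero, add_zero] at t3
    refine squeeze_zero' (Eventually.of_forall fun x => norm_nonneg _) ?_ t3
    filter_upwards [eventually_ge_atTop 0] with x hx
    rw [norm_mul, hexp, norm_neg, ← mul_assoc, ← add_mul]
    gcongr
    refine (norm_add_le _ _).trans (le_of_eq ?_)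
    rw [norm_div, Complex.norm_real, Real.norm_of_nonneg hx]
    ring
  have hI : IntegrableOn (fun x : ℝ => (x : ℂ) * Complex.exp (-s * x)) (Set.Ioi 0) := by
    refine Integrable.mono hgamma (by fun_prop) ?_
    refine (ae_restrict_mem measurableSet_Ioi).mono fun x hx => ?_
    rw [norm_mul, norm_mul, hexp]
    simp
  rw [integral_Ioi_of_hasDerivAt_of_tendsto' hderiv hI hlim]
  simp [hs]

/-- Poisson's formula for the characteristic function of a measure on the half-line. -/
lemma integral_cauchyKernel_mul_charFun {lam : ℝ} (hl : 0 < lam) (ρ : Measure ℝ)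
    [IsFiniteMeasure ρ] (hρ : ρ (Set.Iio 0) = 0) :
    ∫ u : ℝ, (cauchyKernel lam u : ℂ) * charFun ρ u = ((∫ x, Real.exp (-lam * x) ∂ρ : ℝ) : ℂ) := by
  simp_rw [charFun_apply_real, ← integral_const_mul]
  rw [integral_integral_swap]
  · simp_rw [integral_cauchyKernel_mul_exp hl]
    rw [← integral_complex_ofReal]
    refine integral_congr_ae ?_
    have : ∀ᵐ x ∂ρ, x ∉ Set.Iio (0 : ℝ) := measure_eq_zero_iff_ae_notMem.1 hρ
    filter_upwards [this] with x hx
    have hx0 : 0 ≤ x := by simpa using hx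
    show ((Real.exp (-lam * |x|) : ℝ) : ℂ) = _
    rw [abs_of_nonneg hx0]
  · have h := (integrable_cauchyKernel hl).mul_prod (integrable_const (μ := ρ) (1 : ℝ))
    refine h.mono ?_ (ae_of_all _ fun p => ?_)
    · have := (continuous_cauchyKernel hl).measurable
      exact Measurable.aestronglyMeasurable (by fun_prop)
    · simp only [Function.uncurry, norm_mul]
      rw [← Complex.ofReal_mul, Complex.norm_exp_ofReal_mul_I]
      simp

/-- With survival set `Set.univ` nothing is killed, so the killed walk is the n-fold convolution
power. -/
lemma charFun_killedWalk_univ (ρ : Measure ℝ) [IsFiniteMeasure ρ] (n : ℕ) (u : ℝ) :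
    charFun (killedWalk ρ Set.univ n) u = charFun ρ u ^ n := by
  induction n with
  | zero => simp [killedWalk, charFun_dirac]
  | succ n ih => simp only [killedWalk]; rw [Measure.restrict_univ, charFun_conv, ih, pow_succ]

lemma killedWalk_univ_Iio (ρ : Measure ℝ) [IsFiniteMeasure ρ] (hρ : ρ (Set.Iio 0) = 0) (n : ℕ) :
    killedWalk ρ Set.univ n (Set.Iio 0) = 0 := by
  induction n with
  | zero => simp [killedWalk]
  | succ n ih =>
    simp only [killedWalk]
    rw [Measure.restrict_univ, Measure.conv, Measure.map_apply measurable_add measurableSet_Iio]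
    refine measure_mono_null (t := (Set.Iio 0 ×ˢ Set.univ) ∪ (Set.univ ×ˢ Set.Iio 0)) ?_ ?_
    · rintro ⟨x, y⟩ hxy
      by_contra hcon
      simp only [Set.mem_union, Set.mem_prod, Set.mem_Iio, Set.mem_univ, and_true,
        true_and, not_or, not_lt] at hcon
      have : x + y < 0 := hxy
      linarith
    · rw [measure_union_null_iff, Measure.prod_prod, Measure.prod_prod, hρ, ih]
      simp

lemma integrable_exp_neg_of_Iio {lam : ℝ} (hl : 0 ≤ lam) (ρ : Measure ℝ) [IsFiniteMeasure ρ]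
    (hρ : ρ (Set.Iio 0) = 0) : Integrable (fun x => Real.exp (-lam * x)) ρ := by
  refine (integrable_const (1 : ℝ)).mono (by fun_prop) ?_
  have : ∀ᵐ x ∂ρ, x ∉ Set.Iio (0 : ℝ) := measure_eq_zero_iff_ae_notMem.1 hρ
  filter_upwards [this] with x hx
  rw [Real.norm_of_nonneg (Real.exp_pos _).le, norm_one, Real.exp_le_one_iff]
  have : 0 ≤ x := by simpa using hx
  nlinarith

lemma integral_exp_killedWalk_univ {lam : ℝ} (hl : 0 ≤ lam) (ρ : Measure ℝ) [IsFiniteMeasure ρ]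
    (hρ : ρ (Set.Iio 0) = 0) (n : ℕ) :
    ∫ x, Real.exp (-lam * x) ∂(killedWalk ρ Set.univ n) = (∫ x, Real.exp (-lam * x) ∂ρ) ^ n := by
  induction n with
  | zero => simp [killedWalk]
  | succ n ih =>
    have hint := integrable_exp_neg_of_Iio hl _ (killedWalk_univ_Iio ρ hρ (n + 1))
    simp only [killedWalk] at hint ⊢
    rw [Measure.restrict_univ] at hint ⊢
    rw [integral_conv hint, pow_succ, ← ih]
    simp_rw [mul_add, Real.exp_add, integral_const_mul, integral_mul_const]

lemma norm_charFun_le_real (ρ : Measure ℝ) [IsFiniteMeasure ρ] (u : ℝ) :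
    ‖charFun ρ u‖ ≤ ρ.real Set.univ := norm_charFun_le u

/-- The logarithm of `1 - ρ̂` is the Poisson extension of its boundary values. -/
lemma integral_cauchyKernel_mul_log {lam : ℝ} (hl : 0 < lam) (ρ : Measure ℝ)
    [IsFiniteMeasure ρ] (hρ : ρ (Set.Iio 0) = 0) (h1 : ρ Set.univ < 1) :
    ∫ u : ℝ, cauchyKernel lam u * Real.log (‖1 - charFun ρ u‖ ^ 2)
      = 2 * Real.log (1 - ∫ x, Real.exp (-lam * x) ∂ρ) := by
  set q := ρ.real Set.univ with hq
  have hq1 : q < 1 := by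
    rw [hq, Measure.real, ← ENNReal.toReal_one]
    exact (ENNReal.toReal_lt_toReal (measure_ne_top _ _) ENNReal.one_ne_top).2 h1
  have hq0 : 0 ≤ q := measureReal_nonneg
  set m := ∫ x, Real.exp (-lam * x) ∂ρ with hm
  have hae : ∀ᵐ x ∂ρ, x ∉ Set.Iio (0 : ℝ) := measure_eq_zero_iff_ae_notMem.1 hρ
  have hm0 : 0 ≤ m := integral_nonneg fun x => (Real.exp_pos _).le
  have hmq : m ≤ q := by
    rw [hm, hq, ← mul_one (ρ.real Set.univ), ← smul_eq_mul, ← integral_const]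
    refine integral_mono_ae (integrable_exp_neg_of_Iio hl.le ρ hρ) (integrable_const _) ?_
    filter_upwards [hae] with x hx
    rw [Real.exp_le_one_iff]
    have : 0 ≤ x := by simpa using hx
    nlinarith
  have hchar : ∀ u, ‖charFun ρ u‖ < 1 := fun u => (norm_charFun_le_real ρ u).trans_lt hq1
  have hcm : Measurable fun u => charFun ρ u := by
    have := continuous_charFun (μ := ρ)
    exact this.measurable
  -- The terms of the Taylor series of -log(1 - ρ̂). Each power ρ̂^k is the transform of a
  -- convolution power on the half-line, to which Poisson's formula applies; total mass below 1
  -- gives geometric convergence.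
  set F : ℕ → ℝ → ℂ := fun k u => (cauchyKernel lam u : ℂ) * (charFun ρ u ^ k / k)
  have hpm := (continuous_cauchyKernel hl).measurable
  have hFbound : ∀ k u, ‖F k u‖ ≤ cauchyKernel lam u * q ^ k := by
    intro k u
    simp only [F, norm_mul, Complex.norm_real, norm_div, norm_pow,
      Real.norm_of_nonneg (cauchyKernel_nonneg hl u), Complex.norm_natCast]
    refine mul_le_mul_of_nonneg_left ?_ (cauchyKernel_nonneg hl u)
    rcases Nat.eq_zero_or_pos k with rfl | hk
    · simp
    · refine (div_le_self (by positivity) (by exact_mod_cast hk)).trans ?_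
      exact pow_le_pow_left₀ (norm_nonneg _) (norm_charFun_le_real ρ u) k
  have hFint : ∀ k, Integrable (F k) := by
    intro k
    refine ((integrable_cauchyKernel hl).mul_const (q ^ k)).mono
      (Measurable.aestronglyMeasurable (by fun_prop)) (ae_of_all _ fun u => ?_)
    exact (hFbound k u).trans (le_abs_self _)
  have hsum : Summable fun k => ∫ u, ‖F k u‖ := by
    refine Summable.of_nonneg_of_le (fun k => integral_nonneg fun u => norm_nonneg _)
      (fun k => ?_) (summable_geometric_of_lt_one hq0 hq1)
    calc ∫ u, ‖F k u‖ ≤ ∫ u, cauchyKernel lam u * q ^ k :=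
          integral_mono (hFint k).norm ((integrable_cauchyKernel hl).mul_const _) (hFbound k)
      _ = q ^ k := by rw [integral_mul_const, integral_cauchyKernel hl, one_mul]
  have h := hasSum_integral_of_summable_integral_norm hFint hsum
  have hval : ∀ k, ∫ u, F k u = ((m : ℂ)) ^ k / k := by
    intro k
    have := integral_cauchyKernel_mul_charFun hl (killedWalk ρ Set.univ k)
      (killedWalk_univ_Iio ρ hρ k)
    simp_rw [charFun_killedWalk_univ, integral_exp_killedWalk_univ hl.le ρ hρ] at this
    simp only [F, ← mul_div_assoc]
    rw [integral_div, this]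
    push_cast
    rfl
  have hpt : ∀ u, ∑' k, F k u = -((cauchyKernel lam u : ℂ) * Complex.log (1 - charFun ρ u)) := by
    intro u
    have := (Complex.hasSum_taylorSeries_neg_log (hchar u)).mul_left (cauchyKernel lam u : ℂ)
    rw [this.tsum_eq]
    ring
  simp_rw [hpt, hval] at h
  have hmlt : m < 1 := hmq.trans_lt hq1
  have h' := Complex.hasSum_taylorSeries_neg_log (z := (m : ℂ))
    (by rw [Complex.norm_real, Real.norm_of_nonneg hm0]; exact hmlt)
  have key := h.unique h'
  rw [integral_neg, neg_inj] at key
  -- Passing to real parts turns the complex logarithm into the logarithm of a modulus.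
  have key := congrArg Complex.re key
  have hlogint : Integrable fun u => (cauchyKernel lam u : ℂ) * Complex.log (1 - charFun ρ u) := by
    by_contra hcon
    rw [integral_undef hcon] at key
    have hb : ∀ u, ‖Complex.log (1 - charFun ρ u)‖ ≤ (1 - q)⁻¹ := by
      intro u
      have e1 := Complex.hasSum_taylorSeries_neg_log (hchar u)
      rw [← norm_neg]
      rw [← e1.tsum_eq, ← tsum_geometric_of_lt_one hq0 hq1]
      refine tsum_of_norm_bounded (summable_geometric_of_lt_one hq0 hq1).hasSum fun k => ?_
      rw [norm_div, norm_pow, Complex.norm_natCast]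
      rcases Nat.eq_zero_or_pos k with rfl | hk
      · simp
      · refine (div_le_self (by positivity) (by exact_mod_cast hk)).trans ?_
        exact pow_le_pow_left₀ (norm_nonneg _) (norm_charFun_le_real ρ u) k
    apply hcon
    refine ((integrable_cauchyKernel hl).mul_const ((1 - q)⁻¹)).mono
      (Measurable.aestronglyMeasurable (by fun_prop)) (ae_of_all _ fun u => ?_)
    rw [norm_mul, norm_mul, Complex.norm_real]
    gcongr
    exact (hb u).trans (le_abs_self _)
  have hre := integral_re hlogint
  simp only [RCLike.re_to_complex] at hre
  rw [← hre] at key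
  simp only [Complex.re_ofReal_mul, Complex.log_re] at key
  simp_rw [Real.log_pow]
  have e : ∀ u, cauchyKernel lam u * (((2 : ℕ) : ℝ) * Real.log ‖1 - charFun ρ u‖)
      = 2 * (cauchyKernel lam u * Real.log ‖1 - charFun ρ u‖) := by
    intro u; push_cast; ring
  simp_rw [e]
  rw [integral_const_mul, key]
  congr 2
  rw [← Complex.ofReal_one, ← Complex.ofReal_sub, Complex.norm_real,
    Real.norm_of_nonneg (by linarith)]

end Fourier

/-! ### Spitzer's formula for defective symmetric walks. -/

section SpitzerFormula

open scoped ENNReal ComplexConjugate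

lemma integrable_cauchyKernel_mul_of_bounded {lam : ℝ} (hl : 0 < lam) {g : ℝ → ℝ}
    (hg : Measurable g) {C : ℝ} (hC : ∀ u, |g u| ≤ C) :
    Integrable fun u => cauchyKernel lam u * g u := by
  refine ((integrable_cauchyKernel hl).mul_const C).mono
    (((continuous_cauchyKernel hl).measurable.mul hg).aestronglyMeasurable)
    (ae_of_all _ fun u => ?_)
  rw [norm_mul, norm_mul]
  gcongr
  exact (hC u).trans (le_abs_self C)

lemma integrable_cauchyKernel_mul_log {lam : ℝ} (hl : 0 < lam) (ρ : Measure ℝ)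
    [IsFiniteMeasure ρ] (h1 : ρ Set.univ < 1) :
    Integrable fun u => cauchyKernel lam u * Real.log (‖1 - charFun ρ u‖ ^ 2) := by
  set q := ρ.real Set.univ with hq
  have hq1 : q < 1 := by
    rw [hq, Measure.real, ← ENNReal.toReal_one]
    exact (ENNReal.toReal_lt_toReal (measure_ne_top _ _) ENNReal.one_ne_top).2 h1
  have hq0 : 0 ≤ q := measureReal_nonneg
  have hcm : Measurable fun u => charFun ρ u := (continuous_charFun (μ := ρ)).measurable
  refine integrable_cauchyKernel_mul_of_bounded hl (by fun_prop)
    (C := |Real.log ((1 - q) ^ 2)| + |Real.log (2 ^ 2)|) fun u => ?_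
  have hn := norm_charFun_le_real ρ u
  have l1 : 1 - q ≤ ‖1 - charFun ρ u‖ := by
    have := norm_sub_norm_le 1 (charFun ρ u)
    rw [norm_one] at this
    linarith
  have l2 : ‖1 - charFun ρ u‖ ≤ 2 := by
    have := norm_sub_le 1 (charFun ρ u)
    rw [norm_one] at this
    linarith
  have hp : 0 < 1 - q := by linarith
  have a1 : Real.log ((1 - q) ^ 2) ≤ Real.log (‖1 - charFun ρ u‖ ^ 2) :=
    Real.log_le_log (by positivity) (by gcongr)
  have a2 : Real.log (‖1 - charFun ρ u‖ ^ 2) ≤ Real.log (2 ^ 2) :=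
    Real.log_le_log (by have := hp.trans_le l1; positivity) (by gcongr)
  rw [abs_le]
  constructor
  · linarith [neg_abs_le (Real.log ((1 - q) ^ 2)), abs_nonneg (Real.log ((2 : ℝ) ^ 2))]
  · linarith [le_abs_self (Real.log ((2 : ℝ) ^ 2)), abs_nonneg (Real.log ((1 - q) ^ 2))]

/-- The Wiener–Hopf factorization, read as a squared modulus. -/
lemma one_sub_charFun_re {ν : Measure ℝ} [IsFiniteMeasure ν] [NullSingletonClass ν]
    (hν : ν Set.univ < 1) (hsymm : ν.map (fun x => -x) = ν) (u : ℝ) :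
    (1 - charFun ν u).re = ‖1 - charFun (exitTotal ν (Set.Iic 0)) u‖ ^ 2 := by
  rw [one_sub_charFun_eq_mul_conj hν hsymm, Complex.mul_conj, Complex.normSq_eq_norm_sq,
    Complex.ofReal_re]

lemma exitTotal_Iio {ν : Measure ℝ} [IsFiniteMeasure ν] :
    exitTotal ν (Set.Iic 0) (Set.Iio 0) = 0 := by
  rw [exitTotal, Measure.sum_apply _ measurableSet_Iio, ENNReal.tsum_eq_zero]
  intro n
  rw [exitLaw, Measure.restrict_apply measurableSet_Iio]
  have : Set.Iio (0 : ℝ) ∩ (Set.Iic 0)ᶜ = ∅ := by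
    ext x; simp only [Set.mem_inter_iff, Set.mem_Iio, Set.mem_compl_iff, Set.mem_Iic, not_le,
      Set.mem_empty_iff_false, iff_false, not_and, not_lt]; exact fun h => h.le
  rw [this, measure_empty]

/-- The exponential law with scale `1` and total mass `a`. -/
def expLaw (a : ℝ) : Measure ℝ :=
  (volume.restrict (Set.Ioi 0)).withDensity fun x => ENNReal.ofReal (a * Real.exp (-x))

lemma integral_expLaw {E : Type*} [NormedAddCommGroup E] [NormedSpace ℝ E] {a : ℝ} (ha : 0 ≤ a)
    (f : ℝ → E) : ∫ x, f x ∂(expLaw a) = ∫ x in Set.Ioi 0, (a * Real.exp (-x)) • f x := by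
  rw [expLaw, integral_withDensity_eq_integral_toReal_smul (by fun_prop)
    (ae_of_all _ fun x => ENNReal.ofReal_lt_top)]
  refine integral_congr_ae (ae_of_all _ fun x => ?_)
  simp only
  rw [ENNReal.toReal_ofReal (by positivity)]

lemma expLaw_univ {a : ℝ} (ha : 0 ≤ a) : expLaw a Set.univ = ENNReal.ofReal a := by
  rw [expLaw, withDensity_apply _ MeasurableSet.univ, Measure.restrict_univ,
    ← ofReal_integral_eq_lintegral_ofReal ((integrableOn_exp_neg_Ioi 0).const_mul a)
      (ae_of_all _ fun x => by positivity), integral_const_mul]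
  congr 1
  rw [integral_exp_neg_Ioi]
  simp

/-- The ratio is |1 - ρ̂|² for ρ the exponential law of mass 1 - ε, so the integral is an instance
of the Poisson formula for logarithms. It is the reference that absorbs the singularity at u = 0
when the mass defect of the walk tends to 0. -/
lemma integral_cauchyKernel_mul_log_ratio {lam ε : ℝ} (hl : 0 < lam) (hε : 0 < ε) (hε1 : ε ≤ 1) :
    Integrable (fun u => cauchyKernel lam u * Real.log ((ε ^ 2 + u ^ 2) / (1 + u ^ 2))) ∧
    ∫ u : ℝ, cauchyKernel lam u * Real.log ((ε ^ 2 + u ^ 2) / (1 + u ^ 2))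
      = 2 * Real.log ((lam + ε) / (1 + lam)) := by
  have ha : 0 ≤ 1 - ε := by linarith
  have hmass : expLaw (1 - ε) Set.univ < 1 := by
    rw [expLaw_univ ha, ← ENNReal.ofReal_one]
    exact (ENNReal.ofReal_lt_ofReal_iff one_pos).2 (by linarith)
  have : IsFiniteMeasure (expLaw (1 - ε)) := ⟨hmass.trans ENNReal.one_lt_top⟩
  have hneg : expLaw (1 - ε) (Set.Iio 0) = 0 := by
    rw [expLaw]
    refine (withDensity_absolutelyContinuous _ _) ?_
    rw [Measure.restrict_apply measurableSet_Iio]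
    have : Set.Iio (0 : ℝ) ∩ Set.Ioi 0 = ∅ := by
      ext x; simp only [Set.mem_inter_iff, Set.mem_Iio, Set.mem_Ioi,
        Set.mem_empty_iff_false, iff_false, not_and, not_lt]; exact fun h => h.le
    rw [this, measure_empty]
  have hlap : ∫ x, Real.exp (-lam * x) ∂(expLaw (1 - ε)) = (1 - ε) / (1 + lam) := by
    rw [integral_expLaw ha]
    have : ∀ x : ℝ, ((1 - ε) * Real.exp (-x)) • Real.exp (-lam * x)
        = (1 - ε) * Real.exp (-(1 + lam) * x) := by
      intro x
      rw [smul_eq_mul, mul_assoc, ← Real.exp_add]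
      ring_nf
    simp_rw [this]
    rw [integral_const_mul, integral_exp_mul_Ioi (by linarith)]
    simp only [mul_zero, Real.exp_zero]
    field_simp
  have hchar : ∀ u : ℝ, ‖1 - charFun (expLaw (1 - ε)) u‖ ^ 2 = (ε ^ 2 + u ^ 2) / (1 + u ^ 2) := by
    intro u
    have e : charFun (expLaw (1 - ε)) u = (1 - ε : ℝ) / (1 - u * Complex.I) := by
      rw [charFun_apply_real, integral_expLaw ha]
      have : ∀ x : ℝ, ((1 - ε) * Real.exp (-x)) • Complex.exp (u * x * Complex.I)
          = ((1 - ε : ℝ) : ℂ) * Complex.exp ((-1 + u * Complex.I) * x) := by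
        intro x
        rw [Complex.real_smul, Complex.ofReal_mul, mul_assoc, Complex.ofReal_exp, ← Complex.exp_add]
        congr 2
        push_cast
        ring
      simp_rw [this]
      rw [integral_const_mul, integral_exp_mul_complex_Ioi (by simp)]
      simp only [Complex.ofReal_zero, mul_zero, Complex.exp_zero]
      rw [show (-1 + u * Complex.I : ℂ) = -(1 - u * Complex.I) by ring, neg_div_neg_eq]
      ring
    have hne : (1 - u * Complex.I) ≠ 0 := by
      intro h; have := congrArg Complex.re h; simp at this
    rw [e, one_sub_div hne, norm_div, div_pow, ← Complex.normSq_eq_norm_sq,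
      ← Complex.normSq_eq_norm_sq]
    congr 1 <;> simp [Complex.normSq_apply] <;> ring
  have h := integral_cauchyKernel_mul_log hl (expLaw (1 - ε)) hneg hmass
  have h' := integrable_cauchyKernel_mul_log hl (expLaw (1 - ε)) hmass
  simp_rw [hchar] at h h'
  refine ⟨h', ?_⟩
  rw [h, hlap]
  congr 2
  field_simp
  ring

/-- Spitzer's formula for the Laplace transform of the first ladder height of a symmetric killed
walk. -/
lemma two_mul_log_one_sub_laplace_exitTotal {ν : Measure ℝ} [IsFiniteMeasure ν]
    [NullSingletonClass ν]
    (hν : ν Set.univ < 1) (hsymm : ν.map (fun x => -x) = ν) {lam ε : ℝ} (hl : 0 < lam)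
    (hε : 0 < ε) (hε1 : ε ≤ 1) :
    2 * Real.log (1 - ∫ x, Real.exp (-lam * x) ∂(exitTotal ν (Set.Iic 0))) =
      (∫ u : ℝ, cauchyKernel lam u *
        Real.log ((1 - charFun ν u).re * ((1 + u ^ 2) / (ε ^ 2 + u ^ 2)))) +
      2 * Real.log ((lam + ε) / (1 + lam)) := by
  have hs : MeasurableSet (Set.Iic (0 : ℝ)) := measurableSet_Iic
  have := isFiniteMeasure_exitTotal hν hs
  have hmass := (exitTotal_univ_le hν hs).trans_lt hν
  -- Poisson's formula is applied to the exit law and to the reference law; the two logarithms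
  -- recombine pointwise through the factorization.
  rw [← integral_cauchyKernel_mul_log hl _ exitTotal_Iio hmass,
    ← (integral_cauchyKernel_mul_log_ratio hl hε hε1).2, ← integral_add]
  · refine integral_congr_ae (ae_of_all _ fun u => ?_)
    simp only
    rw [← mul_add, one_sub_charFun_re hν hsymm]
    congr 1
    have hpos : 0 < ‖1 - charFun (exitTotal ν (Set.Iic 0)) u‖ ^ 2 := by
      have hn := norm_charFun_le_real (exitTotal ν (Set.Iic 0)) u
      have hlt : (exitTotal ν (Set.Iic 0)).real Set.univ < 1 := by
        rw [Measure.real, ← ENNReal.toReal_one]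
        exact (ENNReal.toReal_lt_toReal (measure_ne_top _ _) ENNReal.one_ne_top).2 hmass
      have := norm_sub_norm_le 1 (charFun (exitTotal ν (Set.Iic 0)) u)
      rw [norm_one] at this
      have : 0 < ‖1 - charFun (exitTotal ν (Set.Iic 0)) u‖ := by linarith
      positivity
    have h1 : (0 : ℝ) < 1 + u ^ 2 := by positivity
    have h2 : (0 : ℝ) < ε ^ 2 + u ^ 2 := by positivity
    rw [Real.log_mul hpos.ne' (by positivity), Real.log_div h1.ne' h2.ne',
      Real.log_div h2.ne' h1.ne']
    ring
  · have h1 := integrable_cauchyKernel_mul_log hl _ hmass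
    have h2 := (integral_cauchyKernel_mul_log_ratio hl hε hε1).1
    refine (h1.sub h2).congr (ae_of_all _ fun u => ?_)
    simp only [Pi.sub_apply]
    rw [← mul_sub, one_sub_charFun_re hν hsymm]
    congr 1
    have hpos : 0 < ‖1 - charFun (exitTotal ν (Set.Iic 0)) u‖ ^ 2 := by
      have hn := norm_charFun_le_real (exitTotal ν (Set.Iic 0)) u
      have hlt : (exitTotal ν (Set.Iic 0)).real Set.univ < 1 := by
        rw [Measure.real, ← ENNReal.toReal_one]
        exact (ENNReal.toReal_lt_toReal (measure_ne_top _ _) ENNReal.one_ne_top).2 hmass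
      have := norm_sub_norm_le 1 (charFun (exitTotal ν (Set.Iic 0)) u)
      rw [norm_one] at this
      have : 0 < ‖1 - charFun (exitTotal ν (Set.Iic 0)) u‖ := by linarith
      positivity
    have h1 : (0 : ℝ) < 1 + u ^ 2 := by positivity
    have h2 : (0 : ℝ) < ε ^ 2 + u ^ 2 := by positivity
    rw [Real.log_mul hpos.ne' (by positivity), Real.log_div h1.ne' h2.ne',
      Real.log_div h2.ne' h1.ne']
    ring
  · exact (integral_cauchyKernel_mul_log_ratio hl hε hε1).1

end SpitzerFormula

/-! ### Non-lattice lower bounds, uniform over bounded tilts. -/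

section SpreadOut

open scoped ENNReal FourierTransform

/-- Riemann–Lebesgue lemma for absolutely continuous finite measures. -/
lemma tendsto_charFun_cocompact {ζ : Measure ℝ} [IsFiniteMeasure ζ] (hζ : ζ ≪ volume) :
    Tendsto (charFun ζ) (cocompact ℝ) (𝓝 0) := by
  have h := Real.tendsto_integral_exp_smul_cocompact
    (fun x => (((ζ.rnDeriv volume x).toReal : ℝ) : ℂ))
  -- Matches the sign and the 2π of the Fourier character with those of `charFun`.
  have hmul : Tendsto (fun t : ℝ => -(2 * Real.pi)⁻¹ * t) (cocompact ℝ) (cocompact ℝ) := by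
    have hne : -(2 * Real.pi)⁻¹ ≠ 0 := by simp [Real.pi_ne_zero]
    exact (Homeomorph.mulLeft₀ _ hne).isClosedEmbedding.tendsto_cocompact
  refine (h.comp hmul).congr fun t => ?_
  simp only [Function.comp]
  rw [charFun_apply_real]
  conv_rhs => rw [← Measure.withDensity_rnDeriv_eq ζ volume hζ]
  rw [integral_withDensity_eq_integral_toReal_smul (Measure.measurable_rnDeriv _ _)
    (Measure.rnDeriv_lt_top _ _)]
  refine integral_congr_ae (ae_of_all _ fun x => ?_)
  simp only [Circle.smul_def, Real.fourierChar_apply, smul_eq_mul, Complex.real_smul]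
  rw [mul_comm]
  congr 2
  push_cast
  have : (Real.pi : ℂ) ≠ 0 := by exact_mod_cast Real.pi_ne_zero
  field_simp

/-- Write |ζ̂(t)|² = ζ̂(-t) ζ̂(t) as a double integral and take the real part. -/
lemma integral_one_sub_cos_prod (ζ : Measure ℝ) [IsFiniteMeasure ζ] (t : ℝ) :
    ∫ p : ℝ × ℝ, (1 - Real.cos (t * (p.2 - p.1))) ∂(ζ.prod ζ)
      = ζ.real Set.univ ^ 2 - ‖charFun ζ t‖ ^ 2 := by
  have hcos : Integrable (fun p : ℝ × ℝ => Real.cos (t * (p.2 - p.1))) (ζ.prod ζ) :=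
    (integrable_const (1 : ℝ)).mono (by fun_prop) (ae_of_all _ fun p => by
      simpa using Real.abs_cos_le_one _)
  rw [integral_sub (integrable_const _) hcos]
  congr 1
  · simp [Measure.real, ← Set.univ_prod_univ, Measure.prod_prod, sq]
  · rw [← Complex.normSq_eq_norm_sq, ← Complex.ofReal_re (Complex.normSq _), ← Complex.mul_conj,
      ← charFun_neg, charFun_apply_real, charFun_apply_real, mul_comm, ← integral_prod_mul]
    have : ∀ p : ℝ × ℝ, Complex.exp (((-t : ℝ) : ℂ) * p.1 * Complex.I) *
        Complex.exp ((t : ℂ) * p.2 * Complex.I)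
        = Complex.exp (((t * (p.2 - p.1) : ℝ) : ℂ) * Complex.I) := by
      intro p; rw [← Complex.exp_add]; congr 1; push_cast; ring
    simp_rw [this]
    rw [← RCLike.re_to_complex, ← integral_re]
    · refine integral_congr_ae (ae_of_all _ fun p => ?_)
      simp only [RCLike.re_to_complex, Complex.exp_ofReal_mul_I_re]
    · exact (integrable_const (1 : ℝ)).mono (by fun_prop) (ae_of_all _ fun p => by
        rw [Complex.norm_exp_ofReal_mul_I]; simp)

lemma two_div_pi_sq_mul_sq_le_one_sub_cos {x : ℝ} (hx : |x| ≤ Real.pi) :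
    2 / Real.pi ^ 2 * x ^ 2 ≤ 1 - Real.cos x := by
  linarith [Real.cos_le_one_sub_mul_cos_sq hx]

/-- The law of a difference of two independent variables with a common absolutely continuous law
is uniformly far from lattice laws. -/
lemma exists_le_integral_one_sub_cos (μ : Measure ℝ) [IsProbabilityMeasure μ] (hμ : μ ≪ volume) :
    ∃ R > 0, ∃ c > 0, ∀ t : ℝ, c * min 1 (t ^ 2) ≤
      ∫ p in Set.Icc (-R) R ×ˢ Set.Icc (-R) R, (1 - Real.cos (t * (p.2 - p.1))) ∂(μ.prod μ) := by
  -- Truncating to a box of positive mass makes all moments finite and later bounds the exponential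
  -- weight from below.
  obtain ⟨n, hn⟩ : ∃ n : ℕ, 0 < μ (Set.Icc (-((n : ℝ) + 1)) ((n : ℝ) + 1)) := by
    by_contra! h
    have h0 : μ (⋃ n : ℕ, Set.Icc (-((n : ℝ) + 1)) ((n : ℝ) + 1)) = 0 :=
      measure_iUnion_null fun n => le_antisymm (h n) (zero_le)
    have hU : (⋃ n : ℕ, Set.Icc (-((n : ℝ) + 1)) ((n : ℝ) + 1)) = Set.univ := by
      ext x
      simp only [Set.mem_iUnion, Set.mem_univ, iff_true, Set.mem_Icc, ← abs_le]
      obtain ⟨n, hn⟩ := exists_nat_ge |x|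
      exact ⟨n, by linarith⟩
    rw [hU, measure_univ] at h0
    exact one_ne_zero h0
  set R : ℝ := (n : ℝ) + 1 with hR
  have hRpos : 0 < R := by positivity
  set A := Set.Icc (-R) R
  set ζ := μ.restrict A with hζ
  have hζac : ζ ≪ volume := Measure.absolutelyContinuous_of_le Measure.restrict_le_self |>.trans hμ
  have : NullSingletonClass ζ := ⟨fun x => hζac (by simp)⟩
  set m := ζ.real Set.univ with hm
  have hmpos : 0 < m := by
    rw [hm, hζ, Measure.real, Measure.restrict_apply_univ]
    exact ENNReal.toReal_pos hn.ne' (measure_ne_top _ _)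
  have hprod : (μ.prod μ).restrict (A ×ˢ A) = ζ.prod ζ := (Measure.prod_restrict A A).symm
  set J : ℝ → ℝ := fun t => ∫ p : ℝ × ℝ, (1 - Real.cos (t * (p.2 - p.1))) ∂(ζ.prod ζ) with hJ
  have hJeq : ∀ t, J t = m ^ 2 - ‖charFun ζ t‖ ^ 2 := fun t => integral_one_sub_cos_prod ζ t
  have hcc : Continuous (charFun ζ) := continuous_charFun
  have hJcont : Continuous J := by
    have : J = fun t => m ^ 2 - ‖charFun ζ t‖ ^ 2 := funext hJeq
    rw [this]
    fun_prop
  have hint : ∀ t, Integrable (fun p : ℝ × ℝ => 1 - Real.cos (t * (p.2 - p.1))) (ζ.prod ζ) :=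
    fun t => (integrable_const (2 : ℝ)).mono (by fun_prop) (ae_of_all _ fun p => by
      rw [Real.norm_of_nonneg (by linarith [Real.cos_le_one (t * (p.2 - p.1))])]
      rw [Real.norm_of_nonneg (by norm_num)]
      linarith [Real.neg_one_le_cos (t * (p.2 - p.1))])
  -- If the integral vanished, then for some x almost every y would lie in x + (2π/t)ℤ, a countable
  -- set, which is null for an absolutely continuous law.
  have hJpos : ∀ t, t ≠ 0 → 0 < J t := by
    intro t ht
    refine lt_of_le_of_ne (integral_nonneg fun p => by
      simp only [Pi.zero_apply]; linarith [Real.cos_le_one (t * (p.2 - p.1))]) fun h0 => ?_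
    have h1 := (integral_eq_zero_iff_of_nonneg (fun p => by
      simp only [Pi.zero_apply]; linarith [Real.cos_le_one (t * (p.2 - p.1))]) (hint t)).1 h0.symm
    have h2 := Measure.ae_ae_of_ae_prod h1
    have hne : ζ ≠ 0 := by
      intro h
      rw [hm, h] at hmpos
      simp at hmpos
    have : (ae ζ).NeBot := ae_neBot.2 hne
    obtain ⟨x, hx⟩ := h2.exists
    have hcount : Set.Countable {y : ℝ | Real.cos (t * (y - x)) = 1} := by
      have : {y : ℝ | Real.cos (t * (y - x)) = 1} ⊆
          Set.range fun k : ℤ => (k : ℝ) * (2 * Real.pi) / t + x := by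
        intro y hy
        obtain ⟨k, hk⟩ := (Real.cos_eq_one_iff _).1 hy
        refine ⟨k, ?_⟩
        simp only
        rw [hk]
        field_simp
        ring
      exact (Set.countable_range _).mono this
    have hnull := hcount.measure_zero ζ
    have hfull : ∀ᵐ y ∂ζ, False := by
      filter_upwards [hx, measure_eq_zero_iff_ae_notMem.1 hnull] with y hy1 hy2
      apply hy2
      simp only [Pi.zero_apply] at hy1
      show Real.cos (t * (y - x)) = 1
      linarith
    exact hfull.exists.elim fun _ h => h
  -- For |t| ≤ π/(2R) the argument of the cosine stays in [-π, π] on the box, where 1 - cos is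
  -- bounded below by a quadratic.
  have hsmall : ∃ c > 0, ∀ t, |t| ≤ Real.pi / (2 * R) → c * t ^ 2 ≤ J t := by
    have hD : Integrable (fun p : ℝ × ℝ => (p.2 - p.1) ^ 2) (ζ.prod ζ) := by
      rw [← hprod]
      have hb : ∀ p ∈ A ×ˢ A, ‖(p.2 - p.1) ^ 2‖ ≤ (2 * R) ^ 2 := by
        rintro ⟨x, y⟩ ⟨⟨hx1, hx2⟩, ⟨hy1, hy2⟩⟩
        simp only at hx1 hx2 hy1 hy2 ⊢
        rw [norm_pow, Real.norm_eq_abs]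
        refine pow_le_pow_left₀ (abs_nonneg _) (abs_le.2 ⟨by linarith, by linarith⟩) 2
      exact Measure.integrableOn_of_bounded (measure_ne_top _ _) (by fun_prop)
        ((ae_restrict_mem (measurableSet_Icc.prod measurableSet_Icc)).mono hb)
    set V := ∫ p : ℝ × ℝ, (p.2 - p.1) ^ 2 ∂(ζ.prod ζ) with hV
    have hVpos : 0 < V := by
      have h1 : J 1 ≤ V := by
        refine integral_mono (hint 1) hD fun p => ?_
        simp only [one_mul]
        have := Real.one_sub_sq_div_two_le_cos (x := p.2 - p.1)
        nlinarith [sq_nonneg (p.2 - p.1)]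
      exact (hJpos 1 one_ne_zero).trans_le h1
    refine ⟨2 / Real.pi ^ 2 * V, by positivity, fun t ht => ?_⟩
    have : ∫ p : ℝ × ℝ, 2 / Real.pi ^ 2 * t ^ 2 * (p.2 - p.1) ^ 2 ∂(ζ.prod ζ) ≤ J t := by
      rw [hJ]
      simp only [← hprod]
      have hi1 := (hD.const_mul (2 / Real.pi ^ 2 * t ^ 2))
      have hi2 := hint t
      rw [← hprod] at hi1 hi2
      refine setIntegral_mono_on hi1 hi2 (measurableSet_Icc.prod measurableSet_Icc) ?_
      rintro ⟨x, y⟩ ⟨⟨hx1, hx2⟩, ⟨hy1, hy2⟩⟩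
      simp only at hx1 hx2 hy1 hy2 ⊢
      have hb : |t * (y - x)| ≤ Real.pi := by
        rw [abs_mul]
        calc |t| * |y - x| ≤ Real.pi / (2 * R) * (2 * R) := by
              gcongr
              exact abs_le.2 ⟨by linarith, by linarith⟩
          _ = Real.pi := by field_simp
      have := two_div_pi_sq_mul_sq_le_one_sub_cos hb
      nlinarith
    rw [integral_const_mul] at this
    linarith
  obtain ⟨c₁, hc₁, hJ1⟩ := hsmall
  -- For large |t| the Riemann–Lebesgue lemma applies; the range in between is compact.
  have hlarge : ∃ T : ℝ, ∀ t, T ≤ |t| → m ^ 2 / 2 ≤ J t := by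
    have h := (tendsto_charFun_cocompact hζac).norm.pow 2
    simp only [norm_zero, ne_eq, OfNat.ofNat_ne_zero, not_false_eq_true, zero_pow] at h
    have h2 := h.eventually (gt_mem_nhds (show 0 < m ^ 2 / 2 by positivity))
    rw [← Metric.cobounded_eq_cocompact, ← comap_norm_atTop] at h2
    obtain ⟨s, hs, hsub⟩ := h2
    obtain ⟨T, hT⟩ := mem_atTop_sets.1 hs
    refine ⟨T, fun t ht => ?_⟩
    have := hsub (show t ∈ norm ⁻¹' s from hT _ ht)
    rw [hJeq]
    have h3 : ‖charFun ζ t‖ ^ 2 < m ^ 2 / 2 := this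
    linarith
  obtain ⟨T, hJ3⟩ := hlarge
  obtain ⟨c₂, hc₂, hJ2⟩ : ∃ c > 0, ∀ t, Real.pi / (2 * R) ≤ |t| → |t| ≤ T → c ≤ J t := by
    have hK : IsCompact {t : ℝ | Real.pi / (2 * R) ≤ |t| ∧ |t| ≤ T} := by
      refine (isCompact_Icc (a := -T) (b := T)).of_isClosed_subset ?_ fun t ht => abs_le.1 ht.2
      exact (isClosed_le continuous_const continuous_abs).inter
        (isClosed_le continuous_abs continuous_const)
    rcases Set.eq_empty_or_nonempty {t : ℝ | Real.pi / (2 * R) ≤ |t| ∧ |t| ≤ T} with he | hne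
    · refine ⟨1, one_pos, fun t h1 h2 => ?_⟩
      have : t ∈ {t : ℝ | Real.pi / (2 * R) ≤ |t| ∧ |t| ≤ T} := ⟨h1, h2⟩
      rw [he] at this
      exact this.elim
    · obtain ⟨t₀, ht₀, hmin⟩ := hK.exists_isMinOn hne hJcont.continuousOn
      refine ⟨J t₀, hJpos t₀ ?_, fun t h1 h2 => hmin ⟨h1, h2⟩⟩
      intro h
      have h1 := ht₀.1
      rw [h, abs_zero] at h1
      have : 0 < Real.pi / (2 * R) := by positivity
      linarith
  refine ⟨R, hRpos, min c₁ (min c₂ (m ^ 2 / 2)), by positivity, fun t => ?_⟩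
  have hfin : (∫ p in A ×ˢ A, (1 - Real.cos (t * (p.2 - p.1))) ∂(μ.prod μ)) = J t := by
    rw [hJ, ← hprod]
  rw [hfin]
  have hmin0 : 0 ≤ min 1 (t ^ 2) := by positivity
  rcases le_total |t| (Real.pi / (2 * R)) with h1 | h1
  · refine le_trans ?_ (hJ1 t h1)
    exact mul_le_mul (min_le_left _ _) (min_le_right _ _) hmin0 hc₁.le
  · have key : min c₂ (m ^ 2 / 2) ≤ J t := by
      rcases le_total |t| T with h2 | h2
      · exact (min_le_left _ _).trans (hJ2 t h1 h2)
      · exact (min_le_right _ _).trans (hJ3 t h2)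
    calc _ ≤ min c₂ (m ^ 2 / 2) * 1 :=
          mul_le_mul (min_le_right _ _) (min_le_left _ _) hmin0 (by positivity)
      _ ≤ J t := by rw [mul_one]; exact key

/-- Uniform lower bound for exponentially weighted characteristic functions. -/
lemma exists_le_integral_exp_mul_one_sub_cos (μ : Measure ℝ) [IsProbabilityMeasure μ]
    (hμ : μ ≪ volume) (K : ℝ) :
    ∃ c > 0, ∀ θ : ℝ, |θ| ≤ K → Integrable (fun x => Real.exp (θ * x)) μ → ∀ t : ℝ,
      c * min 1 (t ^ 2) ≤
      ∫ p : ℝ × ℝ, Real.exp (θ * (p.1 + p.2)) * (1 - Real.cos (t * (p.2 - p.1))) ∂(μ.prod μ) := by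
  obtain ⟨R, hR, c, hc, h⟩ := exists_le_integral_one_sub_cos μ hμ
  -- On the box |x + y| ≤ 2R, so the weight is at least e^{-2RK} for every admissible tilt; the rest
  -- of the plane contributes nonnegatively.
  refine ⟨Real.exp (-(2 * R * K)) * c, by positivity, fun θ hθ hint t => ?_⟩
  have hexp : Integrable (fun p : ℝ × ℝ => Real.exp (θ * (p.1 + p.2))) (μ.prod μ) := by
    refine (hint.mul_prod hint).congr (ae_of_all _ fun p => ?_)
    simp only
    rw [← Real.exp_add, mul_add]
  have hnn : ∀ p : ℝ × ℝ, 0 ≤ 1 - Real.cos (t * (p.2 - p.1)) := fun p => by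
    linarith [Real.cos_le_one (t * (p.2 - p.1))]
  have hle2 : ∀ p : ℝ × ℝ, 1 - Real.cos (t * (p.2 - p.1)) ≤ 2 := fun p => by
    linarith [Real.neg_one_le_cos (t * (p.2 - p.1))]
  have hint2 : Integrable (fun p : ℝ × ℝ =>
      Real.exp (θ * (p.1 + p.2)) * (1 - Real.cos (t * (p.2 - p.1)))) (μ.prod μ) := by
    refine (hexp.mul_const 2).mono (by fun_prop) (ae_of_all _ fun p => ?_)
    rw [norm_mul, norm_mul, Real.norm_of_nonneg (hnn p), Real.norm_two]
    gcongr
    exact hle2 p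
  calc _ = Real.exp (-(2 * R * K)) * (c * min 1 (t ^ 2)) := by ring
    _ ≤ Real.exp (-(2 * R * K)) * ∫ p in Set.Icc (-R) R ×ˢ Set.Icc (-R) R,
          (1 - Real.cos (t * (p.2 - p.1))) ∂(μ.prod μ) := by gcongr; exact h t
    _ = ∫ p in Set.Icc (-R) R ×ˢ Set.Icc (-R) R, Real.exp (-(2 * R * K)) *
          (1 - Real.cos (t * (p.2 - p.1))) ∂(μ.prod μ) := (integral_const_mul _ _).symm
    _ ≤ ∫ p in Set.Icc (-R) R ×ˢ Set.Icc (-R) R, Real.exp (θ * (p.1 + p.2)) *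
          (1 - Real.cos (t * (p.2 - p.1))) ∂(μ.prod μ) := by
        refine setIntegral_mono_on ?_ hint2.integrableOn
          (measurableSet_Icc.prod measurableSet_Icc) ?_
        · refine Integrable.integrableOn ?_
          refine (integrable_const (Real.exp (-(2 * R * K)) * 2)).mono (by fun_prop)
            (ae_of_all _ fun p => ?_)
          rw [norm_mul, norm_mul, Real.norm_of_nonneg (hnn p), Real.norm_two]
          gcongr
          exact hle2 p
        · rintro ⟨x, y⟩ ⟨⟨hx1, hx2⟩, ⟨hy1, hy2⟩⟩
          simp only at hx1 hx2 hy1 hy2 ⊢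
          refine mul_le_mul_of_nonneg_right ?_ (hnn (x, y))
          rw [Real.exp_le_exp]
          have h1 : |θ * (x + y)| ≤ K * (2 * R) := by
            rw [abs_mul]
            have := abs_nonneg θ
            have hxy : |x + y| ≤ 2 * R := abs_le.2 ⟨by linarith, by linarith⟩
            have := abs_nonneg (x + y)
            nlinarith
          have := (abs_le.1 h1).1
          linarith
    _ ≤ _ := setIntegral_le_integral hint2
        (ae_of_all _ fun p => mul_nonneg (Real.exp_pos _).le (hnn p))

end SpreadOut

/-! ### Spitzer's formula at full mass, and moments from a Laplace transform. -/

section LadderHeight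

open scoped ENNReal

/-- The reference ratio is comparable to ε² + min(1, u²) with constants independent of ε and u. -/
lemma ratio_bounds {ε u : ℝ} (hε1 : ε ^ 2 ≤ 1) (h : 0 < ε ^ 2 + u ^ 2) :
    1 ≤ (ε ^ 2 + min 1 (u ^ 2)) * ((1 + u ^ 2) / (ε ^ 2 + u ^ 2)) ∧
    (ε ^ 2 + min 1 (u ^ 2)) * ((1 + u ^ 2) / (ε ^ 2 + u ^ 2)) ≤ 4 := by
  rw [← mul_div_assoc, le_div_iff₀ h, div_le_iff₀ h]
  have h0 := sq_nonneg u
  have h1 := sq_nonneg ε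
  rcases le_total 1 (u ^ 2) with hu | hu
  · rw [min_eq_left hu]
    constructor <;> nlinarith
  · rw [min_eq_right hu]
    constructor <;> nlinarith

lemma conv_smul_smul (c d : ℝ≥0∞) (μ ν : Measure ℝ) [SFinite μ] [SFinite ν] :
    (c • μ) ∗ (d • ν) = (c * d) • (μ ∗ ν) := by
  rw [Measure.conv_smul_left, Measure.conv_comm, Measure.conv_smul_left, Measure.conv_comm,
    smul_smul]

/-- The scalar plays the role of the generating-function variable attached to the number of steps.
-/
lemma killedWalk_smul (c : ℝ≥0∞) (ν : Measure ℝ) [IsFiniteMeasure ν] (s : Set ℝ) (n : ℕ) :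
    killedWalk (c • ν) s n = c ^ n • killedWalk ν s n := by
  induction n with
  | zero => simp [killedWalk]
  | succ n ih =>
    simp only [killedWalk]
    rw [ih, conv_smul_smul, Measure.restrict_smul, pow_succ]

lemma exitLaw_smul (c : ℝ≥0∞) (ν : Measure ℝ) [IsFiniteMeasure ν] (s : Set ℝ) (n : ℕ) :
    exitLaw (c • ν) s n = c ^ (n + 1) • exitLaw ν s n := by
  simp only [exitLaw]
  rw [killedWalk_smul, conv_smul_smul, Measure.restrict_smul, pow_succ]

lemma sum_exitLaw_add_killedWalk (ν : Measure ℝ) [IsProbabilityMeasure ν] {s : Set ℝ}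
    (hs : MeasurableSet s) (n : ℕ) :
    ∑ k ∈ Finset.range n, exitLaw ν s k Set.univ + killedWalk ν s n Set.univ = 1 := by
  induction n with
  | zero => simp [killedWalk]
  | succ n ih =>
    have h := congrArg (fun m => m Set.univ) (killedWalk_add_exitLaw ν hs n)
    simp only [Measure.add_apply, conv_apply_univ, measure_univ, mul_one] at h
    rw [Finset.sum_range_succ, add_assoc, add_comm (exitLaw ν s n Set.univ), h, ih]

lemma exitTotal_univ_le_one (ν : Measure ℝ) [IsProbabilityMeasure ν] {s : Set ℝ}
    (hs : MeasurableSet s) : exitTotal ν s Set.univ ≤ 1 := by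
  rw [exitTotal, Measure.sum_apply _ MeasurableSet.univ]
  refine ENNReal.tsum_le_of_sum_range_le fun n => ?_
  rw [← sum_exitLaw_add_killedWalk ν hs n]
  exact le_self_add

/-- Mass is conserved: what has not exited by step n is still alive. This is how a finite horizon m
gives way to a survival probability. -/
lemma tendsto_killedWalk_univ (ν : Measure ℝ) [IsProbabilityMeasure ν] {s : Set ℝ}
    (hs : MeasurableSet s) :
    Tendsto (fun n => (killedWalk ν s n).real Set.univ) atTop
      (𝓝 (1 - (exitTotal ν s).real Set.univ)) := by
  have h1 : Tendsto (fun n => ∑ k ∈ Finset.range n, exitLaw ν s k Set.univ) atTop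
      (𝓝 (exitTotal ν s Set.univ)) := by
    rw [exitTotal, Measure.sum_apply _ MeasurableSet.univ]
    exact ENNReal.tendsto_nat_tsum _
  have hfin : exitTotal ν s Set.univ ≠ ⊤ :=
    ((exitTotal_univ_le_one ν hs).trans_lt ENNReal.one_lt_top).ne
  have h2 := (ENNReal.tendsto_toReal hfin).comp h1
  have h3 := h2.const_sub 1
  refine h3.congr fun n => ?_
  have h4 := congrArg ENNReal.toReal (sum_exitLaw_add_killedWalk ν hs n)
  rw [ENNReal.toReal_add (ENNReal.sum_ne_top.2 fun k _ => measure_ne_top _ _)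
    (measure_ne_top _ _), ENNReal.toReal_one] at h4
  simp only [Function.comp, Measure.real]
  linarith

/-- Dividing by the reference ratio keeps the argument of the logarithm between two positive
constants for all ε, so dominated convergence applies even though f vanishes at 0. -/
lemma tendsto_ratio_integral {f : ℝ → ℝ} (hf : Measurable f) {c C : ℝ} (hc : 0 < c)
    (hlow : ∀ u, c * min 1 (u ^ 2) ≤ f u) (hup : ∀ u, f u ≤ C * min 1 (u ^ 2))
    {lam : ℝ} (hl : 0 < lam) {ε : ℕ → ℝ} (hε : ∀ k, 0 < ε k ∧ ε k ≤ 1 / 2)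
    (hε0 : Tendsto ε atTop (𝓝 0)) :
    Tendsto (fun k => ∫ u, cauchyKernel lam u * Real.log
      ((ε k ^ 2 + (1 - ε k ^ 2) * f u) * ((1 + u ^ 2) / (ε k ^ 2 + u ^ 2)))) atTop
      (𝓝 (∫ u, cauchyKernel lam u * Real.log (f u * ((1 + u ^ 2) / u ^ 2)))) := by
  have hcC : c ≤ C := by
    have h1 := (hlow 1).trans (hup 1)
    simpa using h1
  set c' := min 1 (3 / 4 * c)
  set C' := 4 * max 1 C
  have hc' : 0 < c' := by positivity
  refine tendsto_integral_of_dominated_convergence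
    (fun u => cauchyKernel lam u * (|Real.log c'| + |Real.log C'|)) (fun k => ?_)
    ((integrable_cauchyKernel hl).mul_const _) (fun k => ae_of_all _ fun u => ?_) ?_
  · have := (continuous_cauchyKernel hl).measurable
    exact Measurable.aestronglyMeasurable (by fun_prop)
  · rw [norm_mul, Real.norm_of_nonneg (cauchyKernel_nonneg hl u)]
    refine mul_le_mul_of_nonneg_left ?_ (cauchyKernel_nonneg hl u)
    obtain ⟨h0, h1⟩ := hε k
    have hesq : ε k ^ 2 ≤ 1 / 4 := by nlinarith
    have hepos : 0 < ε k ^ 2 := by positivity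
    have hpos : 0 < ε k ^ 2 + u ^ 2 := by positivity
    obtain ⟨b1, b2⟩ := ratio_bounds (by linarith : ε k ^ 2 ≤ 1) hpos
    have hr : 0 ≤ (1 + u ^ 2) / (ε k ^ 2 + u ^ 2) := by positivity
    have hm : 0 ≤ min 1 (u ^ 2) := by positivity
    have hfl := hlow u
    have hfu := hup u
    have lo : c' ≤ (ε k ^ 2 + (1 - ε k ^ 2) * f u) * ((1 + u ^ 2) / (ε k ^ 2 + u ^ 2)) := by
      have : c' * (ε k ^ 2 + min 1 (u ^ 2)) ≤ ε k ^ 2 + (1 - ε k ^ 2) * f u := by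
        have a1 : c' ≤ 1 := min_le_left _ _
        have a2 : c' ≤ 3 / 4 * c := min_le_right _ _
        have a3 : c' * min 1 (u ^ 2) ≤ 3 / 4 * (c * min 1 (u ^ 2)) := by nlinarith
        have hf0 : 0 ≤ f u := le_trans (by positivity) hfl
        nlinarith
      calc c' = c' * 1 := (mul_one _).symm
        _ ≤ c' * ((ε k ^ 2 + min 1 (u ^ 2)) * ((1 + u ^ 2) / (ε k ^ 2 + u ^ 2))) := by gcongr
        _ ≤ _ := by rw [← mul_assoc]; gcongr
    have up : (ε k ^ 2 + (1 - ε k ^ 2) * f u) * ((1 + u ^ 2) / (ε k ^ 2 + u ^ 2)) ≤ C' := by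
      have : ε k ^ 2 + (1 - ε k ^ 2) * f u ≤ max 1 C * (ε k ^ 2 + min 1 (u ^ 2)) := by
        have a1 : 1 ≤ max 1 C := le_max_left _ _
        have a2 : C ≤ max 1 C := le_max_right _ _
        have hf0 : 0 ≤ f u := le_trans (by positivity) hfl
        have a3 : C * min 1 (u ^ 2) ≤ max 1 C * min 1 (u ^ 2) := by gcongr
        nlinarith
      calc _ ≤ max 1 C * (ε k ^ 2 + min 1 (u ^ 2)) * ((1 + u ^ 2) / (ε k ^ 2 + u ^ 2)) := by
            gcongr
        _ = max 1 C * ((ε k ^ 2 + min 1 (u ^ 2)) * ((1 + u ^ 2) / (ε k ^ 2 + u ^ 2))) := by ring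
        _ ≤ max 1 C * 4 := by gcongr
        _ = C' := by ring
    have l1 := Real.log_le_log hc' lo
    have l2 := Real.log_le_log (hc'.trans_le lo) up
    rw [Real.norm_eq_abs, abs_le]
    constructor
    · linarith [neg_abs_le (Real.log c'), abs_nonneg (Real.log C')]
    · linarith [le_abs_self (Real.log C'), abs_nonneg (Real.log c')]
  · have hne : ∀ᵐ u : ℝ, u ≠ 0 := by
      simp [ae_iff, measure_singleton]
    filter_upwards [hne] with u hu
    refine Tendsto.const_mul _ ?_
    have hu2 : 0 < u ^ 2 := by positivity
    have hf0 : 0 < f u := lt_of_lt_of_le (by positivity) (hlow u)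
    refine (Real.continuousAt_log (by positivity)).tendsto.comp ?_
    have e1 := hε0.pow 2
    rw [zero_pow two_ne_zero] at e1
    have t1 := e1.add ((e1.const_sub 1).mul_const (f u))
    have t2 := (tendsto_const_nhds (x := 1 + u ^ 2)).div (e1.add_const (u ^ 2))
      (by simpa using hu)
    have t3 := t1.mul t2
    simpa using t3

/-- Spitzer's formula for the Laplace transform of the first ladder height of a symmetric
random walk. -/
lemma one_sub_laplace_exitTotal {ν : Measure ℝ} [IsProbabilityMeasure ν] [NullSingletonClass ν]
    (hsymm : ν.map (fun x => -x) = ν) {c C : ℝ} (hc : 0 < c)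
    (hlow : ∀ u, c * min 1 (u ^ 2) ≤ (1 - charFun ν u).re)
    (hup : ∀ u, (1 - charFun ν u).re ≤ C * min 1 (u ^ 2)) {lam : ℝ} (hl : 0 < lam) :
    1 - ∫ x, Real.exp (-lam * x) ∂(exitTotal ν (Set.Iic 0)) = lam / (1 + lam) *
      Real.exp (1 / 2 * ∫ u, cauchyKernel lam u *
        Real.log ((1 - charFun ν u).re * ((1 + u ^ 2) / u ^ 2))) := by
  have hs : MeasurableSet (Set.Iic (0 : ℝ)) := measurableSet_Iic
  -- Discounting each step by 1 - ε² makes the law defective; one minus its transform at u = 0 is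
  -- then ε², like the numerator of the reference ratio. The shift by 2 keeps ε ≤ 1/2.
  set ε : ℕ → ℝ := fun k => 1 / ((k : ℝ) + 2) with hεdef
  have hε : ∀ k, 0 < ε k ∧ ε k ≤ 1 / 2 := by
    intro k
    refine ⟨by positivity, ?_⟩
    simp only [hεdef]
    gcongr
    linarith [Nat.cast_nonneg (α := ℝ) k]
  have hε0 : Tendsto ε atTop (𝓝 0) := by
    have := tendsto_one_div_add_atTop_nhds_zero_nat (𝕜 := ℝ)
    have h2 := (tendsto_add_atTop_iff_nat 1).2 this
    refine h2.congr fun k => ?_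
    simp only [hεdef]
    push_cast
    ring
  have hmeas : Measurable fun u => (1 - charFun ν u).re := by
    have : Measurable fun u => charFun ν u := (continuous_charFun (μ := ν)).measurable
    exact Complex.measurable_re.comp (by fun_prop)
  have hconv := tendsto_ratio_integral hmeas hc hlow hup hl hε hε0
  set a : ℕ → ℝ := fun n => ∫ x, Real.exp (-lam * x) ∂(exitLaw ν (Set.Iic 0) n) with ha
  have hfin : IsFiniteMeasure (exitTotal ν (Set.Iic 0)) :=
    ⟨(exitTotal_univ_le_one ν hs).trans_lt ENNReal.one_lt_top⟩
  have ha0 : ∀ n, 0 ≤ a n := fun n => integral_nonneg fun x => (Real.exp_pos _).le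
  have hsum : HasSum a (∫ x, Real.exp (-lam * x) ∂(exitTotal ν (Set.Iic 0))) :=
    hasSum_integral_measure
      (integrable_exp_neg_of_Iio hl.le (exitTotal ν (Set.Iic 0)) exitTotal_Iio)
  have hz : ∀ k, 0 < 1 - ε k ^ 2 ∧ 1 - ε k ^ 2 < 1 := by
    intro k
    obtain ⟨h0, h1⟩ := hε k
    constructor <;> nlinarith
  set ν' : ℕ → Measure ℝ := fun k => ENNReal.ofReal (1 - ε k ^ 2) • ν with hν'
  have hfin' : ∀ k, IsFiniteMeasure (ν' k) := fun k => Measure.smul_finite _ ENNReal.ofReal_ne_top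
  have hmass : ∀ k, ν' k Set.univ < 1 := by
    intro k
    simp only [hν', Measure.smul_apply, measure_univ, smul_eq_mul, mul_one]
    rw [← ENNReal.ofReal_one]
    exact (ENNReal.ofReal_lt_ofReal_iff one_pos).2 (hz k).2
  have hatom : ∀ k, NullSingletonClass (ν' k) := fun k => ⟨fun x => by simp [hν']⟩
  have hsymm' : ∀ k, (ν' k).map (fun x => -x) = ν' k := by
    intro k
    simp only [hν', Measure.map_smul, hsymm]
  have hchar : ∀ k u, (1 - charFun (ν' k) u).re =
      ε k ^ 2 + (1 - ε k ^ 2) * (1 - charFun ν u).re := by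
    intro k u
    rw [charFun_apply_real, charFun_apply_real, integral_smul_measure,
      ENNReal.toReal_ofReal (hz k).1.le]
    simp only [Complex.sub_re, Complex.one_re, Complex.smul_re, smul_eq_mul]
    ring
  have hlap : ∀ k, ∫ x, Real.exp (-lam * x) ∂(exitTotal (ν' k) (Set.Iic 0)) =
      ∑' n, (1 - ε k ^ 2) ^ (n + 1) * a n := by
    intro k
    have := isFiniteMeasure_exitTotal (hmass k) hs
    have h := hasSum_integral_measure (μ := exitLaw (ν' k) (Set.Iic 0))
      (integrable_exp_neg_of_Iio hl.le (exitTotal (ν' k) (Set.Iic 0)) exitTotal_Iio)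
    refine h.tsum_eq.symm.trans ?_
    refine tsum_congr fun n => ?_
    rw [hν', exitLaw_smul, integral_smul_measure, ENNReal.toReal_pow,
      ENNReal.toReal_ofReal (hz k).1.le]
    rfl
  -- Abel's argument: the discounts (1 - ε²)^(n+1) tend to 1 and are dominated by 1 in a convergent
  -- series.
  have hL : Tendsto (fun k => 1 - ∫ x, Real.exp (-lam * x) ∂(exitTotal (ν' k) (Set.Iic 0))) atTop
      (𝓝 (1 - ∫ x, Real.exp (-lam * x) ∂(exitTotal ν (Set.Iic 0)))) := by
    refine Tendsto.const_sub _ ?_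
    simp_rw [hlap]
    rw [← hsum.tsum_eq]
    refine tendsto_tsum_of_dominated_convergence hsum.summable (fun n => ?_)
      (Eventually.of_forall fun k n => ?_)
    · have e1 := hε0.pow 2
      rw [zero_pow two_ne_zero] at e1
      have := ((e1.const_sub 1).pow (n + 1)).mul_const (a n)
      simpa using this
    · rw [norm_mul, Real.norm_of_nonneg (ha0 n), norm_pow, Real.norm_of_nonneg (hz k).1.le]
      exact mul_le_of_le_one_left (ha0 n) (pow_le_one₀ (hz k).1.le (hz k).2.le)
  have hR : Tendsto (fun k => Real.exp (1 / 2 * (∫ u, cauchyKernel lam u * Real.log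
      ((ε k ^ 2 + (1 - ε k ^ 2) * (1 - charFun ν u).re) * ((1 + u ^ 2) / (ε k ^ 2 + u ^ 2))))) *
        ((lam + ε k) / (1 + lam))) atTop
      (𝓝 (Real.exp (1 / 2 * ∫ u, cauchyKernel lam u *
        Real.log ((1 - charFun ν u).re * ((1 + u ^ 2) / u ^ 2))) * ((lam + 0) / (1 + lam)))) := by
    refine ((Real.continuous_exp.tendsto _).comp (hconv.const_mul _)).mul ?_
    exact (hε0.const_add lam).div_const _
  have heq : ∀ k, 1 - ∫ x, Real.exp (-lam * x) ∂(exitTotal (ν' k) (Set.Iic 0)) =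
      Real.exp (1 / 2 * (∫ u, cauchyKernel lam u * Real.log
      ((ε k ^ 2 + (1 - ε k ^ 2) * (1 - charFun ν u).re) * ((1 + u ^ 2) / (ε k ^ 2 + u ^ 2))))) *
        ((lam + ε k) / (1 + lam)) := by
    intro k
    have hk := hfin' k
    have hk2 := hatom k
    have := isFiniteMeasure_exitTotal (hmass k) hs
    obtain ⟨h0, h1⟩ := hε k
    have h := two_mul_log_one_sub_laplace_exitTotal (hmass k) (hsymm' k) hl h0 (by linarith)
    simp_rw [hchar] at h
    have hlt : ∫ x, Real.exp (-lam * x) ∂(exitTotal (ν' k) (Set.Iic 0)) < 1 := by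
      have hae : ∀ᵐ x ∂(exitTotal (ν' k) (Set.Iic 0)), x ∉ Set.Iio (0 : ℝ) :=
        measure_eq_zero_iff_ae_notMem.1 exitTotal_Iio
      calc _ ≤ ∫ x, (1 : ℝ) ∂(exitTotal (ν' k) (Set.Iic 0)) := by
            refine integral_mono_ae (integrable_exp_neg_of_Iio hl.le _ exitTotal_Iio)
              (integrable_const _) ?_
            filter_upwards [hae] with x hx
            rw [Real.exp_le_one_iff]
            have : 0 ≤ x := by simpa using hx
            nlinarith
        _ = (exitTotal (ν' k) (Set.Iic 0)).real Set.univ := by simp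
        _ < 1 := by
            rw [Measure.real, ← ENNReal.toReal_one]
            exact (ENNReal.toReal_lt_toReal (measure_ne_top _ _) ENNReal.one_ne_top).2
              ((exitTotal_univ_le (hmass k) hs).trans_lt (hmass k))
    have hpos : 0 < (lam + ε k) / (1 + lam) := by positivity
    conv_rhs => rw [← Real.exp_log hpos, ← Real.exp_add]
    rw [← Real.exp_log (sub_pos.2 hlt)]
    congr 1
    linarith
  have := tendsto_nhds_unique (hL.congr heq) hR
  rw [this, add_zero]
  ring

/-- Take reciprocals: (1 - y + y²/2)(1 + y + y²/2) = 1 + y⁴/4 ≥ 1. -/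
lemma exp_neg_le_quadratic {y : ℝ} (hy : 0 ≤ y) : Real.exp (-y) ≤ 1 - y + y ^ 2 / 2 := by
  rw [Real.exp_neg]
  refine inv_le_of_inv_le₀ (by nlinarith [sq_nonneg (y - 1)]) ?_
  refine le_trans ?_ (Real.quadratic_le_exp_of_nonneg hy)
  rw [inv_le_iff_one_le_mul₀ (by nlinarith [sq_nonneg (y - 1)])]
  nlinarith [sq_nonneg (y ^ 2)]

lemma abs_exp_sub_quadratic_le (x : ℝ) :
    |Real.exp x - (1 + x + x ^ 2 / 2)| ≤ |x| ^ 3 * Real.exp |x| := by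
  have h := Complex.norm_exp_sub_sum_le_norm_mul_exp (x : ℂ) 3
  simp only [Finset.sum_range_succ, Finset.sum_range_zero, Nat.factorial, Complex.norm_real,
    Real.norm_eq_abs] at h
  rw [← Real.norm_eq_abs, ← Complex.norm_real]
  convert h using 2
  push_cast
  norm_num

/-- Moments of a law on the half-line from the expansion of its Laplace transform at `0`. -/
lemma moments_of_laplace {H : Measure ℝ} [IsFiniteMeasure H]
    (hH : H (Set.Iio 0) = 0) {a g₀ : ℝ} {g : ℝ → ℝ}
    (hg : Tendsto g (𝓝[>] 0) (𝓝 g₀))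
    (hlap : ∀ lam > 0, 1 - ∫ x, Real.exp (-lam * x) ∂H = lam * a * Real.exp (lam * g lam)) :
    H Set.univ = 1 ∧ Integrable (fun x => x ^ 2) H ∧ ∫ x, x ∂H = a ∧
      ∫ x, x ^ 2 ∂H = -2 * a * g₀ := by
  have hae : ∀ᵐ x ∂H, 0 ≤ x := by
    filter_upwards [measure_eq_zero_iff_ae_notMem.1 hH] with x hx
    simpa using hx
  set l : ℕ → ℝ := fun k => 1 / ((k : ℝ) + 1) with hl
  have hlpos : ∀ k, 0 < l k := fun k => by positivity
  have hl0 : Tendsto l atTop (𝓝 0) := tendsto_one_div_add_atTop_nhds_zero_nat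
  have hl0' : Tendsto l atTop (𝓝[>] 0) :=
    tendsto_nhdsWithin_iff.2 ⟨hl0, Eventually.of_forall hlpos⟩
  have hgl := hg.comp hl0'
  have hint : ∀ k, Integrable (fun x => Real.exp (-l k * x)) H :=
    fun k => integrable_exp_neg_of_Iio (hlpos k).le H hH
  have hlg : Tendsto (fun k => l k * g (l k)) atTop (𝓝 0) := by
    simpa using hl0.mul hgl
  have hexp : Tendsto (fun k => Real.exp (l k * g (l k))) atTop (𝓝 1) := by
    simpa [Function.comp_def] using (Real.continuous_exp.tendsto _).comp hlg
  have hlim1 : Tendsto (fun k => 1 - ∫ x, Real.exp (-l k * x) ∂H) atTop (𝓝 0) := by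
    have := (hl0.mul_const a).mul hexp
    simp only [zero_mul] at this
    exact this.congr fun k => (hlap _ (hlpos k)).symm
  have hlim1' : Tendsto (fun k => ∫ x, Real.exp (-l k * x) ∂H) atTop (𝓝 (∫ _, (1 : ℝ) ∂H)) := by
    refine tendsto_integral_of_dominated_convergence (fun _ => 1)
      (fun k => (hint k).aestronglyMeasurable) (integrable_const _) (fun k => ?_)
      (ae_of_all _ fun x => ?_)
    · filter_upwards [hae] with x hx
      rw [Real.norm_of_nonneg (Real.exp_pos _).le, Real.exp_le_one_iff]
      have := hlpos k
      nlinarith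
    · have := (Real.continuous_exp.tendsto _).comp ((hl0.neg).mul_const x)
      simpa [Function.comp_def] using this
  have hmass : H.real Set.univ = 1 := by
    have h := tendsto_nhds_unique (hlim1'.const_sub 1) hlim1
    simp only [integral_const, smul_eq_mul, mul_one] at h
    linarith
  have hH1' : H Set.univ = 1 := by
    rw [← ENNReal.toReal_eq_one_iff]; exact hmass
  -- first moment
  have e1 : ∀ k, ∫ x, (1 - Real.exp (-l k * x)) / l k ∂H = a * Real.exp (l k * g (l k)) := by
    intro k
    rw [integral_div, integral_sub (integrable_const _) (hint k), integral_const, hmass,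
      one_smul, hlap _ (hlpos k)]
    have := hlpos k
    field_simp
  have hi1 : ∀ k, Integrable (fun x => (1 - Real.exp (-l k * x)) / l k) H :=
    fun k => ((integrable_const _).sub (hint k)).div_const _
  have hpt1 : ∀ x : ℝ, Tendsto (fun k => (1 - Real.exp (-l k * x)) / l k) atTop (𝓝 x) := by
    intro x
    have hd : HasDerivAt (fun s : ℝ => 1 - Real.exp (-s * x)) x 0 := by
      have := (((hasDerivAt_id (0 : ℝ)).neg.mul_const x).exp).const_sub 1
      simpa using this
    have h2 := hd.tendsto_slope_zero_right.comp hl0'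
    refine h2.congr fun k => ?_
    simp only [Function.comp, zero_add, neg_zero, zero_mul, Real.exp_zero, sub_self, sub_zero,
      smul_eq_mul]
    rw [div_eq_inv_mul]
  have hnn1 : ∀ k, ∀ᵐ x ∂H, 0 ≤ (1 - Real.exp (-l k * x)) / l k := by
    intro k
    filter_upwards [hae] with x hx
    refine div_nonneg ?_ (hlpos k).le
    have : Real.exp (-l k * x) ≤ 1 := by
      rw [Real.exp_le_one_iff]; have := hlpos k; nlinarith
    linarith
  have hlimA : Tendsto (fun k => a * Real.exp (l k * g (l k))) atTop (𝓝 a) := by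
    simpa using hexp.const_mul a
  -- Fatou's lemma along the difference quotients gives integrability first; their limit is then
  -- justified by domination with x itself.
  have hx1 : Integrable (fun x => x) H := by
    refine ⟨measurable_id.aestronglyMeasurable, ?_⟩
    rw [hasFiniteIntegral_iff_ofReal hae]
    calc ∫⁻ x, ENNReal.ofReal x ∂H = ∫⁻ x, liminf (fun k =>
          ENNReal.ofReal ((1 - Real.exp (-l k * x)) / l k)) atTop ∂H := by
          refine lintegral_congr fun x => ?_
          exact ((ENNReal.tendsto_ofReal (hpt1 x)).liminf_eq).symm
      _ ≤ liminf (fun k => ∫⁻ x, ENNReal.ofReal ((1 - Real.exp (-l k * x)) / l k) ∂H) atTop :=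
          lintegral_liminf_le fun k => by fun_prop
      _ = liminf (fun k => ENNReal.ofReal (a * Real.exp (l k * g (l k)))) atTop := by
          congr 1
          ext k
          rw [← ofReal_integral_eq_lintegral_ofReal (hi1 k) (hnn1 k), e1]
      _ = ENNReal.ofReal a := (ENNReal.tendsto_ofReal hlimA).liminf_eq
      _ < ⊤ := ENNReal.ofReal_lt_top
  have hEx : ∫ x, x ∂H = a := by
    refine tendsto_nhds_unique ?_ hlimA
    simp_rw [← e1]
    refine tendsto_integral_of_dominated_convergence (fun x => x)
      (fun k => (hi1 k).aestronglyMeasurable) hx1 (fun k => ?_) (ae_of_all _ hpt1)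
    filter_upwards [hnn1 k] with x hx
    rw [Real.norm_of_nonneg hx, div_le_iff₀ (hlpos k)]
    have := Real.add_one_le_exp (-l k * x)
    linarith
  -- second moment
  have hi2 : ∀ k, Integrable (fun x => (l k * x - (1 - Real.exp (-l k * x))) / l k ^ 2) H :=
    fun k => ((hx1.const_mul _).sub ((integrable_const _).sub (hint k))).div_const _
  have e2 : ∀ k, ∫ x, (l k * x - (1 - Real.exp (-l k * x))) / l k ^ 2 ∂H =
      a * ((1 - Real.exp (l k * g (l k))) / l k) := by
    intro k
    have hs1 : Integrable (fun x => 1 - Real.exp (-l k * x)) H := (integrable_const _).sub (hint k)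
    rw [integral_div, integral_sub (hx1.const_mul _) hs1, integral_const_mul, hEx,
      integral_sub (integrable_const _) (hint k), integral_const, hmass,
      one_smul, hlap _ (hlpos k)]
    have := hlpos k
    field_simp
  have hlimB : Tendsto (fun k => a * ((1 - Real.exp (l k * g (l k))) / l k)) atTop
      (𝓝 (a * -g₀)) := by
    refine Tendsto.const_mul a ?_
    have hd : HasDerivAt (fun s : ℝ => Real.exp s) 1 0 := by
      simpa using Real.hasDerivAt_exp 0
    -- `dslope` is continuous at 0, so no case distinction is needed when `l k * g (l k)` vanishes.
    have hslope : Tendsto (fun k => dslope Real.exp 0 (l k * g (l k))) atTop (𝓝 1) := by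
      have hc : ContinuousAt (dslope Real.exp 0) 0 :=
        continuousAt_dslope_same.2 hd.differentiableAt
      have := hc.tendsto.comp hlg
      rw [dslope_same, hd.deriv] at this
      exact this
    have h3 := (hslope.mul hgl).neg
    rw [one_mul] at h3
    refine h3.congr fun k => ?_
    have hsl := sub_smul_dslope Real.exp 0 (l k * g (l k))
    simp only [sub_zero, smul_eq_mul, Real.exp_zero] at hsl
    have := hlpos k
    simp only [Function.comp]
    rw [eq_div_iff this.ne']
    linarith
  have hpt2 : ∀ x : ℝ, 0 ≤ x → Tendsto
      (fun k => (l k * x - (1 - Real.exp (-l k * x))) / l k ^ 2) atTop (𝓝 (x ^ 2 / 2)) := by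
    intro x hx
    have hb : ∀ k, |(l k * x - (1 - Real.exp (-l k * x))) / l k ^ 2 - x ^ 2 / 2|
        ≤ l k * x ^ 3 * Real.exp (l k * x) := by
      intro k
      have hk := hlpos k
      have h := abs_exp_sub_quadratic_le (-l k * x)
      have hab : |(-l k * x)| = l k * x := by
        rw [neg_mul, abs_neg, abs_of_nonneg (by positivity)]
      rw [hab] at h
      have : (l k * x - (1 - Real.exp (-l k * x))) / l k ^ 2 - x ^ 2 / 2 =
          (Real.exp (-l k * x) - (1 + -l k * x + (-l k * x) ^ 2 / 2))
            / l k ^ 2 := by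
        field_simp
        ring
      rw [this, abs_div, abs_of_pos (show 0 < l k ^ 2 by positivity), div_le_iff₀ (by positivity)]
      refine h.trans (le_of_eq ?_)
      ring
    rw [tendsto_iff_norm_sub_tendsto_zero]
    refine squeeze_zero (fun k => norm_nonneg _) hb ?_
    have := (hl0.mul_const (x ^ 3)).mul
      ((Real.continuous_exp.tendsto _).comp (hl0.mul_const x))
    simpa using this
  have hnn2 : ∀ k, ∀ x : ℝ, 0 ≤ (l k * x - (1 - Real.exp (-l k * x))) / l k ^ 2 := by
    intro k x
    refine div_nonneg ?_ (sq_nonneg _)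
    have := Real.add_one_le_exp (-l k * x)
    linarith
  -- The same scheme for the second-order quotients: Fatou for integrability, then domination by
  -- x²/2.
  have hx2 : Integrable (fun x => x ^ 2 / 2) H := by
    refine ⟨Measurable.aestronglyMeasurable (by fun_prop), ?_⟩
    rw [hasFiniteIntegral_iff_ofReal (ae_of_all _ fun x => by positivity)]
    calc ∫⁻ x, ENNReal.ofReal (x ^ 2 / 2) ∂H = ∫⁻ x, liminf (fun k =>
          ENNReal.ofReal ((l k * x - (1 - Real.exp (-l k * x))) / l k ^ 2)) atTop ∂H := by
          refine lintegral_congr_ae ?_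
          filter_upwards [hae] with x hx
          exact ((ENNReal.tendsto_ofReal (hpt2 x hx)).liminf_eq).symm
      _ ≤ liminf (fun k => ∫⁻ x,
            ENNReal.ofReal ((l k * x - (1 - Real.exp (-l k * x))) / l k ^ 2) ∂H) atTop :=
          lintegral_liminf_le fun k => by fun_prop
      _ = liminf (fun k => ENNReal.ofReal (a * ((1 - Real.exp (l k * g (l k))) / l k))) atTop := by
          congr 1
          ext k
          rw [← ofReal_integral_eq_lintegral_ofReal (hi2 k) (ae_of_all _ (hnn2 k)), e2]
      _ = ENNReal.ofReal (a * -g₀) := (ENNReal.tendsto_ofReal hlimB).liminf_eq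
      _ < ⊤ := ENNReal.ofReal_lt_top
  have hEx2 : ∫ x, x ^ 2 / 2 ∂H = a * -g₀ := by
    refine tendsto_nhds_unique ?_ hlimB
    simp_rw [← e2]
    refine tendsto_integral_of_dominated_convergence (fun x => x ^ 2 / 2)
      (fun k => (hi2 k).aestronglyMeasurable) hx2 (fun k => ?_) ?_
    · filter_upwards [hae] with x hx
      rw [Real.norm_of_nonneg (hnn2 k x), div_le_iff₀ (by have := hlpos k; positivity)]
      have hq : Real.exp (-(l k * x)) ≤ 1 - l k * x + (l k * x) ^ 2 / 2 :=
        exp_neg_le_quadratic (by have := hlpos k; positivity)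
      rw [neg_mul]
      nlinarith
    · filter_upwards [hae] with x hx
      exact hpt2 x hx
  refine ⟨hH1', ?_, hEx, ?_⟩
  · refine (hx2.mul_const 2).congr (ae_of_all _ fun x => ?_)
    ring
  · rw [integral_div] at hEx2
    linarith

end LadderHeight

/-! ### Second-order expansions of expectations over an independent pair. -/

section PairExpansion

lemma abs_exp_sub_sum_le (x : ℝ) (n : ℕ) :
    |Real.exp x - ∑ m ∈ Finset.range n, x ^ m / (m.factorial : ℝ)| ≤ |x| ^ n * Real.exp |x| := by
  have h := Complex.norm_exp_sub_sum_le_norm_mul_exp (x : ℂ) n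
  rw [Complex.norm_real, Real.norm_eq_abs] at h
  rw [← Real.norm_eq_abs, ← Complex.norm_real]
  convert h using 2
  push_cast
  rfl

lemma abs_exp_sub_one_le' (x : ℝ) : |Real.exp x - 1| ≤ |x| * Real.exp |x| := by
  simpa using abs_exp_sub_sum_le x 1

lemma abs_cosh_sub_le (x : ℝ) : |Real.cosh x - 1 - x ^ 2 / 2| ≤ x ^ 4 * Real.exp |x| := by
  have h1 := abs_exp_sub_sum_le x 4
  have h2 := abs_exp_sub_sum_le (-x) 4
  simp only [Finset.sum_range_succ, Finset.sum_range_zero, Nat.factorial, abs_neg] at h1 h2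
  have e : |x| ^ 4 = x ^ 4 := by rw [← abs_pow]; exact abs_of_nonneg (by positivity)
  rw [e] at h1 h2
  push_cast at h1 h2
  rw [Real.cosh_eq]
  have h1 := abs_le.1 h1
  have h2 := abs_le.1 h2
  rw [abs_le]
  constructor <;> nlinarith [h1.1, h1.2, h2.1, h2.2]

lemma abs_sinh_sub_le (x : ℝ) : |Real.sinh x - x| ≤ |x| ^ 3 * Real.exp |x| := by
  have h1 := abs_le.1 (abs_exp_sub_sum_le x 3)
  have h2 := abs_le.1 (abs_exp_sub_sum_le (-x) 3)
  simp only [Finset.sum_range_succ, Finset.sum_range_zero, Nat.factorial, abs_neg] at h1 h2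
  push_cast at h1 h2
  rw [Real.sinh_eq, abs_le]
  constructor <;> nlinarith [h1.1, h1.2, h2.1, h2.2]

lemma cosh_sub_one_le (x : ℝ) : Real.cosh x - 1 ≤ x ^ 2 * Real.exp |x| := by
  have h1 := abs_le.1 (abs_exp_sub_sum_le x 2)
  have h2 := abs_le.1 (abs_exp_sub_sum_le (-x) 2)
  simp only [Finset.sum_range_succ, Finset.sum_range_zero, Nat.factorial, abs_neg, sq_abs] at h1 h2
  push_cast at h1 h2
  rw [Real.cosh_eq]
  nlinarith [h1.1, h1.2, h2.1, h2.2]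

lemma sq_div_two_le_cosh_sub_one (x : ℝ) : x ^ 2 / 2 ≤ Real.cosh x - 1 := by
  have key : ∀ y : ℝ, 0 ≤ y → y ^ 2 / 2 ≤ Real.cosh y - 1 := by
    intro y hy
    rw [show y = 2 * (y / 2) by ring, Real.cosh_two_mul, Real.cosh_sq]
    have := Real.self_le_sinh_iff.2 (show 0 ≤ y / 2 by linarith)
    nlinarith
  rw [← Real.cosh_abs, ← sq_abs]
  exact key _ (abs_nonneg x)

lemma abs_cos_sub_le (x : ℝ) : |x ^ 2 / 2 - (1 - Real.cos x)| ≤ x ^ 4 := by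
  have h1 := Real.one_sub_sq_div_two_le_cos (x := x)
  rw [abs_of_nonneg (by linarith)]
  rcases le_total |x| 1 with h | h
  · have := abs_le.1 (Real.cos_bound h)
    have e : |x| ^ 4 = x ^ 4 := by rw [← abs_pow]; exact abs_of_nonneg (by positivity)
    rw [e] at this
    have : 0 ≤ x ^ 4 := by positivity
    linarith
  · have h2 : 1 ≤ x ^ 2 := by rw [← sq_abs]; nlinarith
    have := Real.cos_le_one x
    nlinarith

lemma one_sub_cos_le_sq (x : ℝ) : 1 - Real.cos x ≤ x ^ 2 / 2 := by
  have h1 := Real.one_sub_sq_div_two_le_cos (x := x)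
  linarith

lemma exists_integrable_exp_mul_abs {μ : Measure ℝ} (h0 : (0 : ℝ) ∈ naturalInterior μ) :
    ∃ δ > 0, Integrable (fun x => Real.exp (δ * |x|)) μ := by
  obtain ⟨ε, hε, hb⟩ := Metric.mem_nhds_iff.1 (mem_interior_iff_mem_nhds.1 h0)
  refine ⟨ε / 2, by positivity, ?_⟩
  refine integrable_exp_mul_abs (X := fun x => x) (t := ε / 2) ?_ ?_
  · exact hb (by rw [Metric.mem_ball, Real.dist_eq, sub_zero, abs_of_pos (by positivity)]; linarith)
  · exact hb (by rw [Metric.mem_ball, Real.dist_eq, sub_zero, abs_neg, abs_of_pos (by positivity)]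
                 linarith)

/-- `M(2η) - |M(η + iu)|²` as an expectation over an independent pair. -/
def pairGap (μ : Measure ℝ) (η u : ℝ) : ℝ :=
  ∫ p : ℝ × ℝ, Real.exp (η * (p.1 + p.2)) *
    (Real.cosh (η * (p.2 - p.1)) - Real.cos (u * (p.2 - p.1))) ∂(μ.prod μ)

/-- The exponentially weighted variance. -/
def pairVar (μ : Measure ℝ) (η : ℝ) : ℝ :=
  ∫ p : ℝ × ℝ, Real.exp (η * (p.1 + p.2)) * ((p.2 - p.1) ^ 2 / 2) ∂(μ.prod μ)

/-- A polynomial-exponential weight dominating all integrands below. -/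
def pairWeight (δ : ℝ) (p : ℝ × ℝ) : ℝ :=
  (1 + (|p.1| + |p.2|)) ^ 5 * Real.exp (δ / 2 * (|p.1| + |p.2|))

lemma measurable_pairWeight (δ : ℝ) : Measurable (pairWeight δ) := by
  unfold pairWeight; fun_prop

lemma integrable_pairWeight {μ : Measure ℝ} [IsProbabilityMeasure μ] {δ : ℝ} (hδ : 0 < δ)
    (h : Integrable (fun x => Real.exp (δ * |x|)) μ) : Integrable (pairWeight δ) (μ.prod μ) := by
  obtain ⟨C, hC⟩ : ∃ C : ℝ, ∀ s : ℝ, 0 ≤ s → (1 + s) ^ 5 ≤ C * Real.exp (δ / 2 * s) := by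
    refine ⟨((Nat.factorial 5 : ℕ) : ℝ) * ((δ / 2)⁻¹) ^ 5 * Real.exp (δ / 2), fun s hs => ?_⟩
    have h1 := Real.pow_div_factorial_le_exp (δ / 2 * (1 + s)) (by positivity) 5
    rw [div_le_iff₀ (by positivity), mul_pow] at h1
    have h2 : (1 + s) ^ 5 = ((δ / 2)⁻¹) ^ 5 * ((δ / 2) ^ 5 * (1 + s) ^ 5) := by
      rw [← mul_assoc, ← mul_pow, inv_mul_cancel₀ (by positivity), one_pow, one_mul]
    rw [h2]
    calc _ ≤ ((δ / 2)⁻¹) ^ 5 * (Real.exp (δ / 2 * (1 + s)) * ((Nat.factorial 5 : ℕ) : ℝ)) := by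
          gcongr
      _ = _ := by rw [mul_add, mul_one, Real.exp_add]; ring
  refine ((h.mul_prod h).const_mul C).mono (measurable_pairWeight δ).aestronglyMeasurable
    (ae_of_all _ fun p => ?_)
  have hs : 0 ≤ |p.1| + |p.2| := by positivity
  rw [Real.norm_of_nonneg (by unfold pairWeight; positivity)]
  refine le_trans ?_ (le_abs_self _)
  rw [pairWeight, ← Real.exp_add, ← mul_add]
  calc _ ≤ C * Real.exp (δ / 2 * (|p.1| + |p.2|)) * Real.exp (δ / 2 * (|p.1| + |p.2|)) := by
        gcongr; exact hC _ hs
    _ = _ := by rw [mul_assoc, ← Real.exp_add]; ring_nf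

/-- One exponential factor comes from the tilt e^{ηB}, the other from the Taylor remainder e^{|ηD|};
together they cost 2η ≤ δ/2. Degree 5 covers a quartic remainder and one more power from e^{ηB} - 1.
-/
lemma pairWeight_dominates {δ η : ℝ} (hηδ : η ≤ δ / 4) (p : ℝ × ℝ) {k : ℕ}
    (hk : k ≤ 5) {x : ℝ} (hx : |x| ≤ (|p.1| + |p.2|) ^ k) :
    |x| * (Real.exp (η * (|p.1| + |p.2|)) * Real.exp (η * (|p.1| + |p.2|))) ≤ pairWeight δ p := by
  have hs : 0 ≤ |p.1| + |p.2| := by positivity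
  rw [pairWeight, ← Real.exp_add]
  have h1 : |x| ≤ (1 + (|p.1| + |p.2|)) ^ 5 := hx.trans
    ((pow_le_pow_left₀ hs (by linarith) k).trans (pow_le_pow_right₀ (by linarith) hk))
  have h2 : Real.exp (η * (|p.1| + |p.2|) + η * (|p.1| + |p.2|)) ≤
      Real.exp (δ / 2 * (|p.1| + |p.2|)) := by
    rw [Real.exp_le_exp]; nlinarith
  exact mul_le_mul h1 h2 (Real.exp_pos _).le (by positivity)

lemma integral_le_of_dominated {α : Type*} [MeasurableSpace α] {m : Measure α} {V f : α → ℝ}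
    (hV : Integrable V m) (hf : AEStronglyMeasurable f m) {K : ℝ} (h : ∀ p, |f p| ≤ K * V p) :
    Integrable f m ∧ |∫ p, f p ∂m| ≤ K * ∫ p, V p ∂m := by
  have hi : Integrable f m := (hV.const_mul K).mono hf (ae_of_all _ fun p => by
    rw [Real.norm_eq_abs, Real.norm_eq_abs]
    exact (h p).trans (le_abs_self _))
  refine ⟨hi, ?_⟩
  rw [← integral_const_mul]
  exact (abs_integral_le_integral_abs).trans (integral_mono hi.abs (hV.const_mul K) h)

lemma exp_mul_add_le {η : ℝ} (hη : 0 ≤ η) (p : ℝ × ℝ) :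
    Real.exp (η * (p.1 + p.2)) ≤ Real.exp (η * (|p.1| + |p.2|)) := by
  rw [Real.exp_le_exp]
  have := le_abs_self p.1
  have := le_abs_self p.2
  gcongr

lemma abs_sub_le_sum (p : ℝ × ℝ) : |p.2 - p.1| ≤ |p.1| + |p.2| := by
  have := abs_sub p.2 p.1
  linarith

lemma exp_abs_mul_sub_le {η : ℝ} (hη : 0 ≤ η) (p : ℝ × ℝ) :
    Real.exp |η * (p.2 - p.1)| ≤ Real.exp (η * (|p.1| + |p.2|)) := by
  rw [Real.exp_le_exp, abs_mul, abs_of_nonneg hη]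
  have := abs_sub_le_sum p
  gcongr

/-- Domination of integrands of the form `e^{ηB} f` with `f` of polynomial-exponential growth. -/
lemma weighted_dominated {μ : Measure ℝ} [IsProbabilityMeasure μ] {δ : ℝ} (hδ : 0 < δ)
    (h : Integrable (fun x => Real.exp (δ * |x|)) μ) {η : ℝ} (hη : 0 ≤ η) (hηδ : η ≤ δ / 4)
    {f : ℝ × ℝ → ℝ} (hf : Measurable f) {K : ℝ} (hK : 0 ≤ K) {k : ℕ} (hk : k ≤ 5)
    (hb : ∀ p, |f p| ≤ K * ((|p.1| + |p.2|) ^ k * Real.exp (η * (|p.1| + |p.2|)))) :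
    Integrable (fun p : ℝ × ℝ => Real.exp (η * (p.1 + p.2)) * f p) (μ.prod μ) ∧
    |∫ p : ℝ × ℝ, Real.exp (η * (p.1 + p.2)) * f p ∂(μ.prod μ)| ≤
      K * ∫ p, pairWeight δ p ∂(μ.prod μ) := by
  refine integral_le_of_dominated (integrable_pairWeight hδ h)
    (Measurable.aestronglyMeasurable (by fun_prop)) fun p => ?_
  have hs : 0 ≤ |p.1| + |p.2| := by positivity
  rw [abs_mul, abs_of_pos (Real.exp_pos _)]
  have h1 := pairWeight_dominates hηδ p hk (x := (|p.1| + |p.2|) ^ k)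
    (by rw [abs_of_nonneg (by positivity)])
  rw [abs_of_nonneg (by positivity)] at h1
  calc _ ≤ Real.exp (η * (|p.1| + |p.2|)) *
        (K * ((|p.1| + |p.2|) ^ k * Real.exp (η * (|p.1| + |p.2|)))) := by
        exact mul_le_mul (exp_mul_add_le hη p) (hb p) (abs_nonneg _) (Real.exp_pos _).le
    _ = K * ((|p.1| + |p.2|) ^ k * (Real.exp (η * (|p.1| + |p.2|)) *
        Real.exp (η * (|p.1| + |p.2|)))) := by ring
    _ ≤ _ := by gcongr

/-- Domination of integrands of the form `(e^{ηB} - 1) f` with `f` of polynomial growth. -/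
lemma weighted_sub_dominated {μ : Measure ℝ} [IsProbabilityMeasure μ] {δ : ℝ} (hδ : 0 < δ)
    (h : Integrable (fun x => Real.exp (δ * |x|)) μ) {η : ℝ} (hη : 0 ≤ η) (hηδ : η ≤ δ / 4)
    {f : ℝ × ℝ → ℝ} (hf : Measurable f) {K : ℝ} (hK : 0 ≤ K) {k : ℕ} (hk : k ≤ 4)
    (hb : ∀ p, |f p| ≤ K * (|p.1| + |p.2|) ^ k) :
    |∫ p : ℝ × ℝ, (Real.exp (η * (p.1 + p.2)) - 1) * f p ∂(μ.prod μ)| ≤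
      η * K * ∫ p, pairWeight δ p ∂(μ.prod μ) := by
  refine (integral_le_of_dominated (integrable_pairWeight hδ h)
    (Measurable.aestronglyMeasurable (by fun_prop)) fun p => ?_).2
  have hs : 0 ≤ |p.1| + |p.2| := by positivity
  have hB : |p.1 + p.2| ≤ |p.1| + |p.2| := abs_add_le _ _
  have h1 := pairWeight_dominates hηδ p (Nat.succ_le_succ hk) (x := (|p.1| + |p.2|) ^ (k + 1))
    (by rw [abs_of_nonneg (by positivity)])
  rw [abs_of_nonneg (by positivity)] at h1
  have h2 : |Real.exp (η * (p.1 + p.2)) - 1| ≤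
      η * (|p.1| + |p.2|) * Real.exp (η * (|p.1| + |p.2|)) := by
    refine (abs_exp_sub_one_le' _).trans ?_
    rw [abs_mul, abs_of_nonneg hη]
    gcongr
  have h3 : 1 ≤ Real.exp (η * (|p.1| + |p.2|)) := Real.one_le_exp (by positivity)
  rw [abs_mul]
  calc _ ≤ η * (|p.1| + |p.2|) * Real.exp (η * (|p.1| + |p.2|)) * (K * (|p.1| + |p.2|) ^ k) := by
        gcongr
        exact hb p
    _ = η * K * ((|p.1| + |p.2|) ^ (k + 1) * (Real.exp (η * (|p.1| + |p.2|)) * 1)) := by ring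
    _ ≤ η * K * ((|p.1| + |p.2|) ^ (k + 1) * (Real.exp (η * (|p.1| + |p.2|)) *
        Real.exp (η * (|p.1| + |p.2|)))) := by gcongr
    _ ≤ _ := by gcongr

/-- Expansions of the pair functionals for small tilts. -/
structure PairBounds (μ : Measure ℝ) (η₀ c C : ℝ) : Prop where
  η₀_pos : 0 < η₀
  η₀_le : η₀ ≤ 1
  c_pos : 0 < c
  C_pos : 0 < C
  gap_lower : ∀ η, 0 ≤ η → η ≤ η₀ → ∀ u, c * (η ^ 2 + min 1 (u ^ 2)) ≤ pairGap μ η u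
  gap_upper : ∀ η, 0 ≤ η → η ≤ η₀ → ∀ u, pairGap μ η u ≤ C * (η ^ 2 + min 1 (u ^ 2))
  var_lower : c ≤ pairVar μ 0
  var_sub : ∀ η, 0 ≤ η → η ≤ η₀ → |pairVar μ η - pairVar μ 0| ≤ C * η
  gap_zero : ∀ η, 0 < η → η ≤ η₀ → |pairGap μ η 0 / η ^ 2 - pairVar μ η| ≤ C * η ^ 2
  sinh_sub : ∀ η, 0 < η → η ≤ η₀ → |(∫ p : ℝ × ℝ, Real.exp (η * (p.1 + p.2)) *
    ((p.2 - p.1) * Real.sinh (η * (p.2 - p.1))) ∂(μ.prod μ)) / (2 * η) - pairVar μ η| ≤ C * η ^ 2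
  gap_small : ∀ η, 0 ≤ η → η ≤ η₀ → ∀ u, u ≠ 0 → u ^ 2 ≤ 1 →
    |pairGap μ η u / (η ^ 2 + u ^ 2) - pairGap μ 0 u / u ^ 2 - (pairVar μ η - pairVar μ 0)| ≤
      C * (η ^ 2 + η * u ^ 2)
  gap_large : ∀ η, 0 ≤ η → η ≤ η₀ → ∀ u, 1 ≤ u ^ 2 →
    (1 + u ^ 2) * |pairGap μ η u / (η ^ 2 + u ^ 2) - pairGap μ 0 u / u ^ 2| ≤ C * η
  gap_untilted : ∀ u, u ≠ 0 → |pairGap μ 0 u / u ^ 2 - pairVar μ 0| ≤ C * u ^ 2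


lemma abs_sub_pow_le (p : ℝ × ℝ) (k : ℕ) : |p.2 - p.1| ^ k ≤ (|p.1| + |p.2|) ^ k :=
  pow_le_pow_left₀ (abs_nonneg _) (abs_sub_le_sum p) k

/-- With B the sum and D the difference of the pair, each functional is the mean of e^{ηB} times an
even function of D. Even Taylor expansions of cosh, cos and D sinh have no cubic term, so the
relative errors are of order η² and u²; only the weight e^{ηB} contributes to first order in η, and
it does so in the same way for all functionals. -/
theorem exists_pairBounds (μ : Measure ℝ) [IsProbabilityMeasure μ] (hμ : μ ≪ volume)
    (h0 : (0 : ℝ) ∈ naturalInterior μ) : ∃ η₀ c C, PairBounds μ η₀ c C := by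
  obtain ⟨δ, hδ, hint⟩ := exists_integrable_exp_mul_abs h0
  obtain ⟨c, hc, hlow⟩ := exists_le_integral_exp_mul_one_sub_cos μ hμ 1
  set V := ∫ p, pairWeight δ p ∂(μ.prod μ) with hV
  have hV0 : 0 ≤ V := integral_nonneg fun p => by unfold pairWeight; positivity
  have hs0 : ∀ p : ℝ × ℝ, 0 ≤ |p.1| + |p.2| := fun p => by positivity
  have hexp1 : ∀ η : ℝ, 0 ≤ η → ∀ p : ℝ × ℝ, 1 ≤ Real.exp (η * (|p.1| + |p.2|)) := fun η hη p =>
    Real.one_le_exp (mul_nonneg hη (hs0 p))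
  have hD2 : ∀ p : ℝ × ℝ, (p.2 - p.1) ^ 2 ≤ (|p.1| + |p.2|) ^ 2 := fun p => by
    rw [← sq_abs]; exact abs_sub_pow_le p 2
  have hD4 : ∀ p : ℝ × ℝ, (p.2 - p.1) ^ 4 ≤ (|p.1| + |p.2|) ^ 4 := fun p => by
    have := abs_sub_pow_le p 4
    rwa [← abs_pow, abs_of_nonneg (by positivity)] at this
  -- The bound δ/4 is the range of the dominating weight; the bound 1 is the range of the uniform
  -- lower bound `hlow`.
  set η₀ := min 1 (δ / 4) with hη₀
  have hη1 : ∀ η, η ≤ η₀ → η ≤ 1 := fun η h => h.trans (min_le_left _ _)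
  have hηδ : ∀ η, η ≤ η₀ → η ≤ δ / 4 := fun η h => h.trans (min_le_right _ _)
  have hexpint : ∀ η, 0 ≤ η → η ≤ η₀ → Integrable (fun x => Real.exp (η * x)) μ := by
    intro η hη hη'
    refine hint.mono (by fun_prop) (ae_of_all _ fun x => ?_)
    rw [Real.norm_of_nonneg (Real.exp_pos _).le, Real.norm_of_nonneg (Real.exp_pos _).le,
      Real.exp_le_exp]
    have h1 := le_abs_self x
    have h2 := abs_nonneg x
    have h3 := hηδ η hη'
    nlinarith
  -- the hyperbolic part
  have hA : ∀ η, 0 ≤ η → η ≤ η₀ →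
      Integrable (fun p : ℝ × ℝ => Real.exp (η * (p.1 + p.2)) *
        (Real.cosh (η * (p.2 - p.1)) - 1)) (μ.prod μ) ∧
      |∫ p : ℝ × ℝ, Real.exp (η * (p.1 + p.2)) * (Real.cosh (η * (p.2 - p.1)) - 1) ∂(μ.prod μ)| ≤
        η ^ 2 * V := by
    intro η hη hη'
    refine weighted_dominated hδ hint hη (hηδ η hη') (k := 2) ?_ (by positivity) (by norm_num)
      fun p => ?_
    · exact (Real.continuous_cosh.measurable.comp (by fun_prop)).sub_const 1
    · have h1 := cosh_sub_one_le (η * (p.2 - p.1))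
      have h2 := Real.one_le_cosh (η * (p.2 - p.1))
      rw [abs_of_nonneg (by linarith)]
      refine h1.trans ?_
      rw [mul_pow, mul_assoc]
      exact mul_le_mul_of_nonneg_left (mul_le_mul (hD2 p) (exp_abs_mul_sub_le hη p)
        (Real.exp_pos _).le (by positivity)) (by positivity)
  -- the trigonometric part
  have hB : ∀ η, 0 ≤ η → η ≤ η₀ → ∀ u,
      Integrable (fun p : ℝ × ℝ => Real.exp (η * (p.1 + p.2)) *
        (1 - Real.cos (u * (p.2 - p.1)))) (μ.prod μ) ∧
      |∫ p : ℝ × ℝ, Real.exp (η * (p.1 + p.2)) * (1 - Real.cos (u * (p.2 - p.1))) ∂(μ.prod μ)| ≤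
        2 * V := by
    intro η hη hη' u
    refine weighted_dominated hδ hint hη (hηδ η hη') (k := 0) (by fun_prop) (by norm_num)
      (by norm_num) fun p => ?_
    have h1 := Real.cos_le_one (u * (p.2 - p.1))
    have h2 := Real.neg_one_le_cos (u * (p.2 - p.1))
    have h3 := hexp1 η hη p
    rw [abs_of_nonneg (by linarith)]
    linarith
  -- The quadratic bound for small u; with the previous bounded estimate it produces min(1, u²).
  have hB' : ∀ η, 0 ≤ η → η ≤ η₀ → ∀ u,
      |∫ p : ℝ × ℝ, Real.exp (η * (p.1 + p.2)) * (1 - Real.cos (u * (p.2 - p.1))) ∂(μ.prod μ)| ≤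
        u ^ 2 * V := by
    intro η hη hη' u
    refine (weighted_dominated hδ hint hη (hηδ η hη') (k := 2) (by fun_prop) (by positivity)
      (by norm_num) fun p => ?_).2
    have h1 := Real.cos_le_one (u * (p.2 - p.1))
    have h2 := one_sub_cos_le_sq (u * (p.2 - p.1))
    have h3 := hexp1 η hη p
    rw [abs_of_nonneg (by linarith)]
    have h4 := hD2 p
    calc _ ≤ (u * (p.2 - p.1)) ^ 2 := by nlinarith [sq_nonneg (u * (p.2 - p.1))]
      _ = u ^ 2 * ((p.2 - p.1) ^ 2 * 1) := by ring
      _ ≤ _ := by gcongr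
  have hgap : ∀ η, 0 ≤ η → η ≤ η₀ → ∀ u, pairGap μ η u =
      (∫ p : ℝ × ℝ, Real.exp (η * (p.1 + p.2)) * (Real.cosh (η * (p.2 - p.1)) - 1) ∂(μ.prod μ)) +
      ∫ p : ℝ × ℝ, Real.exp (η * (p.1 + p.2)) * (1 - Real.cos (u * (p.2 - p.1))) ∂(μ.prod μ) := by
    intro η hη hη' u
    rw [pairGap, ← integral_add (hA η hη hη').1 (hB η hη hη' u).1]
    refine integral_congr_ae (ae_of_all _ fun p => ?_)
    simp only
    ring
  have hVar : ∀ η, 0 ≤ η → η ≤ η₀ →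
      Integrable (fun p : ℝ × ℝ => Real.exp (η * (p.1 + p.2)) * ((p.2 - p.1) ^ 2 / 2))
        (μ.prod μ) := by
    intro η hη hη'
    refine (weighted_dominated hδ hint hη (hηδ η hη') (k := 2) (K := 1) (by fun_prop)
      (by norm_num) (by norm_num) fun p => ?_).1
    have h3 := hexp1 η hη p
    have h4 := hD2 p
    rw [abs_of_nonneg (by positivity)]
    nlinarith [sq_nonneg (p.2 - p.1), sq_nonneg (|p.1| + |p.2|)]
  have hvlow : ∀ η, 0 ≤ η → η ≤ η₀ → c ≤ pairVar μ η := by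
    intro η hη hη'
    have h1 := hlow η (by rw [abs_of_nonneg hη]; exact hη1 η hη') (hexpint η hη hη') 1
    simp only [one_pow, min_self, mul_one] at h1
    refine h1.trans (integral_mono (by simpa using (hB η hη hη' 1).1) (hVar η hη hη') fun p => ?_)
    have h2 := one_sub_cos_le_sq (1 * (p.2 - p.1))
    rw [one_mul] at h2
    simp only [one_mul]
    gcongr
  -- A single constant for all estimates: 10 covers every numerical factor below, and adding 1 makes
  -- it positive without a lower bound for V.
  have hCV : 0 ≤ 10 * V + 1 := by positivity
  have hle : ∀ x y : ℝ, 0 ≤ y → x ≤ 10 * V * y → x ≤ (10 * V + 1) * y := fun x y hy h => by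
    nlinarith
  refine ⟨η₀, c, 10 * V + 1, lt_min one_pos (by positivity), min_le_left _ _, hc, by positivity,
    ?_, ?_, hvlow 0 le_rfl (le_min zero_le_one (by positivity)), ?_, ?_, ?_, ?_, ?_, ?_⟩
  · intro η hη hη' u
    rw [hgap η hη hη' u, mul_add]
    refine add_le_add ?_ (hlow η (by rw [abs_of_nonneg hη]; exact hη1 η hη') (hexpint η hη hη') u)
    calc c * η ^ 2 ≤ pairVar μ η * η ^ 2 := by gcongr; exact hvlow η hη hη'
      _ = ∫ p : ℝ × ℝ, (Real.exp (η * (p.1 + p.2)) * ((p.2 - p.1) ^ 2 / 2)) * η ^ 2 ∂(μ.prod μ) := by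
          rw [pairVar, integral_mul_const]
      _ ≤ _ := by
          refine integral_mono ((hVar η hη hη').mul_const _) (hA η hη hη').1 fun p => ?_
          have h2 := sq_div_two_le_cosh_sub_one (η * (p.2 - p.1))
          simp only
          rw [mul_assoc]
          refine mul_le_mul_of_nonneg_left ?_ (Real.exp_pos _).le
          linarith [show (p.2 - p.1) ^ 2 / 2 * η ^ 2 = (η * (p.2 - p.1)) ^ 2 / 2 by ring]
  · intro η hη hη' u
    have hm : 0 ≤ min 1 (u ^ 2) := le_min zero_le_one (sq_nonneg u)
    refine hle _ _ (by positivity) ?_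
    rw [hgap η hη hη' u]
    have h1 := le_of_abs_le (hA η hη hη').2
    have h2 := le_of_abs_le (hB η hη hη' u).2
    have h3 := le_of_abs_le (hB' η hη hη' u)
    rcases min_cases 1 (u ^ 2) with ⟨e, _⟩ | ⟨e, _⟩ <;> rw [e] <;> nlinarith [sq_nonneg η, sq_nonneg u]
  · intro η hη hη'
    have := weighted_sub_dominated hδ hint hη (hηδ η hη') (f := fun p => (p.2 - p.1) ^ 2 / 2)
      (k := 2) (K := 1) (by fun_prop) (by norm_num) (by norm_num) fun p => by
        rw [abs_of_nonneg (by positivity)]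
        have := hD2 p
        nlinarith [sq_nonneg (p.2 - p.1)]
    have e : pairVar μ η - pairVar μ 0 = ∫ p : ℝ × ℝ, (Real.exp (η * (p.1 + p.2)) - 1) *
        ((p.2 - p.1) ^ 2 / 2) ∂(μ.prod μ) := by
      rw [pairVar, pairVar, ← integral_sub (hVar η hη hη')
        (hVar 0 le_rfl (le_min zero_le_one (by positivity)))]
      refine integral_congr_ae (ae_of_all _ fun p => ?_)
      simp only [zero_mul, Real.exp_zero]
      ring
    rw [e]
    refine hle _ _ hη (this.trans ?_)
    nlinarith
  · intro η hη hη'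
    have := weighted_dominated hδ hint hη.le (hηδ η hη') (k := 4) (K := η ^ 2)
      (f := fun p => (Real.cosh (η * (p.2 - p.1)) - 1) / η ^ 2 - (p.2 - p.1) ^ 2 / 2)
      (((Real.continuous_cosh.measurable.comp (by fun_prop)).sub_const 1).div_const _ |>.sub
        (by fun_prop)) (by positivity) (by norm_num) fun p => by
        have h1 := abs_cosh_sub_le (η * (p.2 - p.1))
        have e : (Real.cosh (η * (p.2 - p.1)) - 1) / η ^ 2 - (p.2 - p.1) ^ 2 / 2 =
            (Real.cosh (η * (p.2 - p.1)) - 1 - (η * (p.2 - p.1)) ^ 2 / 2) / η ^ 2 := by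
          field_simp
        rw [e, abs_div, abs_of_pos (show 0 < η ^ 2 by positivity), div_le_iff₀ (by positivity)]
        calc _ ≤ _ := h1
          _ = η ^ 4 * ((p.2 - p.1) ^ 4 * Real.exp |η * (p.2 - p.1)|) := by ring
          _ ≤ η ^ 4 * ((|p.1| + |p.2|) ^ 4 * Real.exp (η * (|p.1| + |p.2|))) :=
              mul_le_mul_of_nonneg_left (mul_le_mul (hD4 p) (exp_abs_mul_sub_le hη.le p)
                (Real.exp_pos _).le (by positivity)) (by positivity)
          _ = _ := by ring
    have e : pairGap μ η 0 / η ^ 2 - pairVar μ η = ∫ p : ℝ × ℝ, Real.exp (η * (p.1 + p.2)) *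
        ((Real.cosh (η * (p.2 - p.1)) - 1) / η ^ 2 - (p.2 - p.1) ^ 2 / 2) ∂(μ.prod μ) := by
      have h1 : pairGap μ η 0 = ∫ p : ℝ × ℝ, Real.exp (η * (p.1 + p.2)) *
          (Real.cosh (η * (p.2 - p.1)) - 1) ∂(μ.prod μ) := by simp [pairGap]
      rw [h1, pairVar, ← integral_div, ← integral_sub ((hA η hη.le hη').1.div_const _)
        (hVar η hη.le hη')]
      refine integral_congr_ae (ae_of_all _ fun p => ?_)
      simp only
      ring
    rw [e]
    refine hle _ _ (by positivity) (this.2.trans ?_)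
    nlinarith [mul_nonneg hV0 (sq_nonneg η)]
  · intro η hη hη'
    have := weighted_dominated hδ hint hη.le (hηδ η hη') (k := 4) (K := η ^ 2)
      (f := fun p => (p.2 - p.1) * (Real.sinh (η * (p.2 - p.1)) - η * (p.2 - p.1)) / (2 * η))
      (((measurable_snd.sub measurable_fst).mul ((Real.continuous_sinh.measurable.comp
        (by fun_prop)).sub (by fun_prop))).div_const _) (by positivity) (by norm_num) fun p => by
        have h1 := abs_sinh_sub_le (η * (p.2 - p.1))
        rw [abs_div, abs_of_pos (show 0 < 2 * η by positivity), div_le_iff₀ (by positivity), abs_mul]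
        calc |p.2 - p.1| * _ ≤ |p.2 - p.1| * _ := mul_le_mul_of_nonneg_left h1 (abs_nonneg _)
          _ = η ^ 3 * (|p.2 - p.1| ^ 4 * Real.exp |η * (p.2 - p.1)|) := by
              rw [abs_mul, abs_of_pos hη]; ring
          _ ≤ η ^ 3 * ((|p.1| + |p.2|) ^ 4 * Real.exp (η * (|p.1| + |p.2|))) :=
              mul_le_mul_of_nonneg_left (mul_le_mul (abs_sub_pow_le p 4)
                (exp_abs_mul_sub_le hη.le p) (Real.exp_pos _).le (by positivity)) (by positivity)
          _ ≤ 2 * (η ^ 3 * ((|p.1| + |p.2|) ^ 4 * Real.exp (η * (|p.1| + |p.2|)))) := by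
              have : 0 ≤ η ^ 3 * ((|p.1| + |p.2|) ^ 4 * Real.exp (η * (|p.1| + |p.2|))) := by
                positivity
              linarith
          _ = _ := by ring
    have e : (∫ p : ℝ × ℝ, Real.exp (η * (p.1 + p.2)) *
        ((p.2 - p.1) * Real.sinh (η * (p.2 - p.1))) ∂(μ.prod μ)) / (2 * η) - pairVar μ η =
        ∫ p : ℝ × ℝ, Real.exp (η * (p.1 + p.2)) *
          ((p.2 - p.1) * (Real.sinh (η * (p.2 - p.1)) - η * (p.2 - p.1)) / (2 * η)) ∂(μ.prod μ) := by
      rw [← integral_div, sub_eq_iff_eq_add, pairVar, ← integral_add this.1 (hVar η hη.le hη')]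
      refine integral_congr_ae (ae_of_all _ fun p => ?_)
      simp only
      field_simp
      ring
    rw [e]
    refine hle _ _ (by positivity) (this.2.trans ?_)
    nlinarith [mul_nonneg hV0 (sq_nonneg η)]
  · intro η hη hη' u hu hu1
    have h00 : (0 : ℝ) ≤ η₀ := hη.trans hη'
    -- The quadratic parts cancel exactly, since (η²D²/2 + u²D²/2)/(η² + u²) = D²/2; the quartic
    -- remainders leave a factor η².
    have hf1 := weighted_dominated hδ hint hη (hηδ η hη') (k := 4) (K := η ^ 2)
      (f := fun p => (Real.cosh (η * (p.2 - p.1)) - 1) / (η ^ 2 + u ^ 2) +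
        ((1 - Real.cos (u * (p.2 - p.1))) / (η ^ 2 + u ^ 2) -
          (1 - Real.cos (u * (p.2 - p.1))) / u ^ 2))
      ((((Real.continuous_cosh.measurable.comp (by fun_prop)).sub_const 1).div_const _).add
        (by fun_prop)) (by positivity) (by norm_num) fun p => by
        have h1 := abs_cosh_sub_le (η * (p.2 - p.1))
        have h2 := abs_cos_sub_le (u * (p.2 - p.1))
        have e : (Real.cosh (η * (p.2 - p.1)) - 1) / (η ^ 2 + u ^ 2) +
            ((1 - Real.cos (u * (p.2 - p.1))) / (η ^ 2 + u ^ 2) -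
            (1 - Real.cos (u * (p.2 - p.1))) / u ^ 2) =
            (u ^ 2 * (Real.cosh (η * (p.2 - p.1)) - 1 - (η * (p.2 - p.1)) ^ 2 / 2) +
              η ^ 2 * ((u * (p.2 - p.1)) ^ 2 / 2 - (1 - Real.cos (u * (p.2 - p.1))))) /
              (u ^ 2 * (η ^ 2 + u ^ 2)) := by
          field_simp
          ring
        have h3 := exp_abs_mul_sub_le hη p
        have h4 := hexp1 η hη p
        rw [e, abs_div, abs_of_pos (show 0 < u ^ 2 * (η ^ 2 + u ^ 2) by positivity),
          div_le_iff₀ (by positivity)]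
        calc _ ≤ |u ^ 2 * (Real.cosh (η * (p.2 - p.1)) - 1 - (η * (p.2 - p.1)) ^ 2 / 2)| +
              |η ^ 2 * ((u * (p.2 - p.1)) ^ 2 / 2 - (1 - Real.cos (u * (p.2 - p.1))))| :=
              abs_add_le _ _
          _ ≤ u ^ 2 * ((η * (p.2 - p.1)) ^ 4 * Real.exp |η * (p.2 - p.1)|) +
              η ^ 2 * (u * (p.2 - p.1)) ^ 4 := by
              rw [abs_mul, abs_mul, abs_of_nonneg (sq_nonneg u), abs_of_nonneg (sq_nonneg η)]
              exact add_le_add (mul_le_mul_of_nonneg_left h1 (sq_nonneg _))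
                (mul_le_mul_of_nonneg_left h2 (sq_nonneg _))
          _ = u ^ 2 * η ^ 4 * ((p.2 - p.1) ^ 4 * Real.exp |η * (p.2 - p.1)|) +
              η ^ 2 * u ^ 4 * ((p.2 - p.1) ^ 4 * 1) := by ring
          _ ≤ u ^ 2 * η ^ 4 * ((|p.1| + |p.2|) ^ 4 * Real.exp (η * (|p.1| + |p.2|))) +
              η ^ 2 * u ^ 4 * ((|p.1| + |p.2|) ^ 4 * Real.exp (η * (|p.1| + |p.2|))) := by
              refine add_le_add (mul_le_mul_of_nonneg_left (mul_le_mul (hD4 p) h3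
                (Real.exp_pos _).le (by positivity)) (by positivity)) 
                (mul_le_mul_of_nonneg_left (mul_le_mul (hD4 p) h4 zero_le_one (by positivity))
                (by positivity))
          _ = _ := by ring
    -- The mixed term: e^{ηB} - 1 supplies η, and the remainder of the cosine supplies u².
    have hf2 := weighted_sub_dominated hδ hint hη (hηδ η hη') (k := 4) (K := u ^ 2)
      (f := fun p => (1 - Real.cos (u * (p.2 - p.1))) / u ^ 2 - (p.2 - p.1) ^ 2 / 2)
      (by fun_prop) (by positivity) (by norm_num) fun p => by
        have h2 := abs_cos_sub_le (u * (p.2 - p.1))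
        rw [show (1 - Real.cos (u * (p.2 - p.1))) / u ^ 2 - (p.2 - p.1) ^ 2 / 2 =
          ((1 - Real.cos (u * (p.2 - p.1))) - (u * (p.2 - p.1)) ^ 2 / 2) / u ^ 2 by field_simp,
          abs_div, abs_of_pos (show 0 < u ^ 2 by positivity), div_le_iff₀ (by positivity),
          abs_sub_comm]
        refine h2.trans ?_
        rw [mul_pow]
        nlinarith [mul_le_mul_of_nonneg_left (hD4 p) (show 0 ≤ u ^ 4 by positivity)]
    have hg0 : pairGap μ 0 u = ∫ p : ℝ × ℝ, (1 - Real.cos (u * (p.2 - p.1))) ∂(μ.prod μ) := by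
      simp [pairGap]
    have hv0 : pairVar μ 0 = ∫ p : ℝ × ℝ, (p.2 - p.1) ^ 2 / 2 ∂(μ.prod μ) := by
      simp [pairVar]
    have i1 := (hA η hη hη').1
    have i2 := (hB η hη hη' u).1
    have i3 := hVar η hη hη'
    have i4 : Integrable (fun p : ℝ × ℝ => 1 - Real.cos (u * (p.2 - p.1))) (μ.prod μ) := by
      simpa using (hB 0 le_rfl h00 u).1
    have i5 : Integrable (fun p : ℝ × ℝ => (p.2 - p.1) ^ 2 / 2) (μ.prod μ) := by
      simpa using hVar 0 le_rfl h00
    have hf3 : Integrable (fun p : ℝ × ℝ => (Real.exp (η * (p.1 + p.2)) - 1) *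
        ((1 - Real.cos (u * (p.2 - p.1))) / u ^ 2 - (p.2 - p.1) ^ 2 / 2)) (μ.prod μ) := by
      have := ((i2.div_const (u ^ 2)).sub i3).sub ((i4.div_const (u ^ 2)).sub i5)
      refine this.congr (ae_of_all _ fun p => ?_)
      simp only [Pi.sub_apply]
      ring
    have i12 : Integrable (fun p : ℝ × ℝ => Real.exp (η * (p.1 + p.2)) *
        (Real.cosh (η * (p.2 - p.1)) - 1) + Real.exp (η * (p.1 + p.2)) *
        (1 - Real.cos (u * (p.2 - p.1)))) (μ.prod μ) := i1.add i2
    have i124 : Integrable (fun p : ℝ × ℝ => (Real.exp (η * (p.1 + p.2)) *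
        (Real.cosh (η * (p.2 - p.1)) - 1) + Real.exp (η * (p.1 + p.2)) *
        (1 - Real.cos (u * (p.2 - p.1)))) / (η ^ 2 + u ^ 2) -
        (1 - Real.cos (u * (p.2 - p.1))) / u ^ 2) (μ.prod μ) :=
      (i12.div_const _).sub (i4.div_const _)
    have i35 : Integrable (fun p : ℝ × ℝ => Real.exp (η * (p.1 + p.2)) * ((p.2 - p.1) ^ 2 / 2) -
        (p.2 - p.1) ^ 2 / 2) (μ.prod μ) := i3.sub i5
    have e : pairGap μ η u / (η ^ 2 + u ^ 2) - pairGap μ 0 u / u ^ 2 -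
        (pairVar μ η - pairVar μ 0) =
        (∫ p : ℝ × ℝ, Real.exp (η * (p.1 + p.2)) *
          ((Real.cosh (η * (p.2 - p.1)) - 1) / (η ^ 2 + u ^ 2) +
          ((1 - Real.cos (u * (p.2 - p.1))) / (η ^ 2 + u ^ 2) -
          (1 - Real.cos (u * (p.2 - p.1))) / u ^ 2)) ∂(μ.prod μ)) +
        ∫ p : ℝ × ℝ, (Real.exp (η * (p.1 + p.2)) - 1) *
          ((1 - Real.cos (u * (p.2 - p.1))) / u ^ 2 - (p.2 - p.1) ^ 2 / 2) ∂(μ.prod μ) := by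
      rw [hgap η hη hη' u, hg0, hv0, pairVar, ← integral_add i1 i2, ← integral_div,
        ← integral_div, ← integral_sub i3 i5, ← integral_sub (i12.div_const _)
        (i4.div_const _), ← integral_sub i124 i35, ← integral_add hf1.1 hf3]
      refine integral_congr_ae (ae_of_all _ fun p => ?_)
      beta_reduce
      ring
    rw [e]
    refine hle _ _ (by positivity) ((abs_add_le _ _).trans ((add_le_add hf1.2 hf2).trans ?_))
    nlinarith [mul_nonneg hV0 (sq_nonneg η), mul_nonneg hV0 (mul_nonneg hη (sq_nonneg u))]
  · intro η hη hη' u hu1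
    have h00 : (0 : ℝ) ≤ η₀ := hη.trans hη'
    have hu0 : 0 < u ^ 2 := by linarith
    have hg0 : pairGap μ 0 u = ∫ p : ℝ × ℝ, (1 - Real.cos (u * (p.2 - p.1))) ∂(μ.prod μ) := by
      simp [pairGap]
    have i2 := (hB η hη hη' u).1
    have i4 : Integrable (fun p : ℝ × ℝ => 1 - Real.cos (u * (p.2 - p.1))) (μ.prod μ) := by
      simpa using (hB 0 le_rfl h00 u).1
    have b1 := (hA η hη hη').2
    have b4 : |pairGap μ 0 u| ≤ 2 * V := by
      rw [hg0]
      simpa using (hB 0 le_rfl h00 u).2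
    have hf2 := weighted_sub_dominated hδ hint hη (hηδ η hη') (k := 0) (K := 2)
      (f := fun p => 1 - Real.cos (u * (p.2 - p.1))) (by fun_prop) (by norm_num) (by norm_num)
      fun p => by
        have h1 := Real.cos_le_one (u * (p.2 - p.1))
        have h2 := Real.neg_one_le_cos (u * (p.2 - p.1))
        rw [abs_of_nonneg (by linarith)]
        linarith
    -- For |u| ≥ 1 no cancellation is needed: the change of weight alone is O(η), and the
    -- denominator η² + u² absorbs the prefactor 1 + u².
    have e2 : (∫ p : ℝ × ℝ, Real.exp (η * (p.1 + p.2)) * (1 - Real.cos (u * (p.2 - p.1)))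
        ∂(μ.prod μ)) = pairGap μ 0 u + ∫ p : ℝ × ℝ, (Real.exp (η * (p.1 + p.2)) - 1) *
          (1 - Real.cos (u * (p.2 - p.1))) ∂(μ.prod μ) := by
      rw [hg0, ← sub_eq_iff_eq_add', ← integral_sub i2 i4]
      refine integral_congr_ae (ae_of_all _ fun p => ?_)
      simp only
      ring
    rw [hgap η hη hη' u, e2]
    set a := ∫ p : ℝ × ℝ, Real.exp (η * (p.1 + p.2)) * (Real.cosh (η * (p.2 - p.1)) - 1)
      ∂(μ.prod μ)
    set b := ∫ p : ℝ × ℝ, (Real.exp (η * (p.1 + p.2)) - 1) * (1 - Real.cos (u * (p.2 - p.1)))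
      ∂(μ.prod μ)
    set g := pairGap μ 0 u
    have e3 : (a + (g + b)) / (η ^ 2 + u ^ 2) - g / u ^ 2 =
        (a + b - g * η ^ 2 / u ^ 2) / (η ^ 2 + u ^ 2) := by
      have hu : u ≠ 0 := fun h => by simp [h] at hu0
      have : η ^ 2 + u ^ 2 ≠ 0 := by positivity
      field_simp
      ring
    have h5 : |a + b - g * η ^ 2 / u ^ 2| ≤ 5 * V * η := by
      have h6 : |g * η ^ 2 / u ^ 2| ≤ 2 * V * η ^ 2 := by
        rw [abs_div, abs_mul, abs_of_nonneg (sq_nonneg η), abs_of_pos hu0, div_le_iff₀ hu0]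
        calc |g| * η ^ 2 ≤ 2 * V * η ^ 2 * 1 := by rw [mul_one]; gcongr
          _ ≤ _ := by gcongr
      have h7 : η ^ 2 ≤ η := by nlinarith [hη1 η hη']
      have h8 : V * η ^ 2 ≤ V * η := by gcongr
      calc _ ≤ |a| + |b| + |g * η ^ 2 / u ^ 2| := (abs_sub _ _).trans
            (add_le_add (abs_add_le _ _) le_rfl)
        _ ≤ η ^ 2 * V + η * 2 * V + 2 * V * η ^ 2 := add_le_add (add_le_add b1 hf2) h6
        _ ≤ _ := by nlinarith
    have h9 : 0 < η ^ 2 + u ^ 2 := by positivity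
    rw [e3, abs_div, abs_of_pos h9, mul_div_assoc', div_le_iff₀ h9]
    calc (1 + u ^ 2) * _ ≤ (2 * (η ^ 2 + u ^ 2)) * (5 * V * η) := by
          refine mul_le_mul ?_ h5 (abs_nonneg _) (by positivity)
          nlinarith [sq_nonneg η]
      _ = 10 * V * η * (η ^ 2 + u ^ 2) := by ring
      _ ≤ _ := by
          have : 0 ≤ η * (η ^ 2 + u ^ 2) := by positivity
          nlinarith
  · intro u hu
    have h00 : (0 : ℝ) ≤ η₀ := le_min zero_le_one (by positivity)
    have hf1 := weighted_dominated hδ hint le_rfl (hηδ 0 h00) (k := 4) (K := u ^ 2)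
      (f := fun p => (1 - Real.cos (u * (p.2 - p.1))) / u ^ 2 - (p.2 - p.1) ^ 2 / 2)
      (by fun_prop) (by positivity) (by norm_num) fun p => by
        have h2 := abs_cos_sub_le (u * (p.2 - p.1))
        rw [show (1 - Real.cos (u * (p.2 - p.1))) / u ^ 2 - (p.2 - p.1) ^ 2 / 2 =
          ((1 - Real.cos (u * (p.2 - p.1))) - (u * (p.2 - p.1)) ^ 2 / 2) / u ^ 2 by field_simp,
          abs_div, abs_of_pos (show 0 < u ^ 2 by positivity), div_le_iff₀ (by positivity),
          abs_sub_comm]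
        refine h2.trans ?_
        rw [mul_pow, zero_mul, Real.exp_zero]
        nlinarith [mul_le_mul_of_nonneg_left (hD4 p) (show 0 ≤ u ^ 4 by positivity)]
    have i4 : Integrable (fun p : ℝ × ℝ => 1 - Real.cos (u * (p.2 - p.1))) (μ.prod μ) := by
      simpa using (hB 0 le_rfl h00 u).1
    have i5 : Integrable (fun p : ℝ × ℝ => (p.2 - p.1) ^ 2 / 2) (μ.prod μ) := by
      simpa using hVar 0 le_rfl h00
    have e : pairGap μ 0 u / u ^ 2 - pairVar μ 0 = ∫ p : ℝ × ℝ, Real.exp (0 * (p.1 + p.2)) *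
        ((1 - Real.cos (u * (p.2 - p.1))) / u ^ 2 - (p.2 - p.1) ^ 2 / 2) ∂(μ.prod μ) := by
      simp only [pairGap, pairVar, zero_mul, Real.exp_zero, one_mul, Real.cosh_zero]
      rw [← integral_div, ← integral_sub (i4.div_const _) i5]
    rw [e]
    refine hle _ _ (by positivity) (hf1.2.trans ?_)
    nlinarith [mul_nonneg hV0 (sq_nonneg u)]

end PairExpansion

/-! ### Logarithmic gap ratios, their Poisson integrals and the ladder moments. -/

section LogRatio

lemma abs_log_sub_log_le {x y m : ℝ} (hm : 0 < m) (hx : m ≤ x) (hy : m ≤ y) :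
    |Real.log x - Real.log y| ≤ |x - y| / m := by
  have key : ∀ a b : ℝ, m ≤ a → m ≤ b → Real.log a - Real.log b ≤ |a - b| / m := by
    intro a b ha hb
    have ha0 := hm.trans_le ha
    have hb0 := hm.trans_le hb
    rw [← Real.log_div ha0.ne' hb0.ne']
    calc _ ≤ a / b - 1 := Real.log_le_sub_one_of_pos (by positivity)
      _ = (a - b) / b := by field_simp
      _ ≤ |a - b| / b := by gcongr; exact le_abs_self _
      _ ≤ _ := by gcongr
  rw [abs_le]
  have h1 := key x y hx hy
  have h2 := key y x hy hx
  rw [abs_sub_comm] at h2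
  constructor <;> linarith

lemma min_one_sq_le (u : ℝ) : min 1 (u ^ 2) * (1 + u ^ 2) ≤ 2 * u ^ 2 := by
  have := sq_nonneg u
  rcases min_cases 1 (u ^ 2) with ⟨e, h⟩ | ⟨e, h⟩ <;> rw [e] <;> nlinarith

/-- The pair gap relative to that of a Laplace-type reference law. -/
def gapRatio (μ : Measure ℝ) (η u : ℝ) : ℝ := pairGap μ η u * ((1 + u ^ 2) / (η ^ 2 + u ^ 2))

lemma measurable_pairGap (μ : Measure ℝ) [IsProbabilityMeasure μ] (η : ℝ) :
    Measurable (pairGap μ η) := by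
  unfold pairGap
  refine (StronglyMeasurable.integral_prod_right (f := fun (u : ℝ) (p : ℝ × ℝ) =>
    Real.exp (η * (p.1 + p.2)) * (Real.cosh (η * (p.2 - p.1)) - Real.cos (u * (p.2 - p.1))))
    (Measurable.stronglyMeasurable ?_)).measurable
  have : Measurable fun q : ℝ × (ℝ × ℝ) => Real.cosh (η * (q.2.2 - q.2.1)) :=
    Real.continuous_cosh.measurable.comp (by fun_prop)
  unfold Function.uncurry
  fun_prop

lemma measurable_gapRatio (μ : Measure ℝ) [IsProbabilityMeasure μ] (η : ℝ) :
    Measurable (gapRatio μ η) := by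
  have := measurable_pairGap μ η
  unfold gapRatio
  fun_prop

namespace PairBounds

variable {μ : Measure ℝ} {η₀ c C : ℝ}

lemma gapRatio_bounds (h : PairBounds μ η₀ c C) {η : ℝ} (hη : 0 ≤ η) (hη' : η ≤ η₀) {u : ℝ}
    (hu : 0 < η ^ 2 + u ^ 2) : c ≤ gapRatio μ η u ∧ gapRatio μ η u ≤ 4 * C := by
  have h1 : η ^ 2 ≤ 1 := by nlinarith [h.η₀_le]
  obtain ⟨b1, b2⟩ := ratio_bounds h1 hu
  have h2 := h.gap_lower η hη hη' u
  have h3 := h.gap_upper η hη hη' u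
  have h4 : 0 ≤ (1 + u ^ 2) / (η ^ 2 + u ^ 2) := by positivity
  have hc := h.c_pos
  have hC := h.C_pos
  unfold gapRatio
  constructor
  · calc c ≤ c * ((η ^ 2 + min 1 (u ^ 2)) * ((1 + u ^ 2) / (η ^ 2 + u ^ 2))) := by nlinarith
      _ = c * (η ^ 2 + min 1 (u ^ 2)) * ((1 + u ^ 2) / (η ^ 2 + u ^ 2)) := by ring
      _ ≤ _ := by gcongr
  · calc _ ≤ C * (η ^ 2 + min 1 (u ^ 2)) * ((1 + u ^ 2) / (η ^ 2 + u ^ 2)) := by gcongr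
      _ = C * ((η ^ 2 + min 1 (u ^ 2)) * ((1 + u ^ 2) / (η ^ 2 + u ^ 2))) := by ring
      _ ≤ _ := by nlinarith

lemma gap_div_bounds (h : PairBounds μ η₀ c C) {η : ℝ} (hη : 0 < η) (hη' : η ≤ η₀) :
    c ≤ pairGap μ η 0 / η ^ 2 ∧ pairGap μ η 0 / η ^ 2 ≤ C := by
  have h2 := h.gap_lower η hη.le hη' 0
  have h3 := h.gap_upper η hη.le hη' 0
  rw [le_div_iff₀ (by positivity), div_le_iff₀ (by positivity)]
  norm_num at h2 h3
  exact ⟨h2, h3⟩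

set_option maxHeartbeats 1000000 in
-- Tilting changes the logarithm of the gap to first order in η, but this change is almost constant
-- for small u. Normalizing by the value at u = 0 removes it up to η², and the remaining linear term
-- carries min(1, u²). This is what makes the Poisson integral at height η differ from the untilted
-- one only by O(η²).
lemma exists_log_bounds (h : PairBounds μ η₀ c C) : ∃ T, 0 < T ∧
    (∀ u, u ≠ 0 → |Real.log (gapRatio μ 0 u) - Real.log (pairVar μ 0)| ≤ T * min 1 (u ^ 2)) ∧
    ∀ η, 0 < η → η ≤ η₀ → ∀ u, u ≠ 0 →
      |(Real.log (gapRatio μ η u) - Real.log (pairGap μ η 0 / η ^ 2)) -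
        (Real.log (gapRatio μ 0 u) - Real.log (pairVar μ 0))| ≤
        T * (η ^ 2 + η * min 1 (u ^ 2)) := by
  have hc := h.c_pos
  have hC := h.C_pos
  have hk := h.var_lower
  set k := pairVar μ 0 with hkdef
  have hk0 : 0 < k := hc.trans_le hk
  have hη₀ := h.η₀_pos
  have H0b : ∀ u : ℝ, u ≠ 0 → c ≤ gapRatio μ 0 u ∧ gapRatio μ 0 u ≤ 4 * C := fun u hu =>
    h.gapRatio_bounds le_rfl hη₀.le (by positivity)
  have e0 : ∀ u, gapRatio μ 0 u = pairGap μ 0 u / u ^ 2 * (1 + u ^ 2) := by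
    intro u
    rw [gapRatio, zero_pow two_ne_zero, zero_add]
    ring
  have eη : ∀ η u, gapRatio μ η u = pairGap μ η u / (η ^ 2 + u ^ 2) * (1 + u ^ 2) := by
    intro η u
    rw [gapRatio]
    ring
  set T := 2 * (k * C + 8 * C * C) / c ^ 2 + (5 * C + k) / c with hT
  have hT1 : 2 * (k * C + 8 * C * C) / c ^ 2 ≤ T := by
    rw [hT]; have : 0 ≤ (5 * C + k) / c := by positivity
    linarith
  have hT2 : (5 * C + k) / c ≤ T := by
    rw [hT]; have : 0 ≤ 2 * (k * C + 8 * C * C) / c ^ 2 := by positivity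
    linarith
  refine ⟨T, by positivity, ?_, ?_⟩
  · intro u hu
    obtain ⟨b1, b2⟩ := H0b u hu
    have hm0 : 0 ≤ min 1 (u ^ 2) := le_min zero_le_one (sq_nonneg u)
    refine (abs_log_sub_log_le hc b1 hk).trans (le_trans ?_
      (mul_le_mul_of_nonneg_right hT2 hm0))
    rw [div_mul_eq_mul_div]
    gcongr
    rcases le_total (u ^ 2) 1 with hu1 | hu1
    · rw [min_eq_right hu1]
      have h1 := h.gap_untilted u hu
      have h2 : gapRatio μ 0 u - k = (pairGap μ 0 u / u ^ 2 - k) + u ^ 2 * (pairGap μ 0 u / u ^ 2) := by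
        rw [e0]; ring
      have h3 : 0 ≤ pairGap μ 0 u / u ^ 2 := by
        have : 0 ≤ gapRatio μ 0 u := hc.le.trans b1
        rw [e0] at this
        exact nonneg_of_mul_nonneg_left this (by positivity)
      have h4 : pairGap μ 0 u / u ^ 2 ≤ 4 * C := by
        rw [e0] at b2
        nlinarith [sq_nonneg u]
      rw [h2]
      refine (abs_add_le _ _).trans ?_
      rw [abs_of_nonneg (mul_nonneg (sq_nonneg u) h3)]
      nlinarith [sq_nonneg u, mul_le_mul_of_nonneg_left h4 (sq_nonneg u)]
    · rw [min_eq_left hu1, abs_le]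
      constructor <;> linarith
  · intro η hη hη' u hu
    obtain ⟨b1, b2⟩ := H0b u hu
    obtain ⟨d1, d2⟩ := h.gapRatio_bounds hη.le hη' (u := u) (by positivity)
    obtain ⟨a1, a2⟩ := h.gap_div_bounds hη hη'
    set a := pairGap μ η 0 / η ^ 2 with ha
    have hη1 : η ≤ 1 := hη'.trans h.η₀_le
    have hav : |a - pairVar μ η| ≤ C * η ^ 2 := h.gap_zero η hη hη'
    have hvv : |pairVar μ η - k| ≤ C * η := h.var_sub η hη.le hη'
    have hG0 : 0 < gapRatio μ 0 u := hc.trans_le b1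
    have hG : 0 < gapRatio μ η u := hc.trans_le d1
    have ha0 : 0 < a := hc.trans_le a1
    -- Four logarithms become a difference of two, whose arguments are both at least c²; it suffices
    -- to compare cross products.
    have hlog : (Real.log (gapRatio μ η u) - Real.log a) - (Real.log (gapRatio μ 0 u) - Real.log k)
        = Real.log (gapRatio μ η u * k) - Real.log (a * gapRatio μ 0 u) := by
      rw [Real.log_mul hG.ne' hk0.ne', Real.log_mul ha0.ne' hG0.ne']
      ring
    have hm0 : 0 ≤ min 1 (u ^ 2) := le_min zero_le_one (sq_nonneg u)
    have hr : 0 ≤ η ^ 2 + η * min 1 (u ^ 2) := by positivity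
    rw [hlog]
    refine (abs_log_sub_log_le (m := c ^ 2) (by positivity) (by nlinarith) (by nlinarith)).trans
      (le_trans ?_ (mul_le_mul_of_nonneg_right hT1 hr))
    refine le_trans (div_le_div_of_nonneg_right ?_ (sq_nonneg c)) (div_mul_eq_mul_div _ _ _).ge
    rw [eη, e0]
    rw [e0] at b1 b2 hG0
    rw [eη] at d1 d2 hG
    set Hη := pairGap μ η u / (η ^ 2 + u ^ 2) with hHη
    set H0 := pairGap μ 0 u / u ^ 2 with hH0
    have hu2 : 0 < 1 + u ^ 2 := by positivity
    have hH0p : 0 < H0 := (mul_pos_iff_of_pos_right hu2).1 hG0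
    have hfac : Hη * (1 + u ^ 2) * k - a * (H0 * (1 + u ^ 2)) = (1 + u ^ 2) * (Hη * k - a * H0) := by
      ring
    rw [hfac, abs_mul, abs_of_pos hu2]
    rcases le_total (u ^ 2) 1 with hu1 | hu1
    · rw [min_eq_right hu1]
      have g1 := h.gap_small η hη.le hη' u hu hu1
      have g2 := h.gap_untilted u hu
      rw [← hHη, ← hH0, ← hkdef] at g1
      rw [← hH0, ← hkdef] at g2
      -- The first-order change of the variance enters both Hη and a; removing it leaves terms of
      -- order η² + ηu², η·u² and η².
      have hsplit : Hη * k - a * H0 = k * (Hη - H0 - (pairVar μ η - k)) +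
          ((pairVar μ η - k) * (k - H0) - (a - pairVar μ η) * H0) := by ring
      have hH4 : H0 ≤ 4 * C := by nlinarith [sq_nonneg u]
      have t1 : |k * (Hη - H0 - (pairVar μ η - k))| ≤ k * (C * (η ^ 2 + η * u ^ 2)) := by
        rw [abs_mul, abs_of_pos hk0]; gcongr
      have t2 : |(pairVar μ η - k) * (k - H0)| ≤ (C * η) * (C * u ^ 2) := by
        rw [abs_mul, abs_sub_comm k]
        exact mul_le_mul hvv g2 (abs_nonneg _) (by positivity)
      have t3 : |(a - pairVar μ η) * H0| ≤ (C * η ^ 2) * (4 * C) := by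
        rw [abs_mul, abs_of_pos hH0p]
        exact mul_le_mul hav hH4 hH0p.le (by positivity)
      have t4 : |Hη * k - a * H0| ≤ (k * C + 8 * C * C) * (η ^ 2 + η * u ^ 2) := by
        rw [hsplit]
        refine (abs_add_le _ _).trans ((add_le_add t1 ((abs_sub _ _).trans
          (add_le_add t2 t3))).trans ?_)
        have : 0 ≤ C * C * η ^ 2 := by positivity
        have : 0 ≤ C * C * (η * u ^ 2) := by positivity
        nlinarith
      have : 0 ≤ (k * C + 8 * C * C) * (η ^ 2 + η * u ^ 2) := by positivity
      calc _ ≤ 2 * ((k * C + 8 * C * C) * (η ^ 2 + η * u ^ 2)) :=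
            mul_le_mul (by linarith) t4 (abs_nonneg _) (by norm_num)
        _ = _ := by ring
    · rw [min_eq_left hu1]
      have g1 := h.gap_large η hη.le hη' u hu1
      rw [← hHη, ← hH0] at g1
      have hsplit : (1 + u ^ 2) * (Hη * k - a * H0) =
          k * ((1 + u ^ 2) * (Hη - H0)) - (a - k) * (H0 * (1 + u ^ 2)) := by ring
      have hak : |a - k| ≤ 2 * C * η := by
        have : a - k = (a - pairVar μ η) + (pairVar μ η - k) := by ring
        rw [this]
        refine (abs_add_le _ _).trans ((add_le_add hav hvv).trans ?_)
        have : η ^ 2 ≤ η := by nlinarith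
        nlinarith
      have t1 : |k * ((1 + u ^ 2) * (Hη - H0))| ≤ k * (C * η) := by
        rw [abs_mul, abs_mul, abs_of_pos hk0, abs_of_pos hu2]; gcongr
      have t3 : |(a - k) * (H0 * (1 + u ^ 2))| ≤ (2 * C * η) * (4 * C) := by
        rw [abs_mul, abs_of_pos hG0]
        exact mul_le_mul hak b2 hG0.le (by positivity)
      rw [← abs_of_pos hu2, ← abs_mul, hsplit]
      refine (abs_sub _ _).trans ((add_le_add t1 t3).trans ?_)
      have : 0 ≤ (k * C + 8 * C * C) * η ^ 2 := by positivity
      have : 0 ≤ (k * C + 8 * C * C) * η := by positivity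
      nlinarith

end PairBounds

/-- The kernel satisfies P_λ(u) = λ/(πu²) - λ² P_λ(u)/u². As f/u² is bounded and P_λ has mass 1, the
second term contributes O(λ²). -/
lemma cauchyKernel_expansion {f : ℝ → ℝ} (hf : Measurable f) {T : ℝ} (hT : 0 ≤ T)
    (hb : ∀ u, u ≠ 0 → |f u| ≤ T * min 1 (u ^ 2)) {lam : ℝ} (hl : 0 < lam) :
    Integrable (fun u => cauchyKernel lam u * f u) ∧
    |(∫ u, cauchyKernel lam u * f u) - lam * (Real.pi⁻¹ * ∫ u, f u / u ^ 2)| ≤ T * lam ^ 2 := by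
  have hne : ∀ᵐ u : ℝ, u ≠ 0 := by simp [ae_iff]
  have hm := (continuous_cauchyKernel hl).measurable
  have i1 : Integrable (fun u => cauchyKernel lam u * f u) := by
    refine ((integrable_cauchyKernel hl).mul_const T).mono (by fun_prop) ?_
    filter_upwards [hne] with u hu
    rw [norm_mul, Real.norm_of_nonneg (cauchyKernel_nonneg hl u), Real.norm_eq_abs, norm_mul,
      Real.norm_of_nonneg (cauchyKernel_nonneg hl u), Real.norm_of_nonneg hT]
    refine mul_le_mul_of_nonneg_left ((hb u hu).trans ?_) (cauchyKernel_nonneg hl u)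
    exact mul_le_of_le_one_right hT (min_le_left _ _)
  have hb' : ∀ u, u ≠ 0 → |f u / u ^ 2| ≤ T * 2 * (1 + u ^ 2)⁻¹ := by
    intro u hu
    have hu2 : 0 < u ^ 2 := by positivity
    rw [abs_div, abs_of_pos hu2, div_le_iff₀ hu2]
    refine (hb u hu).trans ?_
    have := min_one_sq_le u
    have h2 : min 1 (u ^ 2) ≤ 2 * u ^ 2 * (1 + u ^ 2)⁻¹ := by
      rwa [← div_eq_mul_inv, le_div_iff₀ (by positivity)]
    calc _ ≤ T * (2 * u ^ 2 * (1 + u ^ 2)⁻¹) := by gcongr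
      _ = _ := by ring
  have i2 : Integrable (fun u => f u / u ^ 2) := by
    refine (integrable_inv_one_add_sq.const_mul (T * 2)).mono
      (hf.div (by fun_prop)).aestronglyMeasurable ?_
    filter_upwards [hne] with u hu
    exact (hb' u hu).trans (le_abs_self _)
  refine ⟨i1, ?_⟩
  rw [← mul_assoc, ← integral_const_mul, ← integral_sub i1 (i2.const_mul _)]
  have : T * lam ^ 2 = ∫ u, cauchyKernel lam u * (T * lam ^ 2) := by
    rw [integral_mul_const, integral_cauchyKernel hl, one_mul]
  rw [this]
  refine (abs_integral_le_integral_abs).trans (integral_mono_ae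
    (i1.sub (i2.const_mul _)).abs ((integrable_cauchyKernel hl).mul_const _) ?_)
  filter_upwards [hne] with u hu
  have hu2 : 0 < u ^ 2 := by positivity
  have e : cauchyKernel lam u * f u - lam * Real.pi⁻¹ * (f u / u ^ 2) =
      cauchyKernel lam u * (-(lam ^ 2 * (f u / u ^ 2))) := by
    rw [cauchyKernel]
    have : lam ^ 2 + u ^ 2 ≠ 0 := by positivity
    field_simp
    ring
  rw [e, abs_mul, abs_of_nonneg (cauchyKernel_nonneg hl u), abs_neg, abs_mul,
    abs_of_nonneg (sq_nonneg lam), mul_comm T]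
  have : |f u / u ^ 2| ≤ T := by
    rw [abs_div, abs_of_pos hu2, div_le_iff₀ hu2]
    exact (hb u hu).trans (by gcongr; exact min_le_right _ _)
  exact mul_le_mul_of_nonneg_left (mul_le_mul_of_nonneg_left this (sq_nonneg _))
    (cauchyKernel_nonneg hl u)

/-- The constant part contributes η² since the kernel has mass 1. For the other part P_η(u) ≤
η/(πu²), and the integral of min(1, u²)/u² is at most 2π, which gives 2η². -/
lemma integral_cauchyKernel_mul_le {f : ℝ → ℝ} (hf : Measurable f) {T η : ℝ} (hT : 0 ≤ T)
    (hη : 0 < η) (hb : ∀ u, u ≠ 0 → |f u| ≤ T * (η ^ 2 + η * min 1 (u ^ 2))) :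
    Integrable (fun u => cauchyKernel η u * f u) ∧
    |∫ u, cauchyKernel η u * f u| ≤ T * (3 * η ^ 2) := by
  have hne : ∀ᵐ u : ℝ, u ≠ 0 := by simp [ae_iff]
  have hm := (continuous_cauchyKernel hη).measurable
  have hpt : ∀ u, u ≠ 0 → |cauchyKernel η u * f u| ≤
      T * (cauchyKernel η u * η ^ 2 + η ^ 2 * (2 * Real.pi⁻¹ * (1 + u ^ 2)⁻¹)) := by
    intro u hu
    have hu2 : 0 < u ^ 2 := by positivity
    rw [abs_mul, abs_of_nonneg (cauchyKernel_nonneg hη u)]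
    refine (mul_le_mul_of_nonneg_left (hb u hu) (cauchyKernel_nonneg hη u)).trans ?_
    have h1 : cauchyKernel η u * (η * min 1 (u ^ 2)) ≤ η ^ 2 * (2 * Real.pi⁻¹ * (1 + u ^ 2)⁻¹) := by
      have := min_one_sq_le u
      have h2 : min 1 (u ^ 2) ≤ 2 * u ^ 2 * (1 + u ^ 2)⁻¹ := by
        rwa [← div_eq_mul_inv, le_div_iff₀ (by positivity)]
      have h3 : cauchyKernel η u ≤ Real.pi⁻¹ * η * (u ^ 2)⁻¹ := by
        rw [cauchyKernel, mul_div_assoc', ← div_eq_mul_inv]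
        have : u ^ 2 ≤ η ^ 2 + u ^ 2 := by nlinarith
        have := Real.pi_pos
        gcongr
      have hp := Real.pi_pos
      calc _ ≤ (Real.pi⁻¹ * η * (u ^ 2)⁻¹) * (η * (2 * u ^ 2 * (1 + u ^ 2)⁻¹)) := by
            gcongr
        _ = _ := by field_simp
    nlinarith [mul_le_mul_of_nonneg_left h1 hT]
  have i1 : Integrable (fun u => T * (cauchyKernel η u * η ^ 2 +
      η ^ 2 * (2 * Real.pi⁻¹ * (1 + u ^ 2)⁻¹))) :=
    (((integrable_cauchyKernel hη).mul_const _).add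
      ((integrable_inv_one_add_sq.const_mul _).const_mul _)).const_mul T
  have i2 : Integrable (fun u => cauchyKernel η u * f u) := by
    refine i1.mono (by fun_prop) ?_
    filter_upwards [hne] with u hu
    exact (hpt u hu).trans (le_abs_self _)
  refine ⟨i2, (abs_integral_le_integral_abs).trans ((integral_mono_ae i2.abs i1 ?_).trans ?_)⟩
  · filter_upwards [hne] with u hu
    exact hpt u hu
  · rw [integral_const_mul, integral_add ((integrable_cauchyKernel hη).mul_const _)
      ((integrable_inv_one_add_sq.const_mul _).const_mul _), integral_mul_const,
      integral_cauchyKernel hη, integral_const_mul, integral_const_mul,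
      integral_univ_inv_one_add_sq]
    have := Real.pi_pos.ne'
    apply le_of_eq
    field_simp
    ring

/-- The Spitzer-type constant governing the second moment of the ladder height. -/
def ladderConst (μ : Measure ℝ) : ℝ :=
  Real.pi⁻¹ * ∫ u, (Real.log (gapRatio μ 0 u) - Real.log (pairVar μ 0)) / u ^ 2

/-- Spitzer's formula puts the Laplace transform in the form 1 - λ √v e^{λ g(λ)}, where v is the
variance; the mass and two moments follow from the limit of g at 0. -/
theorem PairBounds.ladder_moments {μ : Measure ℝ} [IsProbabilityMeasure μ] {η₀ c C : ℝ}
    (h : PairBounds μ η₀ c C) (ν : Measure ℝ) [IsProbabilityMeasure ν] [NullSingletonClass ν]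
    (hsymm : ν.map (fun x => -x) = ν) (hν : ∀ u, (1 - charFun ν u).re = pairGap μ 0 u) :
    exitTotal ν (Set.Iic 0) Set.univ = 1 ∧
    Integrable (fun x => x ^ 2) (exitTotal ν (Set.Iic 0)) ∧
    ∫ x, x ∂(exitTotal ν (Set.Iic 0)) = √(pairVar μ 0) ∧
    ∫ x, x ^ 2 ∂(exitTotal ν (Set.Iic 0)) = 2 * √(pairVar μ 0) * (1 - ladderConst μ / 2) := by
  obtain ⟨T, hT, hb, -⟩ := h.exists_log_bounds
  set Δ := fun u => Real.log (gapRatio μ 0 u) - Real.log (pairVar μ 0) with hΔ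
  have hΔm : Measurable Δ := (Real.measurable_log.comp (measurable_gapRatio μ 0)).sub_const _
  have hk : 0 < pairVar μ 0 := h.c_pos.trans_le h.var_lower
  -- The term log(1 + λ) is the prefactor λ/(1 + λ) of Spitzer's formula; its slope 1 at 0 is the 1
  -- in ρ₊ = 1 - `ladderConst`/2.
  set g : ℝ → ℝ := fun lam => ((1 / 2) * (∫ u, cauchyKernel lam u * Δ u) - Real.log (1 + lam)) / lam
    with hg
  have hlap : ∀ lam > 0, 1 - ∫ x, Real.exp (-lam * x) ∂(exitTotal ν (Set.Iic 0)) =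
      lam * √(pairVar μ 0) * Real.exp (lam * g lam) := by
    intro lam hl
    have hlow : ∀ u, c * min 1 (u ^ 2) ≤ (1 - charFun ν u).re := fun u => by
      rw [hν]; simpa using h.gap_lower 0 le_rfl h.η₀_pos.le u
    have hup : ∀ u, (1 - charFun ν u).re ≤ C * min 1 (u ^ 2) := fun u => by
      rw [hν]; simpa using h.gap_upper 0 le_rfl h.η₀_pos.le u
    rw [one_sub_laplace_exitTotal hsymm h.c_pos hlow hup hl]
    have e1 : ∫ u, cauchyKernel lam u * Real.log ((1 - charFun ν u).re * ((1 + u ^ 2) / u ^ 2)) =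
        (∫ u, cauchyKernel lam u * Δ u) + Real.log (pairVar μ 0) := by
      have : Real.log (pairVar μ 0) = ∫ u, cauchyKernel lam u * Real.log (pairVar μ 0) := by
        rw [integral_mul_const, integral_cauchyKernel hl, one_mul]
      rw [this, ← integral_add (cauchyKernel_expansion hΔm hT.le hb hl).1
        ((integrable_cauchyKernel hl).mul_const _)]
      refine integral_congr_ae (ae_of_all _ fun u => ?_)
      simp only [hΔ, hν, gapRatio, zero_pow two_ne_zero, zero_add]
      ring
    have e2 : lam * g lam = (1 / 2) * (∫ u, cauchyKernel lam u * Δ u) - Real.log (1 + lam) := by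
      rw [hg]; field_simp
    rw [e1, e2, Real.exp_sub, Real.exp_log (by positivity), mul_add, Real.exp_add]
    have e3 : Real.exp (1 / 2 * Real.log (pairVar μ 0)) = √(pairVar μ 0) := by
      rw [Real.sqrt_eq_rpow, Real.rpow_def_of_pos hk, mul_comm]
    rw [e3]
    ring
  have hglim : Tendsto g (𝓝[>] 0) (𝓝 (ladderConst μ / 2 - 1)) := by
    have h1 : Tendsto (fun lam : ℝ => (∫ u, cauchyKernel lam u * Δ u) / lam) (𝓝[>] 0)
        (𝓝 (ladderConst μ)) := by
      rw [tendsto_iff_norm_sub_tendsto_zero]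
      have hz : Tendsto (fun lam : ℝ => T * lam) (𝓝[>] 0) (𝓝 0) := by
        have : Tendsto (fun lam : ℝ => T * lam) (𝓝 0) (𝓝 (T * 0)) :=
          (continuous_const.mul continuous_id).tendsto 0
        rw [mul_zero] at this
        exact this.mono_left nhdsWithin_le_nhds
      refine squeeze_zero' (Eventually.of_forall fun _ => norm_nonneg _) ?_ hz
      filter_upwards [self_mem_nhdsWithin] with lam hl
      have hl : 0 < lam := hl
      have := (cauchyKernel_expansion hΔm hT.le hb hl).2
      rw [Real.norm_eq_abs, ladderConst]
      have e : (∫ u, cauchyKernel lam u * Δ u) / lam - Real.pi⁻¹ * ∫ u, Δ u / u ^ 2 =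
          ((∫ u, cauchyKernel lam u * Δ u) - lam * (Real.pi⁻¹ * ∫ u, Δ u / u ^ 2)) / lam := by
        field_simp
      rw [e, abs_div, abs_of_pos hl, div_le_iff₀ hl]
      linarith [this]
    have h2 : Tendsto (fun lam : ℝ => Real.log (1 + lam) / lam) (𝓝[>] 0) (𝓝 1) := by
      have hd : HasDerivAt (fun x : ℝ => Real.log (1 + x)) 1 0 := by
        have := ((hasDerivAt_id (0 : ℝ)).const_add 1).log (by norm_num)
        simpa using this
      have := hd.tendsto_slope_zero_right
      refine this.congr fun x => ?_
      simp [div_eq_inv_mul]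
    have h3 := (h1.const_mul (1 / 2)).sub h2
    rw [show ladderConst μ / 2 - 1 = 1 / 2 * ladderConst μ - 1 by ring]
    refine h3.congr fun lam => ?_
    rw [hg]
    ring
  have : IsFiniteMeasure (exitTotal ν (Set.Iic 0)) :=
    ⟨(exitTotal_univ_le_one ν measurableSet_Iic).trans_lt ENNReal.one_lt_top⟩
  obtain ⟨m1, m2, m3, m4⟩ := moments_of_laplace exitTotal_Iio hglim hlap
  refine ⟨m1, m2, m3, m4.trans ?_⟩
  ring

end LogRatio

/-! ### The ladder height of the difference walk and its moments. -/

section Ladder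

lemma indepFun_fin_tuple {Ω β : Type*} [MeasurableSpace Ω] [MeasurableSpace β]
    {P : Measure Ω} {ξ : ℕ → Ω → β} (h : iIndepFun ξ P) (hξ : ∀ i, Measurable (ξ i)) (n : ℕ) :
    IndepFun (fun ω (i : Fin n) => ξ i ω) (ξ n) P := by
  have h1 := h.indepFun_finset (Finset.range n) {n} (by simp) hξ
  have m1 : Measurable fun (v : ↥(Finset.range n) → β) (i : Fin n) =>
      v ⟨i, Finset.mem_range.2 i.2⟩ := by fun_prop
  have m2 : Measurable fun (v : ↥({n} : Finset ℕ) → β) => v ⟨n, by simp⟩ := by fun_prop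
  exact h1.comp m1 m2

/-- For a fixed first coordinate the difference takes a given value at a single point, which is
Lebesgue-null; Fubini concludes. -/
lemma nullSingletonClass_map_sub {μ : Measure ℝ} [IsProbabilityMeasure μ] (hμ : μ ≪ volume)
    {m : Measure (ℝ × ℝ)} (hm : m ≪ μ.prod μ) :
    NullSingletonClass (m.map fun p => p.2 - p.1) := by
  refine ⟨fun x => ?_⟩
  rw [Measure.map_apply (by fun_prop) (measurableSet_singleton x)]
  apply hm
  have hs : MeasurableSet ((fun p : ℝ × ℝ => p.2 - p.1) ⁻¹' {x}) :=
    (show Measurable fun p : ℝ × ℝ => p.2 - p.1 by fun_prop) (measurableSet_singleton x)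
  rw [Measure.prod_apply hs]
  simp only [lintegral_eq_zero_iff (measurable_measure_prodMk_left hs)]
  refine ae_of_all _ fun y => hμ ?_
  have : Prod.mk y ⁻¹' ((fun p : ℝ × ℝ => p.2 - p.1) ⁻¹' {x}) = {x + y} := by
    ext z
    simp [sub_eq_iff_eq_add]
  rw [this]
  simp

/-- The law of the difference of an independent pair. -/
def diffLaw (μ : Measure ℝ) : Measure ℝ := (μ.prod μ).map fun p => p.2 - p.1

instance isProbabilityMeasure_diffLaw (μ : Measure ℝ) [IsProbabilityMeasure μ] :
    IsProbabilityMeasure (diffLaw μ) :=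
  Measure.isProbabilityMeasure_map (by fun_prop)

lemma diffLaw_eq_map_fst_sub (μ : Measure ℝ) [IsProbabilityMeasure μ] :
    diffLaw μ = (μ.prod μ).map fun p => p.1 - p.2 := by
  rw [diffLaw]
  conv_lhs => rw [← Measure.prod_swap]
  rw [Measure.map_map (by fun_prop) measurable_swap]
  rfl

lemma diffLaw_map_neg (μ : Measure ℝ) [IsProbabilityMeasure μ] :
    (diffLaw μ).map (fun x => -x) = diffLaw μ := by
  conv_rhs => rw [diffLaw_eq_map_fst_sub]
  rw [diffLaw, Measure.map_map (by fun_prop) (by fun_prop)]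
  congr 1
  ext p
  simp

lemma one_sub_charFun_diffLaw (μ : Measure ℝ) [IsProbabilityMeasure μ] (u : ℝ) :
    (1 - charFun (diffLaw μ) u).re = pairGap μ 0 u := by
  have hint : Integrable (fun p : ℝ × ℝ => Complex.exp (u * (p.2 - p.1 : ℝ) * Complex.I))
      (μ.prod μ) := by
    refine (integrable_const (1 : ℝ)).mono (by fun_prop) (ae_of_all _ fun p => ?_)
    rw [← Complex.ofReal_mul, Complex.norm_exp_ofReal_mul_I]
    simp
  rw [charFun_apply_real, diffLaw, integral_map (by fun_prop) (by fun_prop), Complex.sub_re,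
    Complex.one_re, ← RCLike.re_eq_complex_re, ← integral_re hint, pairGap]
  have h1 : (1 : ℝ) = ∫ p : ℝ × ℝ, (1 : ℝ) ∂(μ.prod μ) := by simp
  rw [h1, ← integral_sub (integrable_const _) hint.re]
  refine integral_congr_ae (ae_of_all _ fun p => ?_)
  simp only [RCLike.re_eq_complex_re]
  rw [← Complex.ofReal_mul, Complex.exp_ofReal_mul_I_re]
  simp

section Epoch

variable (μ : Measure ℝ) [IsProbabilityMeasure μ]

/-- The event that the difference walk first becomes positive at step `n + 1`. -/
def ladderEvent (n : ℕ) : Set (ℕ → ℝ × ℝ) :=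
  {y | (∀ k < n, diffWalk y (k + 1) ∈ Set.Iic (0 : ℝ)) ∧ diffWalk y (n + 1) ∉ Set.Iic (0 : ℝ)}

lemma measurable_diffWalk (n : ℕ) : Measurable fun y => diffWalk y n := by
  unfold diffWalk; fun_prop

lemma measurableSet_ladderEvent (n : ℕ) : MeasurableSet (ladderEvent n) := by
  have : ladderEvent n = (⋂ k, ⋂ (_ : k < n), (fun y => diffWalk y (k + 1)) ⁻¹' Set.Iic 0) ∩
      (fun y => diffWalk y (n + 1)) ⁻¹' (Set.Iic 0)ᶜ := by
    ext y
    simp [ladderEvent]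
  rw [this]
  exact (MeasurableSet.iInter fun k => MeasurableSet.iInter fun _ =>
    measurable_diffWalk _ measurableSet_Iic).inter (measurable_diffWalk _ measurableSet_Iic.compl)

lemma ladderEpoch_of_mem {n : ℕ} {y : ℕ → ℝ × ℝ} (h : y ∈ ladderEvent n) :
    ladderEpoch y = n + 1 := by
  simp only [ladderEvent, Set.mem_ofPred_eq, Set.mem_Iic, not_le] at h
  refine le_antisymm (Nat.sInf_le ⟨Nat.succ_pos n, h.2⟩) ?_
  refine le_csInf ⟨n + 1, Nat.succ_pos n, h.2⟩ ?_
  rintro m ⟨hm, hm'⟩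
  by_contra hlt
  obtain ⟨k, rfl⟩ : ∃ k, m = k + 1 := ⟨m - 1, by omega⟩
  exact absurd (h.1 k (by omega)) (not_le.2 hm')

lemma pairwise_disjoint_ladderEvent : Pairwise (Function.onFun Disjoint ladderEvent) := by
  intro i j hij
  refine Set.disjoint_left.2 fun y hi hj => hij ?_
  have h1 := ladderEpoch_of_mem hi
  have h2 := ladderEpoch_of_mem hj
  omega

lemma exists_mem_ladderEvent_iff (y : ℕ → ℝ × ℝ) :
    (∃ n, y ∈ ladderEvent n) ↔ ∃ n : ℕ, 0 < n ∧ 0 < diffWalk y n := by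
  constructor
  · rintro ⟨n, hn⟩
    exact ⟨n + 1, Nat.succ_pos n, by simpa using hn.2⟩
  · intro h
    have hm := Nat.sInf_mem (s := {n : ℕ | 0 < n ∧ 0 < diffWalk y n}) h
    obtain ⟨k, hk⟩ : ∃ k, ladderEpoch y = k + 1 := ⟨ladderEpoch y - 1, by
      have : 0 < ladderEpoch y := hm.1
      omega⟩
    refine ⟨k, fun j hj => ?_, ?_⟩
    · rw [Set.mem_Iic]
      by_contra hpos
      have : ladderEpoch y ≤ j + 1 := Nat.sInf_le ⟨Nat.succ_pos j, not_le.1 hpos⟩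
      omega
    · rw [← hk]
      exact fun hle => absurd hm.2 (not_lt.2 hle)

lemma measurable_ladderHeight : Measurable ladderHeight := by
  have hτ : Measurable ladderEpoch := by
    refine measurable_to_countable' fun m => ?_
    rcases m with _ | n
    -- The value 0 is the default of `sInf` on the empty set, as genuine ladder epochs are positive.
    · have : ladderEpoch ⁻¹' {0} = (⋃ n, ladderEvent n)ᶜ := by
        ext y
        rw [Set.mem_preimage, Set.mem_singleton_iff, Set.mem_compl_iff, Set.mem_iUnion,
          exists_mem_ladderEvent_iff]
        constructor
        · intro h hex
          have := (Nat.sInf_mem (s := {n : ℕ | 0 < n ∧ 0 < diffWalk y n}) hex).1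
          exact this.ne' h
        · intro h
          rw [ladderEpoch, Nat.sInf_eq_zero]
          right
          ext n
          simp only [Set.mem_ofPred_eq, Set.mem_empty_iff_false, iff_false]
          exact fun hn => h ⟨n, hn⟩
      rw [this]
      exact (MeasurableSet.iUnion measurableSet_ladderEvent).compl
    · have : ladderEpoch ⁻¹' {n + 1} = ladderEvent n := by
        ext y
        rw [Set.mem_preimage, Set.mem_singleton_iff]
        refine ⟨fun h => ?_, ladderEpoch_of_mem⟩
        have hex : ∃ n, y ∈ ladderEvent n := by
          rw [exists_mem_ladderEvent_iff]
          have hne : ladderEpoch y ≠ 0 := by omega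
          exact Nat.nonempty_of_pos_sInf (Nat.pos_of_ne_zero hne)
        obtain ⟨k, hk⟩ := hex
        have := ladderEpoch_of_mem hk
        have : k = n := by omega
        rwa [← this]
      rw [this]
      exact measurableSet_ladderEvent n
  have h1 : Measurable fun q : ℕ × (ℕ → ℝ × ℝ) => diffWalk q.2 q.1 :=
    measurable_from_prod_countable_right fun n => measurable_diffWalk n
  exact h1.comp (hτ.prodMk measurable_id)

lemma map_restrict_ladderEvent (n : ℕ) :
    ((pairLaw μ).restrict (ladderEvent n)).map (fun y => diffWalk y (n + 1)) =
      exitLaw (diffLaw μ) (Set.Iic 0) n := by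
  have hP : IsProbabilityMeasure (pairLaw μ) := by unfold pairLaw; infer_instance
  have hξ : ∀ i, Measurable fun y : ℕ → ℝ × ℝ => (y i).1 - (y i).2 := fun i => by fun_prop
  have hind : iIndepFun (fun i (y : ℕ → ℝ × ℝ) => (y i).1 - (y i).2) (pairLaw μ) :=
    iIndepFun_infinitePi (P := fun _ : ℕ => μ.prod μ)
      (X := fun _ (p : ℝ × ℝ) => p.1 - p.2) fun i => by fun_prop
  have := map_restrict_exit_eq_exitLaw (P := pairLaw μ) hξ (ν := diffLaw μ) (fun i => ?_)
    (fun n => indepFun_fin_tuple hind hξ n) (s := Set.Iic 0) measurableSet_Iic n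
  · exact this
  · rw [diffLaw_eq_map_fst_sub, ← Measure.infinitePi_map_eval (fun _ : ℕ => μ.prod μ) i,
      Measure.map_map (by fun_prop) (by fun_prop)]
    rfl

/-- The ladder events are disjoint and carry the exit laws, so full exit mass means both that the
walk almost surely becomes positive and that the default value of the epoch is never used. -/
theorem map_ladderHeight (h : exitTotal (diffLaw μ) (Set.Iic 0) Set.univ = 1) :
    (∀ᵐ y ∂(pairLaw μ), ∃ n : ℕ, 0 < n ∧ 0 < diffWalk y n) ∧
    (pairLaw μ).map ladderHeight = exitTotal (diffLaw μ) (Set.Iic 0) := by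
  have hP : IsProbabilityMeasure (pairLaw μ) := by unfold pairLaw; infer_instance
  have key : ((pairLaw μ).restrict (⋃ n, ladderEvent n)).map ladderHeight =
      exitTotal (diffLaw μ) (Set.Iic 0) := by
    rw [Measure.restrict_iUnion pairwise_disjoint_ladderEvent measurableSet_ladderEvent,
      Measure.map_sum measurable_ladderHeight.aemeasurable, exitTotal]
    congr 1
    ext1 n
    rw [← map_restrict_ladderEvent]
    refine Measure.map_congr ?_
    filter_upwards [ae_restrict_mem (measurableSet_ladderEvent n)] with y hy
    rw [ladderHeight, ladderEpoch_of_mem hy]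
  have h1 : pairLaw μ (⋃ n, ladderEvent n) = 1 := by
    rw [← h, ← key, Measure.map_apply measurable_ladderHeight MeasurableSet.univ,
      Set.preimage_univ, Measure.restrict_apply_univ]
  have h2 : ∀ᵐ y ∂(pairLaw μ), y ∈ ⋃ n, ladderEvent n :=
    (prob_compl_eq_zero_iff (MeasurableSet.iUnion measurableSet_ladderEvent)).2 h1
  refine ⟨?_, ?_⟩
  · filter_upwards [h2] with y hy
    rw [← exists_mem_ladderEvent_iff]
    exact Set.mem_iUnion.1 hy
  · rw [← key, Measure.restrict_eq_self_of_ae_mem h2]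

end Epoch

theorem ladderHeight_moments (μ : Measure ℝ) [IsProbabilityMeasure μ] (hμ : μ ≪ volume)
    (h0 : (0 : ℝ) ∈ naturalInterior μ) :
    (∀ᵐ y ∂(pairLaw μ), ∃ n : ℕ, 0 < n ∧ 0 < diffWalk y n) ∧
    Integrable (fun y => ladderHeight y ^ 2) (pairLaw μ) ∧
    meanOvershoot μ = 1 - ladderConst μ / 2 := by
  obtain ⟨η₀, c, C, hb⟩ := exists_pairBounds μ hμ h0
  have hna : NullSingletonClass (diffLaw μ) :=
    nullSingletonClass_map_sub hμ Measure.AbsolutelyContinuous.rfl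
  obtain ⟨m1, m2, m3, m4⟩ := hb.ladder_moments (diffLaw μ) (diffLaw_map_neg μ)
    (one_sub_charFun_diffLaw μ)
  obtain ⟨l1, l2⟩ := map_ladderHeight μ m1
  have hm := measurable_ladderHeight
  have hk : 0 < √(pairVar μ 0) := Real.sqrt_pos.2 (hb.c_pos.trans_le hb.var_lower)
  refine ⟨l1, ?_, ?_⟩
  · rw [← l2, integrable_map_measure (by fun_prop) hm.aemeasurable] at m2
    exact m2
  · rw [← l2, integral_map hm.aemeasurable (by fun_prop)] at m3 m4
    rw [meanOvershoot, m3, m4]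
    field_simp

end Ladder

/-! ### The drifting step law, its symmetrization and the survival probability. -/

section TiltedStep

lemma withDensity_map_eq {α β : Type*} [MeasurableSpace α] [MeasurableSpace β] (m : Measure α)
    {f : α → β} (hf : Measurable f) {g : β → ENNReal} (hg : Measurable g) :
    (m.map f).withDensity g = (m.withDensity (fun x => g (f x))).map f := by
  ext s hs
  rw [withDensity_apply _ hs, Measure.map_apply hf hs, withDensity_apply _ (hf hs),
    setLIntegral_map hs hg hf]

lemma integral_withDensity_ofReal {α E : Type*} [MeasurableSpace α] [NormedAddCommGroup E]
    [NormedSpace ℝ E] (m : Measure α) {g : α → ℝ} (hg : Measurable g) (h0 : ∀ x, 0 ≤ g x)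
    (f : α → E) : ∫ x, f x ∂(m.withDensity fun x => ENNReal.ofReal (g x)) = ∫ x, g x • f x ∂m := by
  rw [integral_withDensity_eq_integral_toReal_smul (by fun_prop) (ae_of_all _ fun x => by simp)]
  refine integral_congr_ae (ae_of_all _ fun x => ?_)
  simp only [ENNReal.toReal_ofReal (h0 x)]

variable (μ : Measure ℝ) [IsProbabilityMeasure μ]

/-- The law of `X' - X`, where `X` has the exponentially tilted law and `X'` the baseline law. -/
def stepLaw (ϑ : ℝ) : Measure ℝ :=
  ((μ.prod μ).withDensity fun p => ENNReal.ofReal (Real.exp (ϑ * p.1) / mgf id μ ϑ)).map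
    fun p => p.2 - p.1

/-- The probability that the walk with steps `X' - X` never becomes positive. -/
def survivalProb (ϑ : ℝ) : ℝ := 1 - (exitTotal (stepLaw μ ϑ) (Set.Iic 0)).real Set.univ

/-- The symmetrized version of `stepLaw`, a finite measure. -/
def symLaw (η : ℝ) : Measure ℝ :=
  ((μ.prod μ).withDensity fun p =>
    ENNReal.ofReal (Real.exp (η * (p.1 + p.2)) / mgf id μ (2 * η))).map fun p => p.2 - p.1

lemma mgf_pos_of_integrable {ϑ : ℝ} (h : Integrable (fun x => Real.exp (ϑ * x)) μ) :
    0 < mgf id μ ϑ := mgf_pos h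

lemma isProbabilityMeasure_stepLaw {ϑ : ℝ} (h : Integrable (fun x => Real.exp (ϑ * x)) μ) :
    IsProbabilityMeasure (stepLaw μ ϑ) := by
  have hM := mgf_pos_of_integrable μ h
  have : IsProbabilityMeasure ((μ.prod μ).withDensity
      fun p => ENNReal.ofReal (Real.exp (ϑ * p.1) / mgf id μ ϑ)) := by
    refine ⟨?_⟩
    rw [withDensity_apply _ MeasurableSet.univ, Measure.restrict_univ,
      ← ofReal_integral_eq_lintegral_ofReal _ (ae_of_all _ fun p => by positivity)]
    · rw [integral_div, integral_fun_fst (fun x => Real.exp (ϑ * x))]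
      simp only [probReal_univ, one_smul]
      rw [show ∫ x, Real.exp (ϑ * x) ∂μ = mgf id μ ϑ from rfl, div_self hM.ne', ENNReal.ofReal_one]
    · exact (h.comp_fst μ).div_const _
  exact Measure.isProbabilityMeasure_map (by fun_prop)

/-- Split the tilt evenly: e^{2ηx} = e^{η(x+y)} e^{-η(y-x)}. The first factor is symmetric in the
pair and the second depends on the step alone. -/
lemma stepLaw_eq_withDensity_symLaw (η : ℝ) :
    stepLaw μ (2 * η) = (symLaw μ η).withDensity fun x => ENNReal.ofReal (Real.exp (-η * x)) := by
  rw [symLaw, withDensity_map_eq _ (by fun_prop) (by fun_prop), stepLaw,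
    ← withDensity_mul _ (by fun_prop) (by fun_prop)]
  congr 2
  ext p
  rw [Pi.mul_apply, ← ENNReal.ofReal_mul (by positivity [mgf_nonneg (X := id) (μ := μ) (t := 2 * η)])]
  congr 1
  rw [div_mul_eq_mul_div, ← Real.exp_add]
  ring_nf

variable {μ} {η : ℝ}

lemma integrable_exp_half (h : Integrable (fun x => Real.exp (2 * η * x)) μ) :
    Integrable (fun x => Real.exp (η * x)) μ := by
  refine (h.add (integrable_const (1 : ℝ))).mono (by fun_prop) (ae_of_all _ fun x => ?_)
  have e : Real.exp (2 * η * x) = Real.exp (η * x) ^ 2 := by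
    rw [sq, ← Real.exp_add]; ring_nf
  simp only [Pi.add_apply]
  rw [Real.norm_of_nonneg (by positivity), Real.norm_of_nonneg (by positivity), e]
  nlinarith [Real.exp_pos (η * x)]

lemma integrable_exp_pair (h : Integrable (fun x => Real.exp (η * x)) μ) :
    Integrable (fun p : ℝ × ℝ => Real.exp (η * (p.1 + p.2))) (μ.prod μ) := by
  refine (h.mul_prod h).congr (ae_of_all _ fun p => ?_)
  simp only
  rw [← Real.exp_add, mul_add]

lemma exp_mul_cosh (η : ℝ) (p : ℝ × ℝ) : Real.exp (η * (p.1 + p.2)) * Real.cosh (η * (p.2 - p.1)) =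
    (Real.exp (2 * η * p.2) + Real.exp (2 * η * p.1)) / 2 := by
  rw [Real.cosh_eq, mul_div_assoc', mul_add, ← Real.exp_add, ← Real.exp_add]
  ring_nf

lemma integrable_exp_mul_cosh (h : Integrable (fun x => Real.exp (2 * η * x)) μ) :
    Integrable (fun p : ℝ × ℝ => Real.exp (η * (p.1 + p.2)) * Real.cosh (η * (p.2 - p.1)))
      (μ.prod μ) := by
  simp_rw [exp_mul_cosh]
  exact ((h.comp_snd μ).add (h.comp_fst μ)).div_const 2

lemma integral_exp_mul_cosh (h : Integrable (fun x => Real.exp (2 * η * x)) μ) :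
    ∫ p : ℝ × ℝ, Real.exp (η * (p.1 + p.2)) * Real.cosh (η * (p.2 - p.1)) ∂(μ.prod μ) =
      mgf id μ (2 * η) := by
  simp_rw [exp_mul_cosh]
  rw [integral_div, integral_add (h.comp_snd μ) (h.comp_fst μ),
    integral_fun_fst (fun x => Real.exp (2 * η * x)),
    integral_fun_snd (fun x => Real.exp (2 * η * x))]
  simp [mgf]

lemma integrable_exp_mul_cos (h : Integrable (fun x => Real.exp (η * x)) μ) (u : ℝ) :
    Integrable (fun p : ℝ × ℝ => Real.exp (η * (p.1 + p.2)) * Real.cos (u * (p.2 - p.1)))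
      (μ.prod μ) := by
  refine (integrable_exp_pair h).mono (by fun_prop) (ae_of_all _ fun p => ?_)
  rw [norm_mul]
  exact mul_le_of_le_one_right (norm_nonneg _) (Real.abs_cos_le_one _)

lemma isFiniteMeasure_symLaw (h : Integrable (fun x => Real.exp (2 * η * x)) μ) :
    IsFiniteMeasure (symLaw μ η) := by
  have : IsFiniteMeasure ((μ.prod μ).withDensity fun p =>
      ENNReal.ofReal (Real.exp (η * (p.1 + p.2)) / mgf id μ (2 * η))) := by
    refine isFiniteMeasure_withDensity_ofReal ?_
    exact ((integrable_exp_pair (integrable_exp_half h)).div_const _).2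
  unfold symLaw
  infer_instance

lemma one_sub_charFun_symLaw (h : Integrable (fun x => Real.exp (2 * η * x)) μ) (u : ℝ) :
    (1 - charFun (symLaw μ η) u).re = pairGap μ η u / mgf id μ (2 * η) := by
  have hM := mgf_pos_of_integrable μ h
  have h' := integrable_exp_half h
  have hint : Integrable (fun p : ℝ × ℝ => (Real.exp (η * (p.1 + p.2)) / mgf id μ (2 * η)) •
      Complex.exp (u * (p.2 - p.1 : ℝ) * Complex.I)) (μ.prod μ) := by
    refine ((integrable_exp_pair h').div_const (mgf id μ (2 * η))).mono (by fun_prop)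
      (ae_of_all _ fun p => ?_)
    rw [norm_smul, ← Complex.ofReal_mul, Complex.norm_exp_ofReal_mul_I, mul_one]
  have e : (charFun (symLaw μ η) u).re = (∫ p : ℝ × ℝ, Real.exp (η * (p.1 + p.2)) *
      Real.cos (u * (p.2 - p.1)) ∂(μ.prod μ)) / mgf id μ (2 * η) := by
    rw [charFun_apply_real, symLaw, integral_map (by fun_prop) (by fun_prop),
      integral_withDensity_ofReal _ (by fun_prop) (fun p => by positivity),
      ← RCLike.re_eq_complex_re, ← integral_re hint, ← integral_div]
    refine integral_congr_ae (ae_of_all _ fun p => ?_)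
    simp only [RCLike.re_eq_complex_re]
    rw [Complex.smul_re, ← Complex.ofReal_mul, Complex.exp_ofReal_mul_I_re, smul_eq_mul]
    ring
  have e2 : pairGap μ η u = mgf id μ (2 * η) - ∫ p : ℝ × ℝ, Real.exp (η * (p.1 + p.2)) *
      Real.cos (u * (p.2 - p.1)) ∂(μ.prod μ) := by
    rw [pairGap, ← integral_exp_mul_cosh h, ← integral_sub (integrable_exp_mul_cosh h)
      (integrable_exp_mul_cos h' u)]
    refine integral_congr_ae (ae_of_all _ fun p => ?_)
    simp only
    ring
  rw [Complex.sub_re, Complex.one_re, e, e2, sub_div, div_self hM.ne']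

/-- The weight e^{η(x+y)} is invariant under exchanging the pair, which reverses the difference. -/
lemma symLaw_map_neg : (symLaw μ η).map (fun x => -x) = symLaw μ η := by
  rw [symLaw, Measure.map_map (by fun_prop) (by fun_prop)]
  conv_rhs => rw [← Measure.prod_swap, withDensity_map_eq _ measurable_swap (by fun_prop),
    Measure.map_map (by fun_prop) measurable_swap]
  have e1 : ((fun x : ℝ => -x) ∘ fun p : ℝ × ℝ => p.2 - p.1) =
      (fun p : ℝ × ℝ => p.2 - p.1) ∘ Prod.swap := by
    ext p; simp
  rw [e1]
  congr 2
  ext p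
  simp only [Prod.fst_swap, Prod.snd_swap]
  rw [add_comm]

/-- The factor e^{-ηx} is multiplicative, so it passes to the exit law: the drift becomes the
Laplace parameter λ = η of a symmetric defective walk. -/
lemma survivalProb_eq (h : Integrable (fun x => Real.exp (2 * η * x)) μ)
    (hmass : symLaw μ η Set.univ < 1) :
    survivalProb μ (2 * η) =
      1 - ∫ x, Real.exp (-η * x) ∂(exitTotal (symLaw μ η) (Set.Iic 0)) := by
  have := isFiniteMeasure_symLaw h
  have := isFiniteMeasure_exitTotal hmass (s := Set.Iic 0) measurableSet_Iic
  have e : exitTotal (stepLaw μ (2 * η)) (Set.Iic 0) =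
      (exitTotal (symLaw μ η) (Set.Iic 0)).withDensity
        fun x => ENNReal.ofReal (Real.exp (-η * x)) := by
    rw [exitTotal, exitTotal, withDensity_sum]
    congr 1
    ext1 n
    rw [exitLaw_withDensity (by fun_prop) _ (by simp) _ measurableSet_Iic,
      stepLaw_eq_withDensity_symLaw]
    intro x y
    rw [mul_add, Real.exp_add, ENNReal.ofReal_mul (Real.exp_pos _).le]
  rw [survivalProb, e, Measure.real, withDensity_apply _ MeasurableSet.univ, Measure.restrict_univ,
    integral_eq_lintegral_of_nonneg_ae (ae_of_all _ fun x => (Real.exp_pos _).le) (by fun_prop)]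

/-- Spitzer's formula with both parameters equal to η: the reference ratio is then the one built
into `gapRatio`, and its Poisson integral contributes 2 log(2η/(1 + η)). -/
theorem PairBounds.two_mul_log_survivalProb (hμ : μ ≪ volume) {η₀ c C : ℝ}
    (hb : PairBounds μ η₀ c C) (hη : 0 < η) (hη' : η ≤ η₀)
    (h : Integrable (fun x => Real.exp (2 * η * x)) μ) :
    0 < survivalProb μ (2 * η) ∧
    2 * Real.log (survivalProb μ (2 * η)) = (∫ u, cauchyKernel η u * Real.log (gapRatio μ η u)) -
      Real.log (mgf id μ (2 * η)) + 2 * Real.log (2 * η / (1 + η)) := by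
  have hfin := isFiniteMeasure_symLaw h
  have hM := mgf_pos_of_integrable μ h
  have hna : NullSingletonClass (symLaw μ η) :=
    nullSingletonClass_map_sub hμ (withDensity_absolutelyContinuous _ _)
  -- The gap at u = 0 is M(2η) - M(η)², whose positivity says that the symmetrized law is defective.
  have hmass : symLaw μ η Set.univ < 1 := by
    have h1 := one_sub_charFun_symLaw h 0
    rw [charFun_zero, Complex.sub_re, Complex.one_re, Complex.ofReal_re] at h1
    have h2 := hb.gap_lower η hη.le hη' 0
    have h3 : 0 < pairGap μ η 0 := lt_of_lt_of_le (by
      have := hb.c_pos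
      norm_num
      positivity) h2
    have h4 : (symLaw μ η).real Set.univ < 1 := by
      have : 0 < pairGap μ η 0 / mgf id μ (2 * η) := by positivity
      linarith
    rw [Measure.real] at h4
    rwa [← ENNReal.toReal_one, ENNReal.toReal_lt_toReal (measure_ne_top _ _) ENNReal.one_ne_top]
      at h4
  have hlog := two_mul_log_one_sub_laplace_exitTotal hmass symLaw_map_neg hη hη
    (hη'.trans hb.η₀_le)
  have hsurv := survivalProb_eq h hmass
  have hfinT := isFiniteMeasure_exitTotal hmass (s := Set.Iic 0) measurableSet_Iic
  refine ⟨?_, ?_⟩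
  · rw [hsurv, sub_pos]
    have hae : ∀ᵐ x ∂(exitTotal (symLaw μ η) (Set.Iic 0)), x ∉ Set.Iio (0 : ℝ) :=
      measure_eq_zero_iff_ae_notMem.1 exitTotal_Iio
    calc _ ≤ ∫ x, (1 : ℝ) ∂(exitTotal (symLaw μ η) (Set.Iic 0)) := by
          refine integral_mono_ae (integrable_exp_neg_of_Iio hη.le _ exitTotal_Iio)
            (integrable_const _) ?_
          filter_upwards [hae] with x hx
          rw [Real.exp_le_one_iff]
          have : 0 ≤ x := by simpa using hx
          nlinarith
      _ = (exitTotal (symLaw μ η) (Set.Iic 0)).real Set.univ := by simp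
      _ < 1 := by
          have := (exitTotal_univ_le hmass (s := Set.Iic 0) measurableSet_Iic).trans_lt hmass
          rw [Measure.real]
          rwa [← ENNReal.toReal_one, ENNReal.toReal_lt_toReal (measure_ne_top _ _)
            ENNReal.one_ne_top]
  · rw [hsurv, hlog, ← two_mul]
    congr 1
    have e1 : Real.log (mgf id μ (2 * η)) =
        ∫ u, cauchyKernel η u * Real.log (mgf id μ (2 * η)) := by
      rw [integral_mul_const, integral_cauchyKernel hη, one_mul]
    have hint : Integrable (fun u => cauchyKernel η u * Real.log (gapRatio μ η u)) := by
      have hm := (continuous_cauchyKernel hη).measurable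
      have hg := Real.measurable_log.comp (measurable_gapRatio μ η)
      refine integrable_cauchyKernel_mul_of_bounded hη hg
        (C := max |Real.log c| |Real.log (4 * C)|) fun u => ?_
      obtain ⟨b1, b2⟩ := hb.gapRatio_bounds hη.le hη' (u := u) (by positivity)
      have := hb.c_pos
      have l1 := Real.log_le_log this b1
      have l2 := Real.log_le_log (this.trans_le b1) b2
      exact abs_le_max_abs_abs l1 l2
    rw [e1, ← integral_sub hint ((integrable_cauchyKernel hη).mul_const _)]
    refine integral_congr_ae (ae_of_all _ fun u => ?_)
    simp only
    rw [← mul_sub, one_sub_charFun_symLaw h]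
    have hg : 0 < gapRatio μ η u := hb.c_pos.trans_le
      (hb.gapRatio_bounds hη.le hη' (u := u) (by positivity)).1
    rw [← Real.log_div hg.ne' hM.ne', gapRatio]
    congr 2
    ring

end TiltedStep

/-! ### Derivatives of the log-normalizer and the limiting ratio near zero tilt. -/

section CumulantFacts

variable {μ : Measure ℝ} [IsProbabilityMeasure μ]

lemma integrable_exp_of_mem {ϑ : ℝ} (h : ϑ ∈ naturalInterior μ) :
    Integrable (fun x => Real.exp (ϑ * x)) μ :=
  interior_subset (s := integrableExpSet id μ) h

lemma integrable_pow_mul_exp {ϑ : ℝ} (h : ϑ ∈ naturalInterior μ) (n : ℕ) :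
    Integrable (fun x => x ^ n * Real.exp (ϑ * x)) μ :=
  integrable_pow_mul_exp_of_mem_interior_integrableExpSet (X := id) h n

lemma integrable_mul_exp {ϑ : ℝ} (h : ϑ ∈ naturalInterior μ) :
    Integrable (fun x => x * Real.exp (ϑ * x)) μ := by
  simpa using integrable_pow_mul_exp h 1

lemma deriv_logNormalizer {ϑ : ℝ} (h : ϑ ∈ naturalInterior μ) :
    deriv (logNormalizer μ) ϑ = (∫ x, x * Real.exp (ϑ * x) ∂μ) / mgf id μ ϑ := by
  unfold logNormalizer
  exact deriv_cgf h

lemma deriv_deriv_logNormalizer {ϑ : ℝ} (h : ϑ ∈ naturalInterior μ) :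
    deriv (deriv (logNormalizer μ)) ϑ =
      (∫ x, x ^ 2 * Real.exp (ϑ * x) ∂μ) / mgf id μ ϑ - (deriv (logNormalizer μ) ϑ) ^ 2 := by
  have := iteratedDeriv_two_cgf (X := id) (μ := μ) h
  rw [iteratedDeriv_succ, iteratedDeriv_one] at this
  exact this

lemma analyticOnNhd_logNormalizer : AnalyticOnNhd ℝ (logNormalizer μ) (naturalInterior μ) :=
  analyticOnNhd_cgf

lemma continuousAt_deriv_logNormalizer {ϑ : ℝ} (h : ϑ ∈ naturalInterior μ) :
    ContinuousAt (deriv (logNormalizer μ)) ϑ :=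
  (analyticOnNhd_logNormalizer.deriv ϑ h).continuousAt

lemma continuousAt_deriv_deriv_logNormalizer {ϑ : ℝ} (h : ϑ ∈ naturalInterior μ) :
    ContinuousAt (deriv (deriv (logNormalizer μ))) ϑ :=
  (analyticOnNhd_logNormalizer.deriv.deriv ϑ h).continuousAt

lemma mgf_pos_of_mem {ϑ : ℝ} (h : ϑ ∈ naturalInterior μ) : 0 < mgf id μ ϑ :=
  mgf_pos_of_integrable μ (integrable_exp_of_mem h)

/-- Half the mean squared difference of an independent pair is the variance; the weight contributes
M² since it is not normalized. -/
lemma integral_pair_var {ϑ : ℝ} (h : ϑ ∈ naturalInterior μ) :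
    Integrable (fun p : ℝ × ℝ => Real.exp (ϑ * (p.1 + p.2)) * ((p.2 - p.1) ^ 2 / 2)) (μ.prod μ) ∧
    pairVar μ ϑ = deriv (deriv (logNormalizer μ)) ϑ * mgf id μ ϑ ^ 2 := by
  have i0 := integrable_exp_of_mem h
  have i1 := integrable_mul_exp h
  have i2 := integrable_pow_mul_exp h 2
  have e : (fun p : ℝ × ℝ => Real.exp (ϑ * (p.1 + p.2)) * ((p.2 - p.1) ^ 2 / 2)) = fun p =>
      (Real.exp (ϑ * p.1) * (p.2 ^ 2 * Real.exp (ϑ * p.2)) +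
        (p.1 ^ 2 * Real.exp (ϑ * p.1)) * Real.exp (ϑ * p.2)) / 2 -
        (p.1 * Real.exp (ϑ * p.1)) * (p.2 * Real.exp (ϑ * p.2)) := by
    ext p
    rw [mul_add, Real.exp_add]
    ring
  have j1 := i0.mul_prod i2
  have j2 := i2.mul_prod i0
  have j3 := i1.mul_prod i1
  have j12 : Integrable (fun p : ℝ × ℝ => Real.exp (ϑ * p.1) * (p.2 ^ 2 * Real.exp (ϑ * p.2)) +
        (p.1 ^ 2 * Real.exp (ϑ * p.1)) * Real.exp (ϑ * p.2)) (μ.prod μ) := j1.add j2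
  refine ⟨?_, ?_⟩
  · rw [e]; exact (j12.div_const 2).sub j3
  · have hM := (mgf_pos_of_mem h).ne'
    rw [pairVar, e, integral_sub (j12.div_const 2) j3, integral_div, integral_add j1 j2,
      integral_prod_mul (fun x => Real.exp (ϑ * x)) (fun x => x ^ 2 * Real.exp (ϑ * x)),
      integral_prod_mul (fun x => x ^ 2 * Real.exp (ϑ * x)) (fun x => Real.exp (ϑ * x)),
      integral_prod_mul (fun x => x * Real.exp (ϑ * x)) (fun x => x * Real.exp (ϑ * x)),
      deriv_deriv_logNormalizer h, deriv_logNormalizer h,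
      show ∫ x, Real.exp (ϑ * x) ∂μ = mgf id μ ϑ from rfl]
    generalize ∫ x, x ^ 2 * Real.exp (ϑ * x) ∂μ = A
    generalize ∫ x, x * Real.exp (ϑ * x) ∂μ = B
    field_simp
    ring

/-- Since 1 - cos x ≤ x²/2, the non-lattice lower bound at t = 1 bounds the variance from below. -/
lemma pairVar_pos (hμ : μ ≪ volume) {ϑ : ℝ} (h : ϑ ∈ naturalInterior μ) : 0 < pairVar μ ϑ := by
  obtain ⟨c, hc, hlow⟩ := exists_le_integral_exp_mul_one_sub_cos μ hμ |ϑ|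
  have i0 := integrable_exp_of_mem h
  have h1 := hlow ϑ le_rfl i0 1
  simp only [one_pow, min_self, mul_one, one_mul] at h1
  refine hc.trans_le (h1.trans ?_)
  refine integral_mono ?_ (integral_pair_var h).1 fun p => ?_
  · have := (integrable_exp_pair i0).sub (integrable_exp_mul_cos i0 1)
    refine this.congr (ae_of_all _ fun p => ?_)
    simp only [Pi.sub_apply, one_mul]
    ring
  · have h2 := one_sub_cos_le_sq (p.2 - p.1)
    simp only
    gcongr

lemma deriv_deriv_logNormalizer_pos (hμ : μ ≪ volume) {ϑ : ℝ} (h : ϑ ∈ naturalInterior μ) :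
    0 < deriv (deriv (logNormalizer μ)) ϑ := by
  have h1 := pairVar_pos hμ h
  rw [(integral_pair_var h).2] at h1
  exact (mul_pos_iff_of_pos_right (pow_pos (mgf_pos_of_mem h) 2)).1 h1

lemma convex_naturalInterior : Convex ℝ (naturalInterior μ) := convex_integrableExpSet.interior

lemma strictMonoOn_deriv_logNormalizer (hμ : μ ≪ volume) :
    StrictMonoOn (deriv (logNormalizer μ)) (naturalInterior μ) := by
  refine strictMonoOn_of_deriv_pos convex_naturalInterior
    (fun x hx => (continuousAt_deriv_logNormalizer hx).continuousWithinAt) fun x hx => ?_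
  exact deriv_deriv_logNormalizer_pos hμ (interior_subset hx)

/-- Expanding sinh gives diagonal terms, which yield the right side, and cross terms, which contain
the mean of the baseline law as a factor. This links c' to the same pair expansions as the survival
probability. -/
lemma integral_pair_sinh {η : ℝ} (h : 2 * η ∈ naturalInterior μ) (hmean : ∫ x, x ∂μ = 0)
    (h0 : (0 : ℝ) ∈ naturalInterior μ) :
    ∫ p : ℝ × ℝ, Real.exp (η * (p.1 + p.2)) * ((p.2 - p.1) * Real.sinh (η * (p.2 - p.1)))
      ∂(μ.prod μ) = ∫ x, x * Real.exp (2 * η * x) ∂μ := by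
  have i0 := integrable_exp_of_mem h
  have i1 := integrable_mul_exp h
  have ix : Integrable (fun x : ℝ => x) μ := by simpa using integrable_mul_exp h0
  have e : (fun p : ℝ × ℝ => Real.exp (η * (p.1 + p.2)) *
      ((p.2 - p.1) * Real.sinh (η * (p.2 - p.1)))) = fun p =>
      ((p.2 * Real.exp (2 * η * p.2) + p.1 * Real.exp (2 * η * p.1)) -
        (p.1 * Real.exp (2 * η * p.2) + Real.exp (2 * η * p.1) * p.2)) / 2 := by
    ext p
    have e1 : Real.exp (2 * η * p.2) = Real.exp (η * (p.1 + p.2)) * Real.exp (η * (p.2 - p.1)) := by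
      rw [← Real.exp_add]; ring_nf
    have e2 : Real.exp (2 * η * p.1) =
        Real.exp (η * (p.1 + p.2)) * Real.exp (-(η * (p.2 - p.1))) := by
      rw [← Real.exp_add]; ring_nf
    rw [Real.sinh_eq, e1, e2]
    ring
  have j1 : Integrable (fun p : ℝ × ℝ => p.2 * Real.exp (2 * η * p.2)) (μ.prod μ) := i1.comp_snd μ
  have j2 : Integrable (fun p : ℝ × ℝ => p.1 * Real.exp (2 * η * p.1)) (μ.prod μ) := i1.comp_fst μ
  have j3 := ix.mul_prod i0
  have j4 := i0.mul_prod ix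
  have j12 : Integrable (fun p : ℝ × ℝ => p.2 * Real.exp (2 * η * p.2) +
    p.1 * Real.exp (2 * η * p.1)) (μ.prod μ) := j1.add j2
  have j34 : Integrable (fun p : ℝ × ℝ => p.1 * Real.exp (2 * η * p.2) +
    Real.exp (2 * η * p.1) * p.2) (μ.prod μ) := j3.add j4
  rw [e, integral_div, integral_sub j12 j34, integral_add j1 j2, integral_add j3 j4,
    integral_prod_mul (fun x => x) (fun x => Real.exp (2 * η * x)),
    integral_prod_mul (fun x => Real.exp (2 * η * x)) (fun x => x), hmean,
    integral_fun_snd (fun x => x * Real.exp (2 * η * x)),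
    integral_fun_fst (fun x => x * Real.exp (2 * η * x))]
  simp

lemma integral_id_eq_zero (h0 : (0 : ℝ) ∈ naturalInterior μ)
    (hmean : deriv (logNormalizer μ) 0 = 0) : ∫ x, x ∂μ = 0 := by
  rw [deriv_logNormalizer h0] at hmean
  simpa using hmean

/-- The limiting ratio as a function of the tilting parameter. -/
def tiltRatio (μ : Measure ℝ) [IsProbabilityMeasure μ] (ϑ : ℝ) : ℝ :=
  survivalProb μ ϑ ^ 2 / (ϑ * deriv (logNormalizer μ) ϑ * Real.exp (-ϑ * meanOvershoot μ))

set_option maxHeartbeats 1000000 in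
-- The logarithm of the ratio is computed exactly. Its first-order part consists of η·`ladderConst`
-- from the Poisson integral, -2η from log(1 + η) and 2ηρ₊, whose sum is 0. The normalization at u =
-- 0 matches c'(2η)·M(2η)/(2η) up to a factor 1 + O(η²).
theorem exists_tiltRatio_bounds (hμ : μ ≪ volume) (h0 : (0 : ℝ) ∈ naturalInterior μ)
    (hmean : deriv (logNormalizer μ) 0 = 0) :
    ∃ ϑ₀ > 0, ∃ k > 0, ∃ K : ℝ, ∀ ϑ, 0 < ϑ → ϑ ≤ ϑ₀ → ϑ ∈ naturalInterior μ ∧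
      k * ϑ ≤ deriv (logNormalizer μ) ϑ ∧ |tiltRatio μ ϑ - 1| ≤ K * ϑ ^ 2 := by
  obtain ⟨η₀, c, C, hb⟩ := exists_pairBounds μ hμ h0
  obtain ⟨T, hT, hT1, hT2⟩ := hb.exists_log_bounds
  have hc := hb.c_pos
  have hC := hb.C_pos
  have hρ := (ladderHeight_moments μ hμ h0).2.2
  have hmean' := integral_id_eq_zero h0 hmean
  have hmgf : ∀ᶠ ϑ in 𝓝 (0 : ℝ), ϑ ∈ naturalInterior μ ∧ mgf id μ ϑ < 2 := by
    refine Eventually.and (isOpen_interior.mem_nhds h0) ?_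
    have hcont : ContinuousAt (mgf id μ) 0 := (analyticAt_mgf h0).continuousAt
    refine hcont.eventually_lt continuousAt_const ?_
    simp
  obtain ⟨ε, hε, hball⟩ := Metric.eventually_nhds_iff.1 hmgf
  -- The three summands bound log a - log(J/(2η)), the two Poisson integrals (3T and T), and 2(η -
  -- log(1 + η)).
  set K₀ := 4 * C / c + 4 * T + 2 with hK₀
  have hK₀p : 0 < K₀ := by positivity
  -- The bound ε/4 keeps 2η in the neighbourhood where M < 2, c/(4C) gives J/(2η) ≥ c/2, and 1/K₀
  -- keeps the exponent at most 1 in absolute value.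
  set η₁ := min (min η₀ (ε / 4)) (min (c / (4 * C)) (1 / K₀)) with hη₁
  have hη₁p : 0 < η₁ := by
    have := hb.η₀_pos
    positivity
  refine ⟨2 * η₁, by positivity, c / 4, by positivity, 2 * K₀, fun ϑ hϑ hϑ' => ?_⟩
  obtain ⟨η, rfl⟩ : ∃ η, ϑ = 2 * η := ⟨ϑ / 2, by ring⟩
  have hη : 0 < η := by linarith
  have hη' : η ≤ η₁ := by linarith
  have hη0 : η ≤ η₀ := hη'.trans ((min_le_left _ _).trans (min_le_left _ _))
  have hη1 : η ≤ 1 := hη0.trans hb.η₀_le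
  have hηε : η ≤ ε / 4 := hη'.trans ((min_le_left _ _).trans (min_le_right _ _))
  have hηc : η ≤ c / (4 * C) := hη'.trans ((min_le_right _ _).trans (min_le_left _ _))
  have hηK : η ≤ 1 / K₀ := hη'.trans ((min_le_right _ _).trans (min_le_right _ _))
  rw [le_div_iff₀ (by positivity)] at hηc hηK
  obtain ⟨hmem, hM2⟩ := hball (y := 2 * η) (by
    rw [Real.dist_eq, sub_zero, abs_of_pos hϑ]; linarith)
  have hM := mgf_pos_of_mem hmem
  have hint := integrable_exp_of_mem hmem
  obtain ⟨hq, hlogq⟩ := hb.two_mul_log_survivalProb hμ hη hη0 hint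
  obtain ⟨a1, a2⟩ := hb.gap_div_bounds hη hη0
  have g1 := hb.gap_zero η hη hη0
  have g2 := hb.sinh_sub η hη hη0
  have g3 := hb.var_sub η hη.le hη0
  rw [integral_pair_sinh hmem hmean' h0] at g2
  set J := ∫ x, x * Real.exp (2 * η * x) ∂μ with hJ
  set a := pairGap μ η 0 / η ^ 2 with ha
  have hJc : c / 2 ≤ J / (2 * η) := by
    have h1 := (abs_le.1 g2).1
    have h2 := (abs_le.1 g3).1
    have h3 := hb.var_lower
    nlinarith
  have hJp : 0 < J := by
    have : 0 < J / (2 * η) := by linarith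
    exact (div_pos_iff_of_pos_right hϑ).1 this
  have hd : deriv (logNormalizer μ) (2 * η) = J / mgf id μ (2 * η) := deriv_logNormalizer hmem
  refine ⟨hmem, ?_, ?_⟩
  · rw [hd, le_div_iff₀ hM]
    rw [le_div_iff₀ hϑ] at hJc
    have : 0 ≤ c / 4 * (2 * η) := by positivity
    nlinarith
  · -- logarithm of the ratio
    have hR : tiltRatio μ (2 * η) = Real.exp (2 * Real.log (survivalProb μ (2 * η)) -
        Real.log (2 * η) - Real.log J + Real.log (mgf id μ (2 * η)) +
        2 * η * meanOvershoot μ) := by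
      rw [Real.exp_add, Real.exp_add, Real.exp_sub, Real.exp_sub, Real.exp_log hϑ,
        Real.exp_log hJp, Real.exp_log hM, two_mul (Real.log _), Real.exp_add, Real.exp_log hq,
        tiltRatio, hd, neg_mul, Real.exp_neg]
      have := Real.exp_pos (2 * η * meanOvershoot μ)
      field_simp
    set Δ₀ := fun u => Real.log (gapRatio μ 0 u) - Real.log (pairVar μ 0) with hΔ₀
    have hΔ₀m : Measurable Δ₀ := (Real.measurable_log.comp (measurable_gapRatio μ 0)).sub_const _
    set Δ := fun u => Real.log (gapRatio μ η u) - Real.log a with hΔ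
    have hΔm : Measurable Δ := (Real.measurable_log.comp (measurable_gapRatio μ η)).sub_const _
    obtain ⟨k1, k2⟩ := cauchyKernel_expansion hΔ₀m hT.le hT1 hη
    obtain ⟨k3, k4⟩ := integral_cauchyKernel_mul_le (hΔm.sub hΔ₀m) hT.le hη (hT2 η hη hη0)
    have hsum : ∫ u, cauchyKernel η u * Real.log (gapRatio μ η u) =
        (∫ u, cauchyKernel η u * (Δ - Δ₀) u) + (∫ u, cauchyKernel η u * Δ₀ u) + Real.log a := by
      have e1 : Real.log a = ∫ u, cauchyKernel η u * Real.log a := by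
        rw [integral_mul_const, integral_cauchyKernel hη, one_mul]
      have k13 : Integrable (fun u => cauchyKernel η u * (Δ - Δ₀) u + cauchyKernel η u * Δ₀ u) :=
        k3.add k1
      rw [e1, ← integral_add k3 k1, ← integral_add k13 ((integrable_cauchyKernel hη).mul_const _)]
      refine integral_congr_ae (ae_of_all _ fun u => ?_)
      simp only [Pi.sub_apply, hΔ, hΔ₀]
      ring
    have hla : |Real.log a - Real.log (J / (2 * η))| ≤ 4 * C / c * η ^ 2 := by
      refine (abs_log_sub_log_le (m := c / 2) (by positivity) (by linarith) hJc).trans ?_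
      rw [div_le_iff₀ (by positivity)]
      have : a - J / (2 * η) = (a - pairVar μ η) - (J / (2 * η) - pairVar μ η) := by ring
      rw [this]
      refine (abs_sub _ _).trans ((add_le_add g1 g2).trans (le_of_eq ?_))
      field_simp
      ring
    have hlog1 : |η - Real.log (1 + η)| ≤ η ^ 2 := by
      have l1 := Real.log_le_sub_one_of_pos (show 0 < 1 + η by linarith)
      have l2 := Real.one_sub_inv_le_log_of_pos (show 0 < 1 + η by linarith)
      have l3 : η - η ^ 2 ≤ 1 - (1 + η)⁻¹ := by
        rw [show 1 - (1 + η)⁻¹ = η / (1 + η) by field_simp; ring, le_div_iff₀ (by linarith)]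
        nlinarith [pow_pos hη 3]
      rw [abs_le]
      constructor <;> nlinarith [sq_nonneg η]
    -- Inserting ρ₊ = 1 - `ladderConst`/2 distributes 2ηρ₊ over the Poisson integral and the
    -- logarithm of 1 + η, so that each bracket is O(η²).
    have hexpo : 2 * Real.log (survivalProb μ (2 * η)) -
        Real.log (2 * η) - Real.log J + Real.log (mgf id μ (2 * η)) + 2 * η * meanOvershoot μ =
        (∫ u, cauchyKernel η u * (Δ - Δ₀) u) +
        ((∫ u, cauchyKernel η u * Δ₀ u) - η * ladderConst μ) +
        (Real.log a - Real.log (J / (2 * η))) + 2 * (η - Real.log (1 + η)) := by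
      rw [hlogq, hsum, hρ, Real.log_div hϑ.ne' (by positivity), Real.log_div hJp.ne' hϑ.ne']
      ring
    have hbound : |2 * Real.log (survivalProb μ (2 * η)) -
        Real.log (2 * η) - Real.log J + Real.log (mgf id μ (2 * η)) + 2 * η * meanOvershoot μ| ≤
        K₀ * η ^ 2 := by
      have k2' : |(∫ u, cauchyKernel η u * Δ₀ u) - η * ladderConst μ| ≤ T * η ^ 2 := k2
      have k5 : |2 * (η - Real.log (1 + η))| ≤ 2 * η ^ 2 := by
        rw [abs_mul, abs_two]; gcongr
      rw [hexpo]
      refine (abs_add_le _ _).trans ((add_le_add ((abs_add_le _ _).trans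
        (add_le_add ((abs_add_le _ _).trans (add_le_add k4 k2')) hla)) k5).trans ?_)
      rw [hK₀]; apply le_of_eq; ring
    rw [hR]
    have hone : K₀ * η ^ 2 ≤ 1 := by nlinarith
    refine (Real.abs_exp_sub_one_le (hbound.trans hone)).trans ?_
    have : 0 ≤ K₀ * η ^ 2 := by positivity
    nlinarith

open Classical in
/-- The limiting ratio of the false detection probability and its approximation. -/
def limitRatio (μ : Measure ℝ) [IsProbabilityMeasure μ] (h : ℝ) : ℝ :=
  if hex : ∃ ϑ ∈ naturalInterior μ, deriv (logNormalizer μ) ϑ = h then tiltRatio μ hex.choose else 1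

/-- Since c' is strictly increasing, the tilt chosen in the definition is the only one with this
mean. -/
lemma limitRatio_eq (hμ : μ ≪ volume) {ϑ h : ℝ} (hϑ : ϑ ∈ naturalInterior μ)
    (hh : deriv (logNormalizer μ) ϑ = h) : limitRatio μ h = tiltRatio μ ϑ := by
  have hex : ∃ ϑ ∈ naturalInterior μ, deriv (logNormalizer μ) ϑ = h := ⟨ϑ, hϑ, hh⟩
  rw [limitRatio, dif_pos hex]
  congr 1
  exact (strictMonoOn_deriv_logNormalizer hμ).injOn hex.choose_spec.1 hϑ
    (hex.choose_spec.2.trans hh.symm)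

lemma pos_of_deriv_logNormalizer_pos (hμ : μ ≪ volume) (h0 : (0 : ℝ) ∈ naturalInterior μ)
    (hmean : deriv (logNormalizer μ) 0 = 0) {ϑ : ℝ} (hϑ : ϑ ∈ naturalInterior μ)
    (h : 0 < deriv (logNormalizer μ) ϑ) : 0 < ϑ := by
  rw [← hmean] at h
  exact ((strictMonoOn_deriv_logNormalizer hμ).lt_iff_lt h0 hϑ).1 h

/-- Near 0 the mean satisfies c'(ϑ) ≥ kϑ, so an error of order ϑ² is of order h². -/
theorem limitRatio_sub_one_isBigO (hμ : μ ≪ volume) (h0 : (0 : ℝ) ∈ naturalInterior μ)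
    (hmean : deriv (logNormalizer μ) 0 = 0) :
    (fun h => limitRatio μ h - 1) =O[𝓝[>] (0 : ℝ)] (fun h => h ^ 2) := by
  obtain ⟨ϑ₀, hϑ₀, k, hk, K, hb⟩ := exists_tiltRatio_bounds hμ h0 hmean
  refine IsBigO.of_bound (|K| / k ^ 2) ?_
  have hnear : ∀ᶠ h : ℝ in 𝓝[>] 0, 0 < h ∧ h < k * ϑ₀ := by
    refine (eventually_mem_nhdsWithin).and ?_
    exact nhdsWithin_le_nhds (Iio_mem_nhds (by positivity))
  filter_upwards [hnear] with h ⟨hh0, hh1⟩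
  by_cases hex : ∃ ϑ ∈ naturalInterior μ, deriv (logNormalizer μ) ϑ = h
  · obtain ⟨ϑ, hϑ, hϑh⟩ := hex
    have hpos : 0 < ϑ := pos_of_deriv_logNormalizer_pos hμ h0 hmean hϑ (hϑh ▸ hh0)
    have hle : ϑ ≤ ϑ₀ := by
      by_contra hlt
      have hlt := not_le.1 hlt
      obtain ⟨m1, m2, -⟩ := hb ϑ₀ hϑ₀ le_rfl
      have := strictMonoOn_deriv_logNormalizer hμ m1 hϑ hlt
      linarith
    obtain ⟨-, m2, m3⟩ := hb ϑ hpos hle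
    rw [limitRatio_eq hμ hϑ hϑh, Real.norm_eq_abs, Real.norm_of_nonneg (sq_nonneg h)]
    refine m3.trans ?_
    rw [hϑh] at m2
    have h1 : (k * ϑ) ^ 2 ≤ h ^ 2 := pow_le_pow_left₀ (by positivity) m2 2
    calc K * ϑ ^ 2 ≤ |K| * ϑ ^ 2 := by gcongr; exact le_abs_self K
      _ = |K| / k ^ 2 * (k * ϑ) ^ 2 := by field_simp
      _ ≤ _ := by gcongr
  -- For h outside the range of c' the default value 1 makes the bound trivial.
  · rw [limitRatio, dif_neg hex, sub_self, norm_zero]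
    positivity

end CumulantFacts

/-! ### Tilted characteristic functions and uniform tail bounds for sums. -/

section LocalLimit

lemma norm_exp_mul_I_taylor_le (z : ℝ) :
    ‖Complex.exp (z * Complex.I) - 1 - z * Complex.I + (z : ℂ) ^ 2 / 2‖ ≤ 3 * |z| ^ 3 := by
  rcases le_total |z| 1 with h | h
  · have h1 := Complex.norm_exp_sub_sum_le_norm_mul_exp ((z : ℂ) * Complex.I) 3
    have hn : ‖(z : ℂ) * Complex.I‖ = |z| := by simp
    rw [hn] at h1
    have e : Complex.exp (z * Complex.I) - 1 - z * Complex.I + (z : ℂ) ^ 2 / 2 =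
        Complex.exp (z * Complex.I) -
          ∑ m ∈ Finset.range 3, ((z : ℂ) * Complex.I) ^ m / (m.factorial : ℂ) := by
      simp only [Finset.sum_range_succ, Finset.sum_range_zero, Nat.factorial]
      push_cast
      have e2 : ((z : ℂ) * Complex.I) ^ 2 = -(z : ℂ) ^ 2 := by rw [mul_pow, Complex.I_sq]; ring
      rw [e2]
      ring
    rw [e]
    refine h1.trans ?_
    rw [mul_comm]
    gcongr
    calc Real.exp |z| ≤ Real.exp 1 := Real.exp_le_exp.2 h
      _ ≤ 3 := by linarith [Real.exp_one_lt_d9]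
  · have h1 : ‖Complex.exp (z * Complex.I) - 1‖ ≤ |z| := by
      have := Real.norm_exp_I_mul_ofReal_sub_one_le (x := z)
      rwa [mul_comm, Real.norm_eq_abs] at this
    have h2 : ‖(z : ℂ) * Complex.I‖ = |z| := by simp
    have h3 : ‖(z : ℂ) ^ 2 / 2‖ = |z| ^ 2 / 2 := by simp
    have h4 : |z| ≤ |z| ^ 3 := by
      calc |z| = |z| * 1 * 1 := by ring
        _ ≤ |z| * |z| * |z| := by gcongr
        _ = _ := by ring
    have h5 : |z| ^ 2 ≤ |z| ^ 3 := pow_le_pow_right₀ h (by norm_num)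
    calc _ ≤ ‖Complex.exp (z * Complex.I) - 1‖ + ‖(z : ℂ) * Complex.I‖ + ‖(z : ℂ) ^ 2 / 2‖ :=
          (norm_add_le _ _).trans (add_le_add (norm_sub_le _ _) le_rfl)
      _ ≤ |z| + |z| + |z| ^ 2 / 2 := by rw [h2, h3]; gcongr
      _ ≤ _ := by nlinarith [abs_nonneg z]

lemma norm_inv_sq_add_mul_I (θ u : ℝ) :
    ‖(((θ : ℂ) + u * Complex.I) ^ 2)⁻¹‖ = (θ ^ 2 + u ^ 2)⁻¹ := by
  rw [norm_inv, norm_pow, ← Complex.normSq_eq_norm_sq, Complex.normSq_add_mul_I]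

lemma continuous_inv_sq_add_mul_I {θ : ℝ} (hθ : 0 < θ) :
    Continuous fun u : ℝ => (((θ : ℂ) + u * Complex.I) ^ 2)⁻¹ := by
  refine Continuous.inv₀ (by fun_prop) fun u => pow_ne_zero _ fun h => ?_
  have := congrArg Complex.re h
  simp at this
  exact hθ.ne' this

lemma integrable_inv_sq_add_mul_I {θ : ℝ} (hθ : 0 < θ) :
    Integrable fun u : ℝ => (((θ : ℂ) + u * Complex.I) ^ 2)⁻¹ := by
  refine Integrable.mono ((integrable_cauchyKernel hθ).const_mul (Real.pi / θ))
    (continuous_inv_sq_add_mul_I hθ).aestronglyMeasurable (ae_of_all _ fun u => ?_)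
  rw [norm_inv_sq_add_mul_I, cauchyKernel, Real.norm_of_nonneg (by positivity)]
  refine le_of_eq ?_
  field_simp

lemma integral_inv_one_add_mul_sq {κ : ℝ} (hκ : 0 < κ) :
    Integrable (fun u : ℝ => (1 + κ * u ^ 2)⁻¹) ∧
      ∫ u : ℝ, (1 + κ * u ^ 2)⁻¹ = Real.pi / √κ := by
  have e : (fun u : ℝ => (1 + κ * u ^ 2)⁻¹) = fun u => (1 + (√κ * u) ^ 2)⁻¹ := by
    ext u
    rw [mul_pow, Real.sq_sqrt hκ.le]
  have hs := Real.sqrt_pos.2 hκ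
  rw [e]
  refine ⟨integrable_inv_one_add_sq.comp_mul_left' hs.ne', ?_⟩
  rw [Measure.integral_comp_mul_left (fun u : ℝ => (1 + u ^ 2)⁻¹) (√κ),
    integral_univ_inv_one_add_sq, abs_of_pos (by positivity), smul_eq_mul]
  field_simp

/-- The exponentially weighted measure. -/
def expTilt (μ : Measure ℝ) (ϑ : ℝ) : Measure ℝ :=
  μ.withDensity fun x => ENNReal.ofReal (Real.exp (ϑ * x))

/-- The law of the sum of `n` independent observations. -/
def sumLaw (μ : Measure ℝ) (n : ℕ) : Measure ℝ := killedWalk μ Set.univ n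

lemma killedWalk_univ_univ (ν : Measure ℝ) [IsFiniteMeasure ν] (n : ℕ) :
    killedWalk ν Set.univ n Set.univ = ν Set.univ ^ n := by
  induction n with
  | zero => simp [killedWalk]
  | succ n ih =>
    simp only [killedWalk]
    rw [Measure.restrict_univ, conv_apply_univ, ih, pow_succ]

variable {μ : Measure ℝ} [IsProbabilityMeasure μ]

instance isProbabilityMeasure_sumLaw (n : ℕ) : IsProbabilityMeasure (sumLaw μ n) :=
  ⟨by rw [sumLaw, killedWalk_univ_univ, measure_univ, one_pow]⟩

lemma isFiniteMeasure_expTilt {ϑ : ℝ} (h : Integrable (fun x => Real.exp (ϑ * x)) μ) :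
    IsFiniteMeasure (expTilt μ ϑ) := isFiniteMeasure_withDensity_ofReal h.2

lemma expTilt_sumLaw (ϑ : ℝ) (n : ℕ) :
    expTilt (sumLaw μ n) ϑ = sumLaw (expTilt μ ϑ) n := by
  refine killedWalk_withDensity (by fun_prop) (fun x y => ?_) (by simp) μ MeasurableSet.univ n
  rw [mul_add, Real.exp_add, ENNReal.ofReal_mul (Real.exp_pos _).le]

lemma charFun_expTilt (ϑ u : ℝ) : charFun (expTilt μ ϑ) u =
    ∫ x, (Real.exp (ϑ * x) : ℂ) * Complex.exp (u * x * Complex.I) ∂μ := by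
  rw [charFun_apply_real, expTilt,
    integral_withDensity_ofReal _ (by fun_prop) (fun x => (Real.exp_pos _).le)]
  simp

lemma integrable_exp_mul_cexp {ϑ : ℝ} (h : Integrable (fun x => Real.exp (ϑ * x)) μ) (u : ℝ) :
    Integrable (fun x : ℝ => (Real.exp (ϑ * x) : ℂ) * Complex.exp (u * x * Complex.I)) μ := by
  refine h.mono (by fun_prop) (ae_of_all _ fun x => ?_)
  rw [norm_mul, ← Complex.ofReal_mul, Complex.norm_exp_ofReal_mul_I, mul_one, Complex.norm_real]

/-- Multiply the transform by its conjugate over an independent pair; the deficit from M² is the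
quantity that the non-lattice bound controls. -/
lemma norm_charFun_expTilt_sq {ϑ : ℝ} (h : Integrable (fun x => Real.exp (ϑ * x)) μ) (u : ℝ) :
    ‖charFun (expTilt μ ϑ) u‖ ^ 2 = mgf id μ ϑ ^ 2 -
      ∫ p : ℝ × ℝ, Real.exp (ϑ * (p.1 + p.2)) * (1 - Real.cos (u * (p.2 - p.1))) ∂(μ.prod μ) := by
  have i1 := integrable_exp_mul_cexp h u
  have e1 : ((‖charFun (expTilt μ ϑ) u‖ ^ 2 : ℝ) : ℂ) = ∫ p : ℝ × ℝ,
      (starRingEnd ℂ) ((Real.exp (ϑ * p.1) : ℂ) * Complex.exp (u * p.1 * Complex.I)) *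
      ((Real.exp (ϑ * p.2) : ℂ) * Complex.exp (u * p.2 * Complex.I)) ∂(μ.prod μ) := by
    rw [integral_prod_mul
      (fun x : ℝ => (starRingEnd ℂ) ((Real.exp (ϑ * x) : ℂ) * Complex.exp (u * x * Complex.I)))
      (fun x : ℝ => (Real.exp (ϑ * x) : ℂ) * Complex.exp (u * x * Complex.I)), integral_conj,
      ← charFun_expTilt, mul_comm, Complex.mul_conj, Complex.normSq_eq_norm_sq]
  have hint : Integrable (fun p : ℝ × ℝ =>
      (starRingEnd ℂ) ((Real.exp (ϑ * p.1) : ℂ) * Complex.exp (u * p.1 * Complex.I)) *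
      ((Real.exp (ϑ * p.2) : ℂ) * Complex.exp (u * p.2 * Complex.I))) (μ.prod μ) := by
    refine Integrable.mul_prod
      (f := fun x : ℝ => (starRingEnd ℂ) ((Real.exp (ϑ * x) : ℂ) * Complex.exp (u * x * Complex.I)))
      (g := fun x : ℝ => (Real.exp (ϑ * x) : ℂ) * Complex.exp (u * x * Complex.I)) ?_ i1
    exact (Complex.conjLIE.toContinuousLinearEquiv : ℂ →L[ℝ] ℂ).integrable_comp i1
  have e2 : ‖charFun (expTilt μ ϑ) u‖ ^ 2 = ∫ p : ℝ × ℝ, Real.exp (ϑ * (p.1 + p.2)) *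
      Real.cos (u * (p.2 - p.1)) ∂(μ.prod μ) := by
    have e3 := congrArg Complex.re e1
    rw [Complex.ofReal_re, ← RCLike.re_eq_complex_re, ← integral_re hint] at e3
    rw [e3]
    refine integral_congr_ae (ae_of_all _ fun p => ?_)
    simp only [RCLike.re_eq_complex_re]
    rw [map_mul, ← Complex.exp_conj, Complex.conj_ofReal, mul_mul_mul_comm, ← Complex.exp_add,
      ← Complex.ofReal_mul, ← Real.exp_add, Complex.re_ofReal_mul]
    congr 1
    · rw [mul_add]
    · have : (starRingEnd ℂ) (u * p.1 * Complex.I) + u * p.2 * Complex.I =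
          ((u * (p.2 - p.1) : ℝ) : ℂ) * Complex.I := by
        simp only [map_mul, Complex.conj_ofReal, Complex.conj_I]
        push_cast
        ring
      rw [this, Complex.exp_ofReal_mul_I_re]
  have e4 : mgf id μ ϑ ^ 2 = ∫ p : ℝ × ℝ, Real.exp (ϑ * (p.1 + p.2)) ∂(μ.prod μ) := by
    have := integral_prod_mul (μ := μ) (ν := μ) (fun x => Real.exp (ϑ * x))
      (fun x => Real.exp (ϑ * x))
    rw [sq]
    simp_rw [mul_add, Real.exp_add]
    exact this.symm
  rw [e4, e2, ← integral_sub (integrable_exp_pair h)]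
  · refine integral_congr_ae (ae_of_all _ fun p => ?_)
    simp only
    ring
  · refine ((integrable_exp_pair h).sub (integrable_exp_mul_cos h u)).congr (ae_of_all _ fun p => ?_)
    simp only [Pi.sub_apply]
    ring

lemma Icc_subset_naturalInterior {a b : ℝ} (ha : a ∈ naturalInterior μ)
    (hb : b ∈ naturalInterior μ) : Set.Icc a b ⊆ naturalInterior μ :=
  convex_naturalInterior.ordConnected.out ha hb

lemma exp_mul_le_add {a b ϑ : ℝ} (ha : a ≤ ϑ) (hb : ϑ ≤ b) (x : ℝ) :
    Real.exp (ϑ * x) ≤ Real.exp (a * x) + Real.exp (b * x) := by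
  rcases le_total 0 x with hx | hx
  · have : Real.exp (ϑ * x) ≤ Real.exp (b * x) :=
      Real.exp_le_exp.2 (mul_le_mul_of_nonneg_right hb hx)
    linarith [Real.exp_pos (a * x)]
  · have : Real.exp (ϑ * x) ≤ Real.exp (a * x) :=
      Real.exp_le_exp.2 (mul_le_mul_of_nonpos_right ha hx)
    linarith [Real.exp_pos (b * x)]

lemma mgf_le_add {a b ϑ : ℝ} (ha : a ∈ naturalInterior μ) (hb : b ∈ naturalInterior μ)
    (hϑ : ϑ ∈ Set.Icc a b) : mgf id μ ϑ ≤ mgf id μ a + mgf id μ b := by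
  have ia := integrable_exp_of_mem ha
  have ib := integrable_exp_of_mem hb
  have := integral_mono (integrable_exp_of_mem (Icc_subset_naturalInterior ha hb hϑ)) (ia.add ib)
    fun x => exp_mul_le_add hϑ.1 hϑ.2 x
  rw [integral_add' ia ib] at this
  exact this

/-- A uniform bound for the powers of the tilted characteristic functions. -/
lemma exists_charFun_expTilt_pow_le (hμ : μ ≪ volume) {a b : ℝ} (ha : a ∈ naturalInterior μ)
    (hb : b ∈ naturalInterior μ) : ∃ κ > 0, ∀ ϑ ∈ Set.Icc a b, ∀ (n : ℕ) (u : ℝ),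
      ‖charFun (expTilt μ ϑ) u‖ ^ n ≤ mgf id μ ϑ ^ n * ((1 + u ^ 2) / (1 + κ * n * u ^ 2)) := by
  obtain ⟨c, hc, hlow⟩ := exists_le_integral_exp_mul_one_sub_cos μ hμ (|a| + |b|)
  have hMa := mgf_pos_of_mem ha
  have hMb := mgf_pos_of_mem hb
  set S := mgf id μ a + mgf id μ b with hS
  refine ⟨c / S ^ 2 / 2, by positivity, fun ϑ hϑ n u => ?_⟩
  set κ := c / S ^ 2 / 2 with hκ
  have hκ0 : 0 < κ := by positivity
  have hmem := Icc_subset_naturalInterior ha hb hϑ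
  have hint := integrable_exp_of_mem hmem
  have hM := mgf_pos_of_mem hmem
  have hMS := mgf_le_add ha hb hϑ
  set x := u ^ 2 / (1 + u ^ 2) with hx
  have hu2 : 0 < 1 + u ^ 2 := by positivity
  have hx0 : 0 ≤ x := by positivity
  have hxm : x ≤ min 1 (u ^ 2) := by
    refine le_min ?_ ?_
    · rw [hx, div_le_one hu2]; linarith
    · rw [hx, div_le_iff₀ hu2]; nlinarith [sq_nonneg u, sq_nonneg (u ^ 2)]
  have habs : |ϑ| ≤ |a| + |b| := by
    rw [abs_le]
    constructor
    · linarith [hϑ.1, neg_abs_le a, abs_nonneg b]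
    · linarith [hϑ.2, le_abs_self b, abs_nonneg a]
  have h1 : ‖charFun (expTilt μ ϑ) u‖ ^ 2 ≤ mgf id μ ϑ ^ 2 * (1 - 2 * κ * x) := by
    rw [norm_charFun_expTilt_sq hint]
    have h2 := hlow ϑ habs hint u
    have h3 : 2 * κ * x * mgf id μ ϑ ^ 2 ≤ c * min 1 (u ^ 2) := by
      calc 2 * κ * x * mgf id μ ϑ ^ 2 ≤ 2 * κ * x * S ^ 2 := by gcongr
        _ = c * x := by
            have : S ≠ 0 := by positivity
            rw [hκ]; field_simp
        _ ≤ _ := by gcongr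
    nlinarith
  have h2 : ‖charFun (expTilt μ ϑ) u‖ ≤ mgf id μ ϑ * Real.exp (-(κ * x)) := by
    refine le_of_sq_le_sq ?_ (by positivity)
    refine h1.trans ?_
    rw [mul_pow, ← Real.exp_nat_mul]
    gcongr
    have := Real.add_one_le_exp (((2 : ℕ) : ℝ) * -(κ * x))
    push_cast at this ⊢
    linarith
  calc _ ≤ (mgf id μ ϑ * Real.exp (-(κ * x))) ^ n := by gcongr
    _ = mgf id μ ϑ ^ n * Real.exp (-(n * (κ * x))) := by
        rw [mul_pow, ← Real.exp_nat_mul]; ring_nf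
    -- The exponential is traded for 1/(1 + s). This rational bound suffices: against 1/(ϑ² + u²) it
    -- integrates to order 1/√n.
    _ ≤ _ := by
        gcongr
        rw [Real.exp_neg]
        have h4 : 1 + n * (κ * x) ≤ Real.exp (n * (κ * x)) := by
          linarith [Real.add_one_le_exp (n * (κ * x))]
        have h5 : 0 ≤ n * (κ * x) := by positivity
        calc (Real.exp (n * (κ * x)))⁻¹ ≤ (1 + n * (κ * x))⁻¹ := by gcongr
          _ = (1 + u ^ 2) / (1 + u ^ 2 + κ * n * u ^ 2) := by
              rw [hx]; field_simp
          _ ≤ _ := by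
              have : 0 ≤ u ^ 2 := sq_nonneg u
              gcongr
              linarith

/-- The stop-loss transform. -/
def stopLoss (ρ : Measure ℝ) (y : ℝ) : ℝ := ∫ x, max (x - y) 0 ∂ρ

lemma integrable_max_mul_exp {θ : ℝ} (hθ : 0 < θ) (ρ : Measure ℝ) [IsFiniteMeasure ρ] (y : ℝ) :
    Integrable (fun x => max (x - y) 0 * Real.exp (-θ * (x - y))) ρ := by
  refine (integrable_const (1 / θ)).mono (by fun_prop) (ae_of_all _ fun x => ?_)
  rw [Real.norm_of_nonneg (by positivity), Real.norm_of_nonneg (by positivity), le_div_iff₀ hθ]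
  rcases le_total (x - y) 0 with h | h
  · simp [max_eq_right h]
  · rw [max_eq_left h]
    have h1 := Real.add_one_le_exp (θ * (x - y))
    have h2 : Real.exp (θ * (x - y)) * Real.exp (-θ * (x - y)) = 1 := by
      rw [← Real.exp_add]; simp
    nlinarith [Real.exp_pos (-θ * (x - y))]

/-- Under the tilted law the integrand acquires the damping e^{-ϑ(x-y)}, which makes it bounded. -/
lemma integrable_max_sumLaw {ϑ : ℝ} (hϑ : 0 < ϑ)
    (h : Integrable (fun x => Real.exp (ϑ * x)) μ) (n : ℕ) (y : ℝ) :
    Integrable (fun x => max (x - y) 0) (sumLaw μ n) ∧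
    stopLoss (sumLaw μ n) y = Real.exp (-ϑ * y) *
      ∫ x, max (x - y) 0 * Real.exp (-ϑ * (x - y)) ∂(sumLaw (expTilt μ ϑ) n) := by
  have := isFiniteMeasure_expTilt h
  have hfin : IsFiniteMeasure (sumLaw (expTilt μ ϑ) n) := by unfold sumLaw; infer_instance
  have h1 := integrable_max_mul_exp hϑ (sumLaw (expTilt μ ϑ) n) y
  rw [← expTilt_sumLaw] at h1 ⊢
  have e : ∀ x, Real.exp (ϑ * x) • (max (x - y) 0 * Real.exp (-ϑ * (x - y))) =
      Real.exp (ϑ * y) * max (x - y) 0 := by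
    intro x
    rw [smul_eq_mul, mul_left_comm, ← Real.exp_add, mul_comm]
    ring_nf
  constructor
  · rw [expTilt, integrable_withDensity_iff_integrable_smul' (by fun_prop)
      (ae_of_all _ fun x => ENNReal.ofReal_lt_top)] at h1
    simp only [ENNReal.toReal_ofReal (Real.exp_pos _).le, e] at h1
    refine (h1.const_mul (Real.exp (-ϑ * y))).congr (ae_of_all _ fun x => ?_)
    simp only
    rw [← mul_assoc, ← Real.exp_add]
    simp
  · rw [expTilt, integral_withDensity_ofReal _ (by fun_prop) (fun x => (Real.exp_pos _).le)]
    simp_rw [e]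
    rw [integral_const_mul, ← mul_assoc, ← Real.exp_add, stopLoss]
    simp

/-- The tail itself would lead to the kernel 1/(ϑ + iu), which is not absolutely integrable; its
integral, the stop-loss transform, leads to 1/(ϑ + iu)². Hence no integrability of the
characteristic function is needed. -/
theorem stopLoss_sumLaw_eq {ϑ : ℝ} (hϑ : 0 < ϑ)
    (h : Integrable (fun x => Real.exp (ϑ * x)) μ) (n : ℕ) (y : ℝ) :
    ((Real.exp (ϑ * y) * stopLoss (sumLaw μ n) y : ℝ) : ℂ) = (2 * Real.pi : ℂ)⁻¹ *
      ∫ u : ℝ, Complex.exp (-(u * y) * Complex.I) * charFun (expTilt μ ϑ) u ^ n *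
        (((ϑ : ℂ) + u * Complex.I) ^ 2)⁻¹ := by
  have := isFiniteMeasure_expTilt h
  have hfin : IsFiniteMeasure (sumLaw (expTilt μ ϑ) n) := by unfold sumLaw; infer_instance
  rw [(integrable_max_sumLaw hϑ h n y).2, ← mul_assoc, ← Real.exp_add,
    show ϑ * y + -ϑ * y = 0 by ring, Real.exp_zero, one_mul, ← integral_complex_ofReal]
  simp_rw [posPart_mul_exp_eq_integral hϑ]
  rw [integral_const_mul]
  congr 1
  rw [integral_integral_swap]
  · refine integral_congr_ae (ae_of_all _ fun u => ?_)
    simp only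
    rw [integral_mul_const]
    congr 1
    rw [← charFun_killedWalk_univ, charFun_apply_real, ← integral_const_mul]
    refine integral_congr_ae (ae_of_all _ fun x => ?_)
    simp only
    rw [← Complex.exp_add]
    congr 1
    push_cast
    ring
  · have h2 := (integrable_const (μ := sumLaw (expTilt μ ϑ) n) (1 : ℂ)).mul_prod
      (integrable_inv_sq_add_mul_I hϑ)
    refine h2.mono ?_ (ae_of_all _ fun p => ?_)
    · have := (continuous_inv_sq_add_mul_I hϑ).measurable
      exact Measurable.aestronglyMeasurable (by fun_prop)
    · simp only [Function.uncurry, norm_mul]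
      rw [← Complex.ofReal_mul, Complex.norm_exp_ofReal_mul_I]
      simp

lemma one_add_sq_div_le {ϑ : ℝ} (hϑ : 0 < ϑ) {a : ℝ} (ha : 0 < a) (haϑ : a ≤ ϑ) (u : ℝ) :
    (1 + u ^ 2) * (ϑ ^ 2 + u ^ 2)⁻¹ ≤ 1 + (a ^ 2)⁻¹ := by
  rw [← div_eq_mul_inv, div_le_iff₀ (by positivity)]
  have h1 : 1 ≤ (a ^ 2)⁻¹ * ϑ ^ 2 := by
    rw [inv_mul_eq_div, le_div_iff₀ (by positivity), one_mul]
    gcongr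
  have h2 : 0 ≤ (a ^ 2)⁻¹ * u ^ 2 := by positivity
  nlinarith [sq_nonneg ϑ]

/-- Chernoff's bound improved by the local-limit factor 1/√n, uniformly over a compact range of
tilts. The factor 1/√n comes from integrating 1/(1 + κnu²). -/
theorem exists_sumLaw_Ioi_le (hμ : μ ≪ volume) {a b : ℝ} (ha0 : 0 < a)
    (ha : a ∈ naturalInterior μ) (hb : b ∈ naturalInterior μ) :
    ∃ C > 0, ∀ ϑ ∈ Set.Icc a b, ∀ n : ℕ, 0 < n → ∀ y : ℝ,
      (sumLaw μ n).real (Set.Ioi y) ≤ C * (mgf id μ ϑ ^ n * Real.exp (-ϑ * y) / √n) := by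
  obtain ⟨κ, hκ, hbd⟩ := exists_charFun_expTilt_pow_le hμ ha hb
  refine ⟨Real.exp b * ((2 * Real.pi)⁻¹ * ((1 + (a ^ 2)⁻¹) * (Real.pi / √κ))), by positivity,
    fun ϑ hϑ n hn y => ?_⟩
  have hϑ0 : 0 < ϑ := ha0.trans_le hϑ.1
  have hmem := Icc_subset_naturalInterior ha hb hϑ
  have hint := integrable_exp_of_mem hmem
  have hM := mgf_pos_of_mem hmem
  have hn' : (0 : ℝ) < n := by exact_mod_cast hn
  have hκn : 0 < κ * n := by positivity
  obtain ⟨g1, g2⟩ := integral_inv_one_add_mul_sq hκn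
  -- the stop-loss transform dominates the tail
  have h1 : (sumLaw μ n).real (Set.Ioi y) ≤ stopLoss (sumLaw μ n) (y - 1) := by
    have e : (sumLaw μ n).real (Set.Ioi y) =
        ∫ x, (Set.Ioi y).indicator (fun _ => (1 : ℝ)) x ∂(sumLaw μ n) := by
      rw [integral_indicator measurableSet_Ioi]; simp
    rw [e]
    refine integral_mono ((integrable_const 1).indicator measurableSet_Ioi)
      (integrable_max_sumLaw hϑ0 hint n _).1 fun x => ?_
    by_cases hx : x ∈ Set.Ioi y
    · simp only [Set.indicator_of_mem hx]
      rw [Set.mem_Ioi] at hx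
      exact le_max_of_le_left (by linarith)
    · simp only [Set.indicator_of_notMem hx]
      exact le_max_right _ _
  have h2 : Real.exp (ϑ * (y - 1)) * stopLoss (sumLaw μ n) (y - 1) ≤
      (2 * Real.pi)⁻¹ * (mgf id μ ϑ ^ n * ((1 + (a ^ 2)⁻¹) * (Real.pi / √(κ * n)))) := by
    refine (le_abs_self _).trans ?_
    rw [← Real.norm_eq_abs, ← Complex.norm_real, stopLoss_sumLaw_eq hϑ0 hint, norm_mul]
    have e : ‖(2 * Real.pi : ℂ)⁻¹‖ = (2 * Real.pi)⁻¹ := by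
      rw [norm_inv, norm_mul, Complex.norm_real, Real.norm_of_nonneg Real.pi_pos.le]
      simp
    rw [e]
    gcongr
    rw [← g2, ← integral_const_mul, ← integral_const_mul]
    refine norm_integral_le_of_norm_le ((g1.const_mul _).const_mul _) (ae_of_all _ fun u => ?_)
    rw [norm_mul, norm_mul, ← Complex.ofReal_mul, ← Complex.ofReal_neg,
      Complex.norm_exp_ofReal_mul_I, one_mul, norm_pow, norm_inv_sq_add_mul_I]
    calc _ ≤ mgf id μ ϑ ^ n * ((1 + u ^ 2) / (1 + κ * n * u ^ 2)) * (ϑ ^ 2 + u ^ 2)⁻¹ := by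
          gcongr
          exact hbd ϑ hϑ n u
      _ = mgf id μ ϑ ^ n * (((1 + u ^ 2) * (ϑ ^ 2 + u ^ 2)⁻¹) * (1 + κ * n * u ^ 2)⁻¹) := by
          rw [div_eq_mul_inv]; ring
      _ ≤ _ := by
          gcongr
          exact one_add_sq_div_le hϑ0 ha0 hϑ.1 u
  have h3 : stopLoss (sumLaw μ n) (y - 1) ≤ Real.exp (-ϑ * (y - 1)) *
      ((2 * Real.pi)⁻¹ * (mgf id μ ϑ ^ n * ((1 + (a ^ 2)⁻¹) * (Real.pi / √(κ * n))))) := by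
    calc stopLoss (sumLaw μ n) (y - 1) = Real.exp (-ϑ * (y - 1)) *
          (Real.exp (ϑ * (y - 1)) * stopLoss (sumLaw μ n) (y - 1)) := by
          rw [← mul_assoc, ← Real.exp_add]; simp
      _ ≤ _ := by gcongr
  refine (h1.trans h3).trans ?_
  rw [Real.sqrt_mul hκ.le, show -ϑ * (y - 1) = -ϑ * y + ϑ by ring, Real.exp_add]
  have : Real.exp ϑ ≤ Real.exp b := Real.exp_le_exp.2 hϑ.2
  calc _ = Real.exp ϑ * ((2 * Real.pi)⁻¹ * ((1 + (a ^ 2)⁻¹) * (Real.pi / √κ))) *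
        (mgf id μ ϑ ^ n * Real.exp (-ϑ * y) / √n) := by field_simp
    _ ≤ _ := by gcongr

end LocalLimit

/-! ### Sharp tail asymptotics with converging tilts. -/

section TailAsymptotics

lemma tendsto_one_add_pow_exp_of_tendsto_mul {g : ℕ → ℂ} {m : ℕ → ℕ} {t : ℂ}
    (hm : Tendsto m atTop atTop) (hg : Tendsto (fun k => (m k : ℂ) * g k) atTop (𝓝 t)) :
    Tendsto (fun k => (1 + g k) ^ m k) atTop (𝓝 (Complex.exp t)) := by
  have hmr : Tendsto (fun k => (m k : ℝ)) atTop atTop := tendsto_natCast_atTop_atTop.comp hm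
  have hminv : Tendsto (fun k => ((m k : ℂ))⁻¹) atTop (𝓝 0) := by
    rw [tendsto_zero_iff_norm_tendsto_zero]
    refine hmr.inv_tendsto_atTop.congr fun k => ?_
    simp
  have hpos : ∀ᶠ k in atTop, 0 < m k := hm.eventually_gt_atTop 0
  have hg0 : Tendsto g atTop (𝓝 0) := by
    have := hminv.mul hg
    rw [zero_mul] at this
    refine this.congr' ?_
    filter_upwards [hpos] with k hk
    have : (m k : ℂ) ≠ 0 := by exact_mod_cast hk.ne'
    field_simp
  have hsmall : ∀ᶠ k in atTop, ‖g k‖ < 1 / 2 := by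
    have := hg0.norm
    rw [norm_zero] at this
    exact this.eventually (gt_mem_nhds (by norm_num))
  have hdiff : Tendsto (fun k => (m k : ℂ) * (Complex.log (1 + g k) - g k)) atTop (𝓝 0) := by
    have h1 : Tendsto (fun k => ‖(m k : ℂ) * g k‖ * ‖g k‖) atTop (𝓝 0) := by
      have := hg.norm.mul hg0.norm
      rwa [norm_zero, mul_zero] at this
    refine squeeze_zero_norm' ?_ h1
    filter_upwards [hsmall] with k hk
    have h2 := Complex.norm_log_one_add_sub_self_le (z := g k) (by linarith)
    rw [norm_mul, norm_mul, mul_assoc]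
    refine mul_le_mul_of_nonneg_left (h2.trans ?_) (norm_nonneg _)
    have h3 : (1 - ‖g k‖)⁻¹ ≤ 2 := by
      rw [inv_le_comm₀ (by linarith) (by norm_num)]
      linarith
    nlinarith [sq_nonneg ‖g k‖]
  have hlog : Tendsto (fun k => (m k : ℂ) * Complex.log (1 + g k)) atTop (𝓝 t) := by
    have := hdiff.add hg
    rw [zero_add] at this
    refine this.congr fun k => ?_
    ring
  refine ((Complex.continuous_exp.tendsto t).comp hlog).congr' ?_
  filter_upwards [hsmall] with k hk
  have hne : 1 + g k ≠ 0 := by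
    intro h
    have : g k = -1 := by linear_combination h
    rw [this, norm_neg, norm_one] at hk
    norm_num at hk
  rw [Function.comp_apply, Complex.exp_nat_mul, Complex.exp_log hne]

variable {μ : Measure ℝ} [IsProbabilityMeasure μ]

lemma integrable_abs_pow_mul_exp {ϑ : ℝ} (h : ϑ ∈ naturalInterior μ) (n : ℕ) :
    Integrable (fun x => |x| ^ n * Real.exp (ϑ * x)) μ :=
  integrable_pow_abs_mul_exp_of_mem_interior_integrableExpSet (X := id) h n

lemma abs_sub_pow_three_le (x d : ℝ) : |x - d| ^ 3 ≤ 4 * (|x| ^ 3 + |d| ^ 3) := by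
  have h1 : |x - d| ≤ |x| + |d| := abs_sub x d
  have h2 : |x - d| ^ 3 ≤ (|x| + |d|) ^ 3 := by gcongr
  refine h2.trans ?_
  nlinarith [mul_nonneg (add_nonneg (abs_nonneg x) (abs_nonneg d)) (sq_nonneg (|x| - |d|))]

/-- Uniform second-order expansion of the centred tilted characteristic functions. -/
lemma exists_charFun_expTilt_expansion (hμ : μ ≪ volume) {a b : ℝ} (ha : a ∈ naturalInterior μ)
    (hb : b ∈ naturalInterior μ) : ∃ B, 0 ≤ B ∧ ∀ ϑ ∈ Set.Icc a b, ∀ u : ℝ,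
      ‖charFun (expTilt μ ϑ) u * Complex.exp (-(u * deriv (logNormalizer μ) ϑ) * Complex.I) -
        mgf id μ ϑ * (1 - u ^ 2 * deriv (deriv (logNormalizer μ)) ϑ / 2)‖ ≤ B * |u| ^ 3 := by
  set A := |deriv (logNormalizer μ) a| + |deriv (logNormalizer μ) b| with hA
  -- An integrable majorant for all tilts in the interval: 12 = 3·4 from the Taylor remainder and
  -- from cubing |x| + |d|, and A bounds every tilted mean by monotonicity of c'.
  set W : ℝ → ℝ := fun x => 12 * (|x| ^ 3 + A ^ 3) * (Real.exp (a * x) + Real.exp (b * x)) with hW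
  have hWint : Integrable W μ := by
    have e : W = fun x => 12 * ((|x| ^ 3 * Real.exp (a * x) + |x| ^ 3 * Real.exp (b * x)) +
        A ^ 3 * (Real.exp (a * x) + Real.exp (b * x))) := by
      ext x; simp only [hW]; ring
    rw [e]
    exact (((integrable_abs_pow_mul_exp ha 3).add (integrable_abs_pow_mul_exp hb 3)).add
      (((integrable_exp_of_mem ha).add (integrable_exp_of_mem hb)).const_mul _)).const_mul _
  have hA0 : 0 ≤ A := by positivity
  have hW0 : ∀ x, 0 ≤ W x := fun x => by simp only [hW]; positivity
  refine ⟨∫ x, W x ∂μ, integral_nonneg hW0, fun ϑ hϑ u => ?_⟩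
  have hmem := Icc_subset_naturalInterior ha hb hϑ
  have hint := integrable_exp_of_mem hmem
  have hM := mgf_pos_of_mem hmem
  set d := deriv (logNormalizer μ) ϑ with hd
  have hdA : |d| ≤ A := by
    have hmono := (strictMonoOn_deriv_logNormalizer hμ).monotoneOn
    have h1 := hmono ha hmem hϑ.1
    have h2 := hmono hmem hb hϑ.2
    rw [abs_le]
    constructor
    · linarith [neg_abs_le (deriv (logNormalizer μ) a), abs_nonneg (deriv (logNormalizer μ) b)]
    · linarith [le_abs_self (deriv (logNormalizer μ) b), abs_nonneg (deriv (logNormalizer μ) a)]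
  -- centred moments
  have ix := integrable_mul_exp hmem
  have ix2 := integrable_pow_mul_exp hmem 2
  have m1 : ∫ x, Real.exp (ϑ * x) * (x - d) ∂μ = 0 := by
    have e : ∀ x, Real.exp (ϑ * x) * (x - d) = x * Real.exp (ϑ * x) - d * Real.exp (ϑ * x) := by
      intro x; ring
    simp_rw [e]
    rw [integral_sub ix (hint.const_mul d), integral_const_mul,
      show ∫ x, Real.exp (ϑ * x) ∂μ = mgf id μ ϑ from rfl, hd, deriv_logNormalizer hmem]
    rw [div_mul_cancel₀ _ hM.ne', sub_self]
  have m2 : ∫ x, Real.exp (ϑ * x) * (x - d) ^ 2 ∂μ =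
      mgf id μ ϑ * deriv (deriv (logNormalizer μ)) ϑ := by
    have := iteratedDeriv_two_cgf_eq_integral (X := id) (μ := μ) hmem
    rw [iteratedDeriv_succ, iteratedDeriv_one] at this
    have e : deriv (deriv (logNormalizer μ)) ϑ =
      (∫ x, (x - d) ^ 2 * Real.exp (ϑ * x) ∂μ) / mgf id μ ϑ := this
    rw [e, mul_div_cancel₀ _ hM.ne']
    exact integral_congr_ae (ae_of_all _ fun x => mul_comm _ _)
  have j1 : Integrable (fun x => Real.exp (ϑ * x) * (x - d)) μ := by
    refine (ix.sub (hint.const_mul d)).congr (ae_of_all _ fun x => ?_)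
    simp only [Pi.sub_apply]; ring
  have j2 : Integrable (fun x => Real.exp (ϑ * x) * (x - d) ^ 2) μ := by
    refine ((ix2.sub (ix.const_mul (2 * d))).add (hint.const_mul (d ^ 2))).congr
      (ae_of_all _ fun x => ?_)
    simp only [Pi.sub_apply, Pi.add_apply]; ring
  have k0 : Integrable (fun x : ℝ => (Real.exp (ϑ * x) : ℂ) * Complex.exp (u * x * Complex.I) *
      Complex.exp (-(u * d) * Complex.I)) μ := (integrable_exp_mul_cexp hint u).mul_const _
  have k1 : Integrable (fun x : ℝ => ((Real.exp (ϑ * x) : ℝ) : ℂ)) μ := hint.ofReal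
  have k2 : Integrable (fun x : ℝ => ((Real.exp (ϑ * x) * (x - d) : ℝ) : ℂ) * (u * Complex.I)) μ :=
    j1.ofReal.mul_const _
  have k3 : Integrable (fun x : ℝ => ((Real.exp (ϑ * x) * (x - d) ^ 2 : ℝ) : ℂ) *
      ((u : ℂ) ^ 2 / 2)) μ := j2.ofReal.mul_const _
  have key : charFun (expTilt μ ϑ) u * Complex.exp (-(u * d) * Complex.I) -
        mgf id μ ϑ * (1 - u ^ 2 * deriv (deriv (logNormalizer μ)) ϑ / 2) =
      ∫ x : ℝ, (Real.exp (ϑ * x) : ℂ) * (Complex.exp (((u * (x - d) : ℝ) : ℂ) * Complex.I) - 1 -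
        ((u * (x - d) : ℝ) : ℂ) * Complex.I + ((u * (x - d) : ℝ) : ℂ) ^ 2 / 2) ∂μ := by
    have e : ∀ x : ℝ, (Real.exp (ϑ * x) : ℂ) * (Complex.exp (((u * (x - d) : ℝ) : ℂ) * Complex.I)
        - 1 - ((u * (x - d) : ℝ) : ℂ) * Complex.I + ((u * (x - d) : ℝ) : ℂ) ^ 2 / 2) =
        ((Real.exp (ϑ * x) : ℂ) * Complex.exp (u * x * Complex.I) *
        Complex.exp (-(u * d) * Complex.I) - ((Real.exp (ϑ * x) : ℝ) : ℂ) -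
        ((Real.exp (ϑ * x) * (x - d) : ℝ) : ℂ) * (u * Complex.I)) +
        ((Real.exp (ϑ * x) * (x - d) ^ 2 : ℝ) : ℂ) * ((u : ℂ) ^ 2 / 2) := by
      intro x
      rw [mul_assoc, ← Complex.exp_add]
      have : (u : ℂ) * x * Complex.I + -(u * d) * Complex.I =
          ((u * (x - d) : ℝ) : ℂ) * Complex.I := by push_cast; ring
      rw [this]
      push_cast
      ring
    simp_rw [e]
    have k01 : Integrable (fun x : ℝ => (Real.exp (ϑ * x) : ℂ) * Complex.exp (u * x * Complex.I) *
      Complex.exp (-(u * d) * Complex.I) - ((Real.exp (ϑ * x) : ℝ) : ℂ)) μ := k0.sub k1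
    have k012 : Integrable (fun x : ℝ => (Real.exp (ϑ * x) : ℂ) * Complex.exp (u * x * Complex.I) *
      Complex.exp (-(u * d) * Complex.I) - ((Real.exp (ϑ * x) : ℝ) : ℂ) -
      ((Real.exp (ϑ * x) * (x - d) : ℝ) : ℂ) * (u * Complex.I)) μ := k01.sub k2
    rw [integral_add k012 k3, integral_sub k01 k2, integral_sub k0 k1, integral_mul_const,
      integral_mul_const, integral_mul_const, integral_complex_ofReal, integral_complex_ofReal,
      integral_complex_ofReal, m1, m2, ← charFun_expTilt,
      show ∫ x, Real.exp (ϑ * x) ∂μ = mgf id μ ϑ from rfl]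
    push_cast
    ring
  rw [key, ← integral_mul_const]
  refine norm_integral_le_of_norm_le (hWint.mul_const _) (ae_of_all _ fun x => ?_)
  rw [norm_mul, Complex.norm_real, Real.norm_of_nonneg (Real.exp_pos _).le]
  have h1 := norm_exp_mul_I_taylor_le (u * (x - d))
  have h2 := abs_sub_pow_three_le x d
  have h3 : |d| ^ 3 ≤ A ^ 3 := by gcongr
  calc _ ≤ Real.exp (ϑ * x) * (3 * |u * (x - d)| ^ 3) := by gcongr
    _ = 3 * |x - d| ^ 3 * Real.exp (ϑ * x) * |u| ^ 3 := by rw [abs_mul, mul_pow]; ring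
    _ ≤ 3 * (4 * (|x| ^ 3 + A ^ 3)) * (Real.exp (a * x) + Real.exp (b * x)) * |u| ^ 3 := by
        refine mul_le_mul_of_nonneg_right (mul_le_mul (by linarith)
          (exp_mul_le_add hϑ.1 hϑ.2 x) (Real.exp_pos _).le (by positivity)) (by positivity)
    _ = W x * |u| ^ 3 := by simp only [hW]; ring

section Sequences

variable {ϑ : ℝ} {t : ℕ → ℝ} {m : ℕ → ℕ}

lemma exists_Icc_of_tendsto (hϑ : ϑ ∈ naturalInterior μ) (hϑ0 : 0 < ϑ)
    (ht : Tendsto t atTop (𝓝 ϑ)) : ∃ a b, 0 < a ∧ a ∈ naturalInterior μ ∧ b ∈ naturalInterior μ ∧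
      ϑ ∈ Set.Icc a b ∧ ∀ᶠ k in atTop, t k ∈ Set.Icc a b := by
  obtain ⟨ε, hε, hball⟩ := Metric.isOpen_iff.1 isOpen_interior ϑ hϑ
  set r := min (ε / 2) (ϑ / 2) with hr
  have hr0 : 0 < r := by positivity
  have hr1 : r ≤ ε / 2 := min_le_left _ _
  have hr2 : r ≤ ϑ / 2 := min_le_right _ _
  refine ⟨ϑ - r, ϑ + r, by linarith, hball ?_, hball ?_, ⟨by linarith, by linarith⟩,
    ht.eventually (Icc_mem_nhds (by linarith) (by linarith))⟩
  · rw [Metric.mem_ball, Real.dist_eq, abs_lt]; constructor <;> linarith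
  · rw [Metric.mem_ball, Real.dist_eq, abs_lt]; constructor <;> linarith

/-- A central limit theorem for the tilted and centred sums; the uniformity of the expansion allows
the tilt to vary with k. -/
lemma tendsto_charFun_expTilt_pow (hμ : μ ≪ volume) (hϑ : ϑ ∈ naturalInterior μ) (hϑ0 : 0 < ϑ)
    (ht : Tendsto t atTop (𝓝 ϑ)) (hm : Tendsto m atTop atTop) (v : ℝ) :
    Tendsto (fun k => (charFun (expTilt μ (t k)) (v / √(m k)) *
      Complex.exp (-(((v / √(m k) : ℝ) : ℂ) * deriv (logNormalizer μ) (t k)) * Complex.I) /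
        mgf id μ (t k)) ^ m k) atTop
      (𝓝 (Complex.exp (-(v ^ 2 * deriv (deriv (logNormalizer μ)) ϑ / 2)))) := by
  obtain ⟨a, b, ha0, ha, hb, hab, hev⟩ := exists_Icc_of_tendsto hϑ hϑ0 ht
  obtain ⟨B, hB, hexp⟩ := exists_charFun_expTilt_expansion hμ ha hb
  have hmr : Tendsto (fun k => (m k : ℝ)) atTop atTop := tendsto_natCast_atTop_atTop.comp hm
  have hms : Tendsto (fun k => √(m k : ℝ)) atTop atTop := Real.tendsto_sqrt_atTop.comp hmr
  have hM : Tendsto (fun k => mgf id μ (t k)) atTop (𝓝 (mgf id μ ϑ)) :=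
    ((analyticAt_mgf hϑ).continuousAt.tendsto).comp ht
  have hMϑ := mgf_pos_of_mem hϑ
  have hc2 : Tendsto (fun k => deriv (deriv (logNormalizer μ)) (t k)) atTop
      (𝓝 (deriv (deriv (logNormalizer μ)) ϑ)) :=
    (continuousAt_deriv_deriv_logNormalizer hϑ).tendsto.comp ht
  set X : ℕ → ℂ := fun k => charFun (expTilt μ (t k)) (v / √(m k)) *
      Complex.exp (-(((v / √(m k) : ℝ) : ℂ) * deriv (logNormalizer μ) (t k)) * Complex.I) with hX
  have hpos : ∀ᶠ k in atTop, 0 < m k := hm.eventually_gt_atTop 0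
  have key : Tendsto (fun k => (m k : ℂ) * (X k / mgf id μ (t k) - 1)) atTop
      (𝓝 (-(v ^ 2 * deriv (deriv (logNormalizer μ)) ϑ / 2))) := by
    have h1 : Tendsto (fun k => (-(v ^ 2 * deriv (deriv (logNormalizer μ)) (t k) / 2) : ℂ)) atTop
        (𝓝 (-(v ^ 2 * deriv (deriv (logNormalizer μ)) ϑ / 2))) :=
      (((Complex.continuous_ofReal.tendsto _).comp hc2).const_mul _ |>.div_const _).neg
    have h2 : Tendsto (fun k => (m k : ℂ) * ((X k - mgf id μ (t k) *
        (1 - ((v / √(m k) : ℝ) : ℂ) ^ 2 * deriv (deriv (logNormalizer μ)) (t k) / 2)) /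
        mgf id μ (t k))) atTop (𝓝 0) := by
      have hz : Tendsto (fun k => B * |v| ^ 3 * (√(m k : ℝ))⁻¹ * (mgf id μ (t k))⁻¹) atTop
          (𝓝 0) := by
        have := (hms.inv_tendsto_atTop.const_mul (B * |v| ^ 3)).mul (hM.inv₀ hMϑ.ne')
        simpa using this
      refine squeeze_zero_norm' ?_ hz
      filter_upwards [hev, hpos] with k hk hk0
      have hMk := mgf_pos_of_mem (Icc_subset_naturalInterior ha hb hk)
      have hmk : (0 : ℝ) < m k := by exact_mod_cast hk0
      have h3 := hexp (t k) hk (v / √(m k))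
      rw [norm_mul, norm_div, Complex.norm_natCast, Complex.norm_real,
        Real.norm_of_nonneg hMk.le, ← div_eq_mul_inv, mul_div_assoc', div_le_div_iff_of_pos_right hMk]
      calc (m k : ℝ) * _ ≤ m k * (B * |v / √(m k)| ^ 3) := by gcongr
        _ = B * |v| ^ 3 * (√(m k : ℝ))⁻¹ := by
            have hs : 0 < √(m k : ℝ) := Real.sqrt_pos.2 hmk
            have hsq : (m k : ℝ) = √(m k : ℝ) ^ 2 := (Real.sq_sqrt hmk.le).symm
            rw [abs_div, abs_of_pos hs, div_pow]
            nth_rewrite 1 [hsq]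
            field_simp
    have h4 := h2.add h1
    rw [zero_add] at h4
    refine h4.congr' ?_
    filter_upwards [hev, hpos] with k hk hk0
    have hMk : (mgf id μ (t k) : ℂ) ≠ 0 := by
      exact_mod_cast (mgf_pos_of_mem (Icc_subset_naturalInterior ha hb hk)).ne'
    have hmk : (0 : ℝ) < m k := by exact_mod_cast hk0
    have e1 : (((v / √(m k) : ℝ) : ℂ)) ^ 2 = (v : ℂ) ^ 2 / (m k : ℂ) := by
      rw [← Complex.ofReal_pow, div_pow, Real.sq_sqrt hmk.le]
      push_cast
      rfl
    have hmc : (m k : ℂ) ≠ 0 := by exact_mod_cast hk0.ne'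
    rw [e1]
    field_simp
    ring
  have := tendsto_one_add_pow_exp_of_tendsto_mul hm key
  refine this.congr fun k => ?_
  congr 1
  ring

/-- After u = v/√m in the Fourier formula the integrand converges to a Gaussian times 1/ϑ²,
dominated by a multiple of 1/(1 + κv²). A bounded shift `s` disappears in the phase. -/
theorem tendsto_stopLoss_sumLaw (hμ : μ ≪ volume) (hϑ : ϑ ∈ naturalInterior μ) (hϑ0 : 0 < ϑ)
    (ht : Tendsto t atTop (𝓝 ϑ)) (hm : Tendsto m atTop atTop) {s : ℕ → ℝ} {s₀ : ℝ}
    (hs : Tendsto s atTop (𝓝 s₀)) :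
    Tendsto (fun k => √(m k) / mgf id μ (t k) ^ m k *
      (Real.exp (t k * (m k * deriv (logNormalizer μ) (t k) + s k)) *
        stopLoss (sumLaw μ (m k)) (m k * deriv (logNormalizer μ) (t k) + s k))) atTop
      (𝓝 (1 / (ϑ ^ 2 * √(2 * Real.pi * deriv (deriv (logNormalizer μ)) ϑ)))) := by
  obtain ⟨a, b, ha0, ha, hb, hab, hev⟩ := exists_Icc_of_tendsto hϑ hϑ0 ht
  obtain ⟨κ, hκ, hbd⟩ := exists_charFun_expTilt_pow_le hμ ha hb
  have hmr : Tendsto (fun k => (m k : ℝ)) atTop atTop := tendsto_natCast_atTop_atTop.comp hm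
  have hms : Tendsto (fun k => √(m k : ℝ)) atTop atTop := Real.tendsto_sqrt_atTop.comp hmr
  have hpos : ∀ᶠ k in atTop, 0 < m k := hm.eventually_gt_atTop 0
  set q := deriv (deriv (logNormalizer μ)) ϑ with hq
  have hq0 : 0 < q := deriv_deriv_logNormalizer_pos hμ hϑ
  set d : ℕ → ℝ := fun k => deriv (logNormalizer μ) (t k) with hd
  set J : ℕ → ℝ → ℂ := fun k v =>
    (charFun (expTilt μ (t k)) (v / √(m k)) *
      Complex.exp (-(((v / √(m k) : ℝ) : ℂ) * d k) * Complex.I) / mgf id μ (t k)) ^ m k *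
    Complex.exp (-(((v / √(m k) : ℝ) : ℂ) * s k) * Complex.I) *
    (((t k : ℂ) + ((v / √(m k) : ℝ) : ℂ) * Complex.I) ^ 2)⁻¹ with hJ
  have hvm : ∀ v : ℝ, Tendsto (fun k => v / √(m k : ℝ)) atTop (𝓝 0) := fun v =>
    hms.const_div_atTop v
  have hvmC : ∀ v : ℝ, Tendsto (fun k => ((v / √(m k : ℝ) : ℝ) : ℂ)) atTop (𝓝 0) := fun v => by
    have := (Complex.continuous_ofReal.tendsto _).comp (hvm v)
    simpa [Function.comp_def] using this
  have hlim : Tendsto (fun k => ∫ v, J k v) atTop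
      (𝓝 (∫ v : ℝ, Complex.exp (-(v ^ 2 * q / 2)) * ((ϑ : ℂ) ^ 2)⁻¹)) := by
    refine tendsto_integral_filter_of_dominated_convergence
      (fun v => (1 + (a ^ 2)⁻¹) * (1 + κ * v ^ 2)⁻¹) ?_ ?_
      ((integral_inv_one_add_mul_sq hκ).1.const_mul _) ?_
    · filter_upwards [hev] with k hk
      have htk : 0 < t k := ha0.trans_le hk.1
      have h1 := isFiniteMeasure_expTilt (integrable_exp_of_mem (Icc_subset_naturalInterior ha hb hk))
      have h2 : Measurable fun v : ℝ => charFun (expTilt μ (t k)) (v / √(m k)) :=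
        measurable_charFun.comp (by fun_prop)
      have h3 : Measurable fun v : ℝ =>
          (((t k : ℂ) + ((v / √(m k) : ℝ) : ℂ) * Complex.I) ^ 2)⁻¹ :=
        (continuous_inv_sq_add_mul_I htk).measurable.comp (by fun_prop)
      exact Measurable.aestronglyMeasurable (by fun_prop)
    · filter_upwards [hev, hpos] with k hk hk0
      refine ae_of_all _ fun v => ?_
      have htk : 0 < t k := ha0.trans_le hk.1
      have hMk := mgf_pos_of_mem (Icc_subset_naturalInterior ha hb hk)
      have hmk : (0 : ℝ) < m k := by exact_mod_cast hk0
      have hn : ∀ x y : ℝ, ‖Complex.exp (-((x : ℂ) * (y : ℂ)) * Complex.I)‖ = 1 := fun x y => by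
        rw [← Complex.ofReal_mul, ← Complex.ofReal_neg, Complex.norm_exp_ofReal_mul_I]
      simp only [hJ]
      rw [norm_mul, norm_mul, hn, mul_one, norm_pow, norm_div, norm_mul, hn, mul_one,
        Complex.norm_real, Real.norm_of_nonneg hMk.le, norm_inv_sq_add_mul_I, div_pow]
      have h1 := hbd (t k) hk (m k) (v / √(m k))
      have e : κ * m k * (v / √(m k : ℝ)) ^ 2 = κ * v ^ 2 := by
        rw [div_pow, Real.sq_sqrt hmk.le]; field_simp
      rw [e] at h1
      calc _ ≤ mgf id μ (t k) ^ m k * ((1 + (v / √(m k : ℝ)) ^ 2) / (1 + κ * v ^ 2)) /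
            mgf id μ (t k) ^ m k * (t k ^ 2 + (v / √(m k : ℝ)) ^ 2)⁻¹ := by gcongr
        _ = ((1 + (v / √(m k : ℝ)) ^ 2) * (t k ^ 2 + (v / √(m k : ℝ)) ^ 2)⁻¹) *
            (1 + κ * v ^ 2)⁻¹ := by
            have : mgf id μ (t k) ^ m k ≠ 0 := by positivity
            field_simp
        _ ≤ _ := by
            gcongr
            exact one_add_sq_div_le htk ha0 hk.1 _
    · refine ae_of_all _ fun v => ?_
      have h1 := tendsto_charFun_expTilt_pow hμ hϑ hϑ0 ht hm v
      have h2 : Tendsto (fun k => Complex.exp (-(((v / √(m k) : ℝ) : ℂ) * s k) * Complex.I)) atTop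
          (𝓝 1) := by
        have h3 : Tendsto (fun k => (s k : ℂ)) atTop (𝓝 s₀) :=
          (Complex.continuous_ofReal.tendsto _).comp hs
        have h4 := (((hvmC v).mul h3).neg.mul_const Complex.I)
        rw [zero_mul, neg_zero, zero_mul] at h4
        have := (Complex.continuous_exp.tendsto 0).comp h4
        rwa [Complex.exp_zero] at this
      have h5 : Tendsto (fun k => (((t k : ℂ) + ((v / √(m k) : ℝ) : ℂ) * Complex.I) ^ 2)⁻¹) atTop
          (𝓝 ((ϑ : ℂ) ^ 2)⁻¹) := by
        have h6 : Tendsto (fun k => (t k : ℂ)) atTop (𝓝 ϑ) :=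
          (Complex.continuous_ofReal.tendsto _).comp ht
        have h7 := (h6.add ((hvmC v).mul_const Complex.I)).pow 2
        rw [zero_mul, add_zero] at h7
        refine h7.inv₀ (pow_ne_zero _ ?_)
        exact_mod_cast hϑ0.ne'
      have := (h1.mul h2).mul h5
      rwa [mul_one] at this
  have hval : (2 * Real.pi : ℂ)⁻¹ * ∫ v : ℝ, Complex.exp (-(v ^ 2 * q / 2)) * ((ϑ : ℂ) ^ 2)⁻¹ =
      ((1 / (ϑ ^ 2 * √(2 * Real.pi * q)) : ℝ) : ℂ) := by
    have e : ∀ v : ℝ, Complex.exp (-(v ^ 2 * q / 2)) * ((ϑ : ℂ) ^ 2)⁻¹ =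
        ((Real.exp (-(q / 2) * v ^ 2) * (ϑ ^ 2)⁻¹ : ℝ) : ℂ) := by
      intro v
      push_cast
      congr 2
      ring
    simp_rw [e]
    rw [integral_complex_ofReal, integral_mul_const, integral_gaussian]
    have e2 : √(Real.pi / (q / 2)) = 2 * Real.pi / √(2 * Real.pi * q) := by
      rw [eq_div_iff (by positivity), ← Real.sqrt_mul (by positivity)]
      rw [show Real.pi / (q / 2) * (2 * Real.pi * q) = (2 * Real.pi) ^ 2 by field_simp]
      exact Real.sqrt_sq (by positivity)
    rw [e2]
    have hpi := Real.pi_pos.ne'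
    rw [← Complex.ofReal_ofNat, ← Complex.ofReal_mul, ← Complex.ofReal_inv, ← Complex.ofReal_mul]
    congr 1
    field_simp
  have hfin := hlim.const_mul (2 * Real.pi : ℂ)⁻¹
  rw [hval] at hfin
  have hre := (Complex.continuous_re.tendsto _).comp hfin
  rw [Complex.ofReal_re] at hre
  refine hre.congr' ?_
  filter_upwards [hev, hpos] with k hk hk0
  have htk : 0 < t k := ha0.trans_le hk.1
  have hMk := mgf_pos_of_mem (Icc_subset_naturalInterior ha hb hk)
  have hmk : (0 : ℝ) < m k := by exact_mod_cast hk0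
  have hsm : 0 < √(m k : ℝ) := Real.sqrt_pos.2 hmk
  have hsl := stopLoss_sumLaw_eq htk (integrable_exp_of_mem (Icc_subset_naturalInterior ha hb hk))
    (m k) (m k * d k + s k)
  rw [Function.comp_apply, ← Complex.ofReal_re (_ * _)]
  congr 1
  rw [Complex.ofReal_mul, hsl, mul_left_comm]
  congr 1
  have hchg := Measure.integral_comp_div (fun u : ℝ =>
    Complex.exp (-(u * ((m k * d k + s k : ℝ) : ℂ)) * Complex.I) * charFun (expTilt μ (t k)) u ^ m k *
        (((t k : ℂ) + u * Complex.I) ^ 2)⁻¹) (√(m k : ℝ))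
  rw [abs_of_pos hsm] at hchg
  have e3 : ((√(m k : ℝ) / mgf id μ (t k) ^ m k : ℝ) : ℂ) * (∫ u : ℝ,
      Complex.exp (-(u * ((m k * d k + s k : ℝ) : ℂ)) * Complex.I) *
        charFun (expTilt μ (t k)) u ^ m k * (((t k : ℂ) + u * Complex.I) ^ 2)⁻¹) =
      ((mgf id μ (t k) : ℂ) ^ m k)⁻¹ * (√(m k : ℝ) • ∫ u : ℝ,
      Complex.exp (-(u * ((m k * d k + s k : ℝ) : ℂ)) * Complex.I) *
        charFun (expTilt μ (t k)) u ^ m k * (((t k : ℂ) + u * Complex.I) ^ 2)⁻¹) := by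
    rw [Complex.real_smul]
    push_cast
    ring
  rw [e3, ← hchg, ← integral_const_mul]
  refine integral_congr_ae (ae_of_all _ fun v => ?_)
  simp only [hJ]
  rw [div_pow, mul_pow, ← Complex.exp_nat_mul]
  have e4 : Complex.exp (-(((v / √(m k) : ℝ) : ℂ) * ((m k * d k + s k : ℝ) : ℂ)) * Complex.I) =
      Complex.exp ((m k : ℂ) * (-(((v / √(m k) : ℝ) : ℂ) * d k) * Complex.I)) *
      Complex.exp (-(((v / √(m k) : ℝ) : ℂ) * s k) * Complex.I) := by
    rw [← Complex.exp_add]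
    congr 1
    push_cast
    ring
  rw [e4]
  ring

/-- Sharp tail asymptotics for sums of independent observations. -/
theorem tendsto_sumLaw_Ioi (hμ : μ ≪ volume) (hϑ : ϑ ∈ naturalInterior μ) (hϑ0 : 0 < ϑ)
    (ht : Tendsto t atTop (𝓝 ϑ)) (hm : Tendsto m atTop atTop) {s : ℕ → ℝ} {s₀ : ℝ}
    (hs : Tendsto s atTop (𝓝 s₀)) :
    Tendsto (fun k => √(m k) / mgf id μ (t k) ^ m k *
      (Real.exp (t k * (m k * deriv (logNormalizer μ) (t k) + s k)) *
        (sumLaw μ (m k)).real (Set.Ioi (m k * deriv (logNormalizer μ) (t k) + s k)))) atTop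
      (𝓝 (1 / (ϑ * √(2 * Real.pi * deriv (deriv (logNormalizer μ)) ϑ)))) := by
  obtain ⟨a, b, ha0, ha, hb, hab, hev⟩ := exists_Icc_of_tendsto hϑ hϑ0 ht
  set A := 1 / (ϑ ^ 2 * √(2 * Real.pi * deriv (deriv (logNormalizer μ)) ϑ)) with hA
  have hq0 : 0 < deriv (deriv (logNormalizer μ)) ϑ := deriv_deriv_logNormalizer_pos hμ hϑ
  have hA0 : 0 < A := by positivity
  have hAϑ : 1 / (ϑ * √(2 * Real.pi * deriv (deriv (logNormalizer μ)) ϑ)) = A * ϑ := by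
    rw [hA]; field_simp
  rw [hAϑ]
  set y : ℕ → ℝ := fun k => m k * deriv (logNormalizer μ) (t k) + s k with hy
  set N : ℕ → ℝ := fun k => √(m k) / mgf id μ (t k) ^ m k * Real.exp (t k * y k) with hN
  have hP : ∀ x : ℝ, Tendsto (fun k => N k * stopLoss (sumLaw μ (m k)) (y k + x)) atTop
      (𝓝 (A * Real.exp (-(ϑ * x)))) := by
    intro x
    have h1 := tendsto_stopLoss_sumLaw hμ hϑ hϑ0 ht hm (hs.add_const x)
    have h2 : Tendsto (fun k => Real.exp (-(t k * x))) atTop (𝓝 (Real.exp (-(ϑ * x)))) :=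
      (Real.continuous_exp.tendsto _).comp (ht.mul_const x).neg
    refine (h1.mul h2).congr fun k => ?_
    simp only [hN, hy]
    have : Real.exp (t k * (m k * deriv (logNormalizer μ) (t k) + (s k + x))) *
        Real.exp (-(t k * x)) = Real.exp (t k * (m k * deriv (logNormalizer μ) (t k) + s k)) := by
      rw [← Real.exp_add]; ring_nf
    rw [← this, add_assoc]
    ring
  have hN0 : ∀ᶠ k in atTop, 0 ≤ N k := by
    filter_upwards [hev] with k hk
    have := mgf_pos_of_mem (Icc_subset_naturalInterior ha hb hk)
    simp only [hN]
    positivity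
  -- The tail is minus the derivative of the convex stop-loss transform, so difference quotients to
  -- the right and to the left enclose it.
  have hmono : ∀ᶠ k in atTop, ∀ ε > 0,
      (stopLoss (sumLaw μ (m k)) (y k + 0) - stopLoss (sumLaw μ (m k)) (y k + ε)) / ε ≤
        (sumLaw μ (m k)).real (Set.Ioi (y k)) ∧
      (sumLaw μ (m k)).real (Set.Ioi (y k)) ≤
        (stopLoss (sumLaw μ (m k)) (y k + -ε) - stopLoss (sumLaw μ (m k)) (y k + 0)) / ε := by
    filter_upwards [hev] with k hk ε hε
    have htk : 0 < t k := ha0.trans_le hk.1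
    have hi := fun z => (integrable_max_sumLaw htk
      (integrable_exp_of_mem (Icc_subset_naturalInterior ha hb hk)) (m k) z).1
    have e : ε * (sumLaw μ (m k)).real (Set.Ioi (y k)) =
        ∫ x, (Set.Ioi (y k)).indicator (fun _ => ε) x ∂(sumLaw μ (m k)) := by
      rw [integral_indicator measurableSet_Ioi]; simp [mul_comm]
    have hind : Integrable ((Set.Ioi (y k)).indicator fun _ => ε) (sumLaw μ (m k)) :=
      (integrable_const ε).indicator measurableSet_Ioi
    rw [div_le_iff₀ hε, le_div_iff₀ hε, mul_comm _ ε, e, stopLoss, stopLoss, stopLoss,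
      ← integral_sub (hi _) (hi _), ← integral_sub (hi _) (hi _)]
    constructor
    · refine integral_mono ((hi _).sub (hi _)) hind fun x => ?_
      by_cases hx : x ∈ Set.Ioi (y k)
      · simp only [Set.indicator_of_mem hx]
        rw [Set.mem_Ioi] at hx
        rw [max_eq_left (by linarith)]
        linarith [le_max_left (x - (y k + ε)) 0]
      · simp only [Set.indicator_of_notMem hx]
        rw [Set.mem_Ioi, not_lt] at hx
        rw [max_eq_right (by linarith), max_eq_right (by linarith), sub_zero]
    · refine integral_mono hind ((hi _).sub (hi _)) fun x => ?_
      by_cases hx : x ∈ Set.Ioi (y k)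
      · simp only [Set.indicator_of_mem hx]
        rw [Set.mem_Ioi] at hx
        rw [max_eq_left (by linarith), max_eq_left (by linarith)]
        linarith
      · simp only [Set.indicator_of_notMem hx]
        have : max (x - (y k + 0)) 0 ≤ max (x - (y k + -ε)) 0 :=
          max_le_max (by linarith) le_rfl
        linarith
  have hgoal : ∀ k, √(m k) / mgf id μ (t k) ^ m k * (Real.exp (t k * y k) *
      (sumLaw μ (m k)).real (Set.Ioi (y k))) = N k * (sumLaw μ (m k)).real (Set.Ioi (y k)) := by
    intro k
    simp only [hN]
    ring
  suffices h : Tendsto (fun k => N k * (sumLaw μ (m k)).real (Set.Ioi (y k))) atTop (𝓝 (A * ϑ)) from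
    h.congr fun k => (hgoal k).symm
  -- The limiting difference quotients are A(1 - e^{-ϑε})/ε; positive ε serves the lower bound,
  -- negative ε the upper one.
  have hslope : Tendsto (fun ε : ℝ => (1 - Real.exp (-(ϑ * ε))) / ε) (𝓝[≠] 0) (𝓝 ϑ) := by
    have hd : HasDerivAt (fun x : ℝ => 1 - Real.exp (-(ϑ * x))) ϑ 0 := by
      have := (((hasDerivAt_id (0 : ℝ)).const_mul ϑ).neg.exp).const_sub 1
      simpa using this
    refine hd.tendsto_slope_zero.congr fun x => ?_
    simp [div_eq_inv_mul]
  refine tendsto_order.2 ⟨fun l hl => ?_, fun l hl => ?_⟩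
  · have h1 : ∀ᶠ ε in 𝓝[>] (0 : ℝ), l < A * ((1 - Real.exp (-(ϑ * ε))) / ε) :=
      ((hslope.mono_left (nhdsWithin_mono _ fun x hx => ne_of_gt hx)).const_mul A).eventually
        (lt_mem_nhds hl)
    obtain ⟨ε, hε1, hε2⟩ := (h1.and self_mem_nhdsWithin).exists
    have hε2 : 0 < ε := hε2
    have h3 : l < (A * Real.exp (-(ϑ * 0)) - A * Real.exp (-(ϑ * ε))) / ε := by
      rw [mul_zero, neg_zero, Real.exp_zero]
      calc l < _ := hε1
        _ = _ := by ring
    have h2 := (((hP 0).sub (hP ε)).div_const ε).eventually (lt_mem_nhds h3)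
    filter_upwards [h2, hmono, hN0] with k hk1 hk2 hk3
    refine hk1.trans_le ?_
    rw [← mul_sub, mul_div_assoc]
    exact mul_le_mul_of_nonneg_left (hk2 ε hε2).1 hk3
  · have h1 : ∀ᶠ ε in 𝓝[<] (0 : ℝ), A * ((1 - Real.exp (-(ϑ * ε))) / ε) < l :=
      ((hslope.mono_left (nhdsWithin_mono _ fun x hx => ne_of_lt hx)).const_mul A).eventually
        (gt_mem_nhds hl)
    obtain ⟨ε, hε1, hε2⟩ := (h1.and self_mem_nhdsWithin).exists
    have hε2 : ε < 0 := hε2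
    have h3 : (A * Real.exp (-(ϑ * ε)) - A * Real.exp (-(ϑ * 0))) / -ε < l := by
      rw [mul_zero, neg_zero, Real.exp_zero]
      calc _ = A * ((1 - Real.exp (-(ϑ * ε))) / ε) := by
            have := hε2.ne
            field_simp
            ring
        _ < l := hε1
    have h2 := (((hP ε).sub (hP 0)).div_const (-ε)).eventually (gt_mem_nhds h3)
    filter_upwards [h2, hmono, hN0] with k hk1 hk2 hk3
    refine lt_of_le_of_lt ?_ hk1
    have h3 := (hk2 (-ε) (by linarith)).2
    rw [neg_neg] at h3
    rw [← mul_sub, mul_div_assoc]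
    exact mul_le_mul_of_nonneg_left h3 hk3

end Sequences

end TailAsymptotics

/-! ### Moving sums of the stationary stream. -/

section MovingSum

variable {μ : Measure ℝ} [IsProbabilityMeasure μ]

instance isProbabilityMeasure_steadyState : IsProbabilityMeasure (steadyState μ) := by
  unfold steadyState; infer_instance

lemma iIndepFun_steadyState : iIndepFun (fun (i : ℤ) (x : ℤ → ℝ) => x i) (steadyState μ) :=
  iIndepFun_infinitePi (P := fun _ : ℤ => μ) (X := fun _ x => x) fun _ => measurable_id

/-- Functions of the stream that depend on disjoint sets of observations are independent. -/
lemma indepFun_of_dependsOn {α β : Type*} [MeasurableSpace α] [MeasurableSpace β]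
    {S T : Finset ℤ} (hST : Disjoint S T) {F : (ℤ → ℝ) → α} {G : (ℤ → ℝ) → β}
    (hF : Measurable F) (hG : Measurable G) (hFS : DependsOn F (S : Set ℤ))
    (hGT : DependsOn G (T : Set ℤ)) : IndepFun F G (steadyState μ) := by
  -- Extension by 0 factors F through the coordinates in S, where the independence of finite blocks
  -- applies.
  let ext (S : Finset ℤ) (z : S → ℝ) : ℤ → ℝ := fun i => if h : i ∈ S then z ⟨i, h⟩ else 0
  have hext : ∀ S, Measurable (ext S) := fun S => measurable_pi_lambda _ fun i => by
    by_cases h : i ∈ S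
    · simp only [ext, h, dif_pos]; exact measurable_pi_apply _
    · simp only [ext, h, dif_neg, not_false_eq_true]; exact measurable_const
  have h1 := (iIndepFun_steadyState (μ := μ)).indepFun_finset S T hST
    fun i => measurable_pi_apply i
  have h2 := h1.comp (hF.comp (hext S)) (hG.comp (hext T))
  have e1 : (F ∘ ext S) ∘ (fun (x : ℤ → ℝ) (i : S) => x i) = F := by
    ext1 x
    exact hFS fun i hi => by
      have hi' : i ∈ S := hi
      simp [ext, hi']
  have e2 : (G ∘ ext T) ∘ (fun (x : ℤ → ℝ) (i : T) => x i) = G := by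
    ext1 x
    exact hGT fun i hi => by
      have hi' : i ∈ T := hi
      simp [ext, hi']
  rwa [e1, e2] at h2

lemma measurable_sum_coord (S : Finset ℤ) : Measurable fun x : ℤ → ℝ => ∑ i ∈ S, x i :=
  Finset.measurable_sum _ fun i _ => measurable_pi_apply i

lemma dependsOn_sum_coord (S : Finset ℤ) :
    DependsOn (fun x : ℤ → ℝ => ∑ i ∈ S, x i) (S : Set ℤ) :=
  fun _ _ h => Finset.sum_congr rfl fun i hi => h i hi

lemma map_coord_steadyState (i : ℤ) : (steadyState μ).map (fun x => x i) = μ :=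
  Measure.infinitePi_map_eval (fun _ : ℤ => μ) i

lemma map_sum_coord (S : Finset ℤ) :
    (steadyState μ).map (fun x => ∑ i ∈ S, x i) = sumLaw μ S.card := by
  induction S using Finset.induction_on with
  | empty => simp [sumLaw, killedWalk]
  | insert a S ha ih =>
    have hind : IndepFun (fun x : ℤ → ℝ => ∑ i ∈ S, x i) (fun x => x a) (steadyState μ) :=
      indepFun_of_dependsOn (T := {a}) (by simpa using ha) (measurable_sum_coord S)
        (measurable_pi_apply a) (dependsOn_sum_coord S)
        fun x y h => h a (by simp)
    have h := hind.map_add_eq_map_conv_map (measurable_sum_coord S) (measurable_pi_apply a)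
    rw [ih, map_coord_steadyState] at h
    have e : (fun x : ℤ → ℝ => ∑ i ∈ insert a S, x i) =
        (fun x => ∑ i ∈ S, x i) + fun x => x a := by
      ext x; simp [Finset.sum_insert ha, add_comm]
    rw [e, h, Finset.card_insert_of_notMem ha]
    simp [sumLaw, killedWalk]

lemma measurable_apply_Ioi_sub (ρ : Measure ℝ) (a : ℝ) :
    Measurable fun u : ℝ => ρ (Set.Ioi (a - u)) :=
  Monotone.measurable fun _ _ h => measure_mono (Set.Ioi_subset_Ioi (by linarith))

lemma measurable_real_Ioi_sub (ρ : Measure ℝ) (a : ℝ) :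
    Measurable fun u : ℝ => ρ.real (Set.Ioi (a - u)) :=
  (measurable_apply_Ioi_sub ρ a).ennreal_toReal

/-- Integrating out an independent summand. -/
lemma measureReal_inter_lt_add {Ω : Type*} [MeasurableSpace Ω] {P : Measure Ω}
    [IsProbabilityMeasure P] {A : Set Ω} (hA : MeasurableSet A) {U V : Ω → ℝ} (hU : Measurable U)
    (hV : Measurable V) (h : IndepFun (fun ω => (ω ∈ A, U ω)) V P) (a : ℝ) :
    P.real (A ∩ {ω | a < V ω + U ω}) =
      ∫ u, (P.map V).real (Set.Ioi (a - u)) ∂((P.restrict A).map U) := by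
  -- Membership in A is carried along as a random variable with values in `Prop`, so that
  -- independence of a pair covers both the event and U.
  have hF : Measurable fun ω => (ω ∈ A, U ω) := (measurable_mem.2 hA).prodMk hU
  have hB : MeasurableSet {q : (Prop × ℝ) × ℝ | q.1.1 ∧ a < q.2 + q.1.2} := by
    refine MeasurableSet.inter ?_ (measurableSet_lt measurable_const
      (measurable_snd.add (measurable_snd.comp measurable_fst)))
    exact measurableSet_setOfPred.2 (measurable_fst.comp measurable_fst)
  have hmap := (indepFun_iff_map_prod_eq_prod_map_map hF.aemeasurable hV.aemeasurable).1 h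
  have e1 : P (A ∩ {ω | a < V ω + U ω}) =
      ∫⁻ u, (P.map V) (Set.Ioi (a - u)) ∂((P.restrict A).map U) := by
    have : A ∩ {ω | a < V ω + U ω} = (fun ω => ((ω ∈ A, U ω), V ω)) ⁻¹'
        {q : (Prop × ℝ) × ℝ | q.1.1 ∧ a < q.2 + q.1.2} := by ext ω; simp
    rw [this, ← Measure.map_apply (hF.prodMk hV) hB, hmap, Measure.prod_apply hB,
      lintegral_map (measurable_measure_prodMk_left hB) hF,
      lintegral_map (measurable_apply_Ioi_sub _ a) hU, ← lintegral_indicator hA]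
    refine lintegral_congr fun ω => ?_
    by_cases hω : ω ∈ A
    · rw [Set.indicator_of_mem hω]
      congr 1
      ext v
      simp [hω, sub_lt_iff_lt_add]
    · rw [Set.indicator_of_notMem hω]
      simp [hω]
  rw [Measure.real, e1]
  simp only [Measure.real]
  rw [integral_toReal (measurable_apply_Ioi_sub _ a).aemeasurable]
  exact ae_of_all _ fun u => by
    have : IsProbabilityMeasure (P.map V) := Measure.isProbabilityMeasure_map hV.aemeasurable
    exact measure_lt_top _ _

/-- The sum of the last `w` observations at time `t`. -/
def movingSum (x : ℤ → ℝ) (w : ℕ) (t : ℤ) : ℝ := ∑ i ∈ Finset.Icc (t - w + 1) t, x i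

lemma measurable_movingSum (w : ℕ) (t : ℤ) : Measurable fun x => movingSum x w t :=
  measurable_sum_coord _

lemma map_movingSum (w : ℕ) (t : ℤ) :
    (steadyState μ).map (fun x => movingSum x w t) = sumLaw μ w := by
  simp only [movingSum]
  rw [map_sum_coord]
  congr 1
  simp

lemma movingSum_succ (x : ℤ → ℝ) (w : ℕ) (t : ℤ) :
    movingSum x w (t + 1) = movingSum x w t + (x (t + 1) - x (t - w + 1)) := by
  have h1 : Finset.Icc (t - w + 1) (t + 1) = insert (t + 1) (Finset.Icc (t - w + 1) t) := by
    ext i; simp only [Finset.mem_Icc, Finset.mem_insert]; omega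
  have h2 : Finset.Icc (t - w + 1) (t + 1) =
      insert (t - w + 1) (Finset.Icc (t + 1 - w + 1) (t + 1)) := by
    ext i; simp only [Finset.mem_Icc, Finset.mem_insert]; omega
  have e1 := congrArg (fun S => ∑ i ∈ S, x i) h1
  have e2 := congrArg (fun S => ∑ i ∈ S, x i) h2
  rw [Finset.sum_insert (by simp)] at e1
  rw [Finset.sum_insert (by simp)] at e2
  simp only [movingSum]
  linarith

lemma movingSum_add (x : ℤ → ℝ) (w : ℕ) (t : ℤ) (k : ℕ) :
    movingSum x w (t + k) = movingSum x w t +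
      ∑ j ∈ Finset.range k, (x (t + 1 + j) - x (t - w + 1 + j)) := by
  induction k with
  | zero => simp
  | succ k ih =>
    rw [Finset.sum_range_succ, ← add_assoc, ← ih]
    have := movingSum_succ x w (t + k)
    push_cast
    rw [← add_assoc, this, show t + 1 + (k : ℤ) = t + k + 1 by ring,
      show t - w + 1 + (k : ℤ) = t + k - w + 1 by ring]

lemma movingSum_sub (x : ℤ → ℝ) (w : ℕ) (t : ℤ) (k : ℕ) :
    movingSum x w (t - k) = movingSum x w t +
      ∑ j ∈ Finset.range k, (x (t - w - j) - x (t - j)) := by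
  induction k with
  | zero => simp
  | succ k ih =>
    rw [Finset.sum_range_succ, ← add_assoc, ← ih]
    have := movingSum_succ x w (t - k - 1)
    push_cast
    rw [show t - ((k : ℤ) + 1) = t - k - 1 by ring]
    rw [sub_add_cancel, show t - (k : ℤ) - 1 - w + 1 = t - w - k by ring] at this
    linarith

/-- The middle block is not touched by m replacements on either side, so it is independent of the
event of a local maximum and supplies the large-deviation tail. -/
lemma movingSum_eq_middle_add (x : ℤ → ℝ) (w : ℕ) (t : ℤ) {m : ℕ} (hm : 2 * m ≤ w) :
    movingSum x w t = ∑ i ∈ Finset.Icc (t - w + 1 + m) (t - m), x i +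
      (∑ j ∈ Finset.range m, x (t - w + 1 + j) + ∑ j ∈ Finset.range m, x (t - j)) := by
  induction m with
  | zero => simp [movingSum]
  | succ m ih =>
    rw [ih (by omega), Finset.sum_range_succ, Finset.sum_range_succ]
    have h1 : Finset.Icc (t - w + 1 + m) (t - m) = insert (t - w + 1 + m) (insert (t - m)
        (Finset.Icc (t - w + 1 + (m + 1 : ℕ)) (t - (m + 1 : ℕ)))) := by
      ext i; simp only [Finset.mem_Icc, Finset.mem_insert]; push_cast; omega
    rw [h1, Finset.sum_insert, Finset.sum_insert]
    · ring
    · simp only [Finset.mem_Icc]; push_cast; omega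
    · simp only [Finset.mem_Icc, Finset.mem_insert]; push_cast; omega

/-- The moving sums at different times are almost surely different. -/
lemma ae_movingSum_ne (hμ : μ ≪ volume) {w : ℕ} (hw : 0 < w) {s t : ℤ} (hst : s < t) :
    ∀ᵐ x ∂(steadyState μ), movingSum x w s ≠ movingSum x w t := by
  have : NullSingletonClass μ := ⟨fun x => hμ (measure_singleton x)⟩
  -- The observation x_t lies in the later window only; isolating it exhibits the difference as an
  -- atomless variable plus an independent one.
  set S := Finset.Icc (t - w + 1) (t - 1) with hS
  set T := Finset.Icc (s - w + 1) s with hT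
  have hG : Measurable fun x : ℤ → ℝ => ∑ i ∈ S, x i - ∑ i ∈ T, x i :=
    (measurable_sum_coord S).sub (measurable_sum_coord T)
  have hind : IndepFun (fun x : ℤ → ℝ => ∑ i ∈ S, x i - ∑ i ∈ T, x i) (fun x => x t)
      (steadyState μ) := by
    refine indepFun_of_dependsOn (S := S ∪ T) (T := {t}) ?_ hG (measurable_pi_apply t)
      (fun x y h => ?_) fun x y h => h t (by simp)
    · simp only [Finset.disjoint_singleton_right, Finset.mem_union, hS, hT, Finset.mem_Icc]; omega
    · have h1 : ∑ i ∈ S, x i = ∑ i ∈ S, y i :=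
        Finset.sum_congr rfl fun i hi => h i (by simp [hi])
      have h2 : ∑ i ∈ T, x i = ∑ i ∈ T, y i :=
        Finset.sum_congr rfl fun i hi => h i (by simp [hi])
      simp only [h1, h2]
  have h := hind.map_add_eq_map_conv_map hG (measurable_pi_apply t)
  rw [map_coord_steadyState] at h
  have hna : NullSingletonClass ((steadyState μ).map
      (fun x : ℤ → ℝ => ∑ i ∈ S, x i - ∑ i ∈ T, x i) ∗ μ) := noAtoms_conv
  rw [← h] at hna
  have h0 := measure_singleton (μ := (steadyState μ).map
    ((fun x : ℤ → ℝ => ∑ i ∈ S, x i - ∑ i ∈ T, x i) + fun x => x t)) (0 : ℝ)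
  rw [Measure.map_apply (hG.add (measurable_pi_apply t)) (measurableSet_singleton 0)] at h0
  refine measure_mono_null (fun x hx => ?_) h0
  have hx : movingSum x w s = movingSum x w t := by simpa using hx
  have e : Finset.Icc (t - w + 1) t = insert t S := by
    ext i; simp only [hS, Finset.mem_Icc, Finset.mem_insert]; omega
  simp only [movingSum, e] at hx
  rw [Finset.sum_insert (by simp [hS])] at hx
  simp only [Set.mem_preimage, Pi.add_apply, Set.mem_singleton_iff]
  linarith

end MovingSum

/-! ### Local maxima as pairs of independent replacement walks; joint exceedances. -/

section LocalMaximum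

variable (μ : Measure ℝ) [IsProbabilityMeasure μ]

/-- The law of an observation, together with the increment of a sum in which this observation is
replaced by an independent one. -/
def replaceLaw : Measure (ℝ × ℝ) := (μ.prod μ).map fun p => (p.1, p.2 - p.1)

instance isProbabilityMeasure_replaceLaw : IsProbabilityMeasure (replaceLaw μ) :=
  Measure.isProbabilityMeasure_map (by fun_prop)

/-- The replacement walk, killed when the sum increases. -/
def replaceWalk (m : ℕ) : Measure (ℝ × ℝ) :=
  killedWalk (replaceLaw μ) ((AddMonoidHom.snd ℝ ℝ) ⁻¹' Set.Iic 0) m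

instance isFiniteMeasure_replaceWalk (m : ℕ) : IsFiniteMeasure (replaceWalk μ m) :=
  isFiniteMeasure_killedWalk _ _ _

variable {μ}

/-- The four observations that move in and out of the window in the `j`-th step after and before
time `t`, arranged as replacements. -/
def replaceStep (w : ℕ) (t : ℤ) (j : ℕ) (x : ℤ → ℝ) : (ℝ × ℝ) × (ℝ × ℝ) :=
  ((x (t - w + 1 + j), x (t + 1 + j) - x (t - w + 1 + j)),
    (x (t - j), x (t - w - j) - x (t - j)))

lemma measurable_replaceStep (w : ℕ) (t : ℤ) (j : ℕ) : Measurable (replaceStep w t j) := by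
  unfold replaceStep; fun_prop

lemma map_pair_steadyState {i j : ℤ} (hij : i ≠ j) :
    (steadyState μ).map (fun x => (x i, x j)) = μ.prod μ := by
  have h := iIndepFun_steadyState (μ := μ)
  rw [(indepFun_iff_map_prod_eq_prod_map_map (measurable_pi_apply i).aemeasurable
    (measurable_pi_apply j).aemeasurable).1 (h.indepFun hij), map_coord_steadyState,
    map_coord_steadyState]

/-- The condition 2j + 2 ≤ w keeps the two observations removed from opposite ends of the window
distinct. -/
lemma map_replaceStep {w : ℕ} (t : ℤ) {j : ℕ} (hj : 2 * j + 2 ≤ w) :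
    (steadyState μ).map (replaceStep w t j) = (replaceLaw μ).prod (replaceLaw μ) := by
  have h := iIndepFun_steadyState (μ := μ)
  have h2 := h.indepFun_prodMk_prodMk (fun i => measurable_pi_apply i) (t - w + 1 + j) (t + 1 + j)
    (t - j) (t - w - j) (by omega) (by omega) (by omega) (by omega)
  have hf : Measurable fun p : ℝ × ℝ => (p.1, p.2 - p.1) := by fun_prop
  have h3 := (indepFun_iff_map_prod_eq_prod_map_map (by fun_prop) (by fun_prop)).1
    (h2.comp hf hf)
  have e : ∀ {a b : ℤ}, a ≠ b → (steadyState μ).map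
      ((fun p : ℝ × ℝ => (p.1, p.2 - p.1)) ∘ fun x => (x a, x b)) = replaceLaw μ := by
    intro a b hab
    rw [← Measure.map_map hf (by fun_prop), map_pair_steadyState hab, replaceLaw]
  rw [e (by omega), e (by omega)] at h3
  exact h3

/-- The observations used by the first `n` replacements. -/
def replaceIndices (w : ℕ) (t : ℤ) (n : ℕ) : Finset ℤ :=
  (Finset.Ioc (t - w) (t - w + n) ∪ Finset.Ioc t (t + n)) ∪
    (Finset.Ioc (t - n) t ∪ Finset.Ioc (t - w - n) (t - w))

lemma replaceStep_congr {w : ℕ} {t : ℤ} {n j : ℕ} (hj : j < n) {x y : ℤ → ℝ}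
    (h : ∀ i ∈ (replaceIndices w t n : Set ℤ), x i = y i) :
    replaceStep w t j x = replaceStep w t j y := by
  unfold replaceStep
  rw [h (t - w + 1 + j), h (t + 1 + j), h (t - j), h (t - w - j)] <;>
  · simp only [replaceIndices, Finset.coe_union, Set.mem_union, Finset.mem_coe, Finset.mem_Ioc]
    omega

lemma indepFun_replaceStep {w : ℕ} (t : ℤ) {n : ℕ} (hn : 2 * n + 2 ≤ w) :
    IndepFun (fun x (i : Fin n) => replaceStep w t i x) (replaceStep w t n) (steadyState μ) := by
  refine indepFun_of_dependsOn (S := replaceIndices w t n)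
    (T := {t - w + 1 + n, t + 1 + n, t - n, t - w - n}) ?_
    (measurable_pi_lambda _ fun i => measurable_replaceStep w t i) (measurable_replaceStep w t n)
    (fun x y h => ?_) (fun x y h => ?_)
  · rw [Finset.disjoint_left]
    intro i hi
    simp only [replaceIndices, Finset.mem_union, Finset.mem_Ioc] at hi
    simp only [Finset.mem_insert, Finset.mem_singleton]
    omega
  · ext1 i
    exact replaceStep_congr i.2 h
  · unfold replaceStep
    rw [h (t - w + 1 + n) (by simp), h (t + 1 + n) (by simp), h (t - n) (by simp),
      h (t - w - n) (by simp)]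

/-- The event that the moving sum exceeds `a` at time `t`, and is maximal within distance `m`. -/
def localMaxEvent (w m : ℕ) (a : ℝ) (t : ℤ) : Set (ℤ → ℝ) :=
  {x | a < movingSum x w t ∧ ∀ k < m, movingSum x w (t + (k + 1 : ℕ)) ≤ movingSum x w t ∧
    movingSum x w (t - (k + 1 : ℕ)) ≤ movingSum x w t}

/-- The probability that the moving sum exceeds `a` at a local maximum. -/
theorem measureReal_localMaxEvent {w m : ℕ} (hm : 2 * m ≤ w) (a : ℝ) (t : ℤ) :
    (steadyState μ).real (localMaxEvent w m a t) =
      ∫ u, (sumLaw μ (w - 2 * m)).real (Set.Ioi (a - (u.1.1 + u.2.1)))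
        ∂((replaceWalk μ m).prod (replaceWalk μ m)) := by
  set s : Set ((ℝ × ℝ) × (ℝ × ℝ)) := ((AddMonoidHom.snd ℝ ℝ) ⁻¹' Set.Iic (0 : ℝ)) ×ˢ
    ((AddMonoidHom.snd ℝ ℝ) ⁻¹' Set.Iic (0 : ℝ)) with hs
  have hsm : MeasurableSet s :=
    (measurable_snd measurableSet_Iic).prod (measurable_snd measurableSet_Iic)
  set A : Set (ℤ → ℝ) :=
    {x | ∀ k < m, ∑ i ∈ Finset.range (k + 1), replaceStep w t i x ∈ s} with hA
  have hsum : ∀ k, Measurable fun x => ∑ i ∈ Finset.range k, replaceStep w t i x := fun k =>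
    Finset.measurable_sum _ fun i _ => measurable_replaceStep w t i
  have hAm : MeasurableSet A := by
    have : A = ⋂ k ∈ Finset.range m,
        (fun x => ∑ i ∈ Finset.range (k + 1), replaceStep w t i x) ⁻¹' s := by
      ext x; simp [hA]
    rw [this]
    exact Finset.measurableSet_biInter _ fun k _ => hsum (k + 1) hsm
  -- The four-coordinate steps are independent up to step m, and the survival set is a rectangle, so
  -- the killed walk is a product of two identical ones.
  have hwalk : ((steadyState μ).restrict A).map
      (fun x => ∑ i ∈ Finset.range m, replaceStep w t i x) =
      (replaceWalk μ m).prod (replaceWalk μ m) := by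
    have := map_restrict_path_eq_killedWalk (P := steadyState μ) (ξ := replaceStep w t)
      (measurable_replaceStep w t) (ν := (replaceLaw μ).prod (replaceLaw μ)) m
      (fun i hi => map_replaceStep t (by omega)) (fun n hn => indepFun_replaceStep t (by omega))
      hsm m le_rfl
    rw [this, hs, killedWalk_prod, replaceWalk]
  set U : (ℤ → ℝ) → ℝ := fun x => (∑ i ∈ Finset.range m, replaceStep w t i x).1.1 +
    (∑ i ∈ Finset.range m, replaceStep w t i x).2.1 with hU
  set V : (ℤ → ℝ) → ℝ := fun x => ∑ i ∈ Finset.Icc (t - w + 1 + m) (t - m), x i with hV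
  have hUm : Measurable U :=
    ((hsum m).fst.fst).add ((hsum m).snd.fst)
  have hind : IndepFun (fun x => (x ∈ A, U x)) V (steadyState μ) := by
    refine indepFun_of_dependsOn (S := replaceIndices w t m) ?_
      ((measurable_mem.2 hAm).prodMk hUm) (measurable_sum_coord _) (fun x y h => ?_)
      (dependsOn_sum_coord _)
    · rw [Finset.disjoint_left]
      intro i hi
      simp only [replaceIndices, Finset.mem_union, Finset.mem_Ioc] at hi
      simp only [Finset.mem_Icc]
      omega
    · have h1 : ∀ k ≤ m, ∑ i ∈ Finset.range k, replaceStep w t i x =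
          ∑ i ∈ Finset.range k, replaceStep w t i y := fun k hk =>
        Finset.sum_congr rfl fun i hi =>
          replaceStep_congr (by have := Finset.mem_range.1 hi; omega) h
      have h2 : (x ∈ A) = (y ∈ A) := by
        simp only [hA, Set.mem_ofPred_eq, eq_iff_iff]
        exact forall₂_congr fun k hk => by rw [h1 (k + 1) hk]
      simp only [h2, hU, h1 m le_rfl]
  have hfst : ∀ (k : ℕ) (x : ℤ → ℝ), ∑ i ∈ Finset.range k, replaceStep w t i x =
      ((∑ i ∈ Finset.range k, x (t - w + 1 + i),
        ∑ i ∈ Finset.range k, (x (t + 1 + i) - x (t - w + 1 + i))),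
      (∑ i ∈ Finset.range k, x (t - i), ∑ i ∈ Finset.range k, (x (t - w - i) - x (t - i)))) := by
    intro k x
    induction k with
    | zero => rfl
    | succ k ih =>
      rw [Finset.sum_range_succ, ih]
      simp only [Finset.sum_range_succ, replaceStep, Prod.mk_add_mk]
  -- Comparing T_t with its neighbours involves only the increments, and T_t is the untouched block
  -- V plus the removed observations U.
  have hev : localMaxEvent w m a t = A ∩ {x | a < V x + U x} := by
    ext x
    simp only [localMaxEvent, Set.mem_ofPred_eq, Set.mem_inter_iff, hA, hU, hV, hfst, hs,
      Set.mem_prod, Set.mem_preimage, AddMonoidHom.coe_snd, Set.mem_Iic, movingSum_add,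
      movingSum_sub, add_le_iff_nonpos_right]
    rw [← movingSum_eq_middle_add x w t hm, and_comm]
  rw [hev, measureReal_inter_lt_add hAm hUm (measurable_sum_coord _) hind, map_sum_coord,
    ← hwalk]
  have hcard : (Finset.Icc (t - w + 1 + m) (t - m)).card = w - 2 * m := by
    rw [Int.card_Icc]; omega
  have hg : Measurable fun u : (ℝ × ℝ) × (ℝ × ℝ) => u.1.1 + u.2.1 := by fun_prop
  have hUe : U = (fun u : (ℝ × ℝ) × (ℝ × ℝ) => u.1.1 + u.2.1) ∘
    fun x => ∑ i ∈ Finset.range m, replaceStep w t i x := rfl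
  rw [hcard, hUe, ← Measure.map_map hg (hsum m), integral_map hg.aemeasurable
    (measurable_real_Ioi_sub _ a).aestronglyMeasurable]

/-- Two moving sums with overlapping windows. -/
lemma measureReal_pair_le_of_lt {w j : ℕ} (hj : j < w) (a : ℝ) (t : ℤ) :
    (steadyState μ).real {x | a < movingSum x w t ∧ a < movingSum x w (t + j)} ≤
      ∫ u, (sumLaw μ (w - j)).real (Set.Ioi (a - u / 2)) ∂(sumLaw μ (2 * j)) := by
  set S := Finset.Icc (t - w + 1) (t - w + j) ∪ Finset.Icc (t + 1) (t + j) with hS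
  set M := Finset.Icc (t - w + 1 + j) t with hM
  have hdisj : Disjoint (Finset.Icc (t - w + 1) (t - w + j)) (Finset.Icc (t + 1) (t + (j : ℤ))) := by
    rw [Finset.disjoint_left]
    intro i hi
    simp only [Finset.mem_Icc] at hi ⊢
    omega
  have hcard : S.card = 2 * j := by
    rw [hS, Finset.card_union_of_disjoint hdisj, Int.card_Icc, Int.card_Icc]; omega
  have hcardM : M.card = w - j := by rw [hM, Int.card_Icc]; omega
  have hSM : Disjoint S M := by
    rw [Finset.disjoint_left]
    intro i hi
    simp only [hS, hM, Finset.mem_union, Finset.mem_Icc] at hi ⊢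
    omega
  -- If both sums exceed a then so does their average: the common block plus half of the 2j
  -- observations that the windows do not share.
  have hUm : Measurable fun x : ℤ → ℝ => (∑ i ∈ S, x i) / 2 := (measurable_sum_coord S).div_const 2
  have hind : IndepFun (fun x : ℤ → ℝ => (x ∈ (Set.univ : Set (ℤ → ℝ)), (∑ i ∈ S, x i) / 2))
      (fun x => ∑ i ∈ M, x i) (steadyState μ) := by
    refine indepFun_of_dependsOn hSM ((measurable_mem.2 MeasurableSet.univ).prodMk hUm)
      (measurable_sum_coord M) (fun x y h => ?_) (dependsOn_sum_coord M)
    have := dependsOn_sum_coord S h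
    simp only at this
    simp only [Set.mem_univ, this]
  have h := measureReal_inter_lt_add MeasurableSet.univ hUm (measurable_sum_coord M) hind a
  rw [map_sum_coord, hcardM, Measure.restrict_univ] at h
  have e : (steadyState μ).map (fun x : ℤ → ℝ => (∑ i ∈ S, x i) / 2) =
      (sumLaw μ (2 * j)).map fun u => u / 2 := by
    rw [← hcard, ← map_sum_coord S, Measure.map_map (by fun_prop) (measurable_sum_coord S)]
    rfl
  rw [e, integral_map (by fun_prop) (measurable_real_Ioi_sub _ a).aestronglyMeasurable] at h
  rw [← h]
  refine measureReal_mono (fun x hx => ⟨trivial, ?_⟩)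
  obtain ⟨h1, h2⟩ := hx
  have e1 : movingSum x w t = ∑ i ∈ Finset.Icc (t - w + 1) (t - w + j), x i + ∑ i ∈ M, x i := by
    rw [movingSum, ← Finset.sum_union]
    · congr 1
      ext i; simp only [hM, Finset.mem_union, Finset.mem_Icc]; omega
    · rw [Finset.disjoint_left]
      intro i hi
      simp only [hM, Finset.mem_Icc] at hi ⊢
      omega
  have e2 : movingSum x w (t + j) = ∑ i ∈ M, x i + ∑ i ∈ Finset.Icc (t + 1) (t + (j : ℤ)), x i := by
    rw [movingSum, ← Finset.sum_union]
    · congr 1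
      ext i; simp only [hM, Finset.mem_union, Finset.mem_Icc]; omega
    · rw [Finset.disjoint_left]
      intro i hi
      simp only [hM, Finset.mem_Icc] at hi ⊢
      omega
  simp only [Set.mem_ofPred_eq, hS, Finset.sum_union hdisj]
  linarith

lemma measureReal_lt_movingSum (w : ℕ) (a : ℝ) (t : ℤ) :
    (steadyState μ).real {x | a < movingSum x w t} = (sumLaw μ w).real (Set.Ioi a) := by
  rw [← map_movingSum w t, map_measureReal_apply (measurable_movingSum w t) measurableSet_Ioi]
  rfl

/-- Two moving sums with disjoint windows. -/
lemma measureReal_pair_of_le {w j : ℕ} (hj : w ≤ j) (a : ℝ) (t : ℤ) :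
    (steadyState μ).real {x | a < movingSum x w t ∧ a < movingSum x w (t + j)} =
      (sumLaw μ w).real (Set.Ioi a) ^ 2 := by
  have hind : IndepFun (fun x : ℤ → ℝ => movingSum x w t) (fun x => movingSum x w (t + j))
      (steadyState μ) := by
    refine indepFun_of_dependsOn ?_ (measurable_movingSum w t) (measurable_movingSum w _)
      (dependsOn_sum_coord _) (dependsOn_sum_coord _)
    rw [Finset.disjoint_left]
    intro i hi
    simp only [Finset.mem_Icc] at hi ⊢
    omega
  have h := hind.measure_inter_preimage_eq_mul (Set.Ioi a) (Set.Ioi a) measurableSet_Ioi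
    measurableSet_Ioi
  have e : {x | a < movingSum x w t ∧ a < movingSum x w (t + j)} =
    (fun x => movingSum x w t) ⁻¹' Set.Ioi a ∩ (fun x => movingSum x w (t + j)) ⁻¹' Set.Ioi a := rfl
  rw [e, Measure.real, h, ENNReal.toReal_mul, sq]
  congr 1
  · exact measureReal_lt_movingSum w a t
  · exact measureReal_lt_movingSum w a (t + j)

end LocalMaximum

/-! ### Asymptotic probability of a high local maximum. -/

section LocalMaximumAsymptotics

variable {μ : Measure ℝ} [IsProbabilityMeasure μ]

/-- Weighting each removed observation by e^{ϑx} and then forgetting it turns a replacement step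
into M(ϑ) times the drifting step law, while survival depends only on the increments. -/
lemma lintegral_exp_replaceWalk {ϑ : ℝ} (h : Integrable (fun x => Real.exp (ϑ * x)) μ) (m : ℕ) :
    ∫⁻ p, ENNReal.ofReal (Real.exp (ϑ * p.1)) ∂(replaceWalk μ m) =
      ENNReal.ofReal (mgf id μ ϑ) ^ m * killedWalk (stepLaw μ ϑ) (Set.Iic 0) m Set.univ := by
  have := isProbabilityMeasure_stepLaw μ h
  have hM := mgf_pos_of_integrable μ h
  set χ : ℝ × ℝ → ENNReal := fun p => ENNReal.ofReal (Real.exp (ϑ * p.1)) with hχ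
  have hχm : Measurable χ := by fun_prop
  have hadd : ∀ x y, χ (x + y) = χ x * χ y := fun x y => by
    simp only [hχ, Prod.fst_add, mul_add, Real.exp_add]
    rw [ENNReal.ofReal_mul (Real.exp_pos _).le]
  have hs : MeasurableSet ((AddMonoidHom.snd ℝ ℝ) ⁻¹' Set.Iic (0 : ℝ)) :=
    measurable_snd measurableSet_Iic
  have hf : Measurable fun p : ℝ × ℝ => (p.1, p.2 - p.1) := by fun_prop
  have e1 : ((replaceLaw μ).withDensity χ).map (AddMonoidHom.snd ℝ ℝ) =
      ENNReal.ofReal (mgf id μ ϑ) • stepLaw μ ϑ := by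
    rw [replaceLaw, withDensity_map_eq _ hf hχm, AddMonoidHom.coe_snd,
      Measure.map_map measurable_snd hf, stepLaw, ← Measure.map_smul,
      ← withDensity_smul _ (by fun_prop)]
    congr 2
    ext p
    simp only [hχ, Pi.smul_apply, smul_eq_mul]
    rw [← ENNReal.ofReal_mul hM.le, mul_div_cancel₀ _ hM.ne']
  have hfin : IsFiniteMeasure ((replaceLaw μ).withDensity χ) := by
    constructor
    have := congrArg (fun ν => ν Set.univ) e1
    simp only [Measure.smul_apply, measure_univ, smul_eq_mul, mul_one] at this
    rw [AddMonoidHom.coe_snd, Measure.map_apply measurable_snd MeasurableSet.univ,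
      Set.preimage_univ] at this
    rw [this]
    exact ENNReal.ofReal_lt_top
  have e2 := killedWalk_withDensity hχm hadd (by simp [hχ]) (replaceLaw μ) hs m
  have e3 := killedWalk_map (AddMonoidHom.snd ℝ ℝ) measurable_snd ((replaceLaw μ).withDensity χ)
    (s := Set.Iic 0) measurableSet_Iic m
  rw [e1, killedWalk_smul, ← e2] at e3
  have e4 := congrArg (fun ν => ν Set.univ) e3
  simp only [Measure.smul_apply, smul_eq_mul] at e4
  rw [AddMonoidHom.coe_snd, Measure.map_apply measurable_snd MeasurableSet.univ, Set.preimage_univ,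
    withDensity_apply _ MeasurableSet.univ, Measure.restrict_univ] at e4
  exact e4

lemma integrable_exp_replaceWalk {ϑ : ℝ} (h : Integrable (fun x => Real.exp (ϑ * x)) μ) (m : ℕ) :
    Integrable (fun p : ℝ × ℝ => Real.exp (ϑ * p.1)) (replaceWalk μ m) := by
  have := isProbabilityMeasure_stepLaw μ h
  refine ⟨by fun_prop, ?_⟩
  rw [hasFiniteIntegral_iff_ofReal (ae_of_all _ fun p => (Real.exp_pos _).le),
    lintegral_exp_replaceWalk h]
  exact ENNReal.mul_lt_top (ENNReal.pow_lt_top ENNReal.ofReal_lt_top) (measure_lt_top _ _)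

lemma integral_exp_replaceWalk {ϑ : ℝ} (h : Integrable (fun x => Real.exp (ϑ * x)) μ) (m : ℕ) :
    ∫ p, Real.exp (ϑ * p.1) ∂(replaceWalk μ m) =
      mgf id μ ϑ ^ m * (killedWalk (stepLaw μ ϑ) (Set.Iic 0) m).real Set.univ := by
  rw [integral_eq_lintegral_of_nonneg_ae (ae_of_all _ fun p => (Real.exp_pos _).le) (by fun_prop),
    lintegral_exp_replaceWalk h, ENNReal.toReal_mul, ENNReal.toReal_pow,
    ENNReal.toReal_ofReal (mgf_pos_of_integrable μ h).le, Measure.real]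

/-- The order of magnitude of the tail `P(T > a)` of the sum `T` of `w` observations. -/
def tailScale (μ : Measure ℝ) (w : ℕ) (θ a : ℝ) : ℝ := mgf id μ θ ^ w * Real.exp (-θ * a) / √w

lemma tailScale_pos {θ : ℝ} (h : θ ∈ naturalInterior μ) {w : ℕ} (hw : 0 < w) (a : ℝ) :
    0 < tailScale μ w θ a := by
  have := mgf_pos_of_mem h
  have : (0 : ℝ) < w := by exact_mod_cast hw
  unfold tailScale
  positivity

lemma tendsto_mgf {ϑ : ℝ} (hϑ : ϑ ∈ naturalInterior μ) {t : ℕ → ℝ} (ht : Tendsto t atTop (𝓝 ϑ)) :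
    Tendsto (fun k => mgf id μ (t k)) atTop (𝓝 (mgf id μ ϑ)) :=
  (continuousOn_mgf.continuousAt (isOpen_interior.mem_nhds hϑ)).tendsto.comp ht

/-- The probability of a high local maximum, relative to the tail probability. -/
theorem tendsto_localMaxEvent (hμ : μ ≪ volume) {ϑ : ℝ} (hϑ : ϑ ∈ naturalInterior μ) (hϑ0 : 0 < ϑ)
    {t : ℕ → ℝ} (ht : Tendsto t atTop (𝓝 ϑ)) {w : ℕ → ℕ} (hw : Tendsto w atTop atTop) (m : ℕ)
    (s : ℕ → ℤ) :
    Tendsto (fun k => (steadyState μ).real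
        (localMaxEvent (w k) m (w k * deriv (logNormalizer μ) (t k)) (s k)) /
        tailScale μ (w k) (t k) (w k * deriv (logNormalizer μ) (t k))) atTop
      (𝓝 (1 / (ϑ * √(2 * Real.pi * deriv (deriv (logNormalizer μ)) ϑ)) *
        (killedWalk (stepLaw μ ϑ) (Set.Iic 0) m).real Set.univ ^ 2)) := by
  obtain ⟨α, β, hα0, hα, hβ, hαβ, hev⟩ := exists_Icc_of_tendsto hϑ hϑ0 ht
  obtain ⟨C, hC, hCb⟩ := exists_sumLaw_Ioi_le hμ hα0 hα hβ
  set N := (replaceWalk μ m).prod (replaceWalk μ m) with hN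
  set D : ℕ → ℝ := fun k => deriv (logNormalizer μ) (t k) with hD
  set K := 1 / (ϑ * √(2 * Real.pi * deriv (deriv (logNormalizer μ)) ϑ)) with hK
  have hM := mgf_pos_of_mem hϑ
  have hlarge : ∀ᶠ k in atTop, 4 * m + 1 ≤ w k := hw.eventually_ge_atTop _
  have hn : Tendsto (fun k => w k - 2 * m) atTop atTop := by
    refine tendsto_atTop.2 fun b => ?_
    filter_upwards [hw.eventually_ge_atTop (b + 2 * m)] with k hk
    omega
  have hDlim : Tendsto D atTop (𝓝 (deriv (logNormalizer μ) ϑ)) :=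
    (continuousAt_deriv_logNormalizer hϑ).tendsto.comp ht
  have hMlim := tendsto_mgf hϑ ht
  have hMinv : Tendsto (fun k => (mgf id μ (t k) ^ (2 * m))⁻¹) atTop
      (𝓝 (mgf id μ ϑ ^ (2 * m))⁻¹) := (hMlim.pow _).inv₀ (by positivity)
  have hsq : Tendsto (fun k => √(w k : ℝ) / √((w k - 2 * m : ℕ) : ℝ)) atTop (𝓝 1) := by
    have h1 : Tendsto (fun k => √(1 + 2 * m * ((w k - 2 * m : ℕ) : ℝ)⁻¹)) atTop (𝓝 1) := by
      have h2 : Tendsto (fun k => ((w k - 2 * m : ℕ) : ℝ)⁻¹) atTop (𝓝 0) :=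
        (tendsto_natCast_atTop_atTop.comp hn).inv_tendsto_atTop
      have h3 := ((h2.const_mul (2 * (m : ℝ))).const_add 1).sqrt
      simpa using h3
    refine h1.congr' ?_
    filter_upwards [hlarge] with k hk
    have h5 : (0 : ℝ) < ((w k - 2 * m : ℕ) : ℝ) := by
      have : 0 < w k - 2 * m := by omega
      exact_mod_cast this
    rw [← Real.sqrt_div (Nat.cast_nonneg _)]
    congr 1
    have : (w k : ℝ) = ((w k - 2 * m : ℕ) : ℝ) + 2 * m := by
      have : w k = (w k - 2 * m) + 2 * m := by omega
      exact_mod_cast this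
    rw [this]
    generalize ((w k - 2 * m : ℕ) : ℝ) = z at h5
    field_simp
  set H : ℕ → (ℝ × ℝ) × (ℝ × ℝ) → ℝ := fun k u =>
    (sumLaw μ (w k - 2 * m)).real (Set.Ioi (w k * D k - (u.1.1 + u.2.1))) /
      tailScale μ (w k) (t k) (w k * D k) with hH
  have hint : ∀ γ ∈ naturalInterior μ, Integrable
      (fun u : (ℝ × ℝ) × (ℝ × ℝ) => Real.exp (γ * (u.1.1 + u.2.1))) N := by
    intro γ hγ
    have h1 := integrable_exp_replaceWalk (integrable_exp_of_mem hγ) m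
    refine (h1.mul_prod h1).congr (ae_of_all _ fun u => ?_)
    simp only [mul_add, Real.exp_add]
  have hlim : Tendsto (fun k => ∫ u, H k u ∂N) atTop
      (𝓝 (∫ u, K * ((mgf id μ ϑ ^ (2 * m))⁻¹ * Real.exp (ϑ * (u.1.1 + u.2.1))) ∂N)) := by
    -- The uniform tail bound contributes e^{tu} with t in [α, β], dominated by the sum of the
    -- exponentials at the two endpoints.
    refine tendsto_integral_filter_of_dominated_convergence
      (fun u => C * 2 * ((mgf id μ ϑ ^ (2 * m))⁻¹ + 1) *
        (Real.exp (α * (u.1.1 + u.2.1)) + Real.exp (β * (u.1.1 + u.2.1)))) ?_ ?_ ?_ ?_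
    · refine Eventually.of_forall fun k => Measurable.aestronglyMeasurable ?_
      exact ((measurable_real_Ioi_sub (sumLaw μ (w k - 2 * m)) (w k * D k)).comp
        (show Measurable fun u : (ℝ × ℝ) × (ℝ × ℝ) => u.1.1 + u.2.1 by fun_prop)).div_const _
    · filter_upwards [hlarge, hev, hMinv.eventually_le_const (lt_add_one _),
        hsq.eventually_le_const one_lt_two] with k hk hk2 hk3 hk4
      refine ae_of_all _ fun u => ?_
      have hMk := mgf_pos_of_mem (Icc_subset_naturalInterior hα hβ hk2)
      have hwk : 0 < w k := by omega
      have hp := tailScale_pos (Icc_subset_naturalInterior hα hβ hk2) hwk (w k * D k)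
      have hnk : 0 < w k - 2 * m := by omega
      have hb := hCb (t k) hk2 (w k - 2 * m) hnk (w k * D k - (u.1.1 + u.2.1))
      have hexp := exp_mul_le_add hk2.1 hk2.2 (u.1.1 + u.2.1)
      rw [Real.norm_of_nonneg (by positivity)]
      simp only [hH]
      rw [div_le_iff₀ hp]
      refine hb.trans ?_
      have hsn : 0 < √((w k - 2 * m : ℕ) : ℝ) := Real.sqrt_pos.2 (by exact_mod_cast hnk)
      have hsw : 0 < √(w k : ℝ) := Real.sqrt_pos.2 (by exact_mod_cast hwk)
      have hpow : mgf id μ (t k) ^ w k =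
          mgf id μ (t k) ^ (w k - 2 * m) * mgf id μ (t k) ^ (2 * m) := by
        rw [← pow_add]; congr 1; omega
      have hee : Real.exp (-t k * (w k * D k - (u.1.1 + u.2.1))) =
          Real.exp (-t k * (w k * D k)) * Real.exp (t k * (u.1.1 + u.2.1)) := by
        rw [← Real.exp_add]; congr 1; ring
      have e : C * (mgf id μ (t k) ^ (w k - 2 * m) *
          Real.exp (-t k * (w k * D k - (u.1.1 + u.2.1))) / √((w k - 2 * m : ℕ) : ℝ)) =
          C * (√(w k : ℝ) / √((w k - 2 * m : ℕ) : ℝ)) * (mgf id μ (t k) ^ (2 * m))⁻¹ *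
            Real.exp (t k * (u.1.1 + u.2.1)) * tailScale μ (w k) (t k) (w k * D k) := by
        rw [hee, tailScale, hpow]
        field_simp
      rw [e]
      refine mul_le_mul_of_nonneg_right ?_ hp.le
      have h0 : 0 ≤ (mgf id μ (t k) ^ (2 * m))⁻¹ := by positivity
      refine mul_le_mul (mul_le_mul (mul_le_mul_of_nonneg_left hk4 hC.le) hk3 h0 (by positivity))
        hexp (Real.exp_pos _).le (by positivity)
    · exact ((hint α hα).add (hint β hβ)).const_mul _
    · refine ae_of_all _ fun u => ?_
      -- The threshold is recentred at the mean of the w - 2m remaining observations; the difference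
      -- is a bounded shift.
      have hs : Tendsto (fun k => 2 * m * D k - (u.1.1 + u.2.1)) atTop
          (𝓝 (2 * m * deriv (logNormalizer μ) ϑ - (u.1.1 + u.2.1))) :=
        (hDlim.const_mul _).sub_const _
      have h1 := tendsto_sumLaw_Ioi hμ hϑ hϑ0 ht hn hs
      have h2 : Tendsto (fun k => Real.exp (t k * (u.1.1 + u.2.1))) atTop
          (𝓝 (Real.exp (ϑ * (u.1.1 + u.2.1)))) :=
        (Real.continuous_exp.tendsto _).comp (ht.mul_const _)
      have h3 := h1.mul ((hsq.mul hMinv).mul h2)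
      rw [one_mul] at h3
      refine h3.congr' ?_
      filter_upwards [hlarge, hev] with k hk hk2
      have hMk := mgf_pos_of_mem (Icc_subset_naturalInterior hα hβ hk2)
      have hwk : 0 < w k := by omega
      have hnk : 0 < w k - 2 * m := by omega
      have hsn : 0 < √((w k - 2 * m : ℕ) : ℝ) := Real.sqrt_pos.2 (by exact_mod_cast hnk)
      have hsw : 0 < √(w k : ℝ) := Real.sqrt_pos.2 (by exact_mod_cast hwk)
      have hy : ((w k - 2 * m : ℕ) : ℝ) * deriv (logNormalizer μ) (t k) +
          (2 * m * D k - (u.1.1 + u.2.1)) = w k * D k - (u.1.1 + u.2.1) := by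
        rw [Nat.cast_sub (by omega)]
        simp only [hD]
        push_cast
        ring
      have hpow : mgf id μ (t k) ^ w k =
          mgf id μ (t k) ^ (w k - 2 * m) * mgf id μ (t k) ^ (2 * m) := by
        rw [← pow_add]; congr 1; omega
      have hee : Real.exp (t k * (w k * D k - (u.1.1 + u.2.1))) *
          Real.exp (t k * (u.1.1 + u.2.1)) * Real.exp (-t k * (w k * D k)) = 1 := by
        rw [← Real.exp_add, ← Real.exp_add, Real.exp_eq_one_iff]; ring
      rw [hy]
      simp only [hH, tailScale, hpow]
      generalize (sumLaw μ (w k - 2 * m)).real (Set.Ioi (w k * D k - (u.1.1 + u.2.1))) = z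
      have hE := Real.exp_pos (-t k * (w k * D k))
      rw [eq_div_iff (by positivity)]
      generalize Real.exp (-t k * (w k * D k)) = E₁ at hee hE ⊢
      generalize Real.exp (t k * (w k * D k - (u.1.1 + u.2.1))) = E₂ at hee ⊢
      generalize Real.exp (t k * (u.1.1 + u.2.1)) = E₃ at hee ⊢
      field_simp
      linear_combination z * hee
  -- The factor M^{2m} from the two weighted walks cancels the one lost by shortening the sum,
  -- leaving a squared survival probability.
  have hval : ∫ u, K * ((mgf id μ ϑ ^ (2 * m))⁻¹ * Real.exp (ϑ * (u.1.1 + u.2.1))) ∂N =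
      K * (killedWalk (stepLaw μ ϑ) (Set.Iic 0) m).real Set.univ ^ 2 := by
    have h1 : ∫ u, Real.exp (ϑ * (u.1.1 + u.2.1)) ∂N =
        (mgf id μ ϑ ^ m * (killedWalk (stepLaw μ ϑ) (Set.Iic 0) m).real Set.univ) ^ 2 := by
      rw [sq, ← integral_exp_replaceWalk (integrable_exp_of_mem hϑ), ← integral_prod_mul]
      refine integral_congr_ae (ae_of_all _ fun u => ?_)
      simp only [mul_add, Real.exp_add]
    rw [integral_const_mul, integral_const_mul, h1, mul_pow, ← pow_mul, mul_comm m 2]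
    field_simp
  rw [hval] at hlim
  refine hlim.congr' ?_
  filter_upwards [hlarge] with k hk
  rw [measureReal_localMaxEvent (by omega), ← integral_div]

end LocalMaximumAsymptotics

/-! ### Decay of joint exceedances, and rarity of exceedances over the monitoring period. -/

section PairBound

variable {μ : Measure ℝ} [IsProbabilityMeasure μ]

lemma lintegral_exp_sumLaw {ϑ : ℝ} (h : Integrable (fun x => Real.exp (ϑ * x)) μ) (n : ℕ) :
    ∫⁻ x, ENNReal.ofReal (Real.exp (ϑ * x)) ∂(sumLaw μ n) = ENNReal.ofReal (mgf id μ ϑ ^ n) := by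
  have := isFiniteMeasure_expTilt h
  have h1 := congrArg (fun ν => ν Set.univ) (expTilt_sumLaw (μ := μ) ϑ n)
  simp only [sumLaw, killedWalk_univ_univ] at h1
  simp only [expTilt] at h1
  rw [withDensity_apply _ MeasurableSet.univ, withDensity_apply _ MeasurableSet.univ,
    Measure.restrict_univ, Measure.restrict_univ,
    ← ofReal_integral_eq_lintegral_ofReal h (ae_of_all _ fun x => (Real.exp_pos _).le)] at h1
  rw [ENNReal.ofReal_pow (mgf_pos_of_integrable μ h).le]
  exact h1

lemma integrable_exp_sumLaw {ϑ : ℝ} (h : Integrable (fun x => Real.exp (ϑ * x)) μ) (n : ℕ) :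
    Integrable (fun x => Real.exp (ϑ * x)) (sumLaw μ n) := by
  refine ⟨by fun_prop, ?_⟩
  rw [hasFiniteIntegral_iff_ofReal (ae_of_all _ fun p => (Real.exp_pos _).le),
    lintegral_exp_sumLaw h]
  exact ENNReal.ofReal_lt_top

lemma integral_exp_sumLaw {ϑ : ℝ} (h : Integrable (fun x => Real.exp (ϑ * x)) μ) (n : ℕ) :
    ∫ x, Real.exp (ϑ * x) ∂(sumLaw μ n) = mgf id μ ϑ ^ n := by
  have := mgf_pos_of_integrable μ h
  rw [integral_eq_lintegral_of_nonneg_ae (ae_of_all _ fun p => (Real.exp_pos _).le) (by fun_prop),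
    lintegral_exp_sumLaw h, ENNReal.toReal_ofReal (by positivity)]

/-- The factor by which a shift by one step decreases the probability of joint exceedances. -/
def pairDecay (μ : Measure ℝ) (ϑ : ℝ) : ℝ := mgf id μ (ϑ / 2) ^ 2 / mgf id μ ϑ

lemma half_mem_naturalInterior (h0 : (0 : ℝ) ∈ naturalInterior μ) {ϑ : ℝ}
    (h : ϑ ∈ naturalInterior μ) : ϑ / 2 ∈ naturalInterior μ := by
  have := convex_naturalInterior (μ := μ) h0 h (a := 1 / 2) (b := 1 / 2) (by norm_num)
    (by norm_num) (by norm_num)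
  simpa [div_eq_inv_mul] using this

/-- Joint exceedances of moving sums. -/
theorem exists_pair_le (hμ : μ ≪ volume) (h0 : (0 : ℝ) ∈ naturalInterior μ) {α β : ℝ}
    (hα0 : 0 < α) (hα : α ∈ naturalInterior μ) (hβ : β ∈ naturalInterior μ) :
    ∃ C > 0, ∀ θ ∈ Set.Icc α β, ∀ w : ℕ, 0 < w → ∀ a : ℝ,
      (sumLaw μ w).real (Set.Ioi a) ≤ C * tailScale μ w θ a ∧ ∀ (j : ℕ) (t : ℤ),
      (steadyState μ).real {x | a < movingSum x w t ∧ a < movingSum x w (t + j)} ≤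
        C * ((1 + j) * pairDecay μ θ ^ j) * tailScale μ w θ a +
          C ^ 2 * tailScale μ w θ a ^ 2 := by
  obtain ⟨C, hC, hCb⟩ := exists_sumLaw_Ioi_le hμ hα0 hα hβ
  refine ⟨C, hC, fun θ hθ w hw a => ⟨hCb θ hθ w hw a, fun j t => ?_⟩⟩
  have hθm := Icc_subset_naturalInterior hα hβ hθ
  have hθ2 := integrable_exp_of_mem (half_mem_naturalInterior h0 hθm)
  have hM := mgf_pos_of_mem hθm
  have hM2 := mgf_pos_of_integrable μ hθ2
  have hp := tailScale_pos hθm hw a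
  have hρ : 0 < pairDecay μ θ := by unfold pairDecay; positivity
  rcases lt_or_ge j w with hj | hj
  · refine le_add_of_le_of_nonneg ((measureReal_pair_le_of_lt hj a t).trans ?_) (by positivity)
    have hwj : 0 < w - j := by omega
    have hcast : ((w - j : ℕ) : ℝ) = w - j := Nat.cast_sub hj.le
    have hwjr : (0 : ℝ) < w - j := by rw [← hcast]; exact_mod_cast hwj
    have hwr : (0 : ℝ) < w := by exact_mod_cast hw
    -- Observations common to both windows are tilted by θ, the others by θ/2; each unit of shift
    -- thus costs the factor M(θ/2)²/M(θ).
    have h1 : ∫ u, (sumLaw μ (w - j)).real (Set.Ioi (a - u / 2)) ∂(sumLaw μ (2 * j)) ≤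
        ∫ u, C * (mgf id μ θ ^ (w - j) * Real.exp (-θ * a) / √((w - j : ℕ) : ℝ)) *
          Real.exp (θ / 2 * u) ∂(sumLaw μ (2 * j)) := by
      refine integral_mono_of_nonneg (ae_of_all _ fun u => by positivity)
        ((integrable_exp_sumLaw hθ2 _).const_mul _) (ae_of_all _ fun u => ?_)
      refine (hCb θ hθ (w - j) hwj (a - u / 2)).trans_eq ?_
      rw [show -θ * (a - u / 2) = -θ * a + θ / 2 * u by ring, Real.exp_add]
      ring
    refine h1.trans ?_
    rw [integral_const_mul, integral_exp_sumLaw hθ2]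
    have hpow : mgf id μ θ ^ w = mgf id μ θ ^ (w - j) * mgf id μ θ ^ j := by
      rw [← pow_add]; congr 1; omega
    -- A crude bound, valid up to j = w - 1; the linear growth is harmless against a geometric
    -- factor.
    have hs : √(w : ℝ) / √((w - j : ℕ) : ℝ) ≤ 1 + j := by
      rw [← Real.sqrt_div hwr.le, Real.sqrt_le_left (by positivity), hcast, div_le_iff₀ hwjr]
      have hj1 : (j : ℝ) + 1 ≤ w := by exact_mod_cast hj
      have hj0 : (0 : ℝ) ≤ j := Nat.cast_nonneg j
      nlinarith [mul_nonneg hj0 (sub_nonneg.2 hj1), mul_nonneg hj0 hwjr.le]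
    have e : C * (mgf id μ θ ^ (w - j) * Real.exp (-θ * a) / √((w - j : ℕ) : ℝ)) *
        mgf id μ (θ / 2) ^ (2 * j) =
        C * ((√(w : ℝ) / √((w - j : ℕ) : ℝ)) * pairDecay μ θ ^ j) * tailScale μ w θ a := by
      have h1 : 0 < √((w - j : ℕ) : ℝ) := Real.sqrt_pos.2 (by exact_mod_cast hwj)
      have h2 : 0 < √(w : ℝ) := Real.sqrt_pos.2 hwr
      rw [pairDecay, tailScale, hpow, div_pow, ← pow_mul]
      field_simp
    rw [e]
    exact mul_le_mul_of_nonneg_right (mul_le_mul_of_nonneg_left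
      (mul_le_mul_of_nonneg_right hs (by positivity)) hC.le) hp.le
  · rw [measureReal_pair_of_le hj, ← mul_pow]
    refine le_add_of_nonneg_of_le (by positivity) ?_
    exact pow_le_pow_left₀ measureReal_nonneg (hCb θ hθ w hw a) 2

lemma strictConvexOn_logNormalizer (hμ : μ ≪ volume) :
    StrictConvexOn ℝ (naturalInterior μ) (logNormalizer μ) := by
  refine StrictMonoOn.strictConvexOn_of_deriv convex_naturalInterior
    analyticOnNhd_logNormalizer.continuousOn ?_
  rw [naturalInterior, interior_interior]
  exact strictMonoOn_deriv_logNormalizer hμ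

lemma logNormalizer_zero : logNormalizer μ 0 = 0 := by
  simp [logNormalizer]

lemma exp_logNormalizer {ϑ : ℝ} (h : ϑ ∈ naturalInterior μ) :
    Real.exp (logNormalizer μ ϑ) = mgf id μ ϑ := by
  rw [logNormalizer, cgf, Real.exp_log (mgf_pos_of_mem h)]

/-- Strict convexity of c with c(0) = 0 gives 2c(ϑ/2) < c(ϑ). -/
lemma pairDecay_lt_one (hμ : μ ≪ volume) (h0 : (0 : ℝ) ∈ naturalInterior μ) {ϑ : ℝ}
    (h : ϑ ∈ naturalInterior μ) (hϑ0 : 0 < ϑ) : pairDecay μ ϑ < 1 := by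
  have h1 := (strictConvexOn_logNormalizer hμ).2 h0 h hϑ0.ne (show (0 : ℝ) < 1 / 2 by norm_num)
    (show (0 : ℝ) < 1 / 2 by norm_num) (by norm_num)
  simp only [smul_eq_mul, mul_zero, zero_add, logNormalizer_zero] at h1
  rw [pairDecay, div_lt_one (mgf_pos_of_mem h), ← exp_logNormalizer h,
    ← exp_logNormalizer (half_mem_naturalInterior h0 h), ← Real.exp_nat_mul]
  refine Real.exp_lt_exp.2 ?_
  rw [show ϑ / 2 = 1 / 2 * ϑ by ring]
  push_cast
  linarith

lemma tendsto_pairDecay (h0 : (0 : ℝ) ∈ naturalInterior μ) {ϑ : ℝ} (h : ϑ ∈ naturalInterior μ)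
    {t : ℕ → ℝ} (ht : Tendsto t atTop (𝓝 ϑ)) :
    Tendsto (fun k => pairDecay μ (t k)) atTop (𝓝 (pairDecay μ ϑ)) :=
  ((tendsto_mgf (half_mem_naturalInterior h0 h) (ht.div_const 2)).pow 2).div (tendsto_mgf h ht)
    (mgf_pos_of_mem h).ne'

/-- The tangent of the strictly convex c at ϑ lies below c(0) = 0 at the origin. The value is minus
the large-deviation rate. -/
lemma logNormalizer_sub_mul_deriv_neg (hμ : μ ≪ volume) (h0 : (0 : ℝ) ∈ naturalInterior μ) {ϑ : ℝ}
    (h : ϑ ∈ naturalInterior μ) (hϑ0 : 0 < ϑ) :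
    logNormalizer μ ϑ - ϑ * deriv (logNormalizer μ) ϑ < 0 := by
  have h1 := (strictConvexOn_logNormalizer hμ).slope_lt_deriv h0 h hϑ0
    (analyticOnNhd_logNormalizer ϑ h).differentiableAt
  rw [slope_def_field, logNormalizer_zero, sub_zero, sub_zero, div_lt_iff₀ hϑ0] at h1
  linarith

/-- The expected number of exceedances in a window tends to zero. -/
lemma tendsto_mul_tailScale (hμ : μ ≪ volume) (h0 : (0 : ℝ) ∈ naturalInterior μ) {ϑ : ℝ}
    (h : ϑ ∈ naturalInterior μ) (hϑ0 : 0 < ϑ) {t : ℕ → ℝ} (ht : Tendsto t atTop (𝓝 ϑ)) {w : ℕ → ℕ}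
    (hw : Tendsto w atTop atTop) {L : ℕ → ℕ}
    (hL : (fun k => (L k : ℝ)) =O[atTop] fun k => (w k : ℝ)) :
    Tendsto (fun k => L k * tailScale μ (w k) (t k) (w k * deriv (logNormalizer μ) (t k))) atTop
      (𝓝 0) := by
  have hwr : Tendsto (fun k => (w k : ℝ)) atTop atTop := tendsto_natCast_atTop_atTop.comp hw
  set I := logNormalizer μ ϑ - ϑ * deriv (logNormalizer μ) ϑ with hI
  have hI0 : I < 0 := logNormalizer_sub_mul_deriv_neg hμ h0 h hϑ0
  have hlim : Tendsto (fun k => logNormalizer μ (t k) - t k * deriv (logNormalizer μ) (t k)) atTop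
      (𝓝 I) :=
    ((analyticOnNhd_logNormalizer ϑ h).continuousAt.tendsto.comp ht).sub
      (ht.mul ((continuousAt_deriv_logNormalizer h).tendsto.comp ht))
  obtain ⟨B, hB0, hB⟩ := hL.exists_pos
  -- The tail scale decays exponentially in w, at half the limiting rate for safety, which beats L =
  -- O(w).
  have hexp : Tendsto (fun k => B * ((w k : ℝ) * Real.exp (-(-I / 2) * w k))) atTop (𝓝 0) := by
    have hI2 : 0 < -I / 2 := by linarith
    have h1 := (Real.tendsto_pow_mul_exp_neg_atTop_nhds_zero 1).comp (hwr.const_mul_atTop hI2)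
    have h2 := h1.const_mul (B * (-I / 2)⁻¹)
    rw [mul_zero] at h2
    refine h2.congr fun k => ?_
    simp only [Function.comp_apply, pow_one, neg_mul]
    generalize Real.exp _ = E
    have := hI0.ne
    field_simp
  refine squeeze_zero' ?_ ?_ hexp
  · filter_upwards [ht.eventually_mem (isOpen_interior.mem_nhds h),
      hw.eventually_gt_atTop 0] with k hk hk2
    have := tailScale_pos hk hk2 (w k * deriv (logNormalizer μ) (t k))
    positivity
  · filter_upwards [ht.eventually_mem (isOpen_interior.mem_nhds h), hw.eventually_gt_atTop 0,
      hB.bound, hlim.eventually_le_const (show I < I / 2 by linarith)] with k hk hk2 hk3 hk4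
    have hp := tailScale_pos hk hk2 (w k * deriv (logNormalizer μ) (t k))
    have hk1 : (1 : ℝ) ≤ w k := by exact_mod_cast hk2
    have h1 : (L k : ℝ) ≤ B * w k := by
      rw [Real.norm_of_nonneg (Nat.cast_nonneg _), Real.norm_of_nonneg (Nat.cast_nonneg _)] at hk3
      exact hk3
    have h2 : tailScale μ (w k) (t k) (w k * deriv (logNormalizer μ) (t k)) ≤
        Real.exp (-(-I / 2) * w k) := by
      rw [tailScale, ← exp_logNormalizer hk, ← Real.exp_nat_mul, ← Real.exp_add]
      refine (div_le_self (Real.exp_pos _).le (Real.one_le_sqrt.2 hk1)).trans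
        (Real.exp_le_exp.2 ?_)
      nlinarith
    calc (L k : ℝ) * _ ≤ B * w k * Real.exp (-(-I / 2) * w k) :=
          mul_le_mul h1 h2 hp.le (by positivity)
      _ = _ := by ring

end PairBound

/-! ### From the alarm time to maxima of the moving sum. -/

section Detection

variable {μ : Measure ℝ} [IsProbabilityMeasure μ]

lemma chartStat_eq (x : ℤ → ℝ) (w : ℕ) (t : ℤ) : chartStat x w t = movingSum x w t / √w := by
  rw [chartStat, movingAverage, movingSum, ← mul_assoc, mul_one_div, Real.sqrt_div_self,
    div_eq_inv_mul]

/-- The event that the moving sum exceeds `a` at one of the times `1, …, L`. -/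
def exceedEvent (w L : ℕ) (a : ℝ) : Set (ℤ → ℝ) :=
  {x | ∃ t ∈ Finset.Icc 1 L, a < movingSum x w (t : ℕ)}

lemma falseDetectionProb_eq {w : ℕ} (hw : 0 < w) (b : ℝ) (L : ℕ) :
    falseDetectionProb μ w b L = (steadyState μ).real (exceedEvent w L (√w * b)) := by
  rw [falseDetectionProb]
  congr 1
  have hs : 0 < √(w : ℝ) := Real.sqrt_pos.2 (by exact_mod_cast hw)
  have hlt : ∀ (x : ℤ → ℝ) (t : ℕ), b < chartStat x w t ↔ √w * b < movingSum x w t := fun x t => by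
    rw [chartStat_eq, lt_div_iff₀ hs, mul_comm]
  ext x
  simp only [exceedEvent, Set.mem_ofPred_eq, alarmTime, Finset.mem_Icc, hlt]
  constructor
  · intro h
    rcases Set.eq_empty_or_nonempty
      {s : ℕ∞ | ∃ t : ℕ, s = (t : ℕ∞) ∧ 0 < t ∧ √w * b < movingSum x w t} with h0 | h0
    -- Without exceedances the alarm time is `⊤`, which is not at most L.
    · rw [h0, sInf_empty] at h
      exact absurd (top_le_iff.1 h) (ENat.natCast_ne_top L)
    · obtain ⟨t, h1, h2, h3⟩ := csInf_mem h0
      rw [h1] at h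
      exact ⟨t, ⟨h2, by exact_mod_cast h⟩, h3⟩
  · rintro ⟨t, ⟨h1, h2⟩, h3⟩
    have h4 : (t : ℕ∞) ≤ L := by exact_mod_cast h2
    exact le_trans (sInf_le ⟨t, rfl, h1, h3⟩) h4

/-- The event that the moving sum exceeds `a` and is maximal over `1, …, L` at time `t`. -/
def globalMaxEvent (w L : ℕ) (a : ℝ) (t : ℕ) : Set (ℤ → ℝ) :=
  {x | a < movingSum x w t ∧ ∀ s ∈ Finset.Icc 1 L, movingSum x w (s : ℕ) ≤ movingSum x w t}

lemma measurableSet_lt_movingSum (w : ℕ) (a : ℝ) (t : ℤ) :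
    MeasurableSet {x | a < movingSum x w t} :=
  measurableSet_lt measurable_const (measurable_movingSum w t)

lemma measurableSet_globalMaxEvent (w L : ℕ) (a : ℝ) (t : ℕ) :
    MeasurableSet (globalMaxEvent w L a t) := by
  have : globalMaxEvent w L a t = {x | a < movingSum x w t} ∩
      ⋂ s ∈ Finset.Icc 1 L, {x | movingSum x w (s : ℕ) ≤ movingSum x w t} := by
    ext x; simp [globalMaxEvent]
  rw [this]
  exact (measurableSet_lt_movingSum w a t).inter (Finset.measurableSet_biInter _ fun s _ =>
    measurableSet_le (measurable_movingSum w s) (measurable_movingSum w t))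

lemma exceedEvent_eq (w L : ℕ) (a : ℝ) :
    exceedEvent w L a = ⋃ t ∈ Finset.Icc 1 L, globalMaxEvent w L a t := by
  ext x
  simp only [exceedEvent, globalMaxEvent, Set.mem_ofPred_eq, Set.mem_iUnion, exists_prop]
  constructor
  · rintro ⟨t, ht, h⟩
    obtain ⟨s, hs, hmax⟩ := (Finset.Icc 1 L).exists_max_image (fun s => movingSum x w (s : ℕ)) ⟨t, ht⟩
    exact ⟨s, hs, h.trans_le (hmax t ht), hmax⟩
  · rintro ⟨t, ht, h, _⟩
    exact ⟨t, ht, h⟩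

/-- Decomposition according to the time of the maximum. -/
lemma measureReal_exceedEvent (hμ : μ ≪ volume) {w : ℕ} (hw : 0 < w) (L : ℕ) (a : ℝ) :
    (steadyState μ).real (exceedEvent w L a) =
      ∑ t ∈ Finset.Icc 1 L, (steadyState μ).real (globalMaxEvent w L a t) := by
  have hne : ∀ s t : ℕ, s ≠ t → ∀ᵐ x ∂(steadyState μ), movingSum x w s ≠ movingSum x w t := by
    intro s t hst
    rcases lt_or_gt_of_ne hst with h | h
    · exact ae_movingSum_ne hμ hw (by exact_mod_cast h)
    · filter_upwards [ae_movingSum_ne hμ hw (s := t) (t := s) (by exact_mod_cast h)] with x hx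
      exact hx.symm
  rw [exceedEvent_eq, Measure.real, measure_biUnion_finset₀ (fun s hs t ht hst => ?_)
    fun t _ => (measurableSet_globalMaxEvent w L a t).nullMeasurableSet,
    ENNReal.toReal_sum fun t _ => measure_ne_top _ _]
  · rfl
  · refine measure_mono_null (fun x hx => ?_) (hne s t hst)
    simp only [Set.mem_compl_iff, Set.mem_ofPred_eq, not_not]
    exact le_antisymm (hx.2.2 s hs) (hx.1.2 t ht)

lemma measureReal_globalMaxEvent_le_tail (w L : ℕ) (a : ℝ) (t : ℕ) :
    (steadyState μ).real (globalMaxEvent w L a t) ≤ (sumLaw μ w).real (Set.Ioi a) := by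
  rw [← measureReal_lt_movingSum w a t]
  exact measureReal_mono fun x hx => hx.1

lemma measureReal_globalMaxEvent_le_local (w m : ℕ) {L t : ℕ} (a : ℝ) (h1 : m < t)
    (h2 : t + m ≤ L) : (steadyState μ).real (globalMaxEvent w L a t) ≤
      (steadyState μ).real (localMaxEvent w m a t) := by
  refine measureReal_mono fun x hx => ⟨hx.1, fun k hk => ⟨?_, ?_⟩⟩
  · have := hx.2 (t + (k + 1)) (Finset.mem_Icc.2 (by omega))
    push_cast at this ⊢
    exact this
  · have := hx.2 (t - (k + 1)) (Finset.mem_Icc.2 (by omega))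
    rw [Nat.cast_sub (by omega)] at this
    exact this

/-- If a local maximum is not the maximum over 1, …, L, then a higher sum occurs at distance j > m
on one side, so that both times exceed a. The backward case is written with the earlier time first
to fit the pair bound. -/
lemma measureReal_localMaxEvent_le (w m : ℕ) {L t : ℕ} (a : ℝ) (ht : t ∈ Finset.Icc 1 L) :
    (steadyState μ).real (localMaxEvent w m a t) ≤
      (steadyState μ).real (globalMaxEvent w L a t) + ∑ j ∈ Finset.Ioc m L,
        ((steadyState μ).real {x | a < movingSum x w t ∧ a < movingSum x w (t + j : ℤ)} +
        (steadyState μ).real {x | a < movingSum x w (t - j : ℤ) ∧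
          a < movingSum x w ((t - j : ℤ) + j)}) := by
  rw [Finset.mem_Icc] at ht
  have hsub : localMaxEvent w m a t ⊆ globalMaxEvent w L a t ∪ ⋃ j ∈ Finset.Ioc m L,
      ({x | a < movingSum x w t ∧ a < movingSum x w (t + j : ℤ)} ∪
        {x | a < movingSum x w (t - j : ℤ) ∧ a < movingSum x w ((t - j : ℤ) + j)}) := by
    intro x hx
    by_cases hg : x ∈ globalMaxEvent w L a t
    · exact Or.inl hg
    right
    simp only [globalMaxEvent, Set.mem_ofPred_eq, not_and, not_forall, not_le] at hg
    obtain ⟨s, hs, hlt⟩ := hg hx.1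
    rw [Finset.mem_Icc] at hs
    simp only [Set.mem_iUnion, Set.mem_union, Set.mem_ofPred_eq, sub_add_cancel, Finset.mem_Ioc,
      exists_prop]
    have hst : s ≠ t := fun h => by rw [h] at hlt; exact lt_irrefl _ hlt
    rcases lt_or_gt_of_ne hst with h | h
    · refine ⟨t - s, ⟨?_, by omega⟩, Or.inr ?_⟩
      · by_contra hm
        have := (hx.2 (t - s - 1) (by omega)).2
        rw [show t - s - 1 + 1 = t - s by omega, Nat.cast_sub h.le, sub_sub_cancel] at this
        exact absurd hlt (not_lt.2 this)
      · rw [Nat.cast_sub h.le, sub_sub_cancel]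
        exact ⟨hx.1.trans hlt, hx.1⟩
    · refine ⟨s - t, ⟨?_, by omega⟩, Or.inl ?_⟩
      · by_contra hm
        have := (hx.2 (s - t - 1) (by omega)).1
        rw [show s - t - 1 + 1 = s - t by omega, Nat.cast_sub h.le, add_sub_cancel] at this
        exact absurd hlt (not_lt.2 this)
      · rw [Nat.cast_sub h.le, add_sub_cancel]
        exact ⟨hx.1, hx.1.trans hlt⟩
  refine (measureReal_mono hsub).trans ((measureReal_union_le _ _).trans (add_le_add_right ?_ _))
  exact (measureReal_biUnion_finset_le _ _).trans
    (Finset.sum_le_sum fun j _ => measureReal_union_le _ _)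

end Detection

/-! ### Assembling the limit of the false detection probability. -/

section Limit

variable {μ : Measure ℝ} [IsProbabilityMeasure μ]

/-- Interchanges the limits: for each fixed m the bounds hold eventually in k, and their limits come
together as m → ∞. -/
lemma tendsto_of_forall_eventually_between {f : ℕ → ℝ} {lo up : ℕ → ℕ → ℝ} {A R : ℕ → ℝ} {c : ℝ}
    (hlo : ∀ m, ∀ᶠ k in atTop, lo m k ≤ f k) (hup : ∀ m, ∀ᶠ k in atTop, f k ≤ up m k)
    (hlo' : ∀ m, Tendsto (lo m) atTop (𝓝 (A m - R m)))
    (hup' : ∀ m, Tendsto (up m) atTop (𝓝 (A m)))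
    (hA : Tendsto A atTop (𝓝 c)) (hR : Tendsto R atTop (𝓝 0)) : Tendsto f atTop (𝓝 c) := by
  refine tendsto_order.2 ⟨fun l hl => ?_, fun l hl => ?_⟩
  · have h1 := hA.sub hR
    rw [sub_zero] at h1
    obtain ⟨m, hm⟩ := (h1.eventually (lt_mem_nhds hl)).exists
    filter_upwards [hlo m, (hlo' m).eventually (lt_mem_nhds hm)] with k h2 h3
    exact h3.trans_le h2
  · obtain ⟨m, hm⟩ := (hA.eventually (gt_mem_nhds hl)).exists
    filter_upwards [hup m, (hup' m).eventually (gt_mem_nhds hm)] with k h2 h3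
    exact h2.trans_lt h3

/-- Boundary effects: upper bound by the probability of a local maximum. -/
lemma measureReal_exceedEvent_le (hμ : μ ≪ volume) {w m : ℕ} (hw : 0 < w) (hm : 2 * m ≤ w) (L : ℕ)
    (a : ℝ) : (steadyState μ).real (exceedEvent w L a) ≤
      L * (steadyState μ).real (localMaxEvent w m a 0) +
        2 * m * (sumLaw μ w).real (Set.Ioi a) := by
  classical
  rw [measureReal_exceedEvent hμ hw]
  -- At most 2m times lie too near an end of the period for a two-sided comparison; these are
  -- bounded by the plain tail.
  set B := Finset.Icc 1 m ∪ Finset.Ioc (L - m) L with hB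
  have hBc : (B.card : ℝ) ≤ 2 * m := by
    have h1 : B.card ≤ 2 * m := by
      refine (Finset.card_union_le _ _).trans ?_
      rw [Nat.card_Icc, Nat.card_Ioc]
      omega
    exact_mod_cast h1
  have h1 : ∀ t ∈ Finset.Icc 1 L, (steadyState μ).real (globalMaxEvent w L a t) ≤
      (steadyState μ).real (localMaxEvent w m a 0) +
        if t ∈ B then (sumLaw μ w).real (Set.Ioi a) else 0 := by
    intro t ht
    rw [Finset.mem_Icc] at ht
    split_ifs with h
    · exact le_add_of_nonneg_of_le measureReal_nonneg (measureReal_globalMaxEvent_le_tail w L a t)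
    · simp only [hB, Finset.mem_union, Finset.mem_Icc, Finset.mem_Ioc] at h
      -- Stationarity: the formula for the local maximum does not involve t.
      rw [add_zero, measureReal_localMaxEvent hm a 0, ← measureReal_localMaxEvent hm a t]
      exact measureReal_globalMaxEvent_le_local w m a (by omega) (by omega)
  refine (Finset.sum_le_sum h1).trans ?_
  rw [Finset.sum_add_distrib, Finset.sum_const, Nat.card_Icc, nsmul_eq_mul, Nat.add_sub_cancel]
  refine add_le_add_right ?_ _
  rw [← Finset.sum_filter, Finset.sum_const, nsmul_eq_mul]
  refine mul_le_mul_of_nonneg_right (le_trans ?_ hBc) measureReal_nonneg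
  exact_mod_cast Finset.card_le_card fun i hi => (Finset.mem_filter.1 hi).2

lemma summable_one_add_mul_pow {ρ : ℝ} (h0 : 0 ≤ ρ) (h1 : ρ < 1) :
    Summable fun j : ℕ => (1 + (j : ℝ)) * ρ ^ j := by
  have h := (summable_geometric_of_lt_one h0 h1).add
    (summable_pow_mul_geometric_of_norm_lt_one 1 (by rwa [Real.norm_of_nonneg h0]))
  refine h.congr fun j => ?_
  ring

/-- The probability that a moving sum exceeds the boundary during the monitoring period. -/
theorem tendsto_exceedEvent (hμ : μ ≪ volume) (h0 : (0 : ℝ) ∈ naturalInterior μ) {ϑ : ℝ}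
    (hϑ : ϑ ∈ naturalInterior μ) (hϑ0 : 0 < ϑ) {t : ℕ → ℝ} (ht : Tendsto t atTop (𝓝 ϑ))
    {w L : ℕ → ℕ} (hw : Tendsto w atTop atTop) (hL : Tendsto L atTop atTop)
    (hLw : (fun k => (L k : ℝ)) =O[atTop] fun k => (w k : ℝ)) :
    Tendsto (fun k => (steadyState μ).real
        (exceedEvent (w k) (L k) (w k * deriv (logNormalizer μ) (t k))) /
        (L k * tailScale μ (w k) (t k) (w k * deriv (logNormalizer μ) (t k)))) atTop
      (𝓝 (1 / (ϑ * √(2 * Real.pi * deriv (deriv (logNormalizer μ)) ϑ)) *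
        survivalProb μ ϑ ^ 2)) := by
  obtain ⟨α, β, hα0, hα, hβ, hαβ, hev⟩ := exists_Icc_of_tendsto hϑ hϑ0 ht
  obtain ⟨C, hC, hCb⟩ := exists_pair_le hμ h0 hα0 hα hβ
  have := isProbabilityMeasure_stepLaw μ (integrable_exp_of_mem hϑ)
  -- A fixed ratio strictly between the limit and 1 dominates `pairDecay` along the sequence of
  -- tilts.
  obtain ⟨ρ, hρ1, hρ2⟩ := exists_between (pairDecay_lt_one hμ h0 hϑ hϑ0)
  have hρ0 : 0 ≤ ρ := by
    have : 0 ≤ pairDecay μ ϑ := div_nonneg (sq_nonneg _) (mgf_pos_of_mem hϑ).le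
    exact this.trans hρ1.le
  have hρev := (tendsto_pairDecay h0 hϑ ht).eventually (gt_mem_nhds hρ1)
  set f : ℕ → ℝ := fun j => (1 + (j : ℝ)) * ρ ^ j with hf
  have hf0 : ∀ j, 0 ≤ f j := fun j => by positivity
  have hsum : Summable f := summable_one_add_mul_pow hρ0 hρ2
  set R : ℕ → ℝ := fun m => (∑' j, f j) - ∑ j ∈ Finset.range (m + 1), f j with hR
  have hRlim : Tendsto R atTop (𝓝 0) := by
    have h1 := ((tendsto_add_atTop_iff_nat 1).2 hsum.hasSum.tendsto_sum_nat).const_sub (∑' j, f j)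
    rw [sub_self] at h1
    exact h1
  have hRle : ∀ m n, ∑ j ∈ Finset.Ioc m n, f j ≤ R m := by
    intro m n
    rw [hR, le_sub_iff_add_le, ← Finset.sum_union]
    · exact hsum.sum_le_tsum _ fun j _ => hf0 j
    · rw [Finset.disjoint_left]
      intro i hi
      simp only [Finset.mem_Ioc, Finset.mem_range] at hi ⊢
      omega
  set a : ℕ → ℝ := fun k => w k * deriv (logNormalizer μ) (t k) with ha
  set p : ℕ → ℝ := fun k => tailScale μ (w k) (t k) (a k) with hp
  set A : ℕ → ℝ := fun m => 1 / (ϑ * √(2 * Real.pi * deriv (deriv (logNormalizer μ)) ϑ)) *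
    (killedWalk (stepLaw μ ϑ) (Set.Iic 0) m).real Set.univ ^ 2 with hA
  have hloc : ∀ m, Tendsto (fun k => (steadyState μ).real (localMaxEvent (w k) m (a k) 0) / p k)
      atTop (𝓝 (A m)) := fun m => tendsto_localMaxEvent hμ hϑ hϑ0 ht hw m fun _ => 0
  have hpL : Tendsto (fun k => L k * p k) atTop (𝓝 0) :=
    tendsto_mul_tailScale hμ h0 hϑ hϑ0 ht hw hLw
  have hLinv : Tendsto (fun k => (L k : ℝ)⁻¹) atTop (𝓝 0) :=
    (tendsto_natCast_atTop_atTop.comp hL).inv_tendsto_atTop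
  -- The lower error has a tail of the geometric series, which vanishes as m → ∞, and a term from
  -- the squared tail scale, which vanishes with L·p. The upper error is the end effect, of relative
  -- size m/L.
  refine tendsto_of_forall_eventually_between
    (lo := fun m k => (steadyState μ).real (localMaxEvent (w k) m (a k) 0) / p k -
      (2 * C * R m + 2 * C ^ 2 * (L k * p k)))
    (up := fun m k => (steadyState μ).real (localMaxEvent (w k) m (a k) 0) / p k +
      2 * m * C * (L k : ℝ)⁻¹) (A := A) (R := fun m => 2 * C * R m) ?_ ?_ ?_ ?_ ?_ ?_
  · intro m
    filter_upwards [hev, hρev, hw.eventually_ge_atTop (2 * m + 1), hL.eventually_gt_atTop 0]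
      with k hk1 hk2 hk3 hk4
    have hwk : 0 < w k := by omega
    have hpk : 0 < p k := tailScale_pos (Icc_subset_naturalInterior hα hβ hk1) hwk _
    have hLk : (0 : ℝ) < L k := by exact_mod_cast hk4
    obtain ⟨-, hpair⟩ := hCb (t k) hk1 (w k) hwk (a k)
    have hd0 : 0 ≤ pairDecay μ (t k) :=
      div_nonneg (sq_nonneg _) (mgf_pos_of_mem (Icc_subset_naturalInterior hα hβ hk1)).le
    have hpair' : ∀ (j : ℕ) (s : ℤ), (steadyState μ).real
        {x | a k < movingSum x (w k) s ∧ a k < movingSum x (w k) (s + j)} ≤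
        C * p k * f j + C ^ 2 * p k ^ 2 := by
      intro j s
      refine (hpair j s).trans (add_le_add_left ?_ _)
      have h1 : (1 + (j : ℝ)) * pairDecay μ (t k) ^ j ≤ f j :=
        mul_le_mul_of_nonneg_left (pow_le_pow_left₀ hd0 hk2.le j) (by positivity)
      calc C * ((1 + (j : ℝ)) * pairDecay μ (t k) ^ j) * p k ≤ C * f j * p k :=
            mul_le_mul_of_nonneg_right (mul_le_mul_of_nonneg_left h1 hC.le) hpk.le
        _ = _ := by ring
    have hsumle : ∑ j ∈ Finset.Ioc m (L k), (C * p k * f j + C ^ 2 * p k ^ 2) ≤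
        C * p k * R m + L k * (C ^ 2 * p k ^ 2) := by
      rw [Finset.sum_add_distrib, ← Finset.mul_sum, Finset.sum_const, Nat.card_Ioc, nsmul_eq_mul]
      refine add_le_add (mul_le_mul_of_nonneg_left (hRle _ _) (by positivity))
        (mul_le_mul_of_nonneg_right ?_ (by positivity))
      exact_mod_cast Nat.sub_le _ _
    have hone : ∀ s ∈ Finset.Icc 1 (L k), (steadyState μ).real (localMaxEvent (w k) m (a k) 0) -
        2 * (C * p k * R m + L k * (C ^ 2 * p k ^ 2)) ≤
          (steadyState μ).real (globalMaxEvent (w k) (L k) (a k) s) := by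
      intro s hs
      have h1 := measureReal_localMaxEvent_le (μ := μ) (w k) m (a k) hs
      rw [measureReal_localMaxEvent (by omega), ← measureReal_localMaxEvent (by omega) (a k) 0] at h1
      have h2 := Finset.sum_le_sum fun j (_ : j ∈ Finset.Ioc m (L k)) =>
        add_le_add (hpair' j s) (hpair' j (s - j))
      rw [Finset.sum_add_distrib (f := fun j => C * p k * f j + C ^ 2 * p k ^ 2)] at h2
      linarith
    have htot := Finset.sum_le_sum hone
    rw [← measureReal_exceedEvent hμ hwk, Finset.sum_const, Nat.card_Icc, nsmul_eq_mul,
      Nat.add_sub_cancel] at htot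
    rw [le_div_iff₀ (by positivity)]
    refine le_trans (le_of_eq ?_) htot
    field_simp
    ring
  · intro m
    filter_upwards [hev, hw.eventually_ge_atTop (2 * m + 1), hL.eventually_gt_atTop 0]
      with k hk1 hk3 hk4
    have hwk : 0 < w k := by omega
    have hpk : 0 < p k := tailScale_pos (Icc_subset_naturalInterior hα hβ hk1) hwk _
    have hLk : (0 : ℝ) < L k := by exact_mod_cast hk4
    obtain ⟨htail, -⟩ := hCb (t k) hk1 (w k) hwk (a k)
    change (steadyState μ).real (exceedEvent (w k) (L k) (a k)) / (L k * p k) ≤ _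
    rw [div_le_iff₀ (by positivity)]
    refine (measureReal_exceedEvent_le (m := m) hμ hwk (by omega) (L k) (a k)).trans ?_
    have h1 : 2 * (m : ℝ) * (sumLaw μ (w k)).real (Set.Ioi (a k)) ≤ 2 * m * (C * p k) :=
      mul_le_mul_of_nonneg_left htail (by positivity)
    refine (add_le_add_right h1 _).trans (le_of_eq ?_)
    field_simp
  · intro m
    have h1 := (hloc m).sub ((hpL.const_mul (2 * C ^ 2)).const_add (2 * C * R m))
    rw [mul_zero, add_zero] at h1
    exact h1
  · intro m
    have h1 := (hloc m).add (hLinv.const_mul (2 * m * C))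
    rw [mul_zero, add_zero] at h1
    exact h1
  · exact ((tendsto_killedWalk_univ (stepLaw μ ϑ) measurableSet_Iic).pow 2).const_mul _
  · have h1 := hRlim.const_mul (2 * C)
    rw [mul_zero] at h1
    exact h1

/-- The parameters converge when the scaled boundaries do. -/
lemma tendsto_of_tendsto_deriv (hμ : μ ≪ volume) {ϑ : ℝ} (hϑ : ϑ ∈ naturalInterior μ) {t : ℕ → ℝ}
    (htm : ∀ᶠ k in atTop, t k ∈ naturalInterior μ)
    (h : Tendsto (fun k => deriv (logNormalizer μ) (t k)) atTop
      (𝓝 (deriv (logNormalizer μ) ϑ))) : Tendsto t atTop (𝓝 ϑ) := by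
  have hmono := strictMonoOn_deriv_logNormalizer (μ := μ) hμ
  have hopen : naturalInterior μ ∈ 𝓝 ϑ := isOpen_interior.mem_nhds hϑ
  refine tendsto_order.2 ⟨fun l hl => ?_, fun l hl => ?_⟩
  · obtain ⟨l', hl', hl2⟩ := ((eventually_nhdsWithin_of_eventually_nhds hopen).and
      (Ioo_mem_nhdsLT hl)).exists
    filter_upwards [htm, h.eventually (lt_mem_nhds (hmono hl' hϑ hl2.2))] with k hk1 hk2
    exact hl2.1.trans ((hmono.lt_iff_lt hl' hk1).1 hk2)
  · obtain ⟨l', hl', hl2⟩ := ((eventually_nhdsWithin_of_eventually_nhds hopen).and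
      (Ioo_mem_nhdsGT hl)).exists
    filter_upwards [htm, h.eventually (gt_mem_nhds (hmono hϑ hl' hl2.1))] with k hk1 hk2
    exact ((hmono.lt_iff_lt hk1 hl').1 hk2).trans hl2.2

/-- Since b = √w c'(θ/√w), the exponent -θb + w c(θ/√w) equals w(c - (θ/√w)c'), which is the
exponent in `tailScale` at the boundary w c'. This leaves a prefactor that converges with θ/√w. -/
lemma fdpApprox_eq {w : ℕ} (hw : 0 < w) {b θ : ℝ} (L : ℕ) (hθ : θ / √w ∈ naturalInterior μ)
    (hb : b = √w * deriv (logNormalizer μ) (θ / √w)) :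
    fdpApprox μ w b θ L = L * tailScale μ w (θ / √w) (w * deriv (logNormalizer μ) (θ / √w)) *
      (deriv (logNormalizer μ) (θ / √w) * Real.exp (-(θ / √w) * meanOvershoot μ) /
        √(2 * Real.pi * deriv (deriv (logNormalizer μ)) (θ / √w))) := by
  have hwr : (0 : ℝ) < w := by exact_mod_cast hw
  have hs : 0 < √(w : ℝ) := Real.sqrt_pos.2 hwr
  have hss : √(w : ℝ) * √(w : ℝ) = w := Real.mul_self_sqrt hwr.le
  rw [fdpApprox, tailScale, ← exp_logNormalizer hθ, ← Real.exp_nat_mul, ← Real.exp_add,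
    Real.sqrt_mul (x := 2 * Real.pi) (by positivity)
      (deriv (deriv (logNormalizer μ)) (θ / √w))]
  have e1 : -θ * b + w * logNormalizer μ (θ / √w) = w * logNormalizer μ (θ / √w) +
      -(θ / √w) * (w * deriv (logNormalizer μ) (θ / √w)) := by
    have : θ / √(w : ℝ) * w = θ * √w := by
      rw [div_mul_eq_mul_div, div_eq_iff hs.ne', mul_assoc, hss]
    rw [hb]
    linear_combination (-deriv (logNormalizer μ) (θ / √w)) * -this
  rw [e1]
  generalize Real.exp (w * logNormalizer μ (θ / √w) +
      -(θ / √w) * (w * deriv (logNormalizer μ) (θ / √w))) = E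
  generalize Real.exp (-(θ / √w) * meanOvershoot μ) = E'
  rw [hb]
  generalize √(deriv (deriv (logNormalizer μ)) (θ / √w)) = c
  generalize deriv (logNormalizer μ) (θ / √w) = d
  have e2 : (L : ℝ) * (√w * d) * E / (√(2 * Real.pi) * w * c) =
      L * d * E / (√(2 * Real.pi) * √w * c) := by
    generalize √(w : ℝ) = σ at hs hss
    rw [← hss]
    -- If c'' vanished, both sides would be 0 by the convention for division, so positivity is not
    -- needed here.
    rcases eq_or_ne c 0 with rfl | hc
    · simp
    · field_simp
  rw [e2]
  ring

/-- The false detection probability relative to its approximation. -/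
theorem tendsto_falseDetectionProb_div (hμ : μ ≪ volume) (h0 : (0 : ℝ) ∈ naturalInterior μ)
    (hmean : deriv (logNormalizer μ) 0 = 0) {h ϑ : ℝ} (hh : 0 < h) (hϑ : ϑ ∈ naturalInterior μ)
    (hϑh : deriv (logNormalizer μ) ϑ = h) {w L : ℕ → ℕ} {b θ : ℕ → ℝ}
    (hw : Tendsto w atTop atTop) (hb : Tendsto (fun n => b n / √(w n : ℝ)) atTop (𝓝 h))
    (hL : Tendsto L atTop atTop) (hLw : (fun n => (L n : ℝ)) =O[atTop] fun n => (w n : ℝ))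
    (hθ : ∀ᶠ n in atTop, θ n / √(w n : ℝ) ∈ naturalInterior μ ∧
      b n = √(w n : ℝ) * deriv (logNormalizer μ) (θ n / √(w n : ℝ))) :
    Tendsto (fun n => falseDetectionProb μ (w n) (b n) (L n) /
      fdpApprox μ (w n) (b n) (θ n) (L n)) atTop (𝓝 (limitRatio μ h)) := by
  set t : ℕ → ℝ := fun n => θ n / √(w n : ℝ) with ht
  have hϑ0 : 0 < ϑ := pos_of_deriv_logNormalizer_pos hμ h0 hmean hϑ (hϑh ▸ hh)
  have hderiv : Tendsto (fun k => deriv (logNormalizer μ) (t k)) atTop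
      (𝓝 (deriv (logNormalizer μ) ϑ)) := by
    rw [hϑh]
    refine hb.congr' ?_
    filter_upwards [hθ, hw.eventually_gt_atTop 0] with n hn hn2
    have hs : 0 < √(w n : ℝ) := Real.sqrt_pos.2 (by exact_mod_cast hn2)
    rw [hn.2, mul_div_cancel_left₀ _ hs.ne']
  have htlim : Tendsto t atTop (𝓝 ϑ) :=
    tendsto_of_tendsto_deriv hμ hϑ (hθ.mono fun n hn => hn.1) hderiv
  have hd2 : Tendsto (fun k => deriv (deriv (logNormalizer μ)) (t k)) atTop
      (𝓝 (deriv (deriv (logNormalizer μ)) ϑ)) :=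
    (continuousAt_deriv_deriv_logNormalizer hϑ).tendsto.comp htlim
  have hq := deriv_deriv_logNormalizer_pos hμ hϑ
  have hS : 0 < √(2 * Real.pi * deriv (deriv (logNormalizer μ)) ϑ) :=
    Real.sqrt_pos.2 (by positivity)
  have hG : Tendsto (fun k => deriv (logNormalizer μ) (t k) *
      Real.exp (-(t k) * meanOvershoot μ) /
        √(2 * Real.pi * deriv (deriv (logNormalizer μ)) (t k))) atTop
      (𝓝 (deriv (logNormalizer μ) ϑ * Real.exp (-ϑ * meanOvershoot μ) /
        √(2 * Real.pi * deriv (deriv (logNormalizer μ)) ϑ))) :=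
    (hderiv.mul ((Real.continuous_exp.tendsto _).comp (htlim.neg.mul_const _))).div
      (hd2.const_mul _).sqrt hS.ne'
  have hmain := (tendsto_exceedEvent hμ h0 hϑ hϑ0 htlim hw hL hLw).div hG
    (by rw [hϑh]; positivity)
  rw [limitRatio_eq hμ hϑ hϑh]
  -- The Gaussian factor √(2πc'') cancels, leaving q²/(ϑ c' e^{-ϑρ₊}).
  have hval : 1 / (ϑ * √(2 * Real.pi * deriv (deriv (logNormalizer μ)) ϑ)) *
      survivalProb μ ϑ ^ 2 / (deriv (logNormalizer μ) ϑ * Real.exp (-ϑ * meanOvershoot μ) /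
        √(2 * Real.pi * deriv (deriv (logNormalizer μ)) ϑ)) = tiltRatio μ ϑ := by
    rw [tiltRatio, hϑh]
    have := Real.exp_pos (-ϑ * meanOvershoot μ)
    generalize Real.exp (-ϑ * meanOvershoot μ) = E at this ⊢
    field_simp
  rw [hval] at hmain
  refine hmain.congr' ?_
  filter_upwards [hθ, hw.eventually_gt_atTop 0] with n hn hn2
  have e : √(w n : ℝ) * b n = w n * deriv (logNormalizer μ) (t n) := by
    rw [hn.2, ← mul_assoc, Real.mul_self_sqrt (Nat.cast_nonneg _)]
  simp only [Pi.div_apply]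
  rw [falseDetectionProb_eq hn2, fdpApprox_eq hn2 (L n) hn.1 hn.2, e, div_div]

end Limit

end

theorem theorem1 (μ : Measure ℝ) [IsProbabilityMeasure μ]
    -- the baseline law has a density
    (hμ : μ ≪ volume)
    -- the log-normalizer is finite near `0`, and the baseline mean is `0`
    (h0 : (0 : ℝ) ∈ naturalInterior μ) (hmean : deriv (logNormalizer μ) 0 = 0) :
    -- the mean overshoot is well defined
    (∀ᵐ y ∂(pairLaw μ), ∃ n : ℕ, 0 < n ∧ 0 < diffWalk y n) ∧
    Integrable (fun y => ladderHeight y ^ 2) (pairLaw μ) ∧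
    -- the limiting ratio `r h` of the false detection probability and its approximation
    ∃ r : ℝ → ℝ,
      (∀ h : ℝ, 0 < h → (∃ ϑ ∈ naturalInterior μ, deriv (logNormalizer μ) ϑ = h) →
        ∀ (w L : ℕ → ℕ) (b θ : ℕ → ℝ),
          Tendsto w atTop atTop →
          Tendsto b atTop atTop →
          Tendsto (fun n => b n / √(w n : ℝ)) atTop (𝓝 h) →
          Tendsto L atTop atTop →
          (fun n => (L n : ℝ)) =O[atTop] (fun n => (w n : ℝ)) →
          (∀ᶠ n in atTop, θ n / √(w n : ℝ) ∈ naturalInterior μ ∧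
            b n = √(w n : ℝ) * deriv (logNormalizer μ) (θ n / √(w n : ℝ))) →
          Tendsto
            (fun n => falseDetectionProb μ (w n) (b n) (L n) /
              fdpApprox μ (w n) (b n) (θ n) (L n))
            atTop (𝓝 (r h))) ∧
      (fun h => r h - 1) =O[𝓝[>] (0 : ℝ)] (fun h => h ^ 2) := by
  obtain ⟨h1, h2, -⟩ := ladderHeight_moments μ hμ h0
  refine ⟨h1, h2, limitRatio μ, ?_, limitRatio_sub_one_isBigO hμ h0 hmean⟩
  rintro h hh ⟨ϑ, hϑ, hϑh⟩ w L b θ hw - hb hL hLw hθ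
  exact tendsto_falseDetectionProb_div hμ h0 hmean hh hϑ hϑh hw hb hL hLw hθ
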